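/- Fix a notion of small set and let $(\mathcal V,\otimes,I)$ be a symmetric monoidal closed category, with small hom-sets, that has all small limits and colimits. Let $F:\mathbf{Set}\to\mathcal V$, $F(A)=\coprod_{A}I$, be the strong monoidal left adjoint of $U=\mathcal V(I,-)$. Write $S\mathcal V=\mathcal V^{\Delta^{op}}$ with the pointwise tensor product, and $\mathcal V\mathrm{Cat}_\Delta$ for the category of small $S\mathcal V$-enriched categories and $S\mathcal V$-functors (so $\mathrm{Cat}_\Delta$ is the category of small simplicial categories when $\mathcal V=\mathbf{Set}$). *Templicial objects.* For a set $S$, a $\mathcal V$-quiver on $S$ is a family $(Q(a,b))_{a,b\in S}$ of objects of $\mathcal V$. These form a monoidal category $\mathcal V\mathrm{Quiv}_S$ with $(Q\otimes_S P)(a,b)=\coprod_{c\in S}Q(a,c)\otimes P(c,b)$ and unit $I_S$, where $I_S(a,a)=I$ and $I_S(a,b)$ is initial for $a\neq b$. Let $\Delta_f\subseteq\Delta$ be the subcategory of all objects $[n]$, $n\ge 0$, and of the order maps preserving the minimum and the maximum; it is monoidal under $[m]+[n]=[m+n]$ (gluing end points). A templicial object of $\mathcal V$ is a pair $(X,S)$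 of a set $S$ and a colax monoidal functor $X:\Delta_f^{op}\to\mathcal V\mathrm{Quiv}_S$, with comultiplications $\mu_{k,l}:X_{k+l}\to X_k\otimes_S X_l$, whose counit $X_0\to I_S$ is invertible. A morphism $(X,S)\to(Y,S')$ is a map $f:S\to S'$ with a natural family $X_n(a,b)\to Y_n(f(a),f(b))$ compatible with comultiplications and counits. They form the category $S_\otimes\mathcal V$. For a simplicial set $K$, the templicial object $\tilde F(K)$ has vertex set $K_0$; $\tilde F(K)_n(a,b)$ is $F$ of the set of $n$-simplices of $K$ with first vertex $a$ and last vertex $b$; $\mu_{k,l}$ is induced by sending $\sigma\in K_{k+l}$ to its front $k$-face and its back $l$-face. This is a functor $\tilde F:\mathbf{SSet}\to S_\otimes\mathcal V$, and $\tilde U:S_\otimes\mathcal V\to\mathbf{SSet}$ is given by $\tilde U(X)_n=S_\otimes\mathcal V(\tilde F(\Delta^n),X)$. *Necklaces.* A necklace is a pair $(T,p)$ with $p\ge 0$ and $\{0,p\}\subseteq T\subseteq[p]$; a map $(T,p)\to(T',q)$ is a map $f:[p]\to[q]$ of $\Delta_f$ with $T'\subseteq f(T)$. The category $\mathrm{Nec}$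 of necklaces is monoidal under $(T,p)\vee(T',q)=(T\cup(p+T'),p+q)$. Let $\mathcal V\mathrm{Cat}_{nec}$ be the category of small categories enriched in $\mathcal V^{\mathrm{Nec}^{op}}$ with Day convolution. For a templicial object $(X,S)$, the necklace category $X^{nec}$ has object set $S$ and hom-objects $T\mapsto X_T(a,b)$, where $X_T=X_{t_1-t_0}\otimes_S\cdots\otimes_S X_{t_k-t_{k-1}}$ for $T=\{0=t_0<\dots<t_k=p\}$. The inclusion maps of necklaces (identity on $[p]$) act through the comultiplications, the maps $f$ with $T'=f(T)$ act through the functoriality of $X$ (and the invertible counit where $f$ collapses a bead), and composition is the canonical $X_T(a,b)\otimes X_{T'}(b,c)\to X_{T\vee T'}(a,c)$. This is a functor $(-)^{nec}:S_\otimes\mathcal V\to\mathcal V\mathrm{Cat}_{nec}$. *Categorification.* For a necklace $(T,p)$ let $\mathcal P_T$ be the poset $\{W\mid T\subseteq W\subseteq[p]\}$ ordered by inclusion. It is covariant in $T$ by $W\mapsto f(W)$, and strong monoidal. Let $N$ be the nerve. Define $\mathfrak s:\mathcal V\mathrm{Cat}_{nec}\to\mathcal V\mathrm{Cat}_\Delta$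 by keeping the objects and taking the hom-objects $$\mathfrak s(\mathcal C)(a,b)=\int^{T\in\mathrm{Nec}}\mathcal C_T(a,b)\otimes F(N\mathcal P_T),$$ with the induced composition and identities, and let $\mathfrak C_{\mathcal V}=\mathfrak s\circ(-)^{nec}:S_\otimes\mathcal V\to\mathcal V\mathrm{Cat}_\Delta$. *Classical functors.* Let $\mathfrak C[\Delta^n]$ be the simplicial category with objects $0,\dots,n$, with hom-object from $i$ to $j$ the nerve of the poset (under inclusion) of the sets $W$ with $\{i,j\}\subseteq W\subseteq\{i,\dots,j\}$ when $i\le j$, and empty otherwise, and with composition given by union. The homotopy coherent nerve $N^{hc}:\mathrm{Cat}_\Delta\to\mathbf{SSet}$ is $N^{hc}(\mathcal C)_n=\mathrm{Cat}_\Delta(\mathfrak C[\Delta^n],\mathcal C)$. Let $\mathcal F:\mathrm{Cat}_\Delta\to\mathcal V\mathrm{Cat}_\Delta$ and $\mathcal U:\mathcal V\mathrm{Cat}_\Delta\to\mathrm{Cat}_\Delta$ be the functors that apply $F$, respectively $U$, levelwise to the hom-objects. **Proposition.** The functor $(-)^{nec}$ has a right adjoint $(-)^{temp}$, the functor $\mathfrak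 s$ has a right adjoint $\mathfrak n$, and $N^{hc}$ has a left adjoint $\mathfrak C:\mathbf{SSet}\to\mathrm{Cat}_\Delta$. With $N^{hc}_{\mathcal V}=(-)^{temp}\circ\mathfrak n:\mathcal V\mathrm{Cat}_\Delta\to S_\otimes\mathcal V$ there are natural isomorphisms $$\mathfrak C_{\mathcal V}\circ\tilde F\;\cong\;\mathcal F\circ\mathfrak C\qquad\text{and}\qquad \tilde U\circ N^{hc}_{\mathcal V}\;\cong\;N^{hc}\circ\mathcal U .$$ -/

import Mathlib

open CategoryTheory MonoidalCategory Limits Opposite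

universe u v w

set_option linter.unusedSectionVars false

/-- `IsInterval m n f` says that `f` is the extension to `ℕ` of an order morphism `[m] ⟶ [n]`
preserving the endpoints, where the extension is normalised by `f (m + i) = n + i`. -/
structure IsInterval (m n : ℕ) (f : ℕ → ℕ) : Prop where
  mono : Monotone f
  map_zero : f 0 = 0
  map_add : ∀ i, f (m + i) = n + i

/-- The sum of `f : [m] ⟶ [m']` and `g : [n] ⟶ [n']`, glued at the common endpoint. -/
def glue (m m' : ℕ) (f g : ℕ → ℕ) (i : ℕ) : ℕ := if i ≤ m then f i else m' + g (i - m)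

namespace IsInterval

variable {m n p m' n' p' : ℕ} {f g f' g' h : ℕ → ℕ}

protected lemma id (m : ℕ) : IsInterval m m (fun i => i) := ⟨monotone_id, rfl, fun _ => rfl⟩

protected lemma comp (hf : IsInterval m n f) (hg : IsInterval n p g) :
    IsInterval m p (fun i => g (f i)) :=
  ⟨hg.mono.comp hf.mono, by rw [hf.map_zero, hg.map_zero],
    fun i => by rw [hf.map_add, hg.map_add]⟩

lemma map_last (hf : IsInterval m n f) : f m = n := hf.map_add 0

lemma map_of_le (hf : IsInterval m n f) {i : ℕ} (h : m ≤ i) : f i = n + (i - m) := by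
  obtain ⟨j, rfl⟩ := Nat.exists_eq_add_of_le h
  rw [hf.map_add, Nat.add_sub_cancel_left]

lemma map_le (hf : IsInterval m n f) {i : ℕ} (h : i ≤ m) : f i ≤ n :=
  (hf.mono h).trans hf.map_last.le

lemma glue (hf : IsInterval m m' f) (hg : IsInterval n n' g) :
    IsInterval (m + n) (m' + n') (glue m m' f g) where
  mono i j hij := by
    unfold _root_.glue
    split_ifs with h h'
    · exact hf.mono hij
    · exact (hf.map_le h).trans (Nat.le_add_right _ _)
    · omega
    · exact Nat.add_le_add_left (hg.mono (by omega)) _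
  map_zero := by simp [_root_.glue, hf.map_zero]
  map_add i := by
    unfold _root_.glue
    split_ifs with h
    · have h1 := hg.map_last
      have hn : n = 0 := by omega
      rw [hn, hg.map_zero] at h1
      have hi : i = 0 := by omega
      subst hi
      rw [hn, Nat.add_zero, Nat.add_zero, hf.map_last, ← h1, Nat.add_zero]
    · rw [show m + n + i - m = n + i by omega, hg.map_add, Nat.add_assoc]

lemma glue_id (hf : IsInterval m m' f) (h1 : ∀ i, f i = i) (h2 : ∀ i, g i = i) (i : ℕ) :
    _root_.glue m m' f g i = i := by
  have := hf.map_last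
  rw [h1] at this
  unfold _root_.glue
  rw [h1, h2]
  split_ifs <;> omega

lemma glue_comp (hf : IsInterval m n f) (hf' : IsInterval n p f') (hg' : g' 0 = 0) (i : ℕ) :
    _root_.glue n p f' g' (_root_.glue m n f g i) =
      _root_.glue m p (fun i => f' (f i)) (fun i => g' (g i)) i := by
  unfold _root_.glue
  by_cases h : i ≤ m
  · rw [if_pos h, if_pos h, if_pos (hf.map_le h)]
  · rw [if_neg h, if_neg h]
    split_ifs with h'
    · have : g (i - m) = 0 := by omega
      simp only [this, hg', Nat.add_zero, hf'.map_last]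
    · rw [Nat.add_sub_cancel_left]

lemma glue_assoc (i : ℕ) :
    _root_.glue (m + n) (m' + n') (_root_.glue m m' f g) h i =
      _root_.glue m m' f (_root_.glue n n' g h) i := by
  unfold _root_.glue
  split_ifs <;> first | rfl | omega | simp [Nat.sub_sub, Nat.add_assoc]

lemma glue_zero_left (hf : f 0 = 0) (hg : g 0 = 0) (i : ℕ) :
    _root_.glue 0 0 f g i = g i := by
  unfold _root_.glue
  split_ifs with h
  · have : i = 0 := by omega
    rw [this, hf, hg]
  · simp

lemma glue_zero_right (hf : IsInterval m m' f) (hg : ∀ i, g i = i) (i : ℕ) :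
    _root_.glue m m' f g i = f i := by
  unfold _root_.glue
  split_ifs with h
  · rfl
  · rw [hg, hf.map_of_le (by omega)]

end IsInterval

/-- The category `Δ_f` of finite intervals: objects are the posets `[n] = {0,…,n}`. -/
structure FinInt where
  len : ℕ

namespace FinInt

/-- An order morphism `[m] ⟶ [n]` preserving the endpoints.  It is recorded through its unique
extension to a monotone map `ℕ → ℕ` with `f (m + i) = n + i` (see `homEquiv`), so that composition
is composition of maps. -/
@[ext]
structure Hom (a b : FinInt) where
  toFun : ℕ → ℕ
  prop : IsInterval a.len b.len toFun

instance : Category FinInt where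
  Hom := Hom
  id a := ⟨fun i => i, .id _⟩
  comp f g := ⟨fun i => g.toFun (f.toFun i), f.prop.comp g.prop⟩

@[ext]
lemma hom_ext {a b : FinInt} {f g : a ⟶ b} (h : ∀ i, f.toFun i = g.toFun i) : f = g :=
  Hom.ext (funext h)

@[simp] lemma comp_apply {a b c : FinInt} (f : a ⟶ b) (g : b ⟶ c) (i : ℕ) :
  (f ≫ g).toFun i = g.toFun (f.toFun i) := rfl
@[simp] lemma id_apply (a : FinInt) (i : ℕ) : Hom.toFun (𝟙 a) i = i := rfl

/-- The order morphism `[m] ⟶ [n]` underlying a morphism of `Δ_f`. -/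
def toOrderHom {a b : FinInt} (f : a ⟶ b) : Fin (a.len + 1) →o Fin (b.len + 1) where
  toFun i := ⟨f.toFun i, Nat.lt_succ_of_le (f.prop.map_le (Nat.le_of_lt_succ i.2))⟩
  monotone' _ _ h := f.prop.mono h

/-- The morphism of `Δ_f` associated to an order morphism `[m] ⟶ [n]` preserving endpoints. -/
def ofOrderHom {m n : ℕ} (f : Fin (m + 1) →o Fin (n + 1)) (h0 : f 0 = 0)
    (h1 : f (Fin.last m) = Fin.last n) : FinInt.mk m ⟶ FinInt.mk n where
  toFun i := if h : i < m + 1 then (f ⟨i, h⟩ : ℕ) else n + (i - m)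
  prop :=
  { mono i j hij := by
      dsimp only
      split_ifs with h h'
      · exact f.monotone hij
      · exact (Nat.le_of_lt_succ (f _).2).trans (by omega)
      · omega
      · omega
    map_zero := by simpa using congrArg Fin.val h0
    map_add i := by
      dsimp only
      split_ifs with h
      · have : i = 0 := by omega
        subst this
        exact congrArg Fin.val h1
      · omega }

/-- Morphisms of `Δ_f` are exactly the order morphisms preserving the endpoints. -/
def homEquiv (m n : ℕ) : (FinInt.mk m ⟶ FinInt.mk n) ≃
    {f : Fin (m + 1) →o Fin (n + 1) // f 0 = 0 ∧ f (Fin.last m) = Fin.last n} where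
  toFun f := ⟨toOrderHom f, Fin.ext f.prop.map_zero, Fin.ext f.prop.map_last⟩
  invFun f := ofOrderHom f.1 f.2.1 f.2.2
  left_inv f := by
    ext i
    dsimp only [ofOrderHom, toOrderHom]
    split_ifs with h
    · rfl
    · exact (f.prop.map_of_le (by dsimp; omega)).symm
  right_inv f := by
    ext i
    exact dif_pos i.2

/-- The inclusion of `Δ_f` into the simplex category. -/
def toSimplex : FinInt ⥤ SimplexCategory where
  obj a := SimplexCategory.mk a.len
  map f := SimplexCategory.Hom.mk (toOrderHom f)

/-- The isomorphism between equal objects. -/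
def eqIso {a b : FinInt} (h : a.len = b.len) : a ≅ b where
  hom := ⟨fun i => i, h ▸ .id _⟩
  inv := ⟨fun i => i, h ▸ .id _⟩

instance : MonoidalCategoryStruct FinInt where
  tensorObj a b := ⟨a.len + b.len⟩
  tensorUnit := ⟨0⟩
  tensorHom {a a' _ _} f g := ⟨glue a.len a'.len f.toFun g.toFun, f.prop.glue g.prop⟩
  whiskerLeft a _ _ g := ⟨glue a.len a.len (fun i => i) g.toFun, (IsInterval.id _).glue g.prop⟩
  whiskerRight {a a'} f b := ⟨glue a.len a'.len f.toFun (fun i => i), f.prop.glue (.id _)⟩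
  associator _ _ _ := eqIso (Nat.add_assoc _ _ _)
  leftUnitor _ := eqIso (Nat.zero_add _)
  rightUnitor _ := eqIso (Nat.add_zero _)

instance : MonoidalCategory FinInt := MonoidalCategory.ofTensorHom
  (id_tensorHom_id := fun _ _ => hom_ext (IsInterval.glue_id (.id _) (fun _ => rfl) fun _ => rfl))
  (tensorHom_comp_tensorHom := fun f g f' g' =>
    hom_ext (IsInterval.glue_comp f.prop f'.prop g'.prop.map_zero))
  (associator_naturality := fun _ _ _ => hom_ext fun _ => IsInterval.glue_assoc _)
  (leftUnitor_naturality := fun f => hom_ext (IsInterval.glue_zero_left rfl f.prop.map_zero))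
  (rightUnitor_naturality := fun f => hom_ext (IsInterval.glue_zero_right f.prop fun _ => rfl))
  (pentagon := fun a b c d => hom_ext fun i =>
    (IsInterval.glue_id (.id _) (fun _ => rfl) (fun _ => rfl) _).trans
      (IsInterval.glue_id (α_ a b c).hom.prop (fun _ => rfl) (fun _ => rfl) i))
  (triangle := fun a b => hom_ext fun i =>
    (IsInterval.glue_id (.id _) (fun _ => rfl) (fun _ => rfl) i).trans
      (IsInterval.glue_id (ρ_ a).hom.prop (fun _ => rfl) (fun _ => rfl) i).symm)

end FinInt

/-- A necklace `Δ^{n₁} ∨ ⋯ ∨ Δ^{nₖ}`, given by the list of dimensions `n₁, …, nₖ > 0`. -/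
structure Nec where
  beads : List ℕ
  pos : ∀ n ∈ beads, 0 < n

namespace Nec

/-- The set of joints `{0 < n₁ < n₁ + n₂ < ⋯}` of a list of beads. -/
def joints : List ℕ → Set ℕ
  | [] => {0}
  | n :: L => {0} ∪ (fun i => n + i) '' joints L

/-- A morphism `T ⟶ U`: an endpoint preserving order morphism `f` between the vertices
such that every joint of `U` is the image of a joint of `T`. -/
@[ext]
structure Hom (T U : Nec) where
  toFun : ℕ → ℕ
  prop : IsInterval T.beads.sum U.beads.sum toFun
  joints_subset : joints U.beads ⊆ toFun '' joints T.beads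

instance : Category Nec where
  Hom := Hom
  id T := ⟨fun i => i, .id _, by simp⟩
  comp f g := ⟨fun i => g.toFun (f.toFun i), f.prop.comp g.prop, by
    rw [← Function.comp_def, Set.image_comp]
    exact g.joints_subset.trans (Set.image_mono f.joints_subset)⟩

@[ext]
lemma hom_ext {T U : Nec} {f g : T ⟶ U} (h : ∀ i, f.toFun i = g.toFun i) : f = g :=
  Hom.ext (funext h)

@[simp] lemma comp_apply {a b c : Nec} (f : a ⟶ b) (g : b ⟶ c) (i : ℕ) :
  (f ≫ g).toFun i = g.toFun (f.toFun i) := rfl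
@[simp] lemma id_apply (a : Nec) (i : ℕ) : Hom.toFun (𝟙 a) i = i := rfl

lemma zero_mem_joints (L : List ℕ) : 0 ∈ joints L := by cases L <;> simp [joints]

lemma sum_mem_joints (L : List ℕ) : L.sum ∈ joints L := by
  induction L with
  | nil => simp [joints]
  | cons n L ih => exact Or.inr ⟨_, ih, by simp⟩

lemma le_of_mem_joints {L : List ℕ} {i : ℕ} (h : i ∈ joints L) : i ≤ L.sum := by
  induction L generalizing i with
  | nil => simpa [joints] using h
  | cons n L ih =>
    rcases h with h | ⟨j, hj, rfl⟩
    · simp [Set.mem_singleton_iff.1 h]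
    · simpa using ih hj

lemma joints_append (L M : List ℕ) :
    joints (L ++ M) = joints L ∪ (fun i => L.sum + i) '' joints M := by
  induction L with
  | nil => simp [joints, zero_mem_joints]
  | cons n L ih =>
    simp [joints, ih, Set.image_union, Set.image_image, Set.insert_union, Nat.add_assoc]

lemma joints_glue {L L' M M' : List ℕ} {f g : ℕ → ℕ} (hf : IsInterval L.sum L'.sum f)
    (hg : g 0 = 0)
    (h1 : joints L' ⊆ f '' joints L) (h2 : joints M' ⊆ g '' joints M) :
    joints (L' ++ M') ⊆ glue L.sum L'.sum f g '' joints (L ++ M) := by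
  rw [joints_append, joints_append]
  rintro i (hi | ⟨j, hj, rfl⟩)
  · obtain ⟨k, hk, rfl⟩ := h1 hi
    exact ⟨k, Or.inl hk, if_pos (le_of_mem_joints hk)⟩
  · obtain ⟨k, hk, rfl⟩ := h2 hj
    refine ⟨L.sum + k, Or.inr ⟨k, hk, rfl⟩, ?_⟩
    unfold glue
    split_ifs with h
    · have : k = 0 := by omega
      subst this
      simp [hg, hf.map_last]
    · simp

/-- The isomorphism of necklaces given by the identity, for equal lists of beads. -/
def eqIso {T U : Nec} (h : T.beads = U.beads) : T ≅ U where
  hom := ⟨fun i => i, h ▸ .id _, by simp [h]⟩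
  inv := ⟨fun i => i, h ▸ .id _, by simp [h]⟩

/-- The sum `f ∨ g`. -/
def wedgeHom {T T' U U' : Nec} (f : T ⟶ T') (g : U ⟶ U') :
    (Nec.mk (T.beads ++ U.beads) (by simpa [or_imp, forall_and] using ⟨T.pos, U.pos⟩)) ⟶
    (Nec.mk (T'.beads ++ U'.beads) (by simpa [or_imp, forall_and] using ⟨T'.pos, U'.pos⟩)) :=
  ⟨glue T.beads.sum T'.beads.sum f.toFun g.toFun, by
    simpa using f.prop.glue g.prop,
    joints_glue f.prop g.prop.map_zero f.joints_subset g.joints_subset⟩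

/-- The wedge `T ∨ U` of necklaces, with unit `Δ⁰`. -/
instance : MonoidalCategoryStruct Nec where
  tensorObj T U := ⟨T.beads ++ U.beads, by simpa [or_imp, forall_and] using ⟨T.pos, U.pos⟩⟩
  tensorUnit := ⟨[], by simp⟩
  tensorHom f g := wedgeHom f g
  whiskerLeft T _ _ g := wedgeHom (𝟙 T) g
  whiskerRight f U := wedgeHom f (𝟙 U)
  associator _ _ _ := eqIso (List.append_assoc _ _ _)
  leftUnitor _ := eqIso (List.nil_append _)
  rightUnitor _ := eqIso (List.append_nil _)

instance : MonoidalCategory Nec := MonoidalCategory.ofTensorHom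
  (id_tensorHom_id := fun _ _ => hom_ext (IsInterval.glue_id (.id _) (fun _ => rfl) fun _ => rfl))
  (tensorHom_comp_tensorHom := fun f g f' g' =>
    hom_ext (IsInterval.glue_comp f.prop f'.prop g'.prop.map_zero))
  (associator_naturality := fun {T U V T' U' V'} f g h => hom_ext fun i => by
    change glue (T.beads ++ U.beads).sum (T'.beads ++ U'.beads).sum _ _ _ = _
    rw [List.sum_append, List.sum_append]
    exact IsInterval.glue_assoc _)
  (leftUnitor_naturality := fun f => hom_ext (IsInterval.glue_zero_left rfl f.prop.map_zero))
  (rightUnitor_naturality := fun f => hom_ext (IsInterval.glue_zero_right f.prop fun _ => rfl))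
  (pentagon := fun a b c d => hom_ext fun i =>
    (IsInterval.glue_id (.id _) (fun _ => rfl) (fun _ => rfl) _).trans
      (IsInterval.glue_id (α_ a b c).hom.prop (fun _ => rfl) (fun _ => rfl) i))
  (triangle := fun a b => hom_ext fun i =>
    (IsInterval.glue_id (.id _) (fun _ => rfl) (fun _ => rfl) i).trans
      (IsInterval.glue_id (ρ_ a).hom.prop (fun _ => rfl) (fun _ => rfl) i).symm)

end Nec

noncomputable section

section SigmaTensor

variable {V : Type v} [Category.{u} V] [MonoidalCategory V] [MonoidalClosed V] [BraidedCategory V]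
  [HasColimitsOfSize.{u, u} V] {ι : Type u} {A : ι → V} {B Z : V}

/-- Morphisms out of `(∐ A) ⊗ B`. -/
def sigmaTensorDesc (f : ∀ i, A i ⊗ B ⟶ Z) : (∐ A) ⊗ B ⟶ Z :=
  (isColimitOfPreserves (tensorRight B) (colimit.isColimit (Discrete.functor A))).desc
    { pt := Z
      ι := { app j := f j.as
             naturality := by rintro ⟨i⟩ ⟨j⟩ ⟨⟨⟨⟩⟩⟩; simp } }

@[simp] lemma ι_sigmaTensorDesc (f : ∀ i, A i ⊗ B ⟶ Z) (i : ι) :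
    Sigma.ι A i ▷ B ≫ sigmaTensorDesc f = f i :=
  (isColimitOfPreserves (tensorRight B) (colimit.isColimit (Discrete.functor A))).fac _ ⟨i⟩

@[simp] lemma ι_sigmaTensorDesc_assoc : type_of% (reassoc_of% @ι_sigmaTensorDesc) :=
  @(reassoc_of% @ι_sigmaTensorDesc)

lemma sigmaTensor_hom_ext {f g : (∐ A) ⊗ B ⟶ Z}
    (h : ∀ i, Sigma.ι A i ▷ B ≫ f = Sigma.ι A i ▷ B ≫ g) : f = g :=
  (isColimitOfPreserves (tensorRight B) (colimit.isColimit (Discrete.functor A))).hom_ext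
    fun j => h j.as

/-- Morphisms out of `B ⊗ (∐ A)`. -/
def tensorSigmaDesc (f : ∀ i, B ⊗ A i ⟶ Z) : B ⊗ (∐ A) ⟶ Z :=
  (isColimitOfPreserves (tensorLeft B) (colimit.isColimit (Discrete.functor A))).desc
    { pt := Z
      ι := { app j := f j.as
             naturality := by rintro ⟨i⟩ ⟨j⟩ ⟨⟨⟨⟩⟩⟩; simp } }

@[simp] lemma ι_tensorSigmaDesc (f : ∀ i, B ⊗ A i ⟶ Z) (i : ι) :
    B ◁ Sigma.ι A i ≫ tensorSigmaDesc f = f i :=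
  (isColimitOfPreserves (tensorLeft B) (colimit.isColimit (Discrete.functor A))).fac _ ⟨i⟩

@[simp] lemma ι_tensorSigmaDesc_assoc : type_of% (reassoc_of% @ι_tensorSigmaDesc) :=
  @(reassoc_of% @ι_tensorSigmaDesc)

lemma tensorSigma_hom_ext {f g : B ⊗ (∐ A) ⟶ Z}
    (h : ∀ i, B ◁ Sigma.ι A i ≫ f = B ◁ Sigma.ι A i ≫ g) : f = g :=
  (isColimitOfPreserves (tensorLeft B) (colimit.isColimit (Discrete.functor A))).hom_ext
    fun j => h j.as

end SigmaTensor

/-- `V`-enriched quivers with vertex set `S`. -/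
structure VQuiv (V : Type v) (S : Type u) where
  obj : S → S → V

namespace VQuiv

variable {V : Type v} [Category.{u} V] {S T : Type u}

/-- Quiver morphisms. -/
@[ext]
structure Hom (Q P : VQuiv V S) where
  app : ∀ a b, Q.obj a b ⟶ P.obj a b

instance : Category (VQuiv V S) where
  Hom := Hom
  id _ := ⟨fun _ _ => 𝟙 _⟩
  comp f g := ⟨fun a b => f.app a b ≫ g.app a b⟩

@[ext]
lemma hom_ext {Q P : VQuiv V S} {f g : Q ⟶ P} (h : ∀ a b, f.app a b = g.app a b) : f = g :=
  Hom.ext (funext fun a => funext fun b => h a b)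

@[simp] lemma id_app (Q : VQuiv V S) (a b : S) : Hom.app (𝟙 Q) a b = 𝟙 _ := rfl
@[simp] lemma comp_app {Q P R : VQuiv V S} (f : Q ⟶ P) (g : P ⟶ R) (a b : S) :
  (f ≫ g).app a b = f.app a b ≫ g.app a b := rfl

/-- An isomorphism of quivers from componentwise isomorphisms. -/
@[simps]
def isoMk {Q P : VQuiv V S} (f : ∀ a b, Q.obj a b ≅ P.obj a b) : Q ≅ P where
  hom := ⟨fun a b => (f a b).hom⟩
  inv := ⟨fun a b => (f a b).inv⟩

variable [MonoidalCategory V] [HasColimitsOfSize.{u, u} V]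

/-- `(Q ⊗ P)(a, b) = ∐ c, Q(a, c) ⊗ P(c, b)`. -/
def tObj (Q P : VQuiv V S) : VQuiv V S :=
  ⟨fun a b => ∐ fun c => Q.obj a c ⊗ P.obj c b⟩

variable (V S) in
/-- The unit quiver: `I(a, a) = I` and `I(a, b) = 0` for `a ≠ b`, written as the coproduct of
copies of `I` indexed by the proofs of `a = b`. -/
def tUnit : VQuiv V S := ⟨fun a b => ∐ fun _ : ULift.{u} (PLift (a = b)) => 𝟙_ V⟩

/-- The inclusion of a summand in `(Q ⊗ P)(a, b)`. -/
def tι (Q P : VQuiv V S) (a c b : S) : Q.obj a c ⊗ P.obj c b ⟶ (tObj Q P).obj a b :=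
  Sigma.ι (fun c => Q.obj a c ⊗ P.obj c b) c

variable (V) in
/-- The identification of `I` with `I(a, a)`. -/
def uι (a : S) : 𝟙_ V ⟶ (tUnit V S).obj a a :=
  Sigma.ι (fun _ : ULift.{u} (PLift (a = a)) => 𝟙_ V) ⟨⟨rfl⟩⟩

section
variable {Q P R : VQuiv V S} {a b c : S} {Z : V}

lemma tObj_hom_ext {f g : (tObj Q P).obj a b ⟶ Z} (h : ∀ c, tι Q P a c b ≫ f = tι Q P a c b ≫ g) :
    f = g := Sigma.hom_ext _ _ h

/-- Morphisms out of `(Q ⊗ P)(a, b)`. -/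
def tDesc (f : ∀ c, Q.obj a c ⊗ P.obj c b ⟶ Z) : (tObj Q P).obj a b ⟶ Z := Sigma.desc f

@[simp] lemma tι_tDesc (f : ∀ c, Q.obj a c ⊗ P.obj c b ⟶ Z) (c : S) :
    tι Q P a c b ≫ tDesc f = f c := Sigma.ι_desc _ _

@[simp] lemma tι_tDesc_assoc : type_of% (reassoc_of% @tι_tDesc) :=
  @(reassoc_of% @tι_tDesc)

lemma tUnit_hom_ext {f g : (tUnit V S).obj a b ⟶ Z}
    (h : ∀ e : a = b, uι V a ≫ eqToHom (by rw [e]) ≫ f = uι V a ≫ eqToHom (by rw [e]) ≫ g) :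
    f = g := Sigma.hom_ext _ _ (by
      rintro ⟨⟨⟨⟩⟩⟩; have := h rfl; simp only [eqToHom_refl, Category.id_comp] at this; exact this)

/-- Morphisms out of `I(a, b)`. -/
def uDesc (f : a = b → (𝟙_ V ⟶ Z)) : (tUnit V S).obj a b ⟶ Z := Sigma.desc fun h => f h.down.down

@[simp] lemma uι_uDesc (f : a = a → (𝟙_ V ⟶ Z)) : uι V a ≫ uDesc f = f rfl := Sigma.ι_desc _ _

@[simp] lemma uι_uDesc_assoc : type_of% (reassoc_of% @uι_uDesc) :=
  @(reassoc_of% @uι_uDesc)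

variable [MonoidalClosed V] [BraidedCategory V]

lemma tObj_hom_ext_right {W : V} {f g : (tObj Q P).obj a b ⊗ W ⟶ Z}
    (h : ∀ c, tι Q P a c b ▷ W ≫ f = tι Q P a c b ▷ W ≫ g) : f = g := sigmaTensor_hom_ext h

lemma tObj_hom_ext_left {W : V} {f g : W ⊗ (tObj Q P).obj a b ⟶ Z}
    (h : ∀ c, W ◁ tι Q P a c b ≫ f = W ◁ tι Q P a c b ≫ g) : f = g := tensorSigma_hom_ext h

/-- Morphisms out of `(Q ⊗ P)(a, b) ⊗ W`. -/
def tDescRight {W : V} (f : ∀ c, (Q.obj a c ⊗ P.obj c b) ⊗ W ⟶ Z) :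
    (tObj Q P).obj a b ⊗ W ⟶ Z := sigmaTensorDesc f

/-- Morphisms out of `W ⊗ (Q ⊗ P)(a, b)`. -/
def tDescLeft {W : V} (f : ∀ c, W ⊗ (Q.obj a c ⊗ P.obj c b) ⟶ Z) :
    W ⊗ (tObj Q P).obj a b ⟶ Z := tensorSigmaDesc f

@[simp] lemma tι_tDescRight {W : V} (f : ∀ c, (Q.obj a c ⊗ P.obj c b) ⊗ W ⟶ Z) (c : S) :
    tι Q P a c b ▷ W ≫ tDescRight f = f c := ι_sigmaTensorDesc _ _

@[simp] lemma tι_tDescRight_assoc : type_of% (reassoc_of% @tι_tDescRight) :=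
  @(reassoc_of% @tι_tDescRight)

@[simp] lemma tι_tDescLeft {W : V} (f : ∀ c, W ⊗ (Q.obj a c ⊗ P.obj c b) ⟶ Z) (c : S) :
    W ◁ tι Q P a c b ≫ tDescLeft f = f c := ι_tensorSigmaDesc _ _

@[simp] lemma tι_tDescLeft_assoc : type_of% (reassoc_of% @tι_tDescLeft) :=
  @(reassoc_of% @tι_tDescLeft)

lemma tUnit_hom_ext_right {W : V} {f g : (tUnit V S).obj a b ⊗ W ⟶ Z}
    (h : ∀ e : a = b, uι V a ▷ W ≫ eqToHom (by rw [e]) ≫ f = uι V a ▷ W ≫ eqToHom (by rw [e]) ≫ g) :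
    f = g := sigmaTensor_hom_ext (by
      rintro ⟨⟨⟨⟩⟩⟩; have := h rfl; simp only [eqToHom_refl, Category.id_comp] at this; exact this)

lemma tUnit_hom_ext_left {W : V} {f g : W ⊗ (tUnit V S).obj a b ⟶ Z}
    (h : ∀ e : a = b, W ◁ uι V a ≫ eqToHom (by rw [e]) ≫ f = W ◁ uι V a ≫ eqToHom (by rw [e]) ≫ g) :
    f = g := tensorSigma_hom_ext (by
      rintro ⟨⟨⟨⟩⟩⟩; have := h rfl; simp only [eqToHom_refl, Category.id_comp] at this; exact this)

/-- Morphisms out of `I(a, b) ⊗ W`. -/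
def uDescRight {W : V} (f : a = b → (𝟙_ V ⊗ W ⟶ Z)) : (tUnit V S).obj a b ⊗ W ⟶ Z :=
  sigmaTensorDesc fun h => f h.down.down

/-- Morphisms out of `W ⊗ I(a, b)`. -/
def uDescLeft {W : V} (f : a = b → (W ⊗ 𝟙_ V ⟶ Z)) : W ⊗ (tUnit V S).obj a b ⟶ Z :=
  tensorSigmaDesc fun h => f h.down.down

@[simp] lemma uι_uDescRight {W : V} (f : a = a → (𝟙_ V ⊗ W ⟶ Z)) :
    uι V a ▷ W ≫ uDescRight f = f rfl := ι_sigmaTensorDesc _ _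

@[simp] lemma uι_uDescRight_assoc : type_of% (reassoc_of% @uι_uDescRight) :=
  @(reassoc_of% @uι_uDescRight)

@[simp] lemma uι_uDescLeft {W : V} (f : a = a → (W ⊗ 𝟙_ V ⟶ Z)) :
    W ◁ uι V a ≫ uDescLeft f = f rfl := ι_tensorSigmaDesc _ _

@[simp] lemma uι_uDescLeft_assoc : type_of% (reassoc_of% @uι_uDescLeft) :=
  @(reassoc_of% @uι_uDescLeft)

end

variable [MonoidalClosed V] [BraidedCategory V]

/-- The action of the tensor product of quivers on morphisms. -/
def tHom {Q Q' P P' : VQuiv V S} (f : Q ⟶ Q') (g : P ⟶ P') : tObj Q P ⟶ tObj Q' P' :=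
  ⟨fun a b => tDesc fun c => (f.app a c ⊗ₘ g.app c b) ≫ tι Q' P' a c b⟩

@[simp] lemma tι_tHom {Q Q' P P' : VQuiv V S} (f : Q ⟶ Q') (g : P ⟶ P') (a c b : S) :
    tι Q P a c b ≫ (tHom f g).app a b = (f.app a c ⊗ₘ g.app c b) ≫ tι Q' P' a c b :=
  tι_tDesc _ _

@[simp] lemma tι_tHom_assoc : type_of% (reassoc_of% @tι_tHom) :=
  @(reassoc_of% @tι_tHom)

@[simp] lemma tι_tHom_right {Q Q' P P' : VQuiv V S} (f : Q ⟶ Q') (g : P ⟶ P') (a c b : S) {W W' : V}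
    (h : W ⟶ W') :
    tι Q P a c b ▷ W ≫ ((tHom f g).app a b ⊗ₘ h) =
      ((f.app a c ⊗ₘ g.app c b) ⊗ₘ h) ≫ tι Q' P' a c b ▷ W' := by
  simp only [← tensorHom_id, tensorHom_comp_tensorHom, tι_tHom, Category.id_comp, Category.comp_id]

@[simp] lemma tι_tHom_right_assoc : type_of% (reassoc_of% @tι_tHom_right) :=
  @(reassoc_of% @tι_tHom_right)

@[simp] lemma tι_tHom_left {Q Q' P P' : VQuiv V S} (f : Q ⟶ Q') (g : P ⟶ P') (a c b : S) {W W' : V}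
    (h : W ⟶ W') :
    W ◁ tι Q P a c b ≫ (h ⊗ₘ (tHom f g).app a b) =
      (h ⊗ₘ (f.app a c ⊗ₘ g.app c b)) ≫ W' ◁ tι Q' P' a c b := by
  simp only [← id_tensorHom, tensorHom_comp_tensorHom, tι_tHom, Category.id_comp, Category.comp_id]

@[simp] lemma tι_tHom_left_assoc : type_of% (reassoc_of% @tι_tHom_left) :=
  @(reassoc_of% @tι_tHom_left)

/-- The associator. -/
def tAssoc (Q P R : VQuiv V S) : tObj (tObj Q P) R ≅ tObj Q (tObj P R) := isoMk fun a d =>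
  { hom := tDesc fun c => tDescRight fun b =>
      (α_ _ _ _).hom ≫ Q.obj a b ◁ tι P R b c d ≫ tι Q (tObj P R) a b d
    inv := tDesc fun b => tDescLeft fun c =>
      (α_ _ _ _).inv ≫ tι Q P a b c ▷ R.obj c d ≫ tι (tObj Q P) R a c d
    hom_inv_id := tObj_hom_ext fun c => tObj_hom_ext_right fun b => by simp
    inv_hom_id := tObj_hom_ext fun c => tObj_hom_ext_left fun b => by simp }

/-- The left unitor. -/
def tLeft (Q : VQuiv V S) : tObj (tUnit V S) Q ≅ Q := isoMk fun a b =>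
  { hom := tDesc fun c => uDescRight fun h => (λ_ _).hom ≫ eqToHom (by rw [h])
    inv := (λ_ _).inv ≫ uι V a ▷ _ ≫ tι (tUnit V S) Q a a b
    hom_inv_id := tObj_hom_ext fun c => tUnit_hom_ext_right fun e => by subst e; simp
    inv_hom_id := by simp }

/-- The right unitor. -/
def tRight (Q : VQuiv V S) : tObj Q (tUnit V S) ≅ Q := isoMk fun a b =>
  { hom := tDesc fun c => uDescLeft fun h => (ρ_ _).hom ≫ eqToHom (by rw [h])
    inv := (ρ_ _).inv ≫ _ ◁ uι V b ≫ tι Q (tUnit V S) a b b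
    hom_inv_id := tObj_hom_ext fun c => tUnit_hom_ext_left fun e => by subst e; simp
    inv_hom_id := by simp }

@[simp] lemma tι_tAssoc_hom (Q P R : VQuiv V S) (a b c d : S) :
    tι Q P a b c ▷ R.obj c d ≫ tι (tObj Q P) R a c d ≫ (tAssoc Q P R).hom.app a d =
      (α_ _ _ _).hom ≫ Q.obj a b ◁ tι P R b c d ≫ tι Q (tObj P R) a b d := by
  simp [tAssoc]

@[simp] lemma tι_tAssoc_hom_assoc : type_of% (reassoc_of% @tι_tAssoc_hom) :=
  @(reassoc_of% @tι_tAssoc_hom)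

@[simp] lemma uι_tLeft_hom (Q : VQuiv V S) (a b : S) :
    uι V a ▷ Q.obj a b ≫ tι (tUnit V S) Q a a b ≫ (tLeft Q).hom.app a b = (λ_ _).hom := by
  simp [tLeft]

@[simp] lemma uι_tLeft_hom_assoc : type_of% (reassoc_of% @uι_tLeft_hom) :=
  @(reassoc_of% @uι_tLeft_hom)

@[simp] lemma uι_tRight_hom (Q : VQuiv V S) (a b : S) :
    Q.obj a b ◁ uι V b ≫ tι Q (tUnit V S) a b b ≫ (tRight Q).hom.app a b = (ρ_ _).hom := by
  simp [tRight]

@[simp] lemma uι_tRight_hom_assoc : type_of% (reassoc_of% @uι_tRight_hom) :=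
  @(reassoc_of% @uι_tRight_hom)

section
variable {Q P R T Q' P' R' : VQuiv V S}

lemma tHom_id : tHom (𝟙 Q) (𝟙 P) = 𝟙 (tObj Q P) := by
  ext a b
  exact tObj_hom_ext fun c => by simp

lemma tHom_comp {Q'' P'' : VQuiv V S} (f : Q ⟶ Q') (g : P ⟶ P') (f' : Q' ⟶ Q'') (g' : P' ⟶ P'') :
    tHom f g ≫ tHom f' g' = tHom (f ≫ f') (g ≫ g') := by
  ext a b
  exact tObj_hom_ext fun c => by simp

lemma tAssoc_naturality (f : Q ⟶ Q') (g : P ⟶ P') (h : R ⟶ R') :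
    tHom (tHom f g) h ≫ (tAssoc Q' P' R').hom = (tAssoc Q P R).hom ≫ tHom f (tHom g h) := by
  ext a d
  refine tObj_hom_ext fun c => tObj_hom_ext_right fun b => ?_
  simp

lemma tLeft_naturality (f : Q ⟶ P) :
    tHom (𝟙 (tUnit V S)) f ≫ (tLeft P).hom = (tLeft Q).hom ≫ f := by
  ext a b
  refine tObj_hom_ext fun c => tUnit_hom_ext_right fun e => ?_
  subst e
  simp [← whisker_exchange_assoc]

lemma tRight_naturality (f : Q ⟶ P) :
    tHom f (𝟙 (tUnit V S)) ≫ (tRight P).hom = (tRight Q).hom ≫ f := by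
  ext a b
  refine tObj_hom_ext fun c => tUnit_hom_ext_left fun e => ?_
  subst e
  simp [whisker_exchange_assoc]

lemma tPentagon (Q P R T : VQuiv V S) :
    tHom (tAssoc Q P R).hom (𝟙 T) ≫ (tAssoc Q (tObj P R) T).hom ≫ tHom (𝟙 Q) (tAssoc P R T).hom =
      (tAssoc (tObj Q P) R T).hom ≫ (tAssoc Q P (tObj R T)).hom := by
  ext a e
  refine tObj_hom_ext fun d => tObj_hom_ext_right fun c => ?_
  apply (isColimitOfPreserves (tensorRight (R.obj c d) ⋙ tensorRight (T.obj d e))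
    (colimit.isColimit (Discrete.functor fun b => Q.obj a b ⊗ P.obj b c))).hom_ext
  rintro ⟨b⟩
  change (tι Q P a b c ▷ _) ▷ _ ≫ _ = (tι Q P a b c ▷ _) ▷ _ ≫ _
  simp only [comp_app]
  rw [tι_tHom_assoc, tensorHom_def_assoc, ← comp_whiskerRight_assoc, ← comp_whiskerRight_assoc,
    Category.assoc, tι_tAssoc_hom]
  simp only [id_app, MonoidalCategory.whiskerLeft_id, Category.id_comp, comp_whiskerRight,
    Category.assoc, tι_tAssoc_hom_assoc, tι_tHom, id_tensorHom, associator_naturality_middle_assoc,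
    ← whiskerLeft_comp_assoc, tι_tAssoc_hom, associator_naturality_left_assoc,
    ← whisker_exchange_assoc]
  simp

lemma tTriangle (Q P : VQuiv V S) :
    (tAssoc Q (tUnit V S) P).hom ≫ tHom (𝟙 Q) (tLeft P).hom = tHom (tRight Q).hom (𝟙 P) := by
  ext a c
  refine tObj_hom_ext fun b => tObj_hom_ext_right fun b' => ?_
  apply (isColimitOfPreserves (tensorLeft (Q.obj a b') ⋙ tensorRight (P.obj b c))
    (colimit.isColimit (Discrete.functor fun _ : ULift.{u} (PLift (b' = b)) => 𝟙_ V))).hom_ext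
  rintro ⟨⟨⟨e⟩⟩⟩
  subst e
  change (Q.obj a b' ◁ uι V b') ▷ _ ≫ _ = (Q.obj a b' ◁ uι V b') ▷ _ ≫ _
  simp only [comp_app, tι_tHom, tι_tAssoc_hom_assoc, id_app, id_tensorHom, tensorHom_id,
    associator_naturality_middle_assoc, ← whiskerLeft_comp_assoc, Category.assoc, uι_tLeft_hom]
  simp only [← comp_whiskerRight_assoc, Category.assoc, uι_tRight_hom]
  simp

end

instance : MonoidalCategoryStruct (VQuiv V S) where
  tensorObj := tObj
  tensorUnit := tUnit V S
  tensorHom := tHom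
  whiskerLeft Q _ _ g := tHom (𝟙 Q) g
  whiskerRight f P := tHom f (𝟙 P)
  associator := tAssoc
  leftUnitor := tLeft
  rightUnitor := tRight

instance : MonoidalCategory (VQuiv V S) := MonoidalCategory.ofTensorHom
  (id_tensorHom_id := fun _ _ => tHom_id)
  (tensorHom_comp_tensorHom := tHom_comp)
  (associator_naturality := tAssoc_naturality)
  (leftUnitor_naturality := tLeft_naturality)
  (rightUnitor_naturality := tRight_naturality)
  (pentagon := tPentagon)
  (triangle := tTriangle)

end VQuiv

end

noncomputable section

namespace VQuiv

variable {V : Type v} [Category.{u} V] {S T R : Type u}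

variable (V) in
/-- The quiver `f^* Q` with `(f^* Q)(a, b) = Q(f a, f b)`. -/
def pull (f : S → T) : VQuiv V T ⥤ VQuiv V S where
  obj Q := ⟨fun a b => Q.obj (f a) (f b)⟩
  map g := ⟨fun a b => g.app (f a) (f b)⟩

@[simp] lemma pull_map_app (f : S → T) {Q P : VQuiv V T} (g : Q ⟶ P) (a b : S) :
  ((pull V f).map g).app a b = g.app (f a) (f b) := rfl

variable [MonoidalCategory V] [HasColimitsOfSize.{u, u} V]

/-- The unit comparison `I_S ⟶ f^* I_T`. -/
def pullε (f : S → T) : tUnit V S ⟶ (pull V f).obj (tUnit V T) :=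
  ⟨fun a b => uDesc fun h => uι V (f a) ≫ eqToHom (by rw [h]; rfl)⟩

/-- The comparison `f^* Q ⊗ f^* P ⟶ f^* (Q ⊗ P)`. -/
def pullμ (f : S → T) (Q P : VQuiv V T) :
    tObj ((pull V f).obj Q) ((pull V f).obj P) ⟶ (pull V f).obj (tObj Q P) :=
  ⟨fun a b => tDesc fun c => tι Q P (f a) (f c) (f b)⟩

@[simp] lemma uι_pullε (f : S → T) (a : S) :
    uι V a ≫ (pullε f).app a a = uι V (f a) := by
  have h := uι_uDesc (a := a) (Z := (tUnit V T).obj (f a) (f a)) fun _ => uι V (f a) ≫ 𝟙 _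
  exact h.trans (Category.comp_id _)

@[simp] lemma tι_pullμ (f : S → T) (Q P : VQuiv V T) (a c b : S) :
    tι ((pull V f).obj Q) ((pull V f).obj P) a c b ≫ (pullμ f Q P).app a b =
      tι Q P (f a) (f c) (f b) := tι_tDesc _ _

@[simp] lemma tι_pullμ_assoc : type_of% (reassoc_of% @tι_pullμ) := @(reassoc_of% @tι_pullμ)

variable [MonoidalClosed V] [BraidedCategory V]

lemma pullμ_natural (f : S → T) {Q Q' P P' : VQuiv V T} (g : Q ⟶ Q') (h : P ⟶ P') :
    tHom ((pull V f).map g) ((pull V f).map h) ≫ pullμ f Q' P' =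
      pullμ f Q P ≫ (pull V f).map (tHom g h) := by
  ext a b
  refine tObj_hom_ext fun c => ?_
  rw [comp_app, comp_app, tι_tHom_assoc, tι_pullμ, tι_pullμ_assoc]
  exact (tι_tHom g h _ _ _).symm

lemma pull_associativity (f : S → T) (Q P R : VQuiv V T) :
    tHom (pullμ f Q P) (𝟙 ((pull V f).obj R)) ≫ pullμ f (tObj Q P) R ≫
        (pull V f).map (tAssoc Q P R).hom =
      (tAssoc ((pull V f).obj Q) ((pull V f).obj P) ((pull V f).obj R)).hom ≫
        tHom (𝟙 ((pull V f).obj Q)) (pullμ f P R) ≫ pullμ f Q (tObj P R) := by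
  ext a d
  refine tObj_hom_ext fun c => tObj_hom_ext_right fun b => ?_
  simp only [comp_app, tι_tHom_assoc, id_app, tensorHom_id, tι_tAssoc_hom_assoc, id_tensorHom]
  rw [← whiskerLeft_comp_assoc, tι_pullμ, ← comp_whiskerRight_assoc, tι_pullμ, tι_pullμ,
    tι_pullμ_assoc]
  exact tι_tAssoc_hom Q P R _ _ _ _

lemma pull_left_unitality (f : S → T) (Q : VQuiv V T) :
    (tLeft ((pull V f).obj Q)).hom = tHom (pullε f) (𝟙 ((pull V f).obj Q)) ≫
      pullμ f (tUnit V T) Q ≫ (pull V f).map (tLeft Q).hom := by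
  ext a b
  refine tObj_hom_ext fun c => tUnit_hom_ext_right fun e => ?_
  subst e
  simp only [eqToHom_refl, Category.id_comp, uι_tLeft_hom, comp_app, tι_tHom_assoc, id_app,
    tensorHom_id, tι_pullμ_assoc]
  rw [← comp_whiskerRight_assoc, uι_pullε]
  exact (uι_tLeft_hom Q _ _).symm

lemma pull_right_unitality (f : S → T) (Q : VQuiv V T) :
    (tRight ((pull V f).obj Q)).hom = tHom (𝟙 ((pull V f).obj Q)) (pullε f) ≫
      pullμ f Q (tUnit V T) ≫ (pull V f).map (tRight Q).hom := by
  ext a b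
  refine tObj_hom_ext fun c => tUnit_hom_ext_left fun e => ?_
  subst e
  simp only [eqToHom_refl, Category.id_comp, uι_tRight_hom, comp_app, tι_tHom_assoc, id_app,
    id_tensorHom, tι_pullμ_assoc]
  rw [← whiskerLeft_comp_assoc, uι_pullε]
  exact (uι_tRight_hom Q _ _).symm

/-- The functor `f^*` is lax monoidal. -/
instance (f : S → T) : (pull V f).LaxMonoidal := .ofTensorHom
  (ε := pullε f)
  (μ := pullμ f)
  (μ_natural := pullμ_natural f)
  (associativity := pull_associativity f)
  (left_unitality := pull_left_unitality f)
  (right_unitality := pull_right_unitality f)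

end VQuiv
end

noncomputable section

namespace VQuiv

variable {V : Type v} [Category.{u} V] {S T R : Type u} [MonoidalCategory V]
  [HasColimitsOfSize.{u, u} V] [MonoidalClosed V] [BraidedCategory V]

open Functor.LaxMonoidal

lemma pull_ε_id : ε (pull V (fun a : S => a)) = 𝟙 (𝟙_ (VQuiv V S)) := by
  ext a b
  refine tUnit_hom_ext fun e => ?_
  subst e
  rw [eqToHom_refl, Category.id_comp, Category.id_comp]
  exact (uι_pullε _ a).trans (Category.comp_id _).symm

lemma pull_μ_id (Q P : VQuiv V S) : μ (pull V (fun a : S => a)) Q P = 𝟙 (Q ⊗ P) := by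
  ext a b
  exact tObj_hom_ext fun c => (tι_pullμ _ Q P a c b).trans (Category.comp_id _).symm

lemma pull_ε_comp (f : S → T) (g : T → R) :
    ε (pull V (fun a => g (f a))) = ε (pull V f) ≫ (pull V f).map (ε (pull V g)) := by
  ext a b
  refine tUnit_hom_ext fun e => ?_
  subst e
  rw [eqToHom_refl, Category.id_comp, Category.id_comp]
  refine (uι_pullε (fun a => g (f a)) a).trans ?_
  refine Eq.trans ?_ (Category.assoc _ _ _)
  exact ((congrArg (· ≫ _) (uι_pullε f a)).trans (uι_pullε g (f a))).symm

lemma pull_μ_comp (f : S → T) (g : T → R) (Q P : VQuiv V R) :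
    μ (pull V (fun a => g (f a))) Q P =
      μ (pull V f) ((pull V g).obj Q) ((pull V g).obj P) ≫ (pull V f).map (μ (pull V g) Q P) := by
  ext a b
  refine tObj_hom_ext fun c => (tι_pullμ (fun a => g (f a)) Q P a c b).trans ?_
  refine Eq.trans ?_ (Category.assoc _ _ _)
  exact ((congrArg (· ≫ _) (tι_pullμ f ((pull V g).obj Q) ((pull V g).obj P) a c b)).trans
    (tι_pullμ g Q P _ _ _)).symm

end VQuiv

open Functor.LaxMonoidal Functor.OplaxMonoidal

section

variable {W W' W'' : Type*} [Category* W] [Category* W'] [Category* W''] [MonoidalCategory W]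
  [MonoidalCategory W'] [MonoidalCategory W''] (G : W' ⥤ W) (H : W'' ⥤ W') [G.LaxMonoidal]
  [H.LaxMonoidal]

lemma counit_comp {x : W} {y : W'} {z : W''} {a : x ⟶ G.obj y} {b : y ⟶ H.obj z} {ηx : x ⟶ 𝟙_ W}
    {ηy : y ⟶ 𝟙_ W'} {ηz : z ⟶ 𝟙_ W''} (h1 : a ≫ G.map ηy = ηx ≫ ε G)
    (h2 : b ≫ H.map ηz = ηy ≫ ε H) :
    (a ≫ G.map b) ≫ G.map (H.map ηz) = ηx ≫ ε G ≫ G.map (ε H) := by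
  rw [Category.assoc, ← G.map_comp, h2, G.map_comp, ← Category.assoc, h1, Category.assoc]

lemma comul_comp {x x₁ x₂ : W} {y y₁ y₂ : W'} {z z₁ z₂ : W''} {a : x ⟶ G.obj y} {b : y ⟶ H.obj z}
    {a₁ : x₁ ⟶ G.obj y₁} {b₁ : y₁ ⟶ H.obj z₁} {a₂ : x₂ ⟶ G.obj y₂} {b₂ : y₂ ⟶ H.obj z₂}
    {δx : x ⟶ x₁ ⊗ x₂} {δy : y ⟶ y₁ ⊗ y₂} {δz : z ⟶ z₁ ⊗ z₂}
    (h1 : a ≫ G.map δy = δx ≫ (a₁ ⊗ₘ a₂) ≫ μ G _ _)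
    (h2 : b ≫ H.map δz = δy ≫ (b₁ ⊗ₘ b₂) ≫ μ H _ _) :
    (a ≫ G.map b) ≫ G.map (H.map δz) =
      δx ≫ ((a₁ ≫ G.map b₁) ⊗ₘ (a₂ ≫ G.map b₂)) ≫ μ G _ _ ≫ G.map (μ H _ _) := by
  rw [Category.assoc, ← G.map_comp, h2, G.map_comp, ← Category.assoc, h1]
  simp [← tensorHom_comp_tensorHom, μ_natural_assoc]

lemma unit_comp {x : W} {y : W'} {z : W''} {a : x ⟶ G.obj y} {b : y ⟶ H.obj z} {εx : 𝟙_ W ⟶ x}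
    {εy : 𝟙_ W' ⟶ y} {εz : 𝟙_ W'' ⟶ z} (h1 : εx ≫ a = ε G ≫ G.map εy)
    (h2 : εy ≫ b = ε H ≫ H.map εz) :
    εx ≫ a ≫ G.map b = (ε G ≫ G.map (ε H)) ≫ G.map (H.map εz) := by
  rw [← Category.assoc, h1, Category.assoc, ← G.map_comp, h2, G.map_comp, Category.assoc]

lemma mul_comp {x x₁ x₂ : W} {y y₁ y₂ : W'} {z z₁ z₂ : W''} {a : x ⟶ G.obj y} {b : y ⟶ H.obj z}
    {a₁ : x₁ ⟶ G.obj y₁} {b₁ : y₁ ⟶ H.obj z₁} {a₂ : x₂ ⟶ G.obj y₂} {b₂ : y₂ ⟶ H.obj z₂}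
    {μx : x₁ ⊗ x₂ ⟶ x} {μy : y₁ ⊗ y₂ ⟶ y} {μz : z₁ ⊗ z₂ ⟶ z}
    (h1 : μx ≫ a = (a₁ ⊗ₘ a₂) ≫ μ G _ _ ≫ G.map μy)
    (h2 : μy ≫ b = (b₁ ⊗ₘ b₂) ≫ μ H _ _ ≫ H.map μz) :
    μx ≫ a ≫ G.map b =
      ((a₁ ≫ G.map b₁) ⊗ₘ (a₂ ≫ G.map b₂)) ≫ (μ G _ _ ≫ G.map (μ H _ _)) ≫ G.map (H.map μz) := by
  rw [← Category.assoc, h1, Category.assoc, Category.assoc, ← G.map_comp, h2]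
  simp [← tensorHom_comp_tensorHom, μ_natural_assoc]

end

variable (V : Type v) [Category.{u} V] [MonoidalCategory V]
  [HasColimitsOfSize.{u, u} V] [MonoidalClosed V] [BraidedCategory V]

/-- A templicial object of `V`: a set of vertices `S` together with a strongly unital colax
monoidal functor `Δ_fᵒᵖ ⥤ V-Quiv_S`. -/
structure Templ where
  S : Type u
  X : FinIntᵒᵖ ⥤ VQuiv V S
  [oplax : X.OplaxMonoidal]
  [isIso_η : IsIso (η X)]

namespace Templ

attribute [instance] oplax isIso_η

variable {V}

/-- A templicial morphism: a map `f` on vertices together with a monoidal natural transformation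
`f_! X ⟶ Y`, the latter being given by its transpose `X ⟶ f^* Y` under `f_! ⊣ f^*`. -/
structure Hom (A B : Templ V) where
  f : A.S → B.S
  α : A.X ⟶ B.X ⋙ VQuiv.pull V f
  counit : α.app (𝟙_ _) ≫ (VQuiv.pull V f).map (η B.X) = η A.X ≫ ε (VQuiv.pull V f)
  comul : ∀ m n, α.app (m ⊗ n) ≫ (VQuiv.pull V f).map (δ B.X m n) =
    δ A.X m n ≫ (α.app m ⊗ₘ α.app n) ≫ μ (VQuiv.pull V f) _ _

lemma Hom.ext_same {A B : Templ V} {f : A.S → B.S} {α α' : A.X ⟶ B.X ⋙ VQuiv.pull V f}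
    {h1 h2 h1' h2'} (h : ∀ n a b, (α.app n).app a b = (α'.app n).app a b) :
    Hom.mk f α h1 h2 = Hom.mk f α' h1' h2' := by
  have : α = α' := by
    ext n a b
    exact h n a b
  subst this
  rfl

/-- The identity. -/
def Hom.id (A : Templ V) : Hom A A where
  f a := a
  α := { app n := 𝟙 (A.X.obj n)
         naturality m n g := (Category.comp_id _).trans (Category.id_comp _).symm }
  counit := by
    rw [VQuiv.pull_ε_id]
    exact (Category.id_comp _).trans (Category.comp_id _).symm
  comul m n := by
    rw [VQuiv.pull_μ_id]
    refine (Category.id_comp _).trans ?_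
    refine Eq.trans ?_ (congrArg (_ ≫ · ≫ _) (id_tensorHom_id _ _).symm)
    exact (((congrArg (_ ≫ ·) (Category.comp_id _)).trans (Category.comp_id _))).symm

/-- The composition. -/
def Hom.comp {A B C : Templ V} (φ : Hom A B) (ψ : Hom B C) : Hom A C where
  f a := ψ.f (φ.f a)
  α := φ.α ≫ Functor.whiskerRight ψ.α (VQuiv.pull V φ.f)
  counit := by
    rw [VQuiv.pull_ε_comp]
    exact counit_comp (VQuiv.pull V φ.f) (VQuiv.pull V ψ.f) φ.counit ψ.counit
  comul m n := by
    rw [VQuiv.pull_μ_comp]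
    exact comul_comp (VQuiv.pull V φ.f) (VQuiv.pull V ψ.f) (φ.comul m n) (ψ.comul m n)

instance : Category (Templ V) where
  Hom := Hom
  id := Hom.id
  comp := Hom.comp
  id_comp _ := Hom.ext_same fun _ _ _ => Category.id_comp _
  comp_id _ := Hom.ext_same fun _ _ _ => Category.comp_id _
  assoc _ _ _ := Hom.ext_same fun _ _ _ => Category.assoc _ _ _

end Templ

/-- A (small) necklace category: a category enriched in `V^(Necᵒᵖ)` with the Day convolution.
Since monoids for the Day convolution are lax monoidal functors, such a category with set of
objects `S` is a lax monoidal functor `C : Necᵒᵖ ⥤ V-Quiv_S`: the object `C_T(a, b)` is the value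
at `T` of the hom-object from `a` to `b`, the composition law is
`∐ b, C_T(a, b) ⊗ C_U(b, c) ⟶ C_{T ∨ U}(a, c)`, and the identities are `I ⟶ C_{Δ⁰}(a, a)`. -/
structure NecCat where
  S : Type u
  C : Necᵒᵖ ⥤ VQuiv V S
  [lax : C.LaxMonoidal]

namespace NecCat

attribute [instance] lax

variable {V}

/-- A functor of necklace categories. -/
structure Hom (A B : NecCat V) where
  f : A.S → B.S
  α : A.C ⟶ B.C ⋙ VQuiv.pull V f
  unit : ε A.C ≫ α.app (𝟙_ _) = ε (VQuiv.pull V f) ≫ (VQuiv.pull V f).map (ε B.C)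
  mul : ∀ T U, μ A.C T U ≫ α.app (T ⊗ U) =
    (α.app T ⊗ₘ α.app U) ≫ μ (VQuiv.pull V f) _ _ ≫ (VQuiv.pull V f).map (μ B.C T U)

lemma Hom.ext_same {A B : NecCat V} {f : A.S → B.S} {α α' : A.C ⟶ B.C ⋙ VQuiv.pull V f}
    {h1 h2 h1' h2'} (h : ∀ n a b, (α.app n).app a b = (α'.app n).app a b) :
    Hom.mk f α h1 h2 = Hom.mk f α' h1' h2' := by
  have : α = α' := by
    ext n a b
    exact h n a b
  subst this
  rfl

/-- The identity. -/
def Hom.id (A : NecCat V) : Hom A A where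
  f a := a
  α := { app n := 𝟙 (A.C.obj n)
         naturality m n g := (Category.comp_id _).trans (Category.id_comp _).symm }
  unit := by
    rw [VQuiv.pull_ε_id]
    exact (Category.comp_id _).trans (Category.id_comp _).symm
  mul m n := by
    rw [VQuiv.pull_μ_id]
    refine (Category.comp_id _).trans ?_
    refine Eq.trans ?_ (congrArg (· ≫ _) (id_tensorHom_id _ _).symm)
    exact (((congrArg (_ ≫ ·) (Category.id_comp _)).trans (Category.id_comp _))).symm

/-- The composition. -/
def Hom.comp {A B C : NecCat V} (φ : Hom A B) (ψ : Hom B C) : Hom A C where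
  f a := ψ.f (φ.f a)
  α := φ.α ≫ Functor.whiskerRight ψ.α (VQuiv.pull V φ.f)
  unit := by
    rw [VQuiv.pull_ε_comp]
    exact unit_comp (VQuiv.pull V φ.f) (VQuiv.pull V ψ.f) φ.unit ψ.unit
  mul m n := by
    rw [VQuiv.pull_μ_comp]
    exact mul_comp (VQuiv.pull V φ.f) (VQuiv.pull V ψ.f) (φ.mul m n) (ψ.mul m n)

instance : Category (NecCat V) where
  Hom := Hom
  id := Hom.id
  comp := Hom.comp
  id_comp _ := Hom.ext_same fun _ _ _ => Category.id_comp _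
  comp_id _ := Hom.ext_same fun _ _ _ => Category.comp_id _
  assoc _ _ _ := Hom.ext_same fun _ _ _ => Category.assoc _ _ _

end NecCat

end

noncomputable section

section NecExt

open Functor.LaxMonoidal Functor.OplaxMonoidal

variable {W : Type*} [Category* W] [MonoidalCategory W] (X : FinIntᵒᵖ ⥤ W) [X.OplaxMonoidal]
  [IsIso (η X)]

/-- `X_{n₁} ⊗ (X_{n₂} ⊗ ⋯)`. -/
def chain : List ℕ → W
  | [] => 𝟙_ W
  | n :: L => X.obj (op ⟨n⟩) ⊗ chain L

/-- The comultiplication `μ_{a,b} : X_m ⟶ X_a ⊗ X_b` for `m = a + b`. -/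
def comul {a b m : ℕ} (h : a + b = m) : X.obj (op ⟨m⟩) ⟶ X.obj (op ⟨a⟩) ⊗ X.obj (op ⟨b⟩) :=
  X.map (FinInt.eqIso (a := ⟨a⟩ ⊗ ⟨b⟩) (b := ⟨m⟩) h).hom.op ≫ δ X (op ⟨a⟩) (op ⟨b⟩)

/-- The isomorphism `X_0 ≅ I` given by the counit. -/
def unitIso : X.obj (op ⟨0⟩) ≅ 𝟙_ W := asIso (η X)

/-- `Cut X m M N σ` says that `N` is what remains of the string of beads `M` after cutting off an
initial interval of length `m` that does not meet the interior of two beads,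
and that `σ : X_M ⟶ X_m ⊗ X_N` is the associated comultiplication. -/
inductive Cut : (m : ℕ) → (M N : List ℕ) → (chain X M ⟶ X.obj (op ⟨m⟩) ⊗ chain X N) → Prop
  | zero (M : List ℕ) : Cut 0 M M ((λ_ (chain X M)).inv ≫ (unitIso X).inv ▷ chain X M)
  | hit {m : ℕ} (hm : 0 < m) (M : List ℕ) : Cut m (m :: M) M (𝟙 _)
  | mid {a b m : ℕ} (ha : 0 < a) (hb : 0 < b) (h : a + b = m) (M : List ℕ) :
    Cut a (m :: M) (b :: M) (comul X h ▷ chain X M ≫ (α_ _ _ _).hom)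

/-- `Pull X M L f φ` says that `φ : X_M ⟶ X_L` is the action of the necklace morphism
`f : L ⟶ M`. If `f` sends the first bead `[n]` of `L` to an interval `[0, m]` by `g`,
then `φ` splits off `X_m` from `X_M`, and it acts by `X(g) : X_m ⟶ X_n` on this factor and
by the rest of `f` on the other factor. -/
inductive Pull : (M L : List ℕ) → (ℕ → ℕ) → (chain X M ⟶ chain X L) → Prop
  | nil : Pull [] [] (fun i => i) (𝟙 _)
  | cons {n m : ℕ} {M N L : List ℕ} {σ : chain X M ⟶ X.obj (op ⟨m⟩) ⊗ chain X N}
    {f : ℕ → ℕ} {φ : chain X N ⟶ chain X L} (g : FinInt.mk n ⟶ FinInt.mk m) (hσ : Cut X m M N σ)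
    (hφ : Pull N L f φ) : Pull M (n :: L) (glue n m g.toFun f) (σ ≫ (X.map g.op ⊗ₘ φ))

variable {X}

lemma Cut.sum {m M N σ} (h : Cut X m M N σ) : M.sum = m + N.sum := by
  cases h with
  | zero => simp
  | hit => simp
  | mid => simp; omega

lemma Pull.interval {M L f φ} (h : Pull X M L f φ) : IsInterval L.sum M.sum f := by
  induction h with
  | nil => exact .id _
  | cons g hσ hφ ih =>
    rw [hσ.sum, List.sum_cons]
    exact g.prop.glue ih

lemma Cut.unique {m M N N' σ σ'} (h : Cut X m M N σ) (h' : Cut X m M N' σ') :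
    N = N' ∧ HEq σ σ' := by
  cases h with
  | zero => cases h' with
    | zero => exact ⟨rfl, HEq.rfl⟩
    | hit hm => omega
    | mid ha hb h => omega
  | hit hm => cases h' with
    | zero => omega
    | hit hm => exact ⟨rfl, HEq.rfl⟩
    | mid ha hb h => omega
  | mid ha hb h => cases h' with
    | zero => omega
    | hit hm => omega
    | mid ha' hb' h' =>
      obtain rfl := Nat.add_left_cancel (h.trans h'.symm)
      exact ⟨rfl, HEq.rfl⟩

lemma Pull.unique {M L f f' φ φ'} (h : Pull X M L f φ) (h' : Pull X M L f' φ') (hf : f = f') :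
    φ = φ' := by
  induction h generalizing f' with
  | nil => cases h'; rfl
  | @cons n m M N L σ f₁ φ₁ g hσ hφ ih =>
    cases h' with
    | @cons _ m' _ N' _ σ' f₁' φ₁' g' hσ' hφ' =>
      have h1 : ∀ i ≤ n, g.toFun i = g'.toFun i := fun i hi => by
        simpa [glue, hi] using congrFun hf i
      have hm : m = m' := by
        have h2 := g.prop.map_last
        have h3 := g'.prop.map_last
        exact h2.symm.trans ((h1 _ le_rfl).trans h3)
      subst hm
      have hg : g = g' := by
        ext i
        by_cases hi : i ≤ n
        · exact h1 i hi
        · rw [g.prop.map_of_le (le_of_not_ge hi), g'.prop.map_of_le (le_of_not_ge hi)]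
      subst hg
      obtain ⟨rfl, hσ⟩ := hσ.unique hσ'
      obtain rfl := eq_of_heq hσ
      have hf' : f₁ = f₁' := by
        funext i
        have := congrFun hf (n + i)
        rcases Nat.eq_zero_or_pos i with rfl | hi
        · rw [hφ.interval.map_zero, hφ'.interval.map_zero]
        · simpa [glue, show ¬ n + i ≤ n by omega] using this
      rw [ih hφ' hf']

lemma Pull.exists {M L : List ℕ} (hM : ∀ n ∈ M, 0 < n) {f : ℕ → ℕ}
    (hf : IsInterval L.sum M.sum f) (hj : Nec.joints M ⊆ f '' Nec.joints L) :
    ∃ φ, Pull X M L f φ := by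
  induction L generalizing M f with
  | nil =>
    have hs : M.sum = 0 := by
      rw [← hf.map_last, List.sum_nil, hf.map_zero]
    obtain rfl : M = [] := by
      cases M with
      | nil => rfl
      | cons a M =>
        have := hM a (by simp)
        simp at hs
        omega
    obtain rfl : f = fun i => i := by
      funext i
      simpa using hf.map_add i
    exact ⟨_, .nil⟩
  | cons n L ih =>
    have hsum : n + L.sum = (n :: L).sum := by simp
    have key : ∃ N σ, Cut X (f n) M N σ ∧ (∀ n ∈ N, 0 < n) ∧
        ∀ i ∈ Nec.joints N, i = 0 ∨ f n + i ∈ Nec.joints M := by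
      by_cases h0 : f n = 0
      · rw [h0]
        exact ⟨M, _, .zero M, hM, fun i hi => Or.inr (by simpa using hi)⟩
      cases M with
      | nil =>
        have := hf.mono (show n ≤ (n :: L).sum by simp)
        rw [hf.map_last, List.sum_nil] at this
        omega
      | cons r R =>
        have hr : 0 < r := hM r (by simp)
        have hle : f n ≤ r := by
          obtain ⟨j, hj1, hj2⟩ := hj (show r ∈ Nec.joints (r :: R) from
            Or.inr ⟨0, Nec.zero_mem_joints R, by simp⟩)
          rcases hj1 with hj1 | ⟨k, -, rfl⟩
          · rw [Set.mem_singleton_iff.1 hj1, hf.map_zero] at hj2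
            omega
          · rw [← hj2]
            exact hf.mono (Nat.le_add_right _ _)
        rcases hle.eq_or_lt with h1 | h1
        · rw [h1]
          exact ⟨R, _, .hit hr R, fun n hn => hM n (by simp [hn]),
            fun i hi => Or.inr (Or.inr ⟨i, hi, rfl⟩)⟩
        · refine ⟨(r - f n) :: R, _, .mid (Nat.pos_of_ne_zero h0) (by omega)
            (by omega : f n + (r - f n) = r) R, ?_, ?_⟩
          · intro k hk
            rcases List.mem_cons.1 hk with rfl | hk
            · omega
            · exact hM k (by simp [hk])
          · rintro i (hi | ⟨k, hk, rfl⟩)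
            · exact Or.inl hi
            · exact Or.inr (Or.inr ⟨k, hk, by dsimp; omega⟩)
    obtain ⟨N, σ, hσ, hN, hNj⟩ := key
    have hfn : ∀ i, f n ≤ f (n + i) := fun i => hf.mono (Nat.le_add_right _ _)
    have hf' : IsInterval L.sum N.sum (fun i => f (n + i) - f n) :=
      { mono := fun i j hij => Nat.sub_le_sub_right (hf.mono (by omega)) _
        map_zero := by simp
        map_add := fun i => by
          have h1 := hf.map_add i
          rw [hσ.sum, ← hsum, Nat.add_assoc] at h1
          rw [h1]
          omega }
    obtain ⟨φ, hφ⟩ := ih hN hf' (by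
      intro i hi
      rcases hNj i hi with rfl | hi'
      · exact ⟨0, Nec.zero_mem_joints _, by simp⟩
      · obtain ⟨j, hj1, hj2⟩ := hj hi'
        rcases hj1 with hj1 | ⟨k, hk, rfl⟩
        · rw [Set.mem_singleton_iff.1 hj1, hf.map_zero] at hj2
          exact ⟨0, Nec.zero_mem_joints _, by simp; omega⟩
        · exact ⟨k, hk, by dsimp at hj2 ⊢; omega⟩)
    let g : FinInt.mk n ⟶ FinInt.mk (f n) :=
      ⟨fun i => if i ≤ n then f i else f n + (i - n),
        { mono := fun i j hij => by
            have := @hf.mono i j hij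
            have := @hf.mono i n
            dsimp only
            split_ifs <;> omega
          map_zero := by simp [hf.map_zero]
          map_add := fun i => by
            dsimp only
            split_ifs with h
            · obtain rfl : i = 0 := by omega
              rfl
            · omega }⟩
    have hg : glue n (f n) g.toFun (fun i => f (n + i) - f n) = f := by
      funext i
      unfold glue
      split_ifs with h
      · exact if_pos h
      · have := hfn (i - n)
        dsimp only
        rw [show n + (i - n) = i by omega] at this ⊢
        omega
    exact ⟨_, hg ▸ Pull.cons g hσ hφ⟩

variable (X) in
lemma comul_refl (a b : ℕ) :
    comul X (rfl : a + b = a + b) = δ X (op ⟨a⟩) (op ⟨b⟩) :=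
  (congrArg (· ≫ _) (X.map_id _)).trans (Category.id_comp _)

lemma comul_coassoc {a b c ab bc r : ℕ} (h1 : a + b = ab) (h2 : ab + c = r) (h3 : b + c = bc)
    (h4 : a + bc = r) :
    comul X h2 ≫ comul X h1 ▷ X.obj (op ⟨c⟩) ≫ (α_ _ _ _).hom =
      comul X h4 ≫ X.obj (op ⟨a⟩) ◁ comul X h3 := by
  subst h1 h3 h2
  rw [comul_refl, comul_refl, comul_refl]
  refine (associativity X (op ⟨a⟩) (op ⟨b⟩) (op ⟨c⟩)).trans ?_
  exact (Category.assoc _ _ _).symm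

lemma comul_natural {a b m a' b' m' : ℕ} (h : a + b = m) (h' : a' + b' = m')
    (g : FinInt.mk m ⟶ ⟨m'⟩) (g₁ : FinInt.mk a ⟶ ⟨a'⟩) (g₂ : FinInt.mk b ⟶ ⟨b'⟩)
    (hg : ∀ i, g.toFun i = glue a a' g₁.toFun g₂.toFun i) :
    X.map g.op ≫ comul X h = comul X h' ≫ (X.map g₁.op ⊗ₘ X.map g₂.op) := by
  subst h h'
  rw [comul_refl, comul_refl]
  refine Eq.trans ?_ (δ_natural X g₁.op g₂.op).symm
  congr 2
  exact congrArg Quiver.Hom.op (FinInt.hom_ext hg)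

lemma comul_zero_left {b : ℕ} (h : 0 + b = b) :
    comul X h = (λ_ (X.obj (op ⟨b⟩))).inv ≫ (unitIso X).inv ▷ X.obj (op ⟨b⟩) := by
  have h1 : comul X h ≫ (unitIso X).hom ▷ X.obj (op ⟨b⟩) = (λ_ (X.obj (op ⟨b⟩))).inv :=
    (Category.assoc _ _ _).trans (left_unitality X (op ⟨b⟩)).symm
  rw [← h1, Category.assoc, hom_inv_whiskerRight, Category.comp_id]

lemma comul_zero_right {a : ℕ} (h : a + 0 = a) :
    comul X h = (ρ_ (X.obj (op ⟨a⟩))).inv ≫ X.obj (op ⟨a⟩) ◁ (unitIso X).inv := by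
  have h1 : comul X h ≫ X.obj (op ⟨a⟩) ◁ (unitIso X).hom = (ρ_ (X.obj (op ⟨a⟩))).inv :=
    (Category.assoc _ _ _).trans (right_unitality X (op ⟨a⟩)).symm
  rw [← h1, Category.assoc, whiskerLeft_hom_inv, Category.comp_id]

lemma Cut.coassoc {m M N σ} (h : Cut X m M N σ) {a b : ℕ} (e : a + b = m) :
    ∃ N₁ τ₁ τ₂, Cut X a M N₁ τ₁ ∧ Cut X b N₁ N τ₂ ∧
      σ ≫ comul X e ▷ chain X N ≫ (α_ _ _ _).hom = τ₁ ≫ X.obj (op ⟨a⟩) ◁ τ₂ := by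
  rcases Nat.eq_zero_or_pos a with rfl | ha
  · obtain rfl : b = m := by omega
    refine ⟨M, _, σ, .zero M, h, ?_⟩
    rw [comul_zero_left, Category.assoc, ← whisker_exchange]
    simp [-Functor.OplaxMonoidal.left_unitality]
  rcases Nat.eq_zero_or_pos b with rfl | hb
  · obtain rfl : a = m := by omega
    refine ⟨N, σ, _, h, .zero N, ?_⟩
    rw [comul_zero_right]
    simp [-Functor.OplaxMonoidal.right_unitality]
  cases h with
  | zero => omega
  | hit hm M =>
    refine ⟨_, _, _, .mid ha hb e N, .hit hb N, ?_⟩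
    simp [chain]
  | @mid _ k r hm hk h M =>
    refine ⟨_, _, _, .mid ha (by omega) (by omega : a + (b + k) = r) M, .mid hb hk rfl M, ?_⟩
    have := congrArg (· ▷ chain X M) (comul_coassoc (X := X) e h rfl (by omega : a + (b + k) = r))
    simp only [comp_whiskerRight] at this
    simp only [chain, Category.assoc, whiskerLeft_comp]
    rw [← associator_naturality_middle_assoc, ← reassoc_of% this]
    simp

/-- Compatibility of the actions of necklace maps with cutting off an initial interval. -/
lemma Cut.pull {m M N σ} (h : Cut X m M N σ) {L f φ} (hφ : Pull X L M f φ) :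
    ∃ (m' : ℕ) (N' : List ℕ) (τ : _) (g : FinInt.mk m ⟶ ⟨m'⟩) (f' : ℕ → ℕ) (φ' : _),
      Cut X m' L N' τ ∧ Pull X N' N f' φ' ∧ φ ≫ σ = τ ≫ (X.map g.op ⊗ₘ φ') ∧
        f = glue m m' g.toFun f' := by
  cases h with
  | zero =>
    refine ⟨0, L, _, 𝟙 _, f, φ, .zero L, hφ, ?_, ?_⟩
    · simp [← whisker_exchange]
    · funext i
      exact (IsInterval.glue_zero_left rfl hφ.interval.map_zero i).symm
  | hit hm N =>
    cases hφ with
    | @cons _ m' _ N' _ τ f' φ' g hτ hφ' =>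
      exact ⟨m', N', τ, g, f', φ', hτ, hφ', Category.comp_id _, rfl⟩
  | @mid _ k r hm hk h N =>
    cases hφ with
    | @cons _ s _ N' _ τ f' φ' g hτ hφ' =>
      have hs : g.toFun m + (s - g.toFun m) = s :=
        Nat.add_sub_cancel' (g.prop.map_le (by dsimp; omega))
      obtain ⟨N₁, τ₁, τ₂, h1, h2, e⟩ := hτ.coassoc hs
      have hk' : g.toFun (m + k) = s := by rw [h]; exact g.prop.map_last
      have hle : ∀ i, g.toFun m ≤ g.toFun (m + i) := fun i => g.prop.mono (Nat.le_add_right _ _)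
      let g₁ : FinInt.mk m ⟶ ⟨g.toFun m⟩ :=
        ⟨fun i => if i ≤ m then g.toFun i else g.toFun m + (i - m),
          { mono := fun i j hij => by
              have h1 : g.toFun i ≤ g.toFun j := g.prop.mono hij
              have h2 : i ≤ m → g.toFun i ≤ g.toFun m := fun h => g.prop.mono h
              dsimp only
              split_ifs <;> omega
            map_zero := by simp [g.prop.map_zero]
            map_add := fun i => by
              dsimp only
              split_ifs with h
              · obtain rfl : i = 0 := by omega
                rfl
              · omega }⟩
      let g₂ : FinInt.mk k ⟶ ⟨s - g.toFun m⟩ :=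
        ⟨fun i => g.toFun (m + i) - g.toFun m,
          { mono := fun i j hij => Nat.sub_le_sub_right (g.prop.mono (by omega)) _
            map_zero := by simp
            map_add := fun i => by
              dsimp only
              rw [← Nat.add_assoc, h]
              refine (congrArg (· - _) (g.prop.map_add i)).trans ?_
              dsimp only
              omega }⟩
      have hg : ∀ i, g.toFun i = glue m (g.toFun m) g₁.toFun g₂.toFun i := fun i => by
        unfold glue
        split_ifs with hi
        · exact (if_pos hi).symm
        · have h1 := hle (i - m)
          change _ = g.toFun m + (g.toFun (m + (i - m)) - g.toFun m)
          rw [Nat.add_sub_cancel' h1, Nat.add_sub_cancel' (by omega)]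
      refine ⟨g.toFun m, N₁, τ₁, g₁, glue k (s - g.toFun m) g₂.toFun f', _, h1,
        .cons g₂ h2 hφ', ?_, ?_⟩
      · have h3 := comul_natural (X := X) h hs g g₁ g₂ hg
        have h4 : (X.map g.op ⊗ₘ φ') ≫ comul X h ▷ chain X N =
            comul X hs ▷ chain X N' ≫ ((X.map g₁.op ⊗ₘ X.map g₂.op) ⊗ₘ φ') := by
          rw [← tensorHom_id, tensorHom_comp_tensorHom, h3, ← tensorHom_id,
            tensorHom_comp_tensorHom, Category.comp_id, Category.id_comp]
        have h6 : (X.map g.op ⊗ₘ φ') ≫ comul X h ▷ chain X N ≫ (α_ _ _ _).hom =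
            (comul X hs ▷ chain X N' ≫ (α_ _ _ _).hom) ≫
              (X.map g₁.op ⊗ₘ (X.map g₂.op ⊗ₘ φ')) := by
          rw [reassoc_of% h4, associator_naturality, Category.assoc]
        refine (Category.assoc _ _ _).trans ((congrArg (τ ≫ ·) h6).trans ?_)
        rw [← Category.assoc, e, Category.assoc, ← id_tensorHom, tensorHom_comp_tensorHom,
          Category.id_comp]
        rfl
      · have h5 := IsInterval.glue_assoc (m := m) (m' := g.toFun m) (n := k)
          (n' := s - g.toFun m) (f := g₁.toFun) (g := g₂.toFun) (h := f')
        funext i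
        rw [← h5 i, h, hs, ← funext hg]

lemma Pull.id {L : List ℕ} (hL : ∀ n ∈ L, 0 < n) : Pull X L L (fun i => i) (𝟙 _) := by
  induction L with
  | nil => exact .nil
  | cons n L ih =>
    have h := Pull.cons (𝟙 (FinInt.mk n)) (.hit (hL n (by simp)) L)
      (ih fun k hk => hL k (by simp [hk]))
    convert h using 1
    · funext i
      exact (IsInterval.glue_id (.id _) (fun _ => rfl) (fun _ => rfl) i).symm
    · simp [chain]

lemma Pull.comp {N M L f g φ ψ} (h : Pull X N M f φ) (h' : Pull X M L g ψ) :
    Pull X N L (fun i => f (g i)) (φ ≫ ψ) := by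
  induction h' generalizing N f with
  | nil =>
    rw [Category.comp_id]
    exact h
  | @cons n m M M' L σ g' ψ' k hσ hψ ih =>
    obtain ⟨m', N', τ, l, f', φ', hτ, hφ', e, rfl⟩ := hσ.pull h
    have h1 := Pull.cons (k ≫ l) hτ (ih hφ')
    convert h1 using 1
    · funext i
      exact IsInterval.glue_comp k.prop l.prop hφ'.interval.map_zero i
    · have e2 : (φ ≫ σ) ≫ (X.map k.op ⊗ₘ ψ') = τ ≫ (X.map (k ≫ l).op ⊗ₘ φ' ≫ ψ') := by
        rw [e, Category.assoc, tensorHom_comp_tensorHom, op_comp, X.map_comp]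
      exact (Category.assoc _ _ _).symm.trans e2

variable (X) in
/-- The isomorphism `X_L ⊗ X_M ≅ X_{L ∨ M}`. -/
def chainAppend : ∀ L M : List ℕ, chain X L ⊗ chain X M ≅ chain X (L ++ M)
  | [], M => λ_ (chain X M)
  | n :: L, M => α_ _ _ _ ≪≫ whiskerLeftIso (X.obj (op ⟨n⟩)) (chainAppend L M)

lemma chainAppend_cons_hom (n : ℕ) (L M : List ℕ) : (chainAppend X (n :: L) M).hom =
    (α_ (X.obj (op ⟨n⟩)) (chain X L) (chain X M)).hom ≫
      X.obj (op ⟨n⟩) ◁ (chainAppend X L M).hom := rfl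

lemma chainAppend_nil_hom (M : List ℕ) : (chainAppend X [] M).hom = (λ_ (chain X M)).hom := rfl

lemma Cut.append {m M N σ} (h : Cut X m M N σ) (P : List ℕ) :
    ∃ τ, Cut X m (M ++ P) (N ++ P) τ ∧ (chainAppend X M P).hom ≫ τ =
      σ ▷ chain X P ≫ (α_ _ _ _).hom ≫ X.obj (op ⟨m⟩) ◁ (chainAppend X N P).hom := by
  cases h with
  | zero =>
    refine ⟨_, .zero _, ?_⟩
    rw [leftUnitor_inv_naturality_assoc, whisker_exchange]
    simp
  | hit hm =>
    refine ⟨_, .hit hm _, ?_⟩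
    rw [chainAppend_cons_hom]
    simp [chain]
  | mid ha hb h =>
    refine ⟨_, .mid ha hb h _, ?_⟩
    rw [chainAppend_cons_hom, chainAppend_cons_hom]
    simp [chain, whisker_exchange_assoc]

lemma Pull.append {M L f φ M' L' f' φ'} (h : Pull X M L f φ) (h' : Pull X M' L' f' φ') :
    ∃ ψ, Pull X (M ++ M') (L ++ L') (glue L.sum M.sum f f') ψ ∧
      (chainAppend X M M').hom ≫ ψ = (φ ⊗ₘ φ') ≫ (chainAppend X L L').hom := by
  induction h with
  | nil =>
    refine ⟨φ', ?_, ?_⟩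
    · have h1 : glue 0 0 (fun i => i) f' = f' :=
        funext (IsInterval.glue_zero_left rfl h'.interval.map_zero)
      exact (congrArg (Pull X M' L' · φ') h1).mpr h'
    · rw [id_tensorHom]
      exact (leftUnitor_naturality φ').symm
  | @cons n m M N L σ g φ k hσ hφ ih =>
    obtain ⟨ψ, hψ, e⟩ := ih
    obtain ⟨τ, hτ, e'⟩ := hσ.append M'
    refine ⟨τ ≫ (X.map k.op ⊗ₘ ψ), ?_, ?_⟩
    · have h1 : glue (n :: L).sum M.sum (glue n m k.toFun g) f' =
          glue n m k.toFun (glue L.sum N.sum g f') := by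
        rw [hσ.sum, List.sum_cons]
        exact funext fun i => IsInterval.glue_assoc i
      exact (congrArg (Pull X (M ++ M') (n :: (L ++ L')) · _) h1).mpr (.cons k hτ hψ)
    · have e2 : σ ▷ chain X M' ≫ (α_ _ _ _).hom ≫
          X.obj (op ⟨m⟩) ◁ (chainAppend X N M').hom ≫ (X.map k.op ⊗ₘ ψ) =
          ((σ ≫ (X.map k.op ⊗ₘ φ)) ⊗ₘ φ') ≫ (α_ _ _ _).hom ≫
            X.obj (op ⟨n⟩) ◁ (chainAppend X L L').hom := by
        have e3 : (X.map k.op ⊗ₘ (φ ⊗ₘ φ') ≫ (chainAppend X L L').hom) =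
            (X.map k.op ⊗ₘ (φ ⊗ₘ φ')) ≫ (𝟙 _ ⊗ₘ (chainAppend X L L').hom) := by
          rw [tensorHom_comp_tensorHom, Category.comp_id]
        rw [← id_tensorHom, tensorHom_comp_tensorHom, e, Category.id_comp, ← id_tensorHom,
          ← tensorHom_id, e3, ← associator_naturality_assoc, tensorHom_comp_tensorHom_assoc,
          Category.id_comp]
      refine (Category.assoc _ _ _).symm.trans
        ((congrArg (· ≫ (X.map k.op ⊗ₘ ψ)) e').trans (Eq.trans ?_ e2))
      exact (Category.assoc _ _ _).trans (congrArg (_ ≫ ·) (Category.assoc _ _ _))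

variable (X) in
/-- The identity `X_L ⟶ X_M` for `L = M`. -/
def chainCast {L M : List ℕ} (h : L = M) : chain X L ⟶ chain X M := eqToHom (congrArg (chain X) h)

lemma chainCast_refl (L : List ℕ) : chainCast X (rfl : L = L) = 𝟙 _ := rfl

lemma chainCast_cons {n : ℕ} {L M : List ℕ} (h : L = M) :
    chainCast X (congrArg (List.cons n) h) = X.obj (op ⟨n⟩) ◁ chainCast X h := by
  subst h
  exact (whiskerLeft_id _ _).symm

lemma chainAppend_assoc (L M N : List ℕ) :
    ((chainAppend X L M).hom ⊗ₘ 𝟙 (chain X N)) ≫ (chainAppend X (L ++ M) N).hom ≫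
        chainCast X (List.append_assoc L M N) =
      (α_ _ _ _).hom ≫ (𝟙 (chain X L) ⊗ₘ (chainAppend X M N).hom) ≫
        (chainAppend X L (M ++ N)).hom := by
  rw [tensorHom_id, id_tensorHom]
  induction L with
  | nil =>
    rw [chainAppend_nil_hom, chainAppend_nil_hom]
    simp [chain, chainCast]
  | cons n L ih =>
    have h1 := congrArg (X.obj (op ⟨n⟩) ◁ ·) ih
    simp only [whiskerLeft_comp] at h1
    have h2 : chainCast X (List.append_assoc (n :: L) M N) =
      X.obj (op ⟨n⟩) ◁ chainCast X (List.append_assoc L M N) := chainCast_cons _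
    have h3 : (chainAppend X (n :: L ++ M) N).hom =
      (α_ (X.obj (op ⟨n⟩)) (chain X (L ++ M)) (chain X N)).hom ≫
      X.obj (op ⟨n⟩) ◁ (chainAppend X (L ++ M) N).hom := rfl
    rw [h2, h3, chainAppend_cons_hom, chainAppend_cons_hom]
    simp only [chain, List.cons_append, comp_whiskerRight, Category.assoc,
      associator_naturality_middle_assoc]
    refine (congrArg (fun z => _ ≫ _ ≫ z) h1).trans ?_
    simp

lemma chainAppend_nil (L : List ℕ) :
    (chainAppend X L []).hom ≫ chainCast X (List.append_nil L) = (ρ_ (chain X L)).hom := by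
  induction L with
  | nil =>
    rw [chainAppend_nil_hom]
    exact (Category.comp_id _).trans unitors_equal
  | cons n L ih =>
    have h1 := congrArg (X.obj (op ⟨n⟩) ◁ ·) ih
    simp only [whiskerLeft_comp] at h1
    have h2 : chainCast X (List.append_nil (n :: L)) =
      X.obj (op ⟨n⟩) ◁ chainCast X (List.append_nil L) := chainCast_cons _
    rw [chainAppend_cons_hom, h2]
    refine (Category.assoc _ _ _).trans ((congrArg (fun z => _ ≫ z) h1).trans ?_)
    simp [chain]

lemma chainAppend_nil_right (L : List ℕ) :
    (𝟙 (chain X L) ⊗ₘ 𝟙 (chain X [])) ≫ (chainAppend X L []).hom ≫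
      chainCast X (List.append_nil L) = (ρ_ (chain X L)).hom := by
  rw [id_tensorHom_id, Category.id_comp, chainAppend_nil]

lemma chainAppend_nil_left (L : List ℕ) :
    (𝟙 (chain X []) ⊗ₘ 𝟙 (chain X L)) ≫ (chainAppend X [] L).hom ≫
      chainCast X (rfl : [] ++ L = L) = (λ_ (chain X L)).hom := by
  rw [id_tensorHom_id, Category.id_comp]
  exact Category.comp_id _

variable (X) in
/-- The action of a necklace morphism. -/
def necMap {T U : Nec} (f : T ⟶ U) : chain X U.beads ⟶ chain X T.beads :=
  (Pull.exists (X := X) U.pos f.prop f.joints_subset).choose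

lemma pull_necMap {T U : Nec} (f : T ⟶ U) : Pull X U.beads T.beads f.toFun (necMap X f) :=
  (Pull.exists (X := X) U.pos f.prop f.joints_subset).choose_spec

lemma necMap_eq {T U : Nec} {f : T ⟶ U} {φ} (h : Pull X U.beads T.beads f.toFun φ) :
    necMap X f = φ := (pull_necMap f).unique h rfl

lemma necMap_eqIso {T U : Nec} (h : T.beads = U.beads) :
    necMap X (Nec.eqIso h).hom = chainCast X h.symm := by
  obtain ⟨T, hT⟩ := T
  obtain ⟨U, hU⟩ := U
  obtain rfl : T = U := h
  exact necMap_eq (Pull.id hU)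

variable (X) in
/-- The functor `X_• : Necᵒᵖ ⥤ W` with `X_T = X_{n₁} ⊗ ⋯ ⊗ X_{nₖ}` for
`T = Δ^{n₁} ∨ ⋯ ∨ Δ^{nₖ}`. -/
def necFunctor : Necᵒᵖ ⥤ W where
  obj T := chain X T.unop.beads
  map f := necMap X f.unop
  map_id T := necMap_eq (Pull.id T.unop.pos)
  map_comp f g := necMap_eq ((pull_necMap f.unop).comp (pull_necMap g.unop))

lemma necMap_wedge {T T' U U' : Nec} (f : T ⟶ T') (g : U ⟶ U') :
    (necMap X f ⊗ₘ necMap X g) ≫ (chainAppend X T.beads U.beads).hom =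
      (chainAppend X T'.beads U'.beads).hom ≫ necMap X (f ⊗ₘ g) := by
  obtain ⟨ψ, h, e⟩ := (pull_necMap (X := X) f).append (pull_necMap g)
  rw [necMap_eq (f := f ⊗ₘ g) h]
  exact e.symm

instance : (necFunctor X).LaxMonoidal := .ofTensorHom
  (ε := 𝟙 _)
  (μ := fun T U => (chainAppend X T.unop.beads U.unop.beads).hom)
  (μ_natural := fun f g => necMap_wedge f.unop g.unop)
  (associativity := fun T U S => (congrArg (fun z => _ ≫ _ ≫ z)
    (necMap_eqIso (T := T.unop ⊗ (U.unop ⊗ S.unop)) (U := (T.unop ⊗ U.unop) ⊗ S.unop)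
      (List.append_assoc _ _ _).symm)).trans (chainAppend_assoc _ _ _))
  (left_unitality := fun T => (chainAppend_nil_left T.unop.beads).symm.trans
    (congrArg (fun z => (𝟙 (chain X []) ⊗ₘ 𝟙 (chain X T.unop.beads)) ≫
      (chainAppend X [] T.unop.beads).hom ≫ z)
      (necMap_eqIso (T := T.unop) (U := 𝟙_ Nec ⊗ T.unop) rfl).symm))
  (right_unitality := fun T => (chainAppend_nil_right T.unop.beads).symm.trans
    (congrArg (fun z => (𝟙 (chain X T.unop.beads) ⊗ₘ 𝟙 (chain X [])) ≫
      (chainAppend X T.unop.beads []).hom ≫ z)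
      (necMap_eqIso (T := T.unop) (U := T.unop ⊗ 𝟙_ Nec) (List.append_nil _).symm).symm))

section

variable {W' : Type*} [Category* W'] [MonoidalCategory W'] {Y : FinIntᵒᵖ ⥤ W'} [Y.OplaxMonoidal]
  [IsIso (η Y)] {G : W' ⥤ W} [G.LaxMonoidal] (α : X ⟶ Y ⋙ G)

/-- The morphism `X_L ⟶ G(Y_L)` induced by `α : X ⟶ Y ⋙ G`. -/
def chainHom : ∀ L : List ℕ, chain X L ⟶ G.obj (chain Y L)
  | [] => ε G
  | n :: L => (α.app (op ⟨n⟩) ⊗ₘ chainHom L) ≫ μ G (Y.obj (op ⟨n⟩)) (chain Y L)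

lemma chainHom_cons (n : ℕ) (L : List ℕ) : chainHom α (n :: L) =
    (α.app (op ⟨n⟩) ⊗ₘ chainHom α L) ≫ μ G (Y.obj (op ⟨n⟩)) (chain Y L) := rfl

variable {α}

lemma unitIso_naturality (h : α.app (𝟙_ _) ≫ G.map (η Y) = η X ≫ ε G) :
    (unitIso X).inv ≫ α.app (op ⟨0⟩) = ε G ≫ G.map (unitIso Y).inv := by
  have h' : α.app (op ⟨0⟩) ≫ G.map (unitIso Y).hom = (unitIso X).hom ≫ ε G := h
  rw [Iso.inv_comp_eq, ← reassoc_of% h', ← G.map_comp, Iso.hom_inv_id, G.map_id, Category.comp_id]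

lemma comul_naturality (h : ∀ m n, α.app (m ⊗ n) ≫ G.map (δ Y m n) =
    δ X m n ≫ (α.app m ⊗ₘ α.app n) ≫ μ G _ _) {a b m : ℕ} (e : a + b = m) :
    α.app (op ⟨m⟩) ≫ G.map (comul Y e) =
      comul X e ≫ (α.app (op ⟨a⟩) ⊗ₘ α.app (op ⟨b⟩)) ≫ μ G _ _ := by
  subst e
  rw [comul_refl, comul_refl]
  exact h (op ⟨a⟩) (op ⟨b⟩)

lemma mul_assoc_aux {x x₁ x₂ z : W} {y y₁ y₂ w : W'} {a : x ⟶ G.obj y} {a₁ : x₁ ⟶ G.obj y₁}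
    {a₂ : x₂ ⟶ G.obj y₂} {d : x ⟶ x₁ ⊗ x₂} {e : y ⟶ y₁ ⊗ y₂}
    (h : a ≫ G.map e = d ≫ (a₁ ⊗ₘ a₂) ≫ μ G _ _) (c : z ⟶ G.obj w) :
    (d ▷ z ≫ (α_ _ _ _).hom) ≫ (a₁ ⊗ₘ ((a₂ ⊗ₘ c) ≫ μ G _ _)) ≫ μ G _ _ =
      ((a ⊗ₘ c) ≫ μ G _ _) ≫ G.map (e ▷ w ≫ (α_ _ _ _).hom) := by
  have h1 : (a₁ ⊗ₘ ((a₂ ⊗ₘ c) ≫ μ G y₂ w)) = (a₁ ⊗ₘ (a₂ ⊗ₘ c)) ≫ G.obj y₁ ◁ μ G y₂ w := by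
    rw [← id_tensorHom, tensorHom_comp_tensorHom, Category.comp_id]
  have h2 : d ▷ z ≫ ((a₁ ⊗ₘ a₂) ⊗ₘ c) ≫ μ G y₁ y₂ ▷ G.obj w = (a ⊗ₘ c) ≫ G.map e ▷ G.obj w := by
    simp only [← tensorHom_id, tensorHom_comp_tensorHom, Category.id_comp, Category.comp_id, h]
  rw [h1, Category.assoc, Category.assoc, ← associator_naturality_assoc,
    ← Functor.LaxMonoidal.associativity,
    reassoc_of% h2, Category.assoc, μ_natural_left_assoc,
    G.map_comp]

lemma mul_assoc_aux' {x₁ x₂ x₃ x₂₃ : W} {y₁ y₂ y₃ y₂₃ : W'} {a : x₁ ⟶ G.obj y₁}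
    {b : x₂ ⟶ G.obj y₂} {c : x₃ ⟶ G.obj y₃} {d : x₂₃ ⟶ G.obj y₂₃} {p : x₂ ⊗ x₃ ⟶ x₂₃}
    {q : y₂ ⊗ y₃ ⟶ y₂₃} (h : p ≫ d = (b ⊗ₘ c) ≫ μ G _ _ ≫ G.map q) :
    ((α_ _ _ _).hom ≫ x₁ ◁ p) ≫ (a ⊗ₘ d) ≫ μ G _ _ =
      (((a ⊗ₘ b) ≫ μ G _ _) ⊗ₘ c) ≫ μ G _ _ ≫ G.map ((α_ _ _ _).hom ≫ y₁ ◁ q) := by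
  have h1 : x₁ ◁ p ≫ (a ⊗ₘ d) = (a ⊗ₘ (b ⊗ₘ c)) ≫ G.obj y₁ ◁ μ G y₂ y₃ ≫ G.obj y₁ ◁ G.map q := by
    simp only [← id_tensorHom, tensorHom_comp_tensorHom, Category.id_comp, Category.comp_id, h]
  have h2 : (((a ⊗ₘ b) ≫ μ G y₁ y₂) ⊗ₘ c) = ((a ⊗ₘ b) ⊗ₘ c) ≫ μ G y₁ y₂ ▷ G.obj y₃ := by
    rw [← tensorHom_id, tensorHom_comp_tensorHom, Category.comp_id]
  rw [Category.assoc, reassoc_of% h1, h2, μ_natural_right, G.map_comp, Category.assoc,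
    Functor.LaxMonoidal.associativity_assoc, associator_naturality_assoc]

lemma Cut.chainHom (h1 : α.app (𝟙_ _) ≫ G.map (η Y) = η X ≫ ε G)
    (h2 : ∀ m n, α.app (m ⊗ n) ≫ G.map (δ Y m n) = δ X m n ≫ (α.app m ⊗ₘ α.app n) ≫ μ G _ _)
    {m M N σ} (hσ : Cut X m M N σ) : ∃ τ, Cut Y m M N τ ∧
    σ ≫ (α.app (op ⟨m⟩) ⊗ₘ chainHom α N) ≫ μ G _ _ = chainHom α M ≫ G.map τ := by
  cases hσ with
  | zero =>
    refine ⟨_, .zero M, ?_⟩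
    have h0 := unitIso_naturality h1
    rw [← tensorHom_id, Category.assoc, tensorHom_comp_tensorHom_assoc, h0, Category.id_comp,
      G.map_comp]
    have h3 : (ε G ≫ G.map (unitIso Y).inv ⊗ₘ _root_.chainHom α M) =
      (ε G ⊗ₘ _root_.chainHom α M) ≫ G.map (unitIso Y).inv ▷ _ := by
        rw [← tensorHom_id, tensorHom_comp_tensorHom, Category.comp_id]
    rw [h3, Category.assoc, μ_natural_left, MonoidalCategory.tensorHom_def', Category.assoc,
      ← leftUnitor_inv_naturality_assoc, left_unitality_inv_assoc]
  | hit hm =>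
    refine ⟨_, .hit hm N, ?_⟩
    exact (Category.id_comp _).trans
      ((Category.comp_id _).symm.trans (congrArg (_ ≫ ·) (G.map_id _).symm))
  | @mid _ b r ha hb h M =>
    refine ⟨_, .mid ha hb h _, ?_⟩
    exact mul_assoc_aux (y := Y.obj (op ⟨r⟩)) (y₁ := Y.obj (op ⟨m⟩)) (y₂ := Y.obj (op ⟨b⟩))
      (comul_naturality h2 h) (_root_.chainHom α M)

lemma Pull.chainHom (h1 : α.app (𝟙_ _) ≫ G.map (η Y) = η X ≫ ε G)
    (h2 : ∀ m n, α.app (m ⊗ n) ≫ G.map (δ Y m n) = δ X m n ≫ (α.app m ⊗ₘ α.app n) ≫ μ G _ _)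
    {M L f φ} (hφ : Pull X M L f φ) : ∃ ψ, Pull Y M L f ψ ∧
    φ ≫ chainHom α L = chainHom α M ≫ G.map ψ := by
  induction hφ with
  | nil =>
    refine ⟨_, .nil, ?_⟩
    rw [Category.id_comp, G.map_id]
    exact (Category.comp_id _).symm
  | @cons n m M N L σ f φ g hσ hφ ih =>
    obtain ⟨ψ, hψ, e⟩ := ih
    obtain ⟨τ, hτ, e'⟩ := hσ.chainHom h1 h2
    refine ⟨_, .cons g hτ hψ, ?_⟩
    have h3 : (X.map g.op ⊗ₘ φ) ≫ (α.app (op ⟨n⟩) ⊗ₘ _root_.chainHom α L) ≫ μ G _ _ =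
        ((α.app (op ⟨m⟩) ⊗ₘ _root_.chainHom α N) ≫ μ G _ _) ≫ G.map (Y.map g.op ⊗ₘ ψ) := by
      rw [tensorHom_comp_tensorHom_assoc, e, α.naturality, Category.assoc, ← μ_natural,
        tensorHom_comp_tensorHom_assoc]
      rfl
    have h4 : (σ ≫ (X.map g.op ⊗ₘ φ)) ≫ (α.app (op ⟨n⟩) ⊗ₘ _root_.chainHom α L) ≫ μ G _ _ =
        _root_.chainHom α M ≫ G.map (τ ≫ (Y.map g.op ⊗ₘ ψ)) := by
      rw [Category.assoc, h3, ← Category.assoc, e', Category.assoc, G.map_comp]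
    exact h4

variable (α) in
lemma chainHom_append (L M : List ℕ) : (chainAppend X L M).hom ≫ chainHom α (L ++ M) =
    (chainHom α L ⊗ₘ chainHom α M) ≫ μ G _ _ ≫ G.map (chainAppend Y L M).hom := by
  induction L with
  | nil =>
    rw [chainAppend_nil_hom, chainAppend_nil_hom]
    have h : (λ_ (chain X M)).hom ≫ chainHom α M =
        (ε G ⊗ₘ chainHom α M) ≫ μ G (𝟙_ W') (chain Y M) ≫ G.map (λ_ (chain Y M)).hom := by
      rw [MonoidalCategory.tensorHom_def', Category.assoc, ← Functor.LaxMonoidal.left_unitality,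
        leftUnitor_naturality]
    exact h
  | cons n L ih =>
    exact mul_assoc_aux' ih

end

end NecExt
end

noncomputable section

section NecTempl

open Functor.LaxMonoidal Functor.OplaxMonoidal

lemma chainHom_comp_aux {W W' W'' : Type*} [Category* W] [Category* W'] [Category* W'']
    [MonoidalCategory W] [MonoidalCategory W'] [MonoidalCategory W''] (G : W' ⥤ W) (H : W'' ⥤ W')
    [G.LaxMonoidal] [H.LaxMonoidal] {x₁ x₂ : W} {y₁ y₂ : W'} {z₁ z₂ : W''} (a : x₁ ⟶ G.obj y₁)
    (b : x₂ ⟶ G.obj y₂) (c : y₁ ⟶ H.obj z₁) (d : y₂ ⟶ H.obj z₂) :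
    ((a ≫ G.map c) ⊗ₘ (b ≫ G.map d)) ≫ μ G _ _ ≫ G.map (μ H z₁ z₂) =
      ((a ⊗ₘ b) ≫ μ G _ _) ≫ G.map ((c ⊗ₘ d) ≫ μ H _ _) := by
  simp [← tensorHom_comp_tensorHom, μ_natural_assoc]

variable {V : Type v} [Category.{u} V] [MonoidalCategory V]
  [HasColimitsOfSize.{u, u} V] [MonoidalClosed V] [BraidedCategory V]

lemma chainHom_id (A : Templ V) (L : List ℕ) :
    chainHom (Templ.Hom.id A).α L = 𝟙 (chain A.X L) := by
  induction L with
  | nil => exact VQuiv.pull_ε_id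
  | cons n L ih =>
    have h : (𝟙 (A.X.obj (op ⟨n⟩)) ⊗ₘ 𝟙 (chain A.X L)) ≫ μ (VQuiv.pull V (fun a : A.S => a))
        (A.X.obj (op ⟨n⟩)) (chain A.X L) = 𝟙 (A.X.obj (op ⟨n⟩) ⊗ chain A.X L) := by
      rw [VQuiv.pull_μ_id, id_tensorHom_id]
      exact Category.comp_id _
    exact (congrArg (fun z => (𝟙 (A.X.obj (op ⟨n⟩)) ⊗ₘ z) ≫ μ (VQuiv.pull V (fun a : A.S => a))
        (A.X.obj (op ⟨n⟩)) (chain A.X L)) ih).trans h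

lemma chainHom_comp {A B C : Templ V} (φ : Templ.Hom A B) (ψ : Templ.Hom B C) (L : List ℕ) :
    chainHom (φ.comp ψ).α L = chainHom φ.α L ≫ (VQuiv.pull V φ.f).map (chainHom ψ.α L) := by
  induction L with
  | nil => exact VQuiv.pull_ε_comp (V := V) φ.f ψ.f
  | cons n L ih =>
    have h := chainHom_comp_aux (VQuiv.pull V φ.f) (VQuiv.pull V ψ.f) (φ.α.app (op ⟨n⟩))
      (chainHom φ.α L) (ψ.α.app (op ⟨n⟩)) (chainHom ψ.α L)
    rw [← ih] at h
    refine Eq.trans ?_ h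
    rw [chainHom_cons]
    exact congrArg (_ ≫ ·) (VQuiv.pull_μ_comp (V := V) φ.f ψ.f _ _)

variable (V) in
/-- The functor `(-)^nec` from templicial objects to necklace categories. -/
def nec : Templ V ⥤ NecCat V where
  obj A := { S := A.S, C := necFunctor A.X }
  map {A B} φ :=
    { f := φ.f
      α :=
      { app T := chainHom φ.α T.unop.beads
        naturality T U g := by
          obtain ⟨ψ, h1, h2⟩ := (pull_necMap (X := A.X) g.unop).chainHom φ.counit φ.comul
          refine h2.trans ?_
          rw [← necMap_eq h1]
          rfl }
      unit := by
        refine (Category.id_comp _).trans ?_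
        refine Eq.trans ?_ (congrArg (_ ≫ ·) ((VQuiv.pull V φ.f).map_id _).symm)
        exact (Category.comp_id _).symm
      mul T U := chainHom_append φ.α T.unop.beads U.unop.beads }
  map_id A := NecCat.Hom.ext_same fun T a b => by
    exact congrArg (fun z => VQuiv.Hom.app z a b) (chainHom_id A T.unop.beads)
  map_comp φ ψ := NecCat.Hom.ext_same fun T a b => by
    exact congrArg (fun z => VQuiv.Hom.app z a b) (chainHom_comp φ ψ T.unop.beads)

end NecTempl
end

noncomputable section

section FreeObj

open Functor.LaxMonoidal

variable (V : Type v) [Category.{u} V] [MonoidalCategory V]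
  [HasColimitsOfSize.{u, u} V]

/-- The free functor `F : Set ⥤ V`, `F(A) = ∐_{a ∈ A} I`. -/
abbrev freeObj : Type u ⥤ V := sigmaConst.obj (𝟙_ V)

variable {V}

/-- The summand of `F(A)` of index `a`. -/
def fι {A : Type u} (a : A) : 𝟙_ V ⟶ (freeObj V).obj A := Sigma.ι (fun _ : A => 𝟙_ V) a

/-- Morphisms out of `F(A)`. -/
def fDesc {A : Type u} {Z : V} (f : A → (𝟙_ V ⟶ Z)) : (freeObj V).obj A ⟶ Z := Sigma.desc f

@[simp] lemma fι_fDesc {A : Type u} {Z : V} (f : A → (𝟙_ V ⟶ Z)) (a : A) :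
    fι a ≫ fDesc f = f a := Sigma.ι_desc _ _

@[simp] lemma fι_fDesc_assoc : type_of% (reassoc_of% @fι_fDesc) := @(reassoc_of% @fι_fDesc)

@[simp] lemma fι_map {A B : Type u} (f : A ⟶ B) (a : A) :
    fι a ≫ (freeObj V).map f = fι (f a) := by
  simp [fι, freeObj]

@[simp] lemma fι_map_assoc : type_of% (reassoc_of% @fι_map) := @(reassoc_of% @fι_map)

lemma free_hom_ext {A : Type u} {Z : V} {f g : (freeObj V).obj A ⟶ Z}
    (h : ∀ a, fι a ≫ f = fι a ≫ g) : f = g := Sigma.hom_ext _ _ h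

variable [MonoidalClosed V] [BraidedCategory V]

lemma free_hom_ext_right {A : Type u} {W Z : V} {f g : (freeObj V).obj A ⊗ W ⟶ Z}
    (h : ∀ a, fι a ▷ W ≫ f = fι a ▷ W ≫ g) : f = g := sigmaTensor_hom_ext h

lemma free_hom_ext_left {A : Type u} {W Z : V} {f g : W ⊗ (freeObj V).obj A ⟶ Z}
    (h : ∀ a, W ◁ fι a ≫ f = W ◁ fι a ≫ g) : f = g := tensorSigma_hom_ext h

lemma free_hom_ext₂ {A B : Type u} {Z : V} {f g : (freeObj V).obj A ⊗ (freeObj V).obj B ⟶ Z}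
    (h : ∀ a b, (fι a ⊗ₘ fι b) ≫ f = (fι a ⊗ₘ fι b) ≫ g) : f = g :=
  free_hom_ext_right fun a => free_hom_ext_left fun b => by
    have := h a b
    simpa [MonoidalCategory.tensorHom_def', ← whisker_exchange_assoc] using h a b

lemma free_hom_ext₃ {A B C : Type u} {Z : V}
    {f g : ((freeObj V).obj A ⊗ (freeObj V).obj B) ⊗ (freeObj V).obj C ⟶ Z}
    (h : ∀ a b c, ((fι a ⊗ₘ fι b) ⊗ₘ fι c) ≫ f = ((fι a ⊗ₘ fι b) ⊗ₘ fι c) ≫ g) : f = g := by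
  refine free_hom_ext_left fun c => ?_
  have h' : ∀ a b, (fι a ⊗ₘ fι b) ≫ (ρ_ _).inv ≫ _ ◁ fι c ≫ f =
      (fι a ⊗ₘ fι b) ≫ (ρ_ _).inv ≫ _ ◁ fι c ≫ g := fun a b => by
    have := (ρ_ _).inv ≫= h a b c
    rw [MonoidalCategory.tensorHom_def] at this
    simpa only [Category.assoc, rightUnitor_inv_naturality_assoc] using this
  have := free_hom_ext₂ h'
  rwa [cancel_epi] at this

/-- The comparison `F(A) ⊗ F(B) ⟶ F(A × B)`, sending the summand `I ⊗ I` of index `(a, b)` to the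
summand `I` of index `(a, b)`. -/
def freeμ (A B : Type u) : (freeObj V).obj A ⊗ (freeObj V).obj B ⟶ (freeObj V).obj (A × B) :=
  sigmaTensorDesc fun a => (λ_ _).hom ≫ fDesc fun b => fι (a, b)

@[simp] lemma fι_freeμ {A B : Type u} (a : A) (b : B) :
    (fι a ⊗ₘ fι b) ≫ freeμ (V := V) A B = (λ_ _).hom ≫ fι (a, b) := by
  have h : fι a ▷ (freeObj V).obj B ≫ freeμ A B = (λ_ _).hom ≫ fDesc fun b => fι (a, b) :=
    ι_sigmaTensorDesc _ _
  rw [MonoidalCategory.tensorHom_def', Category.assoc, h]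
  simp

@[simp] lemma fι_freeμ_assoc : type_of% (reassoc_of% @fι_freeμ) := @(reassoc_of% @fι_freeμ)

lemma freeμ_natural {A B A' B' : Type u} (f : A ⟶ A') (g : B ⟶ B') :
    ((freeObj V).map f ⊗ₘ (freeObj V).map g) ≫ freeμ A' B' =
      freeμ A B ≫ (freeObj V).map (f ⊗ₘ g) := by
  refine free_hom_ext₂ fun a b => ?_
  rw [tensorHom_comp_tensorHom_assoc, fι_map, fι_map, fι_freeμ, fι_freeμ_assoc, fι_map]
  rfl

lemma free_associativity (A B C : Type u) :
    (freeμ A B ⊗ₘ 𝟙 ((freeObj V).obj C)) ≫ freeμ (A × B) C ≫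
        (freeObj V).map (α_ A B C).hom =
      (α_ _ _ _).hom ≫ (𝟙 ((freeObj V).obj A) ⊗ₘ freeμ B C) ≫ freeμ A (B × C) := by
  refine free_hom_ext₃ fun a b c => ?_
  have h1 : ((fι a ⊗ₘ fι b) ⊗ₘ fι c) ≫ (freeμ (V := V) A B ⊗ₘ 𝟙 ((freeObj V).obj C)) =
      (λ_ _).hom ▷ _ ≫ (fι (a, b) ⊗ₘ fι c) := by
    rw [tensorHom_comp_tensorHom, fι_freeμ, ← tensorHom_id, tensorHom_comp_tensorHom,
      Category.comp_id, Category.id_comp]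
  have h2 : (fι a ⊗ₘ (fι b ⊗ₘ fι c)) ≫ (𝟙 ((freeObj V).obj A) ⊗ₘ freeμ (V := V) B C) =
      _ ◁ (λ_ _).hom ≫ (fι a ⊗ₘ fι (b, c)) := by
    rw [tensorHom_comp_tensorHom, fι_freeμ, ← id_tensorHom, tensorHom_comp_tensorHom,
      Category.comp_id, Category.id_comp]
  have h3 : fι (V := V) ((a, b), c) ≫ (freeObj V).map (α_ A B C).hom = fι (a, (b, c)) :=
    fι_map _ _
  have h4 : (fι (a, b) ⊗ₘ fι c) ≫ freeμ (V := V) (A × B) C = (λ_ _).hom ≫ fι ((a, b), c) :=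
    fι_freeμ _ _
  rw [reassoc_of% h1, associator_naturality_assoc, reassoc_of% h2, fι_freeμ]
  refine (congrArg (_ ≫ ·) ((reassoc_of% h4) _)).trans ?_
  rw [h3]
  simp [unitors_equal]

lemma free_left_unitality (A : Type u) : (λ_ ((freeObj V).obj A)).hom =
    (fι PUnit.unit ⊗ₘ 𝟙 ((freeObj V).obj A)) ≫ freeμ PUnit A ≫ (freeObj V).map (λ_ A).hom := by
  refine free_hom_ext_left fun a => ?_
  have h1 : _ ◁ fι a ≫ (fι PUnit.unit ⊗ₘ 𝟙 ((freeObj V).obj A)) = fι PUnit.unit ⊗ₘ fι a := by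
    rw [← id_tensorHom, tensorHom_comp_tensorHom, Category.id_comp, Category.comp_id]
  have h2 : fι (V := V) (PUnit.unit, a) ≫ (freeObj V).map (λ_ A).hom = fι a := fι_map _ _
  rw [reassoc_of% h1, fι_freeμ_assoc, leftUnitor_naturality]
  exact congrArg (_ ≫ ·) h2.symm

lemma free_right_unitality (A : Type u) : (ρ_ ((freeObj V).obj A)).hom =
    (𝟙 ((freeObj V).obj A) ⊗ₘ fι PUnit.unit) ≫ freeμ A PUnit ≫ (freeObj V).map (ρ_ A).hom := by
  refine free_hom_ext_right fun a => ?_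
  have h1 : fι a ▷ _ ≫ (𝟙 ((freeObj V).obj A) ⊗ₘ fι PUnit.unit) = fι a ⊗ₘ fι PUnit.unit := by
    rw [← tensorHom_id, tensorHom_comp_tensorHom, Category.id_comp, Category.comp_id]
  have h2 : fι (V := V) (a, PUnit.unit) ≫ (freeObj V).map (ρ_ A).hom = fι a := fι_map _ _
  rw [reassoc_of% h1, fι_freeμ_assoc, rightUnitor_naturality, unitors_equal]
  exact congrArg (_ ≫ ·) h2.symm

/-- The functor `F` is lax (in fact strong) monoidal. -/
instance : (freeObj V).LaxMonoidal := .ofTensorHom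
  (ε := fι PUnit.unit)
  (μ := freeμ)
  (μ_natural := freeμ_natural)
  (associativity := free_associativity)
  (left_unitality := free_left_unitality)
  (right_unitality := free_right_unitality)

end FreeObj

/-- The category of small categories enriched in `W`, with enriched functors as morphisms. -/
structure ECat (W : Type w) [Category.{v} W] [MonoidalCategory W] where
  obj : Type u
  [str : EnrichedCategory W obj]

namespace ECat

attribute [instance] str

variable {W : Type w} [Category.{v} W] [MonoidalCategory W]

lemma ext_same {A B : Type u} [EnrichedCategory W A] [EnrichedCategory W B] {o : A → B}
    {m m' : ∀ a b : A, (a ⟶[W] b) ⟶ (o a ⟶[W] o b)} {h1 h2 h1' h2'}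
    (h : ∀ a b, m a b = m' a b) :
    EnrichedFunctor.mk o m h1 h2 = EnrichedFunctor.mk o m' h1' h2' := by
  obtain rfl : m = m' := funext fun a => funext fun b => h a b
  rfl

instance : Category (ECat.{u} W) where
  Hom A B := EnrichedFunctor W A.obj B.obj
  id A := EnrichedFunctor.id W A.obj
  comp F G := EnrichedFunctor.comp W F G
  id_comp _ := ext_same fun _ _ => Category.id_comp _
  comp_id _ := ext_same fun _ _ => Category.comp_id _
  assoc _ _ _ := ext_same fun _ _ => Category.assoc _ _ _

open Functor.LaxMonoidal

/-- Base change of enriched categories along a lax monoidal functor. -/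
def baseChange {W' : Type*} [Category* W'] [MonoidalCategory W'] (F : W ⥤ W') [F.LaxMonoidal] :
    ECat.{u} W ⥤ ECat.{u} W' where
  obj A := ⟨TransportEnrichment F A.obj⟩
  map {A B} G :=
    { obj := fun a : A.obj => G.obj a
      map := fun a b : A.obj => F.map (G.map a b)
      map_id := fun a : A.obj => by
        refine (Category.assoc _ _ _).trans ?_
        exact congrArg (_ ≫ ·) ((F.map_comp _ _).symm.trans (congrArg F.map (G.map_id a)))
      map_comp := fun a b c : A.obj => by
        refine (Category.assoc _ _ _).trans ?_
        refine (congrArg (_ ≫ ·) ((F.map_comp _ _).symm.trans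
          ((congrArg F.map (G.map_comp a b c)).trans (F.map_comp _ _)))).trans ?_
        refine Eq.trans ?_ (Category.assoc _ _ _)
        refine (Category.assoc _ _ _).symm.trans (congrArg (· ≫ _) ?_)
        exact (μ_natural F _ _).symm }
  map_id _ := ext_same fun _ _ => F.map_id _
  map_comp _ _ := ext_same fun _ _ => F.map_comp _ _

end ECat
end

noncomputable section

namespace VQuiv

variable {V : Type v} [Category.{u} V] [MonoidalCategory V] [HasColimitsOfSize.{u, u} V]
  [MonoidalClosed V] [BraidedCategory V] {S T : Type u} {Q P R Q' P' : VQuiv V S} {a b c d : S}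

/-- The element of `(Q ⊗ P)(a, b)` given by elements of `Q(a, c)` and `P(c, b)`. -/
def pr (x : 𝟙_ V ⟶ Q.obj a c) (y : 𝟙_ V ⟶ P.obj c b) : 𝟙_ V ⟶ (tObj Q P).obj a b :=
  (λ_ (𝟙_ V)).inv ≫ (x ⊗ₘ y) ≫ tι Q P a c b

lemma pr_tHom (x : 𝟙_ V ⟶ Q.obj a c) (y : 𝟙_ V ⟶ P.obj c b) (f : Q ⟶ Q') (g : P ⟶ P') :
    pr x y ≫ (tHom f g).app a b = pr (x ≫ f.app a c) (y ≫ g.app c b) := by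
  simp [pr]

lemma pr_assoc (x : 𝟙_ V ⟶ Q.obj a b) (y : 𝟙_ V ⟶ P.obj b c) (z : 𝟙_ V ⟶ R.obj c d) :
    pr (pr x y) z ≫ (tAssoc Q P R).hom.app a d = pr x (pr y z) := by
  have h1 : (pr x y ⊗ₘ z) = (λ_ _).inv ▷ _ ≫ ((x ⊗ₘ y) ⊗ₘ z) ≫ tι Q P a b c ▷ _ := by
    rw [← tensorHom_id, ← tensorHom_id, tensorHom_comp_tensorHom, tensorHom_comp_tensorHom]
    simp [pr]
  have h2 : (x ⊗ₘ pr y z) = _ ◁ (λ_ _).inv ≫ (x ⊗ₘ (y ⊗ₘ z)) ≫ _ ◁ tι P R b c d := by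
    rw [← id_tensorHom, ← id_tensorHom, tensorHom_comp_tensorHom, tensorHom_comp_tensorHom]
    simp [pr]
  have h3 : (λ_ (𝟙_ V)).inv ▷ 𝟙_ V ≫ (α_ _ _ _).hom = _ ◁ (λ_ (𝟙_ V)).inv := by
    simp [unitors_inv_equal]
  unfold pr at h1 h2 ⊢
  rw [h1, h2]
  simp only [Category.assoc, tι_tAssoc_hom, associator_naturality_assoc, reassoc_of% h3]

lemma pr_left (y : 𝟙_ V ⟶ Q.obj a b) : pr (uι V a) y ≫ (tLeft Q).hom.app a b = y := by
  simp only [pr, MonoidalCategory.tensorHom_def', Category.assoc, uι_tLeft_hom]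
  simp

lemma pr_right (y : 𝟙_ V ⟶ Q.obj a b) : pr y (uι V b) ≫ (tRight Q).hom.app a b = y := by
  simp only [pr, MonoidalCategory.tensorHom_def, Category.assoc, uι_tRight_hom]
  simp [unitors_inv_equal]

lemma pr_pull (f : S → T) {Q P : VQuiv V T} (x : 𝟙_ V ⟶ Q.obj (f a) (f c))
    (y : 𝟙_ V ⟶ P.obj (f c) (f b)) :
    pr (Q := (pull V f).obj Q) (P := (pull V f).obj P) x y ≫ (pullμ f Q P).app a b =
      pr (Q := Q) (P := P) x y := by
  unfold pr
  rw [Category.assoc, Category.assoc, tι_pullμ]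
  rfl

end VQuiv

open Simplicial SimplexCategory

section FreeTempl

/-- The `i`-th vertex of a simplex. -/
def vert (K : SSet.{u}) {n : ℕ} (i : Fin (n + 1)) (σ : K _⦋n⦌) : K _⦋0⦌ :=
  K.map (⦋0⦌.const ⦋n⦌ i).op σ

lemma vert_map (K : SSet.{u}) {m n : ℕ} (f : ⦋m⦌ ⟶ ⦋n⦌) (i : Fin (m + 1)) (σ : K _⦋n⦌) :
    vert K i (K.map f.op σ) = vert K (f i) σ := by
  unfold vert
  rw [← ConcreteCategory.comp_apply, ← K.map_comp, ← op_comp, SimplexCategory.const_comp]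
  rfl

lemma vert_zero (K : SSet.{u}) (σ : K _⦋0⦌) (i : Fin 1) : vert K i σ = σ := by
  obtain rfl : i = 0 := Subsingleton.elim _ _
  unfold vert
  simp

lemma vert_app {K L : SSet.{u}} (φ : K ⟶ L) {n : ℕ} (i : Fin (n + 1)) (σ : K _⦋n⦌) :
    vert L i (φ.app _ σ) = φ.app _ (vert K i σ) :=
  (ConcreteCategory.congr_hom (φ.naturality (⦋0⦌.const ⦋n⦌ i).op) σ).symm

/-- The set `Kₙ(a, b)` of `n`-simplices of `K` with first vertex `a` and last vertex `b`. -/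
abbrev SimpQuiv (K : SSet.{u}) (n : ℕ) (a b : K _⦋0⦌) : Type u :=
  {σ : K _⦋n⦌ // vert K 0 σ = a ∧ vert K (Fin.last n) σ = b}

/-- The action of a morphism of `Δ_f` on simplices. -/
def SimpQuiv.res (K : SSet.{u}) {m n : FinInt} (g : m ⟶ n) (a b : K _⦋0⦌) :
    SimpQuiv K n.len a b ⟶ SimpQuiv K m.len a b :=
  ↾fun σ => ⟨K.map (FinInt.toSimplex.map g).op σ.1, by
    have h0 : FinInt.toSimplex.map g (0 : Fin (m.len + 1)) = (0 : Fin (n.len + 1)) :=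
      Fin.ext g.prop.map_zero
    have h1 : FinInt.toSimplex.map g (Fin.last m.len) = Fin.last n.len :=
      Fin.ext g.prop.map_last
    exact ⟨((vert_map K _ _ _).trans (congrArg (vert K · σ.1) h0)).trans σ.2.1,
      ((vert_map K _ _ _).trans (congrArg (vert K · σ.1) h1)).trans σ.2.2⟩⟩

/-- The action of a simplicial map on simplices. -/
def SimpQuiv.mapOf {K L : SSet.{u}} (φ : K ⟶ L) (n : ℕ) (a b : K _⦋0⦌) :
    SimpQuiv K n a b ⟶ SimpQuiv L n (φ.app _ a) (φ.app _ b) :=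
  ↾fun σ => ⟨φ.app _ σ.1, by rw [vert_app, σ.2.1], by rw [vert_app, σ.2.2]⟩

/-- The restriction of a simplex to its first `m + 1` vertices. -/
def front (K : SSet.{u}) (m n : ℕ) (σ : K _⦋m + n⦌) : K _⦋m⦌ :=
  K.map (subinterval 0 m (by omega)).op σ

/-- The restriction of a simplex to its last `n + 1` vertices. -/
def back (K : SSet.{u}) (m n : ℕ) (σ : K _⦋m + n⦌) : K _⦋n⦌ :=
  K.map (subinterval m n le_rfl).op σ

section
variable (K : SSet.{u}) (m n : ℕ) (σ : K _⦋m + n⦌)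

lemma vert_front_zero : vert K 0 (front K m n σ) = vert K 0 σ :=
  (vert_map K _ _ _).trans (congrArg (vert K · σ) (Fin.ext rfl))

lemma vert_back_last : vert K (Fin.last n) (back K m n σ) = vert K (Fin.last (m + n)) σ :=
  (vert_map K _ _ _).trans (congrArg (vert K · σ) (Fin.ext (Nat.add_comm _ _)))

lemma vert_back_zero :
    vert K 0 (back K m n σ) = vert K (Fin.last m) (front K m n σ) :=
  (vert_map K _ _ _).trans (((congrArg (vert K · σ) (Fin.ext (Nat.add_comm _ _)))).trans
    (vert_map K _ _ _).symm)

end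

variable {V : Type v} [Category.{u} V] [MonoidalCategory V] [HasColimitsOfSize.{u, u} V]
  [MonoidalClosed V] [BraidedCategory V]

variable (V) in
/-- The quivers `F̃(K)ₙ`. -/
def freeQuiv (K : SSet.{u}) : FinIntᵒᵖ ⥤ VQuiv V (K _⦋0⦌) where
  obj n := ⟨fun a b => (freeObj V).obj (SimpQuiv K n.unop.len a b)⟩
  map g := ⟨fun a b => (freeObj V).map (SimpQuiv.res K g.unop a b)⟩
  map_id n := by
    ext a b
    refine free_hom_ext fun σ => (fι_map _ _).trans ?_
    refine Eq.trans ?_ (Category.comp_id _).symm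
    refine congrArg fι (Subtype.ext ?_)
    exact ConcreteCategory.congr_hom (K.map_id (op (FinInt.toSimplex.obj n.unop))) σ.1
  map_comp f g := by
    ext a b
    refine free_hom_ext fun σ => (fι_map _ _).trans ?_
    refine Eq.trans ?_ ((fι_map_assoc _ _ _).trans (fι_map _ _)).symm
    refine congrArg fι (Subtype.ext ?_)
    exact ConcreteCategory.congr_hom (K.map_comp (FinInt.toSimplex.map f.unop).op
      (FinInt.toSimplex.map g.unop).op) σ.1

/-- The element of `F̃(K)ₙ(a, b)` given by a simplex. -/
def el (K : SSet.{u}) {n : FinIntᵒᵖ} {a b : K _⦋0⦌} (σ : K _⦋n.unop.len⦌) (ha : vert K 0 σ = a)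
    (hb : vert K (Fin.last n.unop.len) σ = b) : 𝟙_ V ⟶ ((freeQuiv V K).obj n).obj a b :=
  fι (A := SimpQuiv K n.unop.len a b) ⟨σ, ha, hb⟩

lemma freeQuiv_hom_ext {K : SSet.{u}} {n : FinIntᵒᵖ} {a b : K _⦋0⦌} {Z : V}
    {f g : ((freeQuiv V K).obj n).obj a b ⟶ Z}
    (h : ∀ σ ha hb, el K σ ha hb ≫ f = el K σ ha hb ≫ g) : f = g :=
  free_hom_ext fun σ => h σ.1 σ.2.1 σ.2.2

lemma el_map (K : SSet.{u}) {n m : FinIntᵒᵖ} {a b : K _⦋0⦌} (g : n ⟶ m) (σ : K _⦋n.unop.len⦌)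
    (ha hb ha' hb') : el (V := V) K (a := a) (b := b) σ ha hb ≫ ((freeQuiv V K).map g).app a b =
      el K (n := m) (K.map (FinInt.toSimplex.map g.unop).op σ) ha' hb' :=
  fι_map _ _

lemma el_map' (K : SSet.{u}) {n m : FinIntᵒᵖ} {a b : K _⦋0⦌} (g : n ⟶ m) (σ : K _⦋n.unop.len⦌)
    (ha hb) : ∃ ha' hb',
    el (V := V) K (a := a) (b := b) σ ha hb ≫ ((freeQuiv V K).map g).app a b =
      el K (n := m) (K.map (FinInt.toSimplex.map g.unop).op σ) ha' hb' :=
  ⟨(SimpQuiv.res K g.unop a b ⟨σ, ha, hb⟩).2.1, (SimpQuiv.res K g.unop a b ⟨σ, ha, hb⟩).2.2,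
    fι_map _ _⟩

lemma el_congr (K : SSet.{u}) {n : FinIntᵒᵖ} {a b : K _⦋0⦌} {σ σ' : K _⦋n.unop.len⦌}
    (h : σ = σ') (ha hb ha' hb') :
    el (V := V) K (a := a) (b := b) σ ha hb = el K σ' ha' hb' := by
  subst h
  rfl

lemma pr_el_congr (K : SSet.{u}) {m n : FinIntᵒᵖ} {a b c c' : K _⦋0⦌} {σ σ' : K _⦋m.unop.len⦌}
    {τ τ' : K _⦋n.unop.len⦌} (h : σ = σ') (h' : τ = τ')
    (h1 h2 h3 h4 h1' h2' h3' h4') :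
    VQuiv.pr (el (V := V) K (a := a) (b := c) σ h1 h2) (el K (b := b) τ h3 h4) =
      VQuiv.pr (el (V := V) K (a := a) (b := c') σ' h1' h2') (el K (b := b) τ' h3' h4') := by
  subst h h' h2 h2'
  rfl

lemma pr_pr_el_congr (K : SSet.{u}) {m n p : FinIntᵒᵖ} {a b c c' d d' : K _⦋0⦌}
    {σ σ' : K _⦋m.unop.len⦌} {τ τ' : K _⦋n.unop.len⦌} {ρ ρ' : K _⦋p.unop.len⦌}
    (h : σ = σ') (h' : τ = τ') (h'' : ρ = ρ')
    (h1 h2 h3 h4 h5 h6 h1' h2' h3' h4' h5' h6') :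
    VQuiv.pr (el (V := V) K (a := a) (b := c) σ h1 h2)
        (VQuiv.pr (el (V := V) K (b := d) τ h3 h4) (el K (b := b) ρ h5 h6)) =
      VQuiv.pr (el (V := V) K (a := a) (b := c') σ' h1' h2')
        (VQuiv.pr (el (V := V) K (b := d') τ' h3' h4') (el K (b := b) ρ' h5' h6')) := by
  subst h h' h'' h2 h2' h4 h4'
  rfl

/-- The colax structure of `F̃(K)`: the summand of a simplex is sent to the summand of its front
and back faces. -/
def freeδ (K : SSet.{u}) (m n : FinIntᵒᵖ) :
    (freeQuiv V K).obj (m ⊗ n) ⟶ (freeQuiv V K).obj m ⊗ (freeQuiv V K).obj n :=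
  ⟨fun _ _ => fDesc fun σ => VQuiv.pr
    (el K (front K m.unop.len n.unop.len σ.1) ((vert_front_zero _ _ _ _).trans σ.2.1) rfl)
    (el K (back K m.unop.len n.unop.len σ.1) (vert_back_zero _ _ _ _)
      ((vert_back_last _ _ _ _).trans σ.2.2))⟩

/-- The counit of `F̃(K)`. -/
def freeη (K : SSet.{u}) : (freeQuiv V K).obj (𝟙_ _) ⟶ 𝟙_ (VQuiv V (K _⦋0⦌)) :=
  ⟨fun a b => fDesc fun σ => VQuiv.uι V a ≫ eqToHom (by
      have h : a = b := σ.2.1.symm.trans ((vert_zero K σ.1 0).trans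
        ((vert_zero K σ.1 (Fin.last 0)).symm.trans σ.2.2))
      rw [h]; rfl)⟩

lemma el_freeη (K : SSet.{u}) (a : K _⦋0⦌) (h h') :
    el (V := V) K (n := 𝟙_ FinIntᵒᵖ) (a := a) (b := a) a h h' ≫ (freeη K).app a a =
      VQuiv.uι V a :=
  (fι_fDesc _ _).trans (Category.comp_id _)

instance (K : SSet.{u}) : IsIso (freeη (V := V) K) := by
  let e : (freeQuiv V K).obj (𝟙_ _) ≅ 𝟙_ (VQuiv V (K _⦋0⦌)) := VQuiv.isoMk fun a b =>
    { hom := (freeη K).app a b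
      inv := VQuiv.uDesc fun h => el K (n := 𝟙_ FinIntᵒᵖ) a (vert_zero K a 0)
        ((vert_zero K a (Fin.last 0)).trans h)
      hom_inv_id := freeQuiv_hom_ext fun σ h0 h1 => by
        obtain rfl : σ = a := (vert_zero K σ 0).symm.trans h0
        obtain rfl : σ = b := (vert_zero K σ (Fin.last 0)).symm.trans h1
        refine (Category.assoc _ _ _).symm.trans ((congrArg (· ≫ _) (el_freeη K σ _ _)).trans ?_)
        exact (VQuiv.uι_uDesc _).trans (Category.comp_id _).symm
      inv_hom_id := VQuiv.tUnit_hom_ext fun e => by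
        subst e
        refine (congrArg (_ ≫ ·) (Category.id_comp _)).trans ?_
        refine (Category.assoc _ _ _).symm.trans ((congrArg (· ≫ _) (VQuiv.uι_uDesc _)).trans ?_)
        refine (el_freeη K a _ _).trans ?_
        exact ((congrArg (_ ≫ ·) (Category.id_comp _)).trans (Category.comp_id _)).symm }
  exact e.isIso_hom

lemma el_freeδ (K : SSet.{u}) {m n : FinIntᵒᵖ} {a b c : K _⦋0⦌}
    (σ : K _⦋m.unop.len + n.unop.len⦌) {σ₁ : K _⦋m.unop.len⦌} {σ₂ : K _⦋n.unop.len⦌}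
    (hσ₁ : front K m.unop.len n.unop.len σ = σ₁) (hσ₂ : back K m.unop.len n.unop.len σ = σ₂)
    (h h' h1 h2 h3 h4) :
    el (V := V) K (n := m ⊗ n) (a := a) (b := b) σ h h' ≫ (freeδ K m n).app a b =
      VQuiv.pr (el K (b := c) σ₁ h1 h2) (el K σ₂ h3 h4) :=
  (fι_fDesc _ _).trans (pr_el_congr K hσ₁ hσ₂ _ _ _ _ _ _ _ _)

lemma el_freeδ' (K : SSet.{u}) {m n : FinIntᵒᵖ} {a b : K _⦋0⦌}
    (σ : K _⦋m.unop.len + n.unop.len⦌) (h h') : ∃ c h1 h2 h3 h4,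
    el (V := V) K (n := m ⊗ n) (a := a) (b := b) σ h h' ≫ (freeδ K m n).app a b =
      VQuiv.pr (el K (b := c) (front K m.unop.len n.unop.len σ) h1 h2)
        (el K (back K m.unop.len n.unop.len σ) h3 h4) :=
  ⟨_, (vert_front_zero _ _ _ _).trans h, rfl, vert_back_zero _ _ _ _,
    (vert_back_last _ _ _ _).trans h', el_freeδ K σ rfl rfl _ _ _ _ _ _⟩

lemma map_map_congr (K : SSet.{u}) {k m m' n : SimplexCategory} {x : k ⟶ m} {y : m ⟶ n}
    {z : k ⟶ m'} {w : m' ⟶ n} (h : ∀ i, (y (x i) : ℕ) = w (z i)) (σ : K.obj (op n)) :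
    K.map x.op (K.map y.op σ) = K.map z.op (K.map w.op σ) := by
  rw [← ConcreteCategory.comp_apply, ← ConcreteCategory.comp_apply, ← K.map_comp, ← K.map_comp,
    ← op_comp, ← op_comp]
  have : x ≫ y = z ≫ w := by
    ext i
    exact h i
  rw [this]

lemma map_map_congr₃ (K : SSet.{u}) {k m m' m'' n : SimplexCategory} {x : k ⟶ m} {y : m ⟶ n}
    {z : k ⟶ m'} {w : m' ⟶ m''} {t : m'' ⟶ n} (h : ∀ i, (y (x i) : ℕ) = t (w (z i)))
    (σ : K.obj (op n)) :
    K.map x.op (K.map y.op σ) = K.map z.op (K.map w.op (K.map t.op σ)) := by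
  refine (map_map_congr K (z := z) (w := w ≫ t) h σ).trans ?_
  rw [op_comp, K.map_comp, ConcreteCategory.comp_apply]

lemma map_map_congr₁₃ (K : SSet.{u}) {k m' m'' n : SimplexCategory} {y : k ⟶ n}
    {z : k ⟶ m'} {w : m' ⟶ m''} {t : m'' ⟶ n} (h : ∀ i, (y i : ℕ) = t (w (z i)))
    (σ : K.obj (op n)) :
    K.map y.op σ = K.map z.op (K.map w.op (K.map t.op σ)) := by
  refine Eq.trans ?_ (map_map_congr₃ K (x := 𝟙 k) (y := y) h σ)
  exact (ConcreteCategory.congr_hom (K.map_id _) _).symm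

lemma map_map_congr₁₂ (K : SSet.{u}) {k m n : SimplexCategory} {y : k ⟶ n}
    {z : k ⟶ m} {w : m ⟶ n} (h : ∀ i, (y i : ℕ) = w (z i))
    (σ : K.obj (op n)) :
    K.map y.op σ = K.map z.op (K.map w.op σ) := by
  refine Eq.trans ?_ (map_map_congr K (x := 𝟙 k) (y := y) h σ)
  exact (ConcreteCategory.congr_hom (K.map_id _) _).symm

lemma map_map_congr₀ (K : SSet.{u}) {m n : SimplexCategory} {z : n ⟶ m} {w : m ⟶ n}
    (h : ∀ i : Fin (n.len + 1), (i : ℕ) = w (z i)) (σ : K.obj (op n)) :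
    σ = K.map z.op (K.map w.op σ) := by
  refine Eq.trans ?_ (map_map_congr₁₂ K (y := 𝟙 n) h σ)
  exact (ConcreteCategory.congr_hom (K.map_id _) _).symm

lemma freeδ_natural (K : SSet.{u}) {m n m' n' : FinIntᵒᵖ} (f : m ⟶ m') (g : n ⟶ n') :
    freeδ (V := V) K m n ≫ ((freeQuiv V K).map f ⊗ₘ (freeQuiv V K).map g) =
      (freeQuiv V K).map (f ⊗ₘ g) ≫ freeδ K m' n' := by
  ext a b
  refine freeQuiv_hom_ext fun σ h h' => ?_
  obtain ⟨c, h1, h2, h3, h4, e⟩ := el_freeδ' (V := V) K (m := m) (n := n) σ h h'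
  refine ((Category.assoc _ _ _).symm.trans (congrArg (· ≫ _) e)).trans ?_
  refine (VQuiv.pr_tHom _ _ _ _).trans ?_
  obtain ⟨i1, i2, e1⟩ := el_map' (V := V) K f _ h1 h2
  obtain ⟨j1, j2, e2⟩ := el_map' (V := V) K g _ h3 h4
  obtain ⟨k1, k2, e3⟩ := el_map' (V := V) K (n := m ⊗ n) (f ⊗ₘ g) σ h h'
  rw [e1, e2]
  refine Eq.trans ?_ ((Category.assoc _ _ _).symm.trans (congrArg (· ≫ _) e3)).symm
  refine (el_freeδ K _ ?_ ?_ _ _ _ _ _ _).symm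
  · refine map_map_congr K (fun i => ?_) σ
    have hi : (i : ℕ) ≤ m'.unop.len := Nat.le_of_lt_succ i.2
    change glue m'.unop.len m.unop.len f.unop.toFun g.unop.toFun (i + 0) = f.unop.toFun i + 0
    simp [glue, hi]
  · refine map_map_congr K (fun i => ?_) σ
    change glue m'.unop.len m.unop.len f.unop.toFun g.unop.toFun (i + m'.unop.len) =
      g.unop.toFun i + m.unop.len
    unfold glue
    split_ifs with h
    · have hi : (i : ℕ) = 0 := by omega
      rw [hi, Nat.zero_add, f.unop.prop.map_last, g.unop.prop.map_zero, Nat.zero_add]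
    · rw [Nat.add_sub_cancel, Nat.add_comm]

lemma freeδ_assoc (K : SSet.{u}) (m n p : FinIntᵒᵖ) :
    freeδ (V := V) K (m ⊗ n) p ≫ freeδ K m n ▷ _ ≫ (α_ _ _ _).hom =
      (freeQuiv V K).map (α_ m n p).hom ≫ freeδ K m (n ⊗ p) ≫ _ ◁ freeδ K n p := by
  ext a b
  refine freeQuiv_hom_ext fun σ h h' => ?_
  obtain ⟨c, h1, h2, h3, h4, e⟩ := el_freeδ' (V := V) K (m := m ⊗ n) (n := p) σ h h'
  obtain ⟨d, i1, i2, i3, i4, e'⟩ := el_freeδ' (V := V) K (m := m) (n := n) _ h1 h2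
  refine ((Category.assoc _ _ _).symm.trans (congrArg (· ≫ _) e)).trans ?_
  refine (Category.assoc _ _ _).symm.trans ?_
  refine (congrArg (· ≫ _) ((VQuiv.pr_tHom _ _ _ _).trans (congrArg₂ VQuiv.pr e'
    (Category.comp_id _)))).trans ?_
  refine (VQuiv.pr_assoc _ _ _).trans ?_
  obtain ⟨j1, j2, e2⟩ := el_map' (V := V) K (n := (m ⊗ n) ⊗ p) (α_ m n p).hom σ h h'
  obtain ⟨c', k1, k2, k3, k4, e3⟩ := el_freeδ' (V := V) K (m := m) (n := n ⊗ p) _ j1 j2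
  obtain ⟨d', l1, l2, l3, l4, e4⟩ := el_freeδ' (V := V) K (m := n) (n := p) _ k3 k4
  refine Eq.trans ?_ ((Category.assoc _ _ _).symm.trans (congrArg (· ≫ _) e2)).symm
  refine Eq.trans ?_ ((Category.assoc _ _ _).symm.trans (congrArg (· ≫ _) e3)).symm
  refine Eq.trans ?_ ((VQuiv.pr_tHom _ _ _ _).trans (congrArg₂ VQuiv.pr
    (Category.comp_id _) e4)).symm
  refine pr_pr_el_congr K ?_ ?_ ?_ _ _ _ _ _ _ _ _ _ _ _ _
  · refine map_map_congr K (fun i => ?_) σ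
    rfl
  · refine map_map_congr₃ K (fun i => ?_) σ
    rfl
  · refine map_map_congr₁₃ K (fun i => ?_) σ
    change (i : ℕ) + (m.unop.len + n.unop.len) = i + n.unop.len + m.unop.len
    omega

lemma freeδ_left (K : SSet.{u}) (m : FinIntᵒᵖ) :
    (λ_ ((freeQuiv V K).obj m)).inv =
      (freeQuiv V K).map (λ_ m).inv ≫ freeδ K (𝟙_ _) m ≫ freeη K ▷ _ := by
  refine ((Iso.comp_hom_eq_id _).1 ?_).symm
  ext a b
  refine freeQuiv_hom_ext fun σ h h' => ?_
  obtain ⟨j1, j2, e1⟩ := el_map' (V := V) K (λ_ m).inv σ h h'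
  obtain ⟨c, k1, k2, k3, k4, e2⟩ := el_freeδ' (V := V) K (m := 𝟙_ FinIntᵒᵖ) (n := m) _ j1 j2
  obtain rfl := (vert_zero _ _ _).symm.trans k1
  obtain rfl := (vert_zero _ _ _).symm.trans k2
  refine (congrArg (_ ≫ ·) (Category.assoc _ _ _)).trans ?_
  refine ((Category.assoc _ _ _).symm.trans (congrArg (· ≫ _) e1)).trans ?_
  refine (congrArg (_ ≫ ·) (Category.assoc _ _ _)).trans ?_
  refine ((Category.assoc _ _ _).symm.trans (congrArg (· ≫ _) e2)).trans ?_
  refine (Category.assoc _ _ _).symm.trans ?_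
  refine (congrArg (· ≫ _) ((VQuiv.pr_tHom _ _ _ _).trans (congrArg₂ VQuiv.pr
    (el_freeη K _ _ _) (Category.comp_id _)))).trans ?_
  refine (VQuiv.pr_left _).trans ?_
  refine Eq.trans ?_ (Category.comp_id _).symm
  refine el_congr K (map_map_congr₀ K (fun i => ?_) σ).symm _ _ _ _
  rfl

lemma freeδ_right (K : SSet.{u}) (m : FinIntᵒᵖ) :
    (ρ_ ((freeQuiv V K).obj m)).inv =
      (freeQuiv V K).map (ρ_ m).inv ≫ freeδ K m (𝟙_ _) ≫ _ ◁ freeη K := by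
  refine ((Iso.comp_hom_eq_id _).1 ?_).symm
  ext a b
  refine freeQuiv_hom_ext fun σ h h' => ?_
  obtain ⟨j1, j2, e1⟩ := el_map' (V := V) K (ρ_ m).inv σ h h'
  obtain ⟨c, k1, k2, k3, k4, e2⟩ := el_freeδ' (V := V) K (m := m) (n := 𝟙_ FinIntᵒᵖ) _ j1 j2
  obtain rfl := (vert_zero _ _ _).symm.trans k3
  obtain rfl := (vert_zero _ _ _).symm.trans k4
  refine (congrArg (_ ≫ ·) (Category.assoc _ _ _)).trans ?_
  refine ((Category.assoc _ _ _).symm.trans (congrArg (· ≫ _) e1)).trans ?_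
  refine (congrArg (_ ≫ ·) (Category.assoc _ _ _)).trans ?_
  refine ((Category.assoc _ _ _).symm.trans (congrArg (· ≫ _) e2)).trans ?_
  refine (Category.assoc _ _ _).symm.trans ?_
  refine (congrArg (· ≫ _) ((VQuiv.pr_tHom _ _ _ _).trans (congrArg₂ VQuiv.pr
    (Category.comp_id _) (el_freeη K _ _ _)))).trans ?_
  refine (VQuiv.pr_right _).trans ?_
  refine Eq.trans ?_ (Category.comp_id _).symm
  refine el_congr K (map_map_congr₀ K (fun i => ?_) σ).symm _ _ _ _
  rfl

instance (K : SSet.{u}) : (freeQuiv V K).OplaxMonoidal where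
  η := freeη K
  δ := freeδ K
  δ_natural_left f n := by
    have := freeδ_natural (V := V) K f (𝟙 n)
    rwa [CategoryTheory.Functor.map_id, tensorHom_id, tensorHom_id] at this
  δ_natural_right n f := by
    have := freeδ_natural (V := V) K (𝟙 n) f
    rwa [CategoryTheory.Functor.map_id, id_tensorHom, id_tensorHom] at this
  oplax_associativity := freeδ_assoc K
  oplax_left_unitality := freeδ_left K
  oplax_right_unitality := freeδ_right K

variable (V) in
/-- The natural transformation `F̃(K) ⟶ f^* F̃(L)` induced by a simplicial map. -/
def freeTemplα {K L : SSet.{u}} (φ : K ⟶ L) :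
    freeQuiv V K ⟶ freeQuiv V L ⋙ VQuiv.pull V (fun a : K _⦋0⦌ => φ.app _ a) where
  app n := ⟨fun a b => (freeObj V).map (SimpQuiv.mapOf φ n.unop.len a b)⟩
  naturality m n g := by
    ext a b
    refine free_hom_ext fun σ => ?_
    refine ((fι_map_assoc _ _ _).trans (fι_map _ _)).trans ?_
    refine Eq.trans ?_ ((fι_map_assoc _ _ _).trans (fι_map _ _)).symm
    refine congrArg fι (Subtype.ext ?_)
    exact ConcreteCategory.congr_hom (φ.naturality (FinInt.toSimplex.map g.unop).op) σ.1

lemma el_freeTemplα {K L : SSet.{u}} (φ : K ⟶ L) {n : FinIntᵒᵖ} {a b : K _⦋0⦌}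
    (σ : K _⦋n.unop.len⦌) (h h') :
    ∃ i i', el (V := V) K (a := a) (b := b) σ h h' ≫ ((freeTemplα V φ).app n).app a b =
      el (V := V) L (n := n) (a := φ.app _ a) (b := φ.app _ b) (φ.app _ σ) i i' :=
  ⟨(SimpQuiv.mapOf φ n.unop.len a b ⟨σ, h, h'⟩).2.1,
    (SimpQuiv.mapOf φ n.unop.len a b ⟨σ, h, h'⟩).2.2, fι_map _ _⟩

variable (V) in
/-- The templicial object `F̃(K)`, with vertex set `K₀` and `F̃(K)ₙ(a, b) = F(Kₙ(a, b))`. -/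
def freeTemplObj (K : SSet.{u}) : Templ V where
  S := K _⦋0⦌
  X := freeQuiv V K
  isIso_η := inferInstanceAs (IsIso (freeη K))

variable (V) in
/-- The templicial morphism `F̃(K) ⟶ F̃(L)` induced by a simplicial map. -/
def freeTemplMap {K L : SSet.{u}} (φ : K ⟶ L) :
    Templ.Hom (freeTemplObj V K) (freeTemplObj V L) where
  f := fun a : K _⦋0⦌ => φ.app _ a
  α := freeTemplα V φ
  counit := by
    ext a b
    refine freeQuiv_hom_ext fun σ h h' => ?_
    obtain rfl := (vert_zero _ _ _).symm.trans h
    obtain rfl := (vert_zero _ _ _).symm.trans h'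
    obtain ⟨i, i', e⟩ := el_freeTemplα (V := V) φ (n := 𝟙_ FinIntᵒᵖ) σ h h'
    refine ((Category.assoc _ _ _).symm.trans (congrArg (· ≫ _) e)).trans ?_
    refine (el_freeη L _ _ _).trans ?_
    refine Eq.trans ?_ ((Category.assoc _ _ _).symm.trans (congrArg (· ≫ _) (el_freeη K _ _ _))).symm
    exact (VQuiv.uι_pullε (V := V) (fun a : K _⦋0⦌ => φ.app _ a) _).symm
  comul m n := by
    ext a b
    refine freeQuiv_hom_ext fun σ h h' => ?_
    obtain ⟨i, i', e⟩ := el_freeTemplα (V := V) φ (n := m ⊗ n) σ h h'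
    obtain ⟨c, h1, h2, h3, h4, e1⟩ := el_freeδ' (V := V) K (m := m) (n := n) σ h h'
    obtain ⟨j1, j2, e2⟩ := el_freeTemplα (V := V) φ _ h1 h2
    obtain ⟨k1, k2, e3⟩ := el_freeTemplα (V := V) φ _ h3 h4
    refine ((Category.assoc _ _ _).symm.trans (congrArg (· ≫ _) e)).trans ?_
    refine Eq.trans ?_ ((Category.assoc _ _ _).symm.trans (congrArg (· ≫ _) e1)).symm
    refine Eq.trans ?_ (Category.assoc _ _ _)
    have e4 := (VQuiv.pr_tHom (el (V := V) K _ h1 h2) (el K _ h3 h4) ((freeTemplα V φ).app m)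
      ((freeTemplα V φ).app n)).trans (congrArg₂ VQuiv.pr e2 e3)
    refine Eq.trans ?_ (congrArg (· ≫ _) e4).symm
    refine Eq.trans ?_ (VQuiv.pr_pull (fun a : K _⦋0⦌ => φ.app _ a) (Q := (freeQuiv V L).obj m)
      (P := (freeQuiv V L).obj n) _ _).symm
    exact el_freeδ (V := V) L _ (ConcreteCategory.congr_hom (φ.naturality _) σ).symm
      (ConcreteCategory.congr_hom (φ.naturality _) σ).symm _ _ _ _ _ _

variable (V) in
/-- The free functor `F̃` from simplicial sets to templicial objects. -/
def freeTempl : SSet.{u} ⥤ Templ V where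
  obj K := freeTemplObj V K
  map φ := freeTemplMap V φ
  map_id _ := Templ.Hom.ext_same fun _ _ _ =>
    free_hom_ext fun _ => (fι_map _ _).trans (Category.comp_id _).symm
  map_comp φ ψ := Templ.Hom.ext_same fun n a b => free_hom_ext fun σ =>
    (fι_map _ _).trans ((fι_map_assoc (SimpQuiv.mapOf φ n.unop.len a b) σ
      ((freeObj V).map (SimpQuiv.mapOf ψ n.unop.len _ _))).trans (fι_map _ _)).symm

variable (V) in
/-- The forgetful functor `Ũ` from templicial objects to simplicial sets, with
`Ũ(X)ₙ = Hom(F̃(Δⁿ), X)`. -/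
def forgetTempl : Templ V ⥤ SSet.{u} :=
  yoneda ⋙ (Functor.whiskeringLeft _ _ _).obj (SSet.stdSimplex ⋙ freeTempl V).op

end FreeTempl
end

noncomputable section

section CoendTensor

variable {J : Type*} [Category* J] {W W' W'' : Type*} [Category* W] [Category* W'] [Category* W'']
  (F : Jᵒᵖ ⥤ J ⥤ W)
  [HasCoend F] (L : W ⥤ W') [PreservesColimit (multispanIndexCoend F).multispan L]
  {X : W'}

/-- Morphisms out of the image of a coend under a functor which preserves it. -/
def coendMapDesc (f : ∀ j, L.obj ((F.obj (op j)).obj j) ⟶ X)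
    (hf : ∀ {i j : J} (g : i ⟶ j), L.map ((F.map g.op).app i) ≫ f i =
      L.map ((F.obj (op j)).map g) ≫ f j) : L.obj (coend F) ⟶ X :=
  (isColimitOfPreserves L (colimit.isColimit (multispanIndexCoend F).multispan)).desc
    { pt := X
      ι :=
      { app := fun
          | .left g => L.map ((F.map g.hom.op).app g.left) ≫ f g.left
          | .right j => f j
        naturality := by
          rintro _ _ (_ | g | g)
          · simp
          · simp
            rfl
          · simp only [MultispanIndex.multispan_map_snd, Functor.comp_map]
            exact (hf (Arrow.hom g)).symm.trans (Category.comp_id _).symm } }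

lemma ι_coendMapDesc (f : ∀ j, L.obj ((F.obj (op j)).obj j) ⟶ X) (hf) (j : J) :
    L.map (coend.ι F j) ≫ coendMapDesc F L f hf = f j :=
  (isColimitOfPreserves L (colimit.isColimit (multispanIndexCoend F).multispan)).fac _ (.right j)

lemma coend_map_hom_ext {f g : L.obj (coend F) ⟶ X}
    (h : ∀ j, L.map (coend.ι F j) ≫ f = L.map (coend.ι F j) ≫ g) : f = g :=
  (isColimitOfPreserves L (colimit.isColimit (multispanIndexCoend F).multispan)).hom_ext fun
    | .left a => by
      have e := (L.mapCocone (colimit.cocone (multispanIndexCoend F).multispan)).w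
        (WalkingMultispan.Hom.fst (J := multispanShapeCoend J) a)
      refine (congrArg (· ≫ f) e.symm).trans (Eq.trans ?_ (congrArg (· ≫ g) e))
      exact (Category.assoc _ _ _).trans ((congrArg (_ ≫ ·) (h a.left)).trans
        (Category.assoc _ _ _).symm)
    | .right j => h j

end CoendTensor

/-- A `J`-indexed family of composition laws on hom-objects in `W`: a category with object set `S`
enriched in `W^(Jᵒᵖ)` with the Day convolution. -/
structure DayCat (J : Type*) [Category* J] [MonoidalCategory J] (W : Type*) [Category* W]
    [MonoidalCategory W] (S : Type*) where
  K : S → S → Jᵒᵖ ⥤ W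
  m : ∀ (a b c : S) (T U : J),
    (K a b).obj (op T) ⊗ (K b c).obj (op U) ⟶ (K a c).obj (op (T ⊗ U))
  e : ∀ a : S, 𝟙_ W ⟶ (K a a).obj (op (𝟙_ J))
  nat : ∀ (a b c : S) {T T' U U' : J} (f : T ⟶ T') (g : U ⟶ U'),
    ((K a b).map f.op ⊗ₘ (K b c).map g.op) ≫ m a b c T U =
      m a b c T' U' ≫ (K a c).map (f ⊗ₘ g).op
  assoc : ∀ (a b c d : S) (T U X : J),
    m a b c T U ▷ _ ≫ m a c d (T ⊗ U) X =
      (α_ _ _ _).hom ≫ _ ◁ m b c d U X ≫ m a b d T (U ⊗ X) ≫ (K a d).map (α_ T U X).hom.op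
  left : ∀ (a b : S) (T : J),
    e a ▷ _ ≫ m a a b (𝟙_ J) T = (λ_ _).hom ≫ (K a b).map (λ_ T).hom.op
  right : ∀ (a b : S) (T : J),
    _ ◁ e b ≫ m a b b T (𝟙_ J) = (ρ_ _).hom ≫ (K a b).map (ρ_ T).hom.op

namespace DayCat

open Functor.LaxMonoidal

variable {J : Type*} [Category* J] [MonoidalCategory J] {W : Type*} [Category* W]
    [MonoidalCategory W] [BraidedCategory W] {S : Type*} (A : DayCat J W S) (N : J ⥤ W)
    [N.LaxMonoidal]

/-- The functor `(T, U) ↦ A_T(a, b) ⊗ N(U)`. -/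
def bi (a b : S) : Jᵒᵖ ⥤ J ⥤ W :=
  (A.K a b ⋙ curriedTensor W) ⋙ (Functor.whiskeringLeft J W W).obj N

lemma bi_map (a b : S) {T T' : J} (f : T' ⟶ T) (U : J) :
    ((A.bi N a b).map f.op).app U = ((A.K a b).map f.op ⊗ₘ 𝟙 (N.obj U)) :=
  (tensorHom_id _ _).symm

lemma bi_obj_map (a b : S) (T : J) {U U' : J} (f : U ⟶ U') :
    ((A.bi N a b).obj (op T)).map f = (𝟙 ((A.K a b).obj (op T)) ⊗ₘ N.map f) :=
  (id_tensorHom _ _).symm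

/-- The composition law of the family `A_T(a, b) ⊗ N(U)`. -/
def p (a b c : S) (T T' U U' : J) :
    ((A.K a b).obj (op T) ⊗ N.obj T') ⊗ ((A.K b c).obj (op U) ⊗ N.obj U') ⟶
      (A.K a c).obj (op (T ⊗ U)) ⊗ N.obj (T' ⊗ U') :=
  tensorμ _ _ _ _ ≫ (A.m a b c T U ⊗ₘ μ N T' U')

lemma p_nat (a b c : S) {T₁ T₁' U₁ U₁' T₂ T₂' U₂ U₂' : J} (f : T₁ ⟶ T₂) (g : U₁ ⟶ U₂)
    (f' : T₁' ⟶ T₂') (g' : U₁' ⟶ U₂') :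
    (((A.K a b).map f.op ⊗ₘ N.map f') ⊗ₘ ((A.K b c).map g.op ⊗ₘ N.map g')) ≫
        A.p N a b c T₁ T₂' U₁ U₂' =
      A.p N a b c T₂ T₁' U₂ U₁' ≫ ((A.K a c).map (f ⊗ₘ g).op ⊗ₘ N.map (f' ⊗ₘ g')) := by
  unfold p
  rw [tensorμ_natural_assoc, Category.assoc, tensorHom_comp_tensorHom, tensorHom_comp_tensorHom,
    A.nat, μ_natural]

lemma p_assoc (a b c d : S) (T T' U U' X X' : J) :
    A.p N a b c T T' U U' ▷ _ ≫ A.p N a c d (T ⊗ U) (T' ⊗ U') X X' =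
      (α_ _ _ _).hom ≫ _ ◁ A.p N b c d U U' X X' ≫ A.p N a b d T T' (U ⊗ X) (U' ⊗ X') ≫
        ((A.K a d).map (α_ T U X).hom.op ⊗ₘ N.map (α_ T' U' X').inv) := by
  unfold p
  have h : μ N T' U' ▷ N.obj X' ≫ μ N (T' ⊗ U') X' =
      (α_ _ _ _).hom ≫ _ ◁ μ N U' X' ≫ μ N T' (U' ⊗ X') ≫ N.map (α_ T' U' X').inv := by
    have := Functor.LaxMonoidal.associativity_assoc N T' U' X' (N.map (α_ T' U' X').inv)
    rw [← N.map_comp, Iso.hom_inv_id, N.map_id, Category.comp_id] at this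
    exact this
  simp only [comp_whiskerRight, Category.assoc, tensorμ_natural_left_assoc,
    tensorHom_comp_tensorHom, MonoidalCategory.whiskerLeft_comp, tensorμ_natural_right_assoc]
  rw [A.assoc, h, ← tensorHom_comp_tensorHom, tensor_associativity_assoc]

lemma p_left (a b : S) (T T' : J) :
    ((λ_ (𝟙_ W)).inv ≫ (A.e a ⊗ₘ ε N)) ▷ _ ≫ A.p N a a b (𝟙_ J) (𝟙_ J) T T' =
      (λ_ _).hom ≫ ((A.K a b).map (λ_ T).hom.op ⊗ₘ N.map (λ_ T').inv) := by
  unfold p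
  have h : ε N ▷ N.obj T' ≫ μ N (𝟙_ J) T' = (λ_ _).hom ≫ N.map (λ_ T').inv := by
    rw [Functor.LaxMonoidal.left_unitality, Category.assoc, Category.assoc, ← N.map_comp,
      Iso.hom_inv_id, N.map_id, Category.comp_id]
  simp only [comp_whiskerRight, Category.assoc, tensorμ_natural_left_assoc,
    tensorHom_comp_tensorHom]
  rw [A.left, h, ← tensorHom_comp_tensorHom, tensor_left_unitality]
  simp only [Category.assoc]

lemma p_right (a b : S) (T T' : J) :
    _ ◁ ((λ_ (𝟙_ W)).inv ≫ (A.e b ⊗ₘ ε N)) ≫ A.p N a b b T T' (𝟙_ J) (𝟙_ J) =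
      (ρ_ _).hom ≫ ((A.K a b).map (ρ_ T).hom.op ⊗ₘ N.map (ρ_ T').inv) := by
  unfold p
  have h : N.obj T' ◁ ε N ≫ μ N T' (𝟙_ J) = (ρ_ _).hom ≫ N.map (ρ_ T').inv := by
    rw [Functor.LaxMonoidal.right_unitality, Category.assoc, Category.assoc, ← N.map_comp,
      Iso.hom_inv_id, N.map_id, Category.comp_id]
  simp only [MonoidalCategory.whiskerLeft_comp, Category.assoc, tensorμ_natural_right_assoc,
    tensorHom_comp_tensorHom]
  rw [A.right, h, ← tensorHom_comp_tensorHom, tensor_right_unitality]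
  simp only [Category.assoc]

variable [∀ F : Jᵒᵖ ⥤ J ⥤ W, HasCoend F]
  [∀ Z : W, PreservesColimitsOfShape (WalkingMultispan (multispanShapeCoend J)) (tensorRight Z)]
  [∀ Z : W, PreservesColimitsOfShape (WalkingMultispan (multispanShapeCoend J)) (tensorLeft Z)]

/-- The hom-objects `∫^T A_T(a, b) ⊗ N(T)`. -/
def hom (a b : S) : W := coend (A.bi N a b)

/-- The coprojections. -/
def ι (a b : S) (T : J) : (A.K a b).obj (op T) ⊗ N.obj T ⟶ A.hom N a b :=
  coend.ι (A.bi N a b) T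

lemma ι_cond (a b : S) {T U : J} (f : T ⟶ U) :
    ((A.K a b).map f.op ⊗ₘ 𝟙 (N.obj T)) ≫ A.ι N a b T =
      (𝟙 ((A.K a b).obj (op U)) ⊗ₘ N.map f) ≫ A.ι N a b U := by
  rw [← bi_map, ← bi_obj_map]
  exact coend.condition (A.bi N a b) f

lemma ι_iso (a b : S) {T U : J} (f : T ≅ U) :
    ((A.K a b).map f.hom.op ⊗ₘ N.map f.inv) ≫ A.ι N a b T = A.ι N a b U := by
  have h := A.ι_cond N a b f.hom
  have h' : ((A.K a b).map f.hom.op ⊗ₘ N.map f.inv) =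
      (𝟙 _ ⊗ₘ N.map f.inv) ≫ ((A.K a b).map f.hom.op ⊗ₘ 𝟙 _) := by
    rw [tensorHom_comp_tensorHom, Category.id_comp, Category.comp_id]
  rw [h', Category.assoc, h, tensorHom_comp_tensorHom_assoc, ← N.map_comp, Iso.inv_hom_id,
    N.map_id, Category.comp_id, id_tensorHom_id, Category.id_comp]

lemma hom_hom_ext {a b : S} {Z : W} {f g : A.hom N a b ⟶ Z}
    (h : ∀ T, A.ι N a b T ≫ f = A.ι N a b T ≫ g) : f = g :=
  coend.hom_ext h

lemma hom_hom_ext₂ {a b c d : S} {Z : W} {f g : A.hom N a b ⊗ A.hom N c d ⟶ Z}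
    (h : ∀ T U, (A.ι N a b T ⊗ₘ A.ι N c d U) ≫ f = (A.ι N a b T ⊗ₘ A.ι N c d U) ≫ g) : f = g := by
  refine coend_map_hom_ext (A.bi N a b) (tensorRight _) fun T => ?_
  refine coend_map_hom_ext (A.bi N c d) (tensorLeft _) fun U => ?_
  have := h T U
  rw [MonoidalCategory.tensorHom_def', Category.assoc, Category.assoc] at this
  exact this

lemma hom_hom_ext₃ {a b c d a' b' : S} {Z : W}
    {f g : (A.hom N a b ⊗ A.hom N c d) ⊗ A.hom N a' b' ⟶ Z}
    (h : ∀ T U X, ((A.ι N a b T ⊗ₘ A.ι N c d U) ⊗ₘ A.ι N a' b' X) ≫ f =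
      ((A.ι N a b T ⊗ₘ A.ι N c d U) ⊗ₘ A.ι N a' b' X) ≫ g) : f = g := by
  refine coend_map_hom_ext (A.bi N a' b') (tensorLeft _) fun X => ?_
  refine coend_map_hom_ext (A.bi N a b) (tensorRight _ ⋙ tensorRight _) fun T => ?_
  refine coend_map_hom_ext (A.bi N c d) (tensorLeft _ ⋙ tensorRight _) fun U => ?_
  have := h T U X
  rw [MonoidalCategory.tensorHom_def, MonoidalCategory.tensorHom_def', comp_whiskerRight,
    Category.assoc, Category.assoc, Category.assoc, Category.assoc] at this
  exact this

lemma p_ι_right (a b c : S) (T : J) {U X : J} (f : U ⟶ X) :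
    _ ◁ ((A.K b c).map f.op ⊗ₘ 𝟙 (N.obj U)) ≫ A.p N a b c T T U U ≫ A.ι N a c (T ⊗ U) =
      _ ◁ (𝟙 ((A.K b c).obj (op X)) ⊗ₘ N.map f) ≫ A.p N a b c T T X X ≫ A.ι N a c (T ⊗ X) := by
  have h1 := A.p_nat N a b c (𝟙 T) f (𝟙 T) (𝟙 U)
  have h2 := A.p_nat N a b c (𝟙 T) (𝟙 X) (𝟙 T) f
  have h3 := A.ι_cond N a c (T ◁ f)
  simp only [op_id, CategoryTheory.Functor.map_id, id_tensorHom, tensorHom_id,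
    id_whiskerRight] at h1 h2 h3 ⊢
  rw [reassoc_of% h1, reassoc_of% h2, h3]

lemma p_ι_left (a b c : S) {T U : J} (X : J) (f : T ⟶ U) :
    ((A.K a b).map f.op ⊗ₘ 𝟙 (N.obj T)) ▷ _ ≫ A.p N a b c T T X X ≫ A.ι N a c (T ⊗ X) =
      (𝟙 ((A.K a b).obj (op U)) ⊗ₘ N.map f) ▷ _ ≫ A.p N a b c U U X X ≫ A.ι N a c (U ⊗ X) := by
  have h1 := A.p_nat N a b c f (𝟙 X) (𝟙 T) (𝟙 X)
  have h2 := A.p_nat N a b c (𝟙 U) (𝟙 X) f (𝟙 X)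
  have h3 := A.ι_cond N a c (f ▷ X)
  simp only [op_id, CategoryTheory.Functor.map_id, id_tensorHom, tensorHom_id,
    id_whiskerRight] at h1 h2 h3 ⊢
  rw [reassoc_of% h1, reassoc_of% h2, h3]

/-- The composition law on a summand, in the first variable. -/
def compAux (a b c : S) (T : J) :
    ((A.K a b).obj (op T) ⊗ N.obj T) ⊗ A.hom N b c ⟶ A.hom N a c :=
  coendMapDesc (A.bi N b c) (tensorLeft _) (fun U => A.p N a b c T T U U ≫ A.ι N a c (T ⊗ U))
    (fun {U X} f => by
      rw [bi_map, bi_obj_map]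
      exact A.p_ι_right N a b c T f)

lemma ι_compAux (a b c : S) (T U : J) :
    _ ◁ A.ι N b c U ≫ A.compAux N a b c T = A.p N a b c T T U U ≫ A.ι N a c (T ⊗ U) :=
  ι_coendMapDesc (A.bi N b c) (tensorLeft _) (fun U => A.p N a b c T T U U ≫ A.ι N a c (T ⊗ U)) _ _

lemma compAux_cond (a b c : S) {T U : J} (f : T ⟶ U) :
    ((A.K a b).map f.op ⊗ₘ 𝟙 (N.obj T)) ▷ _ ≫ A.compAux N a b c T =
      (𝟙 ((A.K a b).obj (op U)) ⊗ₘ N.map f) ▷ _ ≫ A.compAux N a b c U := by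
  refine coend_map_hom_ext (A.bi N b c) (tensorLeft _) fun X => ?_
  have h : ∀ {Z Z' : W} (g : Z ⟶ Z') {Y} (h : Z' ⊗ A.hom N b c ⟶ Y),
      Z ◁ A.ι N b c X ≫ g ▷ _ ≫ h = g ▷ _ ≫ Z' ◁ A.ι N b c X ≫ h :=
    fun g _ h => whisker_exchange_assoc _ _ _
  refine (h _ _).trans (Eq.trans ?_ (h _ _).symm)
  rw [ι_compAux, ι_compAux, p_ι_left]

/-- The composition law. -/
def comp (a b c : S) : A.hom N a b ⊗ A.hom N b c ⟶ A.hom N a c :=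
  coendMapDesc (A.bi N a b) (tensorRight _) (fun T => A.compAux N a b c T) (fun {T U} f => by
    rw [bi_map, bi_obj_map]
    exact A.compAux_cond N a b c f)

lemma ι_comp (a b c : S) (T U : J) :
    (A.ι N a b T ⊗ₘ A.ι N b c U) ≫ A.comp N a b c =
      A.p N a b c T T U U ≫ A.ι N a c (T ⊗ U) := by
  have h : A.ι N a b T ▷ _ ≫ A.comp N a b c = A.compAux N a b c T :=
    ι_coendMapDesc (A.bi N a b) (tensorRight _) (fun T => A.compAux N a b c T) _ _
  rw [MonoidalCategory.tensorHom_def', Category.assoc, h, ι_compAux]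

/-- The identities. -/
def one (a : S) : 𝟙_ W ⟶ A.hom N a a :=
  ((λ_ (𝟙_ W)).inv ≫ (A.e a ⊗ₘ ε N)) ≫ A.ι N a a (𝟙_ J)

lemma comp_left (a b : S) :
    (λ_ (A.hom N a b)).inv ≫ A.one N a ▷ _ ≫ A.comp N a a b = 𝟙 _ := by
    refine A.hom_hom_ext N fun T => ?_
    have h := A.ι_comp N a a b (𝟙_ J) T
    have h2 : A.ι N a b T ≫ (λ_ _).inv ≫ A.one N a ▷ _ =
        (λ_ _).inv ≫ ((λ_ (𝟙_ W)).inv ≫ (A.e a ⊗ₘ ε N)) ▷ _ ≫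
          (A.ι N a a (𝟙_ J) ⊗ₘ A.ι N a b T) := by
      rw [leftUnitor_inv_naturality_assoc, whisker_exchange, one, comp_whiskerRight,
        Category.assoc, ← MonoidalCategory.tensorHom_def]
    have h3 := A.ι_iso N a b (λ_ T)
    rw [reassoc_of% h2, h, reassoc_of% A.p_left, Iso.inv_hom_id_assoc, h3, Category.comp_id]

lemma comp_right (a b : S) :
    (ρ_ (A.hom N a b)).inv ≫ _ ◁ A.one N b ≫ A.comp N a b b = 𝟙 _ := by
    refine A.hom_hom_ext N fun T => ?_
    have h := A.ι_comp N a b b T (𝟙_ J)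
    have h2 : A.ι N a b T ≫ (ρ_ _).inv ≫ _ ◁ A.one N b =
        (ρ_ _).inv ≫ _ ◁ ((λ_ (𝟙_ W)).inv ≫ (A.e b ⊗ₘ ε N)) ≫
          (A.ι N a b T ⊗ₘ A.ι N b b (𝟙_ J)) := by
      rw [rightUnitor_inv_naturality_assoc, ← whisker_exchange, one, MonoidalCategory.whiskerLeft_comp,
        Category.assoc, ← MonoidalCategory.tensorHom_def']
    have h3 := A.ι_iso N a b (ρ_ T)
    rw [reassoc_of% h2, h, reassoc_of% A.p_right, Iso.inv_hom_id_assoc, h3, Category.comp_id]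

lemma comp_assoc (a b c d : S) :
    (α_ (A.hom N a b) (A.hom N b c) (A.hom N c d)).inv ≫ A.comp N a b c ▷ _ ≫ A.comp N a c d =
      _ ◁ A.comp N b c d ≫ A.comp N a b d := by
    rw [Iso.inv_comp_eq]
    refine A.hom_hom_ext₃ N fun T U X => ?_
    rw [associator_naturality_assoc]
    have h1 := A.ι_comp N a b c T U
    have h2 := A.ι_comp N b c d U X
    have h3 : ((A.ι N a b T ⊗ₘ A.ι N b c U) ⊗ₘ A.ι N c d X) ≫ A.comp N a b c ▷ _ =
        A.p N a b c T T U U ▷ _ ≫ (A.ι N a c (T ⊗ U) ⊗ₘ A.ι N c d X) := by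
      rw [← tensorHom_id, ← tensorHom_id, tensorHom_comp_tensorHom, tensorHom_comp_tensorHom, h1,
        Category.comp_id, Category.id_comp]
    have h4 : (A.ι N a b T ⊗ₘ (A.ι N b c U ⊗ₘ A.ι N c d X)) ≫ _ ◁ A.comp N b c d =
        _ ◁ A.p N b c d U U X X ≫ (A.ι N a b T ⊗ₘ A.ι N b d (U ⊗ X)) := by
      rw [← id_tensorHom, ← id_tensorHom, tensorHom_comp_tensorHom, tensorHom_comp_tensorHom, h2,
        Category.comp_id, Category.id_comp]
    rw [reassoc_of% h3, reassoc_of% h4, ι_comp, ι_comp, reassoc_of% A.p_assoc,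
      A.ι_iso N a d (α_ T U X)]

/-- The category enriched in `W` with hom-objects `∫^T A_T(a, b) ⊗ N(T)`. -/
abbrev realization : EnrichedCategory W S where
  Hom a b := A.hom N a b
  id a := A.one N a
  comp a b c := A.comp N a b c
  id_comp a b := A.comp_left N a b
  comp_id a b := A.comp_right N a b
  assoc a b c d := A.comp_assoc N a b c d

/-- A functor of categories enriched in `W^(Jᵒᵖ)`. -/
structure Hom {S S' : Type*} (A : DayCat J W S) (B : DayCat J W S') (f : S → S') where
  α : ∀ a b, A.K a b ⟶ B.K (f a) (f b)
  unit : ∀ a, A.e a ≫ (α a a).app _ = B.e (f a)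
  mul : ∀ a b c T U, A.m a b c T U ≫ (α a c).app _ =
    ((α a b).app _ ⊗ₘ (α b c).app _) ≫ B.m _ _ _ T U

section

variable {A} {S' : Type*} {B : DayCat J W S'} {f : S → S'} (φ : Hom A B f)

/-- The morphism on hom-objects induced by a functor. -/
def Hom.map (a b : S) : A.hom N a b ⟶ B.hom N (f a) (f b) :=
  coend.map (Functor.whiskerRight (Functor.whiskerRight (φ.α a b) (curriedTensor W))
    ((Functor.whiskeringLeft J W W).obj N))

lemma Hom.ι_map (a b : S) (T : J) :
    A.ι N a b T ≫ φ.map N a b = ((φ.α a b).app (op T) ⊗ₘ 𝟙 _) ≫ B.ι N (f a) (f b) T := by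
  rw [tensorHom_id]
  exact coend.ι_map _ _

lemma Hom.map_one (a : S) : A.one N a ≫ φ.map N a a = B.one N (f a) := by
  unfold one
  rw [Category.assoc, Category.assoc, Hom.ι_map, tensorHom_comp_tensorHom_assoc, φ.unit,
    Category.comp_id, Category.assoc]

lemma Hom.map_mul (a b c : S) : A.comp N a b c ≫ φ.map N a c =
    (φ.map N a b ⊗ₘ φ.map N b c) ≫ B.comp N (f a) (f b) (f c) := by
  refine A.hom_hom_ext₂ N fun T U => ?_
  rw [reassoc_of% ι_comp, Hom.ι_map, tensorHom_comp_tensorHom_assoc, Hom.ι_map, Hom.ι_map,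
    ← tensorHom_comp_tensorHom, Category.assoc, ι_comp]
  unfold p
  rw [Category.assoc, Category.assoc, tensorμ_natural_assoc, tensorHom_comp_tensorHom_assoc, φ.mul,
    id_tensorHom_id, Category.comp_id, tensorHom_comp_tensorHom_assoc, Category.id_comp]

lemma Hom.map_eq_id {φ : Hom A A fun a => a} (h : ∀ a b T, (φ.α a b).app T = 𝟙 _) (a b : S) :
    φ.map N a b = 𝟙 (A.hom N a b) := by
  refine A.hom_hom_ext N fun T => ?_
  rw [Hom.ι_map, h, id_tensorHom_id, Category.id_comp, Category.comp_id]

lemma Hom.map_eq_comp {S'' : Type*} {C : DayCat J W S''} {g : S' → S''} {ψ : Hom B C g}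
    {χ : Hom A C fun a => g (f a)}
    (h : ∀ a b T, (χ.α a b).app T = (φ.α a b).app T ≫ (ψ.α (f a) (f b)).app T) (a b : S) :
    χ.map N a b = φ.map N a b ≫ ψ.map N (f a) (f b) := by
  refine A.hom_hom_ext N fun T => ?_
  rw [reassoc_of% Hom.ι_map, Hom.ι_map, Hom.ι_map, h, tensorHom_comp_tensorHom_assoc,
    Category.comp_id]

end

end DayCat
end

noncomputable section

section NecNerve

/-- The elements of the poset `P_T`: the sets of vertices of `T` which contain all joints. -/
@[ext]
structure VertSets (T : Nec) : Type u where
  carrier : Set ℕ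
  joints_subset : Nec.joints T.beads ⊆ carrier
  le_sum : ∀ i ∈ carrier, i ≤ T.beads.sum

namespace VertSets

/-- The order on `P_T` is the inclusion. -/
instance (T : Nec) : PartialOrder (VertSets.{u} T) :=
  PartialOrder.lift VertSets.carrier fun _ _ => VertSets.ext

/-- The order morphism `P_T ⟶ P_U` given by taking images. -/
def map {T U : Nec} (f : T ⟶ U) : VertSets.{u} T →o VertSets.{u} U where
  toFun W := ⟨f.toFun '' W.carrier, f.joints_subset.trans (Set.image_mono W.joints_subset), by
    rintro _ ⟨i, hi, rfl⟩
    exact f.prop.map_le (W.le_sum i hi)⟩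
  monotone' _ _ h := Set.image_mono h

/-- The union `P_T × P_U ⟶ P_{T ∨ U}`. -/
def join {T U : Nec} (W : VertSets.{u} T) (X : VertSets.{u} U) : VertSets.{u} (T ⊗ U) where
  carrier := W.carrier ∪ (fun i => T.beads.sum + i) '' X.carrier
  joints_subset := (Nec.joints_append T.beads U.beads).trans_subset
      (Set.union_subset_union W.joints_subset (Set.image_mono X.joints_subset))
  le_sum := by
    change ∀ i ∈ _, i ≤ (T.beads ++ U.beads).sum
    rw [List.sum_append]
    rintro i (hi | ⟨j, hj, rfl⟩)
    · exact (W.le_sum i hi).trans (Nat.le_add_right _ _)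
    · exact Nat.add_le_add_left (X.le_sum j hj) _

lemma join_mono {T U : Nec} {W W' : VertSets.{u} T} {X X' : VertSets.{u} U} (h : W ≤ W')
    (h' : X ≤ X') : join W X ≤ join W' X' :=
  Set.union_subset_union h (Set.image_mono h')

lemma functor_ext {T : Nec} {I : Type*} [Category* I] {F G : I ⥤ VertSets.{u} T}
    (h : ∀ i, (F.obj i).carrier = (G.obj i).carrier) : F = G :=
  CategoryTheory.Functor.ext (fun i => VertSets.ext (h i)) (fun _ _ _ => Subsingleton.elim _ _)

end VertSets

/-- The functor `T ↦ N(P_T)`. -/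
def necNerve : Nec ⥤ SSet.{u} where
  obj T := nerve (VertSets.{u} T)
  map f := nerveMap (VertSets.map f).monotone.functor
  map_id T := by
    refine NatTrans.ext (funext fun n => ConcreteCategory.hom_ext _ _ fun σ => ?_)
    refine VertSets.functor_ext fun i => ?_
    exact Set.image_id _
  map_comp f g := by
    refine NatTrans.ext (funext fun n => ConcreteCategory.hom_ext _ _ fun σ => ?_)
    refine VertSets.functor_ext fun i => ?_
    exact Set.image_comp g.toFun f.toFun _

/-- The map `N(P_T) × N(P_U) ⟶ N(P_{T ∨ U})`. -/
def necNerveμ (T U : Nec) :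
    necNerve.{u}.obj T ⊗ necNerve.{u}.obj U ⟶ necNerve.{u}.obj (T ⊗ U) where
  app n := ↾fun σ : (Fin (n.unop.len + 1) ⥤ VertSets.{u} T) ×
      (Fin (n.unop.len + 1) ⥤ VertSets.{u} U) =>
    ({ obj i := (σ.1.obj i).join (σ.2.obj i)
       map g := homOfLE (VertSets.join_mono (leOfHom (σ.1.map g)) (leOfHom (σ.2.map g))) } :
      Fin (n.unop.len + 1) ⥤ VertSets.{u} (T ⊗ U))
  naturality n m f := rfl

/-- The vertex of `N(P_{Δ⁰})`. -/
def necNerveε : 𝟙_ SSet.{u} ⟶ necNerve.{u}.obj (𝟙_ Nec) where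
  app n := ↾fun _ => ((Functor.const (Fin (n.unop.len + 1))).obj
    (⟨{0}, subset_rfl, fun _ hi => (Set.mem_singleton_iff.1 hi).le⟩ : VertSets.{u} (𝟙_ Nec)))
  naturality _ _ _ := rfl

lemma glue_image {T T' : Nec} (f : T ⟶ T') (g : ℕ → ℕ) (hg : g 0 = 0) {W X : Set ℕ}
    (hW : ∀ i ∈ W, i ≤ T.beads.sum) :
    f.toFun '' W ∪ (fun i => T'.beads.sum + i) '' (g '' X) =
      glue T.beads.sum T'.beads.sum f.toFun g '' (W ∪ (fun i => T.beads.sum + i) '' X) := by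
  rw [Set.image_union, Set.image_image, Set.image_image]
  congr 1
  · refine Set.image_congr fun i hi => ?_
    rw [glue, if_pos (hW i hi)]
  · refine Set.image_congr fun i _ => ?_
    unfold glue
    split_ifs with h
    · have : i = 0 := by omega
      rw [this, hg, Nat.add_zero, Nat.add_zero, f.prop.map_last]
    · rw [Nat.add_sub_cancel_left]

instance : necNerve.{u}.LaxMonoidal := .ofTensorHom
  (ε := necNerveε)
  (μ := necNerveμ)
  (μ_natural := fun {T U T' U'} f g => by
    ext n ⟨σ, τ⟩
    refine VertSets.functor_ext fun i => ?_
    exact glue_image f g.toFun g.prop.map_zero (VertSets.le_sum _))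
  (associativity := fun T U X => by
    ext n ⟨⟨σ, τ⟩, ρ⟩
    refine VertSets.functor_ext fun i => ?_
    refine (Set.image_id _).trans ?_
    change (_ ∪ _) ∪ (fun i => (T.beads ++ U.beads).sum + i) '' _ = _ ∪ _ '' (_ ∪ _ '' _)
    rw [Set.image_union, Set.union_assoc, Set.image_image, List.sum_append]
    simp only [Nat.add_assoc]
    rfl)
  (left_unitality := fun T => by
    ext n ⟨σ, τ⟩
    refine VertSets.functor_ext fun i => ?_
    refine Eq.symm ((Set.image_id _).trans ?_)
    change {0} ∪ (fun i => 0 + i) '' _ = _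
    simp only [Nat.zero_add, Set.image_id']
    refine Set.union_eq_self_of_subset_left (Set.singleton_subset_iff.2 ?_)
    exact VertSets.joints_subset _ (Nec.zero_mem_joints _))
  (right_unitality := fun T => by
    ext n ⟨σ, τ⟩
    refine VertSets.functor_ext fun i => ?_
    refine Eq.symm ((Set.image_id _).trans ?_)
    change _ ∪ (fun i => T.beads.sum + i) '' {0} = _
    simp only [Set.image_singleton, Nat.add_zero]
    refine Set.union_eq_self_of_subset_right (Set.singleton_subset_iff.2 ?_)
    exact VertSets.joints_subset _ (Nec.sum_mem_joints _))

end NecNerve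
end

noncomputable section

section Realization

open Functor.LaxMonoidal

variable {V : Type v} [Category.{u} V] [MonoidalCategory V] [HasColimitsOfSize.{u, u} V]
  [MonoidalClosed V] [BraidedCategory V]

instance : HasColimitsOfSize.{0, 0} (SimplexCategoryᵒᵖ ⥤ V) :=
  have := hasColimitsOfSizeShrink.{0, 0, u, u} V
  inferInstance

instance {K : Type} [SmallCategory K] (Z : SimplexCategoryᵒᵖ ⥤ V) :
    PreservesColimitsOfShape K (tensorRight Z) :=
  have := hasColimitsOfSizeShrink.{0, 0, u, u} V
  preservesColimitsOfShape_of_evaluation _ _ fun n =>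
    inferInstanceAs (PreservesColimitsOfShape K
      ((evaluation SimplexCategoryᵒᵖ V).obj n ⋙ tensorRight (Z.obj n)))

instance {K : Type} [SmallCategory K] (Z : SimplexCategoryᵒᵖ ⥤ V) :
    PreservesColimitsOfShape K (tensorLeft Z) :=
  have := hasColimitsOfSizeShrink.{0, 0, u, u} V
  preservesColimitsOfShape_of_evaluation _ _ fun n =>
    inferInstanceAs (PreservesColimitsOfShape K
      ((evaluation SimplexCategoryᵒᵖ V).obj n ⋙ tensorLeft (Z.obj n)))

lemma VQuiv.assoc_eval {S : Type u} {P Q R PQ QR X Y : VQuiv V S} {f : tObj P Q ⟶ PQ}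
    {g : tObj PQ R ⟶ X} {h : tObj Q R ⟶ QR} {k : tObj P QR ⟶ Y} {l : Y ⟶ X}
    (H : tHom f (𝟙 R) ≫ g = (tAssoc P Q R).hom ≫ tHom (𝟙 P) h ≫ k ≫ l) (a b c d : S) :
    (tι P Q a b c ≫ f.app a c) ▷ R.obj c d ≫ tι PQ R a c d ≫ g.app a d =
      (α_ _ _ _).hom ≫ P.obj a b ◁ (tι Q R b c d ≫ h.app b d) ≫
        (tι P QR a b d ≫ k.app a d) ≫ l.app a d := by
  have h1 := congrArg (fun z => VQuiv.Hom.app z a d) H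
  simp only [comp_app] at h1
  have h2 := tι_tHom f (𝟙 R) a c d
  have h3 := tι_tHom (𝟙 P) h a b d
  rw [VQuiv.id_app, tensorHom_id] at h2
  rw [VQuiv.id_app, id_tensorHom] at h3
  rw [comp_whiskerRight, Category.assoc, ← reassoc_of% h2, h1, tι_tAssoc_hom_assoc, reassoc_of% h3,
    MonoidalCategory.whiskerLeft_comp, Category.assoc, Category.assoc]

namespace NecCat

variable (A : NecCat V)

/-- The composition `C_T(a, b) ⊗ C_U(b, c) ⟶ C_{T ∨ U}(a, c)`. -/
def comp (a b c : A.S) (T U : Nec) :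
    (A.C.obj (op T)).obj a b ⊗ (A.C.obj (op U)).obj b c ⟶ (A.C.obj (op (T ⊗ U))).obj a c :=
  VQuiv.tι _ _ a b c ≫ (μ A.C (op T) (op U)).app a c

/-- The identity `I ⟶ C_{Δ⁰}(a, a)`. -/
def one (a : A.S) : 𝟙_ V ⟶ (A.C.obj (op (𝟙_ Nec))).obj a a :=
  VQuiv.uι V a ≫ (ε A.C).app a a

lemma comp_nat (a b c : A.S) {T T' U U' : Nec} (f : T ⟶ T') (g : U ⟶ U') :
    ((A.C.map f.op).app a b ⊗ₘ (A.C.map g.op).app b c) ≫ A.comp a b c T U =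
      A.comp a b c T' U' ≫ (A.C.map (f ⊗ₘ g).op).app a c := by
  unfold comp
  have h := congrArg (fun z => VQuiv.Hom.app z a c) (μ_natural A.C f.op g.op)
  have h' := VQuiv.tι_tHom (A.C.map f.op) (A.C.map g.op) a b c
  rw [← Category.assoc, ← h', Category.assoc, Category.assoc]
  exact congrArg (_ ≫ ·) h

lemma comp_assoc (a b c d : A.S) (T U X : Nec) :
    A.comp a b c T U ▷ _ ≫ A.comp a c d (T ⊗ U) X =
      (α_ _ _ _).hom ≫ _ ◁ A.comp b c d U X ≫ A.comp a b d T (U ⊗ X) ≫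
        (A.C.map (α_ T U X).hom.op).app a d := by
  have h0 : μ A.C (op T) (op U) ▷ A.C.obj (op X) ≫ μ A.C (op T ⊗ op U) (op X) =
      (α_ _ _ _).hom ≫ _ ◁ μ A.C (op U) (op X) ≫ μ A.C (op T) (op U ⊗ op X) ≫
        A.C.map (α_ T U X).hom.op := by
    have := Functor.LaxMonoidal.associativity_assoc A.C (op T) (op U) (op X)
      (A.C.map (α_ (op T) (op U) (op X)).inv)
    rw [← A.C.map_comp, Iso.hom_inv_id, A.C.map_id, Category.comp_id] at this
    exact this
  exact VQuiv.assoc_eval h0 a b c d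

lemma comp_left (a b : A.S) (T : Nec) :
    A.one a ▷ _ ≫ A.comp a a b (𝟙_ Nec) T =
      (λ_ _).hom ≫ (A.C.map (λ_ T).hom.op).app a b := by
  have h0 : ε A.C ▷ A.C.obj (op T) ≫ μ A.C (𝟙_ _) (op T) =
      (λ_ _).hom ≫ A.C.map (λ_ T).hom.op := by
    have h := Functor.LaxMonoidal.left_unitality A.C (op T)
    rw [h, Category.assoc, Category.assoc]
    have : A.C.map (λ_ (op T)).hom ≫ A.C.map (λ_ T).hom.op = 𝟙 _ := by
      rw [← A.C.map_comp]
      exact (congrArg A.C.map (λ_ (op T)).hom_inv_id).trans (A.C.map_id _)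
    rw [this, Category.comp_id]
  have h1 : (VQuiv.tHom (ε A.C) (𝟙 (A.C.obj (op T)))).app a b ≫ (μ A.C (𝟙_ _) (op T)).app a b =
      (VQuiv.tLeft _).hom.app a b ≫ (A.C.map (λ_ T).hom.op).app a b :=
    congrArg (fun z => VQuiv.Hom.app z a b) h0
  have h2 := VQuiv.tι_tHom (ε A.C) (𝟙 (A.C.obj (op T))) a a b
  rw [VQuiv.id_app, tensorHom_id] at h2
  unfold comp one
  rw [comp_whiskerRight, Category.assoc]
  refine (congrArg (_ ≫ ·) ((reassoc_of% h2) _).symm).trans ?_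
  refine (congrArg (_ ≫ _ ≫ ·) h1).trans ?_
  exact VQuiv.uι_tLeft_hom_assoc _ _ _ _

lemma comp_right (a b : A.S) (T : Nec) :
    _ ◁ A.one b ≫ A.comp a b b T (𝟙_ Nec) =
      (ρ_ _).hom ≫ (A.C.map (ρ_ T).hom.op).app a b := by
  have h0 : A.C.obj (op T) ◁ ε A.C ≫ μ A.C (op T) (𝟙_ _) =
      (ρ_ _).hom ≫ A.C.map (ρ_ T).hom.op := by
    have h := Functor.LaxMonoidal.right_unitality A.C (op T)
    rw [h, Category.assoc, Category.assoc]
    have : A.C.map (ρ_ (op T)).hom ≫ A.C.map (ρ_ T).hom.op = 𝟙 _ := by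
      rw [← A.C.map_comp]
      exact (congrArg A.C.map (ρ_ (op T)).hom_inv_id).trans (A.C.map_id _)
    rw [this, Category.comp_id]
  have h1 : (VQuiv.tHom (𝟙 (A.C.obj (op T))) (ε A.C)).app a b ≫ (μ A.C (op T) (𝟙_ _)).app a b =
      (VQuiv.tRight _).hom.app a b ≫ (A.C.map (ρ_ T).hom.op).app a b :=
    congrArg (fun z => VQuiv.Hom.app z a b) h0
  have h2 := VQuiv.tι_tHom (𝟙 (A.C.obj (op T))) (ε A.C) a b b
  rw [VQuiv.id_app, id_tensorHom] at h2
  unfold comp one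
  rw [MonoidalCategory.whiskerLeft_comp, Category.assoc]
  refine (congrArg (_ ≫ ·) ((reassoc_of% h2) _).symm).trans ?_
  refine (congrArg (_ ≫ _ ≫ ·) h1).trans ?_
  exact VQuiv.uι_tRight_hom_assoc _ _ _ _

/-- The necklace category regarded as a category enriched in `(SV)^(Necᵒᵖ)`, through the
constant functor `V ⥤ SV`. -/
def toDay : DayCat Nec (SimplexCategoryᵒᵖ ⥤ V) A.S where
  K a b :=
  { obj T := (Functor.const _).obj ((A.C.obj T).obj a b)
    map f := (Functor.const _).map ((A.C.map f).app a b)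
    map_id T := by
      rw [A.C.map_id]
      exact (Functor.const _).map_id _
    map_comp f g := by
      rw [A.C.map_comp]
      exact (Functor.const _).map_comp _ _ }
  m a b c T U :=
  { app _ := A.comp a b c T U
    naturality _ _ _ := by
      refine Eq.trans ?_ (Category.comp_id _).symm
      exact (congrArg (· ≫ _) (id_tensorHom_id _ _)).trans (Category.id_comp _) }
  e a := { app _ := A.one a }
  nat a b c _ _ _ _ f g := NatTrans.ext (funext fun _ => A.comp_nat a b c f g)
  assoc a b c d T U X := NatTrans.ext (funext fun _ => A.comp_assoc a b c d T U X)
  left a b T := NatTrans.ext (funext fun _ => A.comp_left a b T)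
  right a b T := NatTrans.ext (funext fun _ => A.comp_right a b T)

lemma Hom.map_one {A B : NecCat V} (φ : Hom A B) (a : A.S) :
    A.one a ≫ (φ.α.app (op (𝟙_ Nec))).app a a = B.one (φ.f a) := by
  have h : (ε A.C).app a a ≫ (φ.α.app (op (𝟙_ Nec))).app a a =
      (VQuiv.pullε φ.f).app a a ≫ (ε B.C).app (φ.f a) (φ.f a) :=
    congrArg (fun z => VQuiv.Hom.app z a a) φ.unit
  unfold one
  refine (Category.assoc _ _ _).trans ((congrArg (_ ≫ ·) h).trans ?_)
  refine (Category.assoc _ _ _).symm.trans (congrArg (· ≫ _) ?_)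
  exact VQuiv.uι_pullε _ _

lemma Hom.map_comp {A B : NecCat V} (φ : Hom A B) (a b c : A.S) (T U : Nec) :
    A.comp a b c T U ≫ (φ.α.app (op (T ⊗ U))).app a c =
      ((φ.α.app (op T)).app a b ⊗ₘ (φ.α.app (op U)).app b c) ≫
        B.comp (φ.f a) (φ.f b) (φ.f c) T U := by
  have h : (μ A.C (op T) (op U)).app a c ≫ (φ.α.app (op (T ⊗ U))).app a c =
      (VQuiv.tHom (φ.α.app (op T)) (φ.α.app (op U))).app a c ≫
        (VQuiv.pullμ φ.f (B.C.obj (op T)) (B.C.obj (op U))).app a c ≫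
          (μ B.C (op T) (op U)).app (φ.f a) (φ.f c) :=
    congrArg (fun z => VQuiv.Hom.app z a c) (φ.mul (op T) (op U))
  unfold NecCat.comp
  refine (Category.assoc _ _ _).trans ((congrArg (_ ≫ ·) h).trans ?_)
  refine (VQuiv.tι_tHom_assoc _ _ _ _ _ _).trans (congrArg (_ ≫ ·) ?_)
  exact VQuiv.tι_pullμ_assoc _ _ _ _ _ _ _

/-- The functor of enriched categories induced by a functor of necklace categories. -/
def Hom.toDay {A B : NecCat V} (φ : Hom A B) : DayCat.Hom A.toDay B.toDay φ.f where
  α a b :=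
  { app T := (Functor.const _).map ((φ.α.app T).app a b)
    naturality T U g := by
      refine ((Functor.const _).map_comp _ _).symm.trans ?_
      refine Eq.trans ?_ ((Functor.const _).map_comp _ _)
      exact congrArg (fun z => (Functor.const _).map (VQuiv.Hom.app z a b)) (φ.α.naturality g) }
  unit a := NatTrans.ext (funext fun _ => φ.map_one a)
  mul a b c T U := NatTrans.ext (funext fun _ => φ.map_comp a b c T U)

end NecCat

variable (V) in
/-- The functor `T ↦ F N(P_T)`. -/
abbrev freeNecNerve : Nec ⥤ SimplexCategoryᵒᵖ ⥤ V :=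
  necNerve.{u} ⋙ (Functor.whiskeringRight _ _ _).obj (freeObj V)

/-- The enriched category with the same objects as `A` and with hom-objects the coends
`∫^T A_T(a, b) ⊗ F N(P_T)`. -/
abbrev NecCat.realization (A : NecCat V) : EnrichedCategory (SimplexCategoryᵒᵖ ⥤ V) A.S :=
  A.toDay.realization (freeNecNerve V)

variable (V) in
/-- The functor `𝔰` from necklace categories to categories enriched in simplicial objects, whose
hom-objects are the coends `∫^T C_T(a, b) ⊗ F N(P_T)`. -/
def realize : NecCat V ⥤ ECat.{u} (SimplexCategoryᵒᵖ ⥤ V) where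
  obj A := @ECat.mk (SimplexCategoryᵒᵖ ⥤ V) _ _ A.S A.realization
  map {A B} φ := @EnrichedFunctor.mk (SimplexCategoryᵒᵖ ⥤ V) _ _ A.S A.realization B.S B.realization
    φ.f (φ.toDay.map (freeNecNerve V)) (φ.toDay.map_one (freeNecNerve V))
    (φ.toDay.map_mul (freeNecNerve V))
  map_id A := @ECat.ext_same _ _ _ _ _ A.realization A.realization _ _ _ _ _ _ _
    (DayCat.Hom.map_eq_id (freeNecNerve V) fun _ _ _ => rfl)
  map_comp {A _ C} φ ψ := @ECat.ext_same _ _ _ _ _ A.realization C.realization _ _ _ _ _ _ _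
    (DayCat.Hom.map_eq_comp (freeNecNerve V) φ.toDay fun _ _ _ => rfl)

end Realization
end

noncomputable section

section Classical

/-- The cosimplicial simplicially enriched category `[n] ↦ ℭ[Δⁿ]`, with object set `{0, …, n}` and
`ℭ[Δⁿ](i, j)` the nerve of the poset of subsets of `[i, j]` containing `i` and `j`. -/
def thickening : SimplexCategory ⥤ ECat.{u} SSet.{u} where
  obj n := ⟨SimplicialThickening (ULift.{u} (Fin (n.len + 1)))⟩
  map f := SimplicialThickening.functor f.toOrderHom.uliftMap
  map_id _ := SimplicialThickening.functor_id _
  map_comp f g := SimplicialThickening.functor_comp f.toOrderHom.uliftMap g.toOrderHom.uliftMap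

/-- The homotopy coherent nerve of simplicially enriched categories, with
`N^hc(C)ₙ = Hom(ℭ[Δⁿ], C)`. -/
def hcNerve : ECat.{u} SSet.{u} ⥤ SSet.{u} :=
  yoneda ⋙ (Functor.whiskeringLeft _ _ _).obj thickening.{u}.op

end Classical

section BaseChange

variable (V : Type v) [Category.{u} V] [MonoidalCategory V] [HasColimitsOfSize.{u, u} V]
  [MonoidalClosed V] [BraidedCategory V]

/-- The functor `𝓕` from simplicially enriched categories to `SV`-enriched categories, given by
applying `F` levelwise to the hom-objects. -/
def freeECat : ECat.{u} SSet.{u} ⥤ ECat.{u} (SimplexCategoryᵒᵖ ⥤ V) :=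
  ECat.baseChange ((Functor.whiskeringRight SimplexCategoryᵒᵖ (Type u) V).obj (freeObj V))

/-- The functor `𝓤` from `SV`-enriched categories to simplicially enriched categories, given by
applying `U = V(I, -)` levelwise to the hom-objects. -/
def forgetECat : ECat.{u} (SimplexCategoryᵒᵖ ⥤ V) ⥤ ECat.{u} SSet.{u} :=
  ECat.baseChange ((Functor.whiskeringRight SimplexCategoryᵒᵖ V (Type u)).obj
    (coyoneda.obj (op (𝟙_ V))))

/-- The categorification functor `C_V`. -/
def categorify : Templ V ⥤ ECat.{u} (SimplexCategoryᵒᵖ ⥤ V) := nec V ⋙ realize V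

/-- The templicial homotopy coherent nerve `N^hc_V`, the composite of the right adjoints of `𝔰` and
of `(-)^nec`. -/
def templHcNerve [(nec V).IsLeftAdjoint] [(realize V).IsLeftAdjoint] :
    ECat.{u} (SimplexCategoryᵒᵖ ⥤ V) ⥤ Templ V :=
  (realize V).rightAdjoint ⋙ (nec V).rightAdjoint

end BaseChange

end

/-! Both isomorphisms are readings of a single adjunction `ℭ_V ∘ F̃ ⊣ N^hc ∘ 𝓤` (`categorifyAdj`),
obtained by describing a functor `ℭ_V(F̃ K) ⟶ C` in successively simpler terms.

By the universal property of the coend, a functor `𝔰(A) ⟶ C` is a family of maps `A_T(a, b) ⟶ C(a,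
b)_n`, one for each `n`-simplex of `N(P_T)`, compatible with everything in sight (`RealData`).
Equivalently, it is a functor of necklace categories from `A` to `T ↦ Map(N(P_T), C(a, b))`; since
`N(P_T)` is strong monoidal in `T`, these mapping objects do form a necklace category, and this is
the right adjoint `𝔫`. Next, every necklace is a join of single beads, so a functor out of `X^nec`
is the same as a family `X_n ⟶ D_{Δⁿ}` compatible with `Δ_f`, comultiplications and counits
(`BeadNat`, `BeadHom`). For `X = F̃(K)` the source is a coproduct of copies of `I` indexed by
simplices, so what remains is one point of `𝓤 C` for each simplex of `K` and each chain of vertex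
sets of the corresponding bead (`SimpData`). Finally `ℭ[Δⁿ](i, j)` is the nerve of `P_T` for a bead
of length `j - i`. Evaluating such data on the edges of a simplex spanned by the intervals `[i, j]`
therefore gives a simplicial functor `ℭ[Δⁿ] ⟶ 𝓤 C`, and conversely (`SimpData.equivNerve`): the data
amount to a simplicial map `K ⟶ N^hc(𝓤 C)`.

For sets `𝓤` is isomorphic to the identity, so the adjunction provides the left adjoint `ℭ` of
`N^hc`. For general `V` one also has `𝓕 ⊣ 𝓤` (`FreeForget.adj`), so `𝓕 ∘ ℭ` and `ℭ_V ∘ F̃` are left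
adjoint to the same functor, which is the first isomorphism. The second is the Yoneda computation
`Hom(F̃ Δⁿ, N^hc_V C) = Hom(ℭ_V F̃ Δⁿ, C) = Hom(Δⁿ, N^hc 𝓤 C)` (`nerveIso`).

The remaining point is the right adjoint of `(-)^nec`, a cofree construction. Given a lax `D`,
degree `m` of the cofree object must be the limit of elements of `D_{Δᵐ}` together with, for each
proper split `m = a + b`, a lift of their restriction to `Δᵃ ∨ Δᵇ` through the tensor product of
degrees `a` and `b`, these lifts being coassociative. This is a recursion on `m` in which the
comultiplications of lower degrees enter the definition of the next object. It is carried out by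
iterating the limit construction on all degrees at once, starting from the initial sequence
(`Pre.next`, `Pre.iter`): degree `m` is stable from stage `m + 1` on (`isIso_toSucc`). Morphisms
into the result are determined by their component in `D` and their decompositions, hence can be
solved for by strong induction on the degree. One general statement of this (`CoFam.exists_sol` with
`Sol.unique`) serves twice: for the action of `Δ_f` on the cofree sequence, and for its universal
property. Everything is phrased after a functor `G` which preserves limits, because a morphism with
vertex map `f` lands in `f^*` of the cofree object. -/

noncomputable section

/-! ### Necklaces with a single bead and the maps between them -/

namespace Nec

/-- The beads of the necklace `Δⁿ`. -/
def beadList : ℕ → List ℕ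
  -- Beads have positive length, so `Δ⁰` has none. This makes `bead 0` definitionally the monoidal
  -- unit of `Nec`, so that for instance the unit of `D` can be compared with degree zero without a
  -- transport.
  | 0 => []
  | n + 1 => [n + 1]

@[simp] lemma beadList_sum (n : ℕ) : (beadList n).sum = n := by
  cases n <;> simp [beadList]

lemma beadList_of_pos {n : ℕ} (h : 0 < n) : beadList n = [n] := by
  cases n with
  | zero => omega
  | succ n => rfl

@[simp] lemma joints_beadList (n : ℕ) : joints (beadList n) = {0, n} := by
  cases n <;> simp [beadList, joints, Set.pair_comm]

/-- The necklace `Δⁿ`. -/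
def bead (n : ℕ) : Nec := ⟨beadList n, by cases n <;> simp [beadList]⟩

/-- The necklace map `Δᵐ ⟶ Δⁿ` given by a morphism of `Δ_f`. -/
def beadMap {m n : FinInt} (g : m ⟶ n) : bead m.len ⟶ bead n.len where
  toFun := g.toFun
  prop := by
    change IsInterval (beadList _).sum (beadList _).sum _
    rw [beadList_sum, beadList_sum]
    exact g.prop
  joints_subset := by
    change joints (beadList _) ⊆ _ '' joints (beadList _)
    rw [joints_beadList, joints_beadList]
    rintro i (rfl | rfl)
    · exact ⟨0, by simp, g.prop.map_zero⟩
    · exact ⟨m.len, by simp, g.prop.map_last⟩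

/-- The necklace map `T ⟶ U` which is the identity on vertices. -/
def incl {T U : Nec} (h : T.beads.sum = U.beads.sum) (hj : joints U.beads ⊆ joints T.beads) :
    T ⟶ U where
  toFun i := i
  prop := h ▸ .id _
  joints_subset := by simpa using hj

/-- The inclusion `Δᵃ ∨ Δᵇ ⟶ Δᵐ` for `a + b = m`. -/
def join {a b m : ℕ} (h : a + b = m) : bead a ⊗ bead b ⟶ bead m :=
  incl (T := bead a ⊗ bead b)
    (by change (beadList a ++ beadList b).sum = (beadList m).sum; simpa using h)
    (by
      change joints (beadList m) ⊆ joints (beadList a ++ beadList b)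
      rw [joints_beadList]
      rintro i (rfl | rfl)
      · exact zero_mem_joints _
      · have := sum_mem_joints (beadList a ++ beadList b)
        simpa [h] using this)

/-- The isomorphism `T ≅ Δⁿ ∨ U` if the beads of `T` are `n` and those of `U`. -/
def consIso {n : ℕ} {L : List ℕ} (h : ∀ k ∈ n :: L, 0 < k) (h' : ∀ k ∈ L, 0 < k) :
    Nec.mk (n :: L) h ≅ bead n ⊗ Nec.mk L h' :=
  eqIso (U := bead n ⊗ Nec.mk L h') (by
    change n :: L = beadList n ++ L
    rw [beadList_of_pos (h n (by simp))]
    rfl)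

@[simp] lemma join_apply {a b m : ℕ} (h : a + b = m) (i : ℕ) : (join h).toFun i = i := rfl
@[simp] lemma assoc_inv_apply (T U V : Nec) (i : ℕ) : (α_ T U V).inv.toFun i = i := rfl

lemma tensorHom_apply {T T' U U' : Nec} (f : T ⟶ T') (g : U ⟶ U') (i : ℕ) :
  (f ⊗ₘ g).toFun i = glue T.beads.sum T'.beads.sum f.toFun g.toFun i := rfl

lemma whiskerRight_apply_of_id {T T' U : Nec} {f : T ⟶ T'} (hf : ∀ i, f.toFun i = i) (i : ℕ) :
    (f ▷ U).toFun i = i :=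
  IsInterval.glue_id f.prop hf (fun _ => rfl) i

lemma whiskerLeft_apply_of_id {T U U' : Nec} {g : U ⟶ U'} (hg : ∀ i, g.toFun i = i) (i : ℕ) :
    (T ◁ g).toFun i = i :=
  IsInterval.glue_id (.id _) (fun _ => rfl) hg i

@[simp] lemma bead_sum (n : ℕ) : (bead n).beads.sum = n := beadList_sum n

/-- Associators, unitors, `join`, `incl` and `consIso` are all the identity on vertices, so parallel
composites of them coincide. This closes the coherence diagrams of necklaces below. -/
lemma hom_eq_of_id {T U : Nec} {f g : T ⟶ U} (hf : ∀ i, f.toFun i = i)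
    (hg : ∀ i, g.toFun i = i) : f = g := hom_ext fun i => (hf i).trans (hg i).symm

lemma eq_id_of_id {T : Nec} {f : T ⟶ T} (hf : ∀ i, f.toFun i = i) : f = 𝟙 T :=
  hom_eq_of_id hf fun _ => rfl

/-- On vertices both composites are `g`, since `hg` says that `g` splits at `a` into `g₁` and `g₂`.
-/
lemma join_natural {a b m a' b' m' : ℕ} (h : a + b = m) (h' : a' + b' = m')
    (g : FinInt.mk m ⟶ ⟨m'⟩) (g₁ : FinInt.mk a ⟶ ⟨a'⟩) (g₂ : FinInt.mk b ⟶ ⟨b'⟩)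
    (hg : ∀ i, g.toFun i = glue a a' g₁.toFun g₂.toFun i) :
    (beadMap g₁ ⊗ₘ beadMap g₂) ≫ join h' = join h ≫ beadMap g := by
  refine hom_ext fun i => ?_
  rw [comp_apply, comp_apply, join_apply, join_apply, tensorHom_apply, bead_sum, bead_sum]
  exact (hg i).symm

end Nec

/-! ### Monoidal transformations out of `X^nec` are determined on single beads -/

section LaxNec

open Functor.LaxMonoidal Functor.OplaxMonoidal

variable {W : Type*} [Category* W] [MonoidalCategory W] (D : Necᵒᵖ ⥤ W) [D.LaxMonoidal]

/-- The multiplication `D_T ⊗ D_U ⟶ D_{T ∨ U}`. -/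
def necμ (T U : Nec) : D.obj (op T) ⊗ D.obj (op U) ⟶ D.obj (op (T ⊗ U)) := μ D (op T) (op U)

/-- The unit `I ⟶ D_{Δ⁰}`. -/
def necε : 𝟙_ W ⟶ D.obj (op (𝟙_ Nec)) := ε D

lemma necμ_natural {T T' U U' : Nec} (f : T ⟶ T') (g : U ⟶ U') :
    (D.map f.op ⊗ₘ D.map g.op) ≫ necμ D T U = necμ D T' U' ≫ D.map (f ⊗ₘ g).op :=
  μ_natural D f.op g.op

/-- The lax structure is indexed by `Necᵒᵖ`, whose associator is the opposite of the inverse one;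
moving it to the other side gives associativity in terms of the associator of `Nec`. -/
lemma necμ_assoc (T U V : Nec) : necμ D T U ▷ D.obj (op V) ≫ necμ D (T ⊗ U) V =
    (α_ _ _ _).hom ≫ _ ◁ necμ D U V ≫ necμ D T (U ⊗ V) ≫ D.map (α_ T U V).hom.op := by
  have := Functor.LaxMonoidal.associativity_assoc D (op T) (op U) (op V)
    (D.map (α_ (op T) (op U) (op V)).inv)
  rw [← D.map_comp, Iso.hom_inv_id, D.map_id, Category.comp_id] at this
  exact this

lemma necμ_left (T : Nec) : necε D ▷ D.obj (op T) ≫ necμ D (𝟙_ Nec) T =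
    (λ_ _).hom ≫ D.map (λ_ T).hom.op := by
  have h := Functor.LaxMonoidal.left_unitality D (op T)
  rw [h, Category.assoc, Category.assoc]
  have : D.map (λ_ (op T)).hom ≫ D.map (λ_ T).hom.op = 𝟙 _ := by
    rw [← D.map_comp]
    exact (congrArg D.map (λ_ (op T)).hom_inv_id).trans (D.map_id _)
  rw [this, Category.comp_id]
  rfl

lemma necμ_right (T : Nec) : D.obj (op T) ◁ necε D ≫ necμ D T (𝟙_ Nec) =
    (ρ_ _).hom ≫ D.map (ρ_ T).hom.op := by
  have h := Functor.LaxMonoidal.right_unitality D (op T)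
  rw [h, Category.assoc, Category.assoc]
  have : D.map (ρ_ (op T)).hom ≫ D.map (ρ_ T).hom.op = 𝟙 _ := by
    rw [← D.map_comp]
    exact (congrArg D.map (ρ_ (op T)).hom_inv_id).trans (D.map_id _)
  rw [this, Category.comp_id]
  rfl

lemma map_op_comp_eq {W : Type*} [Category* W] (D : Necᵒᵖ ⥤ W) {T U V : Nec} {f : T ⟶ U}
    {g : U ⟶ V} {h : T ⟶ V} (e : f ≫ g = h) : D.map g.op ≫ D.map f.op = D.map h.op := by
  rw [← D.map_comp, ← op_comp, e]

variable (X : FinIntᵒᵖ ⥤ W) [X.OplaxMonoidal]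

/-- A compatible family of morphisms `X_n ⟶ D_{Δⁿ}`. -/
@[ext]
structure BeadNat where
  θ : ∀ n : ℕ, X.obj (op ⟨n⟩) ⟶ D.obj (op (Nec.bead n))
  nat : ∀ {m n : FinInt} (g : m ⟶ n),
    X.map g.op ≫ θ m.len = θ n.len ≫ D.map (Nec.beadMap g).op
  comul : ∀ {a b m : ℕ} (h : a + b = m), θ m ≫ D.map (Nec.join h).op =
    comul X h ≫ (θ a ⊗ₘ θ b) ≫ necμ D (Nec.bead a) (Nec.bead b)
  unit : θ 0 = η X ≫ necε D

variable {X D} [IsIso (η X)]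

/-- The extension of a family of morphisms `X_n ⟶ D_{Δⁿ}` to necklaces. -/
def beadExtend (θ : ∀ n : ℕ, X.obj (op ⟨n⟩) ⟶ D.obj (op (Nec.bead n))) :
    ∀ (L : List ℕ) (hL : ∀ n ∈ L, 0 < n), chain X L ⟶ D.obj (op ⟨L, hL⟩)
  | [], _ => necε D
  | n :: L, hL => (θ n ⊗ₘ beadExtend θ L fun k hk => hL k (List.mem_cons_of_mem _ hk)) ≫
      necμ D (Nec.bead n) ⟨L, _⟩ ≫ D.map (Nec.consIso hL _).hom.op

/-- Frees the positivity proof for the tail, which the definition produces in a specific form. -/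
lemma beadExtend_cons (θ : ∀ n : ℕ, X.obj (op ⟨n⟩) ⟶ D.obj (op (Nec.bead n))) (n : ℕ)
    (L : List ℕ) (hL : ∀ k ∈ n :: L, 0 < k) (hL' : ∀ k ∈ L, 0 < k) :
    beadExtend θ (n :: L) hL = (θ n ⊗ₘ beadExtend θ L hL') ≫
      necμ D (Nec.bead n) ⟨L, hL'⟩ ≫ D.map (Nec.consIso hL hL').hom.op := rfl

/-- Splitting off a degree-zero factor does nothing: the isomorphism `u` cancels, and what is left
is the left unit law `h`. The same computation serves `Cut.beadExtend`, `extθ_mul` and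
`counit_left_aux`. -/
lemma zero_cut_aux {c x y d z : W} (u : c ≅ 𝟙_ W) {e : 𝟙_ W ⟶ d} (φ : x ⟶ y) {m : d ⊗ y ⟶ z}
    {k : y ⟶ z} (h : e ▷ y ≫ m = (λ_ y).hom ≫ k) {t : c ⟶ d} (ht : t = u.hom ≫ e) :
    φ ≫ k = ((λ_ x).inv ≫ u.inv ▷ x) ≫ (t ⊗ₘ φ) ≫ m := by
  have h1 : u.inv ▷ x ≫ (t ⊗ₘ φ) = _ ◁ φ ≫ e ▷ y := by
    rw [ht, whisker_exchange, ← MonoidalCategory.tensorHom_def, ← tensorHom_id,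
      tensorHom_comp_tensorHom, Category.id_comp, Iso.inv_hom_id_assoc]
  rw [Category.assoc, reassoc_of% h1, h, leftUnitor_naturality_assoc, Iso.inv_hom_id_assoc]

/-- The diagram chase for a cut through the interior of a bead, isolated from the necklace indices:
`hc` is compatibility with the comultiplication, `h1` and `h4` are naturality of the multiplication,
`h2` is its associativity and `h3` cancels the associator. -/
lemma mid_cut_aux {xr xa xb y dr da db d dab p q s s' t t' : W} {cm : xr ⟶ xa ⊗ xb} {tr : xr ⟶ dr}
    {ta : xa ⟶ da} {tb : xb ⟶ db} (φ : y ⟶ d) {mr : dr ⊗ d ⟶ p} {j : dr ⟶ dab} {mab : da ⊗ db ⟶ dab}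
    {m' : dab ⊗ d ⟶ q} {mb : db ⊗ d ⟶ s} {ma : da ⊗ s ⟶ t} {ma' : da ⊗ s' ⟶ t'} {k : s ⟶ s'}
    {P : p ⟶ q} {A : t ⟶ q} {A' : q ⟶ t} {K : t ⟶ t'}
    (hc : tr ≫ j = cm ≫ (ta ⊗ₘ tb) ≫ mab) (h1 : j ▷ d ≫ m' = mr ≫ P)
    (h2 : mab ▷ d ≫ m' = (α_ _ _ _).hom ≫ da ◁ mb ≫ ma ≫ A) (h3 : A ≫ A' = 𝟙 _)
    (h4 : da ◁ k ≫ ma' = ma ≫ K) :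
    ((tr ⊗ₘ φ) ≫ mr) ≫ P ≫ A' ≫ K =
      (cm ▷ y ≫ (α_ _ _ _).hom) ≫ (ta ⊗ₘ (tb ⊗ₘ φ) ≫ mb ≫ k) ≫ ma' := by
  have e6 : (tr ⊗ₘ φ) ≫ j ▷ d = cm ▷ y ≫ ((ta ⊗ₘ tb) ⊗ₘ φ) ≫ mab ▷ d := by
    simp only [← tensorHom_id, tensorHom_comp_tensorHom, hc, Category.comp_id, Category.id_comp]
  rw [Category.assoc, Category.assoc, ← reassoc_of% h1, reassoc_of% e6, reassoc_of% h2,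
    reassoc_of% h3, associator_naturality_assoc, ← h4]
  simp only [← id_tensorHom, tensorHom_comp_tensorHom_assoc, Category.comp_id]

/-- Each kind of cut uses one ingredient: cutting off nothing uses the compatibility with counits,
cutting at a joint is the definition of `beadExtend`, and cutting through a bead uses the
compatibility with comultiplications together with associativity. -/
lemma Cut.beadExtend (θ : BeadNat D X) {m M N σ} (h : Cut X m M N σ) (hM : ∀ n ∈ M, 0 < n)
    (hN : ∀ n ∈ N, 0 < n) (c : Nec.bead m ⊗ Nec.mk N hN ⟶ ⟨M, hM⟩) (hc : ∀ i, c.toFun i = i) :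
    beadExtend θ.θ M hM ≫ D.map c.op =
      σ ≫ (θ.θ m ⊗ₘ beadExtend θ.θ N hN) ≫ necμ D (Nec.bead m) ⟨N, hN⟩ := by
  cases h with
  | zero =>
    -- The bead of length zero is the unit, so `c` has the same source as the left unitor, and both
    -- are the identity on vertices.
    obtain rfl : c = (λ_ (Nec.mk M hM)).hom := Nec.hom_eq_of_id hc fun _ => rfl
    exact zero_cut_aux (unitIso X) (_root_.beadExtend θ.θ M hM) (necμ_left D ⟨M, hM⟩) θ.unit
  | hit hm =>
    have : D.map (Nec.consIso hM hN).hom.op ≫ D.map c.op = 𝟙 _ := by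
      rw [map_op_comp_eq D (Nec.eq_id_of_id (f := c ≫ _) fun i => hc i)]
      exact D.map_id _
    have h1 : ((θ.θ m ⊗ₘ _root_.beadExtend θ.θ N hN) ≫
        necμ D (Nec.bead m) ⟨N, hN⟩ ≫ D.map (Nec.consIso hM hN).hom.op) ≫ D.map c.op =
        (θ.θ m ⊗ₘ _root_.beadExtend θ.θ N hN) ≫ necμ D (Nec.bead m) ⟨N, hN⟩ := by
      rw [Category.assoc, Category.assoc, this, Category.comp_id]
    exact h1.trans (Category.id_comp _).symm
  | @mid _ b r ha hb h M =>
    have hM' : ∀ n ∈ M, 0 < n := fun k hk => hM k (List.mem_cons_of_mem _ hk)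
    -- Two ways of passing from `Δᵐ ∨ (Δᵇ ∨ M)` to `Δʳ ∨ M`: directly, or by rebracketing and then
    -- joining the first two beads.
    have e1 : c ≫ (Nec.consIso hM hM').hom =
        (Nec.bead m ◁ (Nec.consIso hN hM').hom ≫ (α_ _ _ _).inv) ≫ Nec.join h ▷ Nec.mk M hM' :=
      Nec.hom_eq_of_id hc fun i => by
        rw [Nec.comp_apply, Nec.comp_apply, Nec.whiskerRight_apply_of_id (fun _ => rfl),
          Nec.assoc_inv_apply, Nec.whiskerLeft_apply_of_id (fun _ => rfl)]
    have e0 : D.map (Nec.consIso hM hM').hom.op ≫ D.map c.op =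
        D.map (Nec.join h ▷ Nec.mk M hM').op ≫ D.map (α_ _ _ _).inv.op ≫
          D.map (Nec.bead m ◁ (Nec.consIso hN hM').hom).op := by
      rw [map_op_comp_eq D e1, op_comp, D.map_comp, op_comp, D.map_comp]
    have e2 := necμ_natural D (Nec.join h) (𝟙 (Nec.mk M hM'))
    rw [op_id, D.map_id, tensorHom_id, tensorHom_id] at e2
    have e3 := necμ_natural D (𝟙 (Nec.bead m)) (Nec.consIso hN hM').hom
    rw [op_id, D.map_id, id_tensorHom, id_tensorHom] at e3
    have e5 : D.map (α_ (Nec.bead m) (Nec.bead b) (Nec.mk M hM')).hom.op ≫ D.map (α_ _ _ _).inv.op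
      = 𝟙 _ := by rw [map_op_comp_eq D (Iso.inv_hom_id _)]; exact D.map_id _
    have e7 := mid_cut_aux (_root_.beadExtend θ.θ M hM') (θ.comul h) e2
      (necμ_assoc D (Nec.bead m) (Nec.bead b) ⟨M, hM'⟩) e5 e3
    rw [← e0] at e7
    refine Eq.trans ?_ e7
    have e8 : ((θ.θ r ⊗ₘ _root_.beadExtend θ.θ M hM') ≫ necμ D (Nec.bead r) ⟨M, hM'⟩ ≫
        D.map (Nec.consIso hM hM').hom.op) ≫ D.map c.op =
        ((θ.θ r ⊗ₘ _root_.beadExtend θ.θ M hM') ≫ necμ D (Nec.bead r) ⟨M, hM'⟩) ≫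
        D.map (Nec.consIso hM hM').hom.op ≫ D.map c.op := by simp only [Category.assoc]
    exact e8

lemma Cut.pos {m M N σ} (h : Cut X m M N σ) (hM : ∀ n ∈ M, 0 < n) : ∀ n ∈ N, 0 < n := by
  cases h with
  | zero => exact hM
  | hit hm => exact fun k hk => hM k (List.mem_cons_of_mem _ hk)
  | mid ha hb h =>
    intro k hk
    rcases List.mem_cons.1 hk with rfl | hk
    · exact hb
    · exact hM k (List.mem_cons_of_mem _ hk)

/-- A cut can only add joints; hence the identity on vertices is a necklace map from `Δᵐ ∨ N` to
`M`. -/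
lemma Cut.joints {m M N σ} (h : Cut X m M N σ) :
    Nec.joints M ⊆ Nec.joints (Nec.beadList m ++ N) := by
  cases h with
  | zero => exact subset_rfl
  | hit hm => rw [Nec.beadList_of_pos hm]; exact subset_rfl
  | @mid _ b r ha hb h M =>
    rw [Nec.beadList_of_pos ha, List.singleton_append, Nec.joints, Nec.joints, Nec.joints, ← h]
    rintro i (hi | ⟨j, hj, rfl⟩)
    · exact Or.inl hi
    · exact Or.inr ⟨b + j, Or.inr ⟨j, hj, rfl⟩, by dsimp; omega⟩

/-- Recovers the joint condition from the inductive description, so that in an induction on beads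
the tail of a necklace map is again a necklace map. -/
lemma Pull.joints {M L f φ} (h : Pull X M L f φ) (hL : ∀ n ∈ L, 0 < n) :
    Nec.joints M ⊆ f '' Nec.joints L := by
  induction h with
  | nil => simp
  | @cons n m M N L σ f φ g hσ hφ ih =>
    have h1 := Nec.joints_glue (L := Nec.beadList n) (L' := Nec.beadList m)
      (f := g.toFun) (by simpa using g.prop) hφ.interval.map_zero (Nec.beadMap g).joints_subset
      (ih fun k hk => hL k (List.mem_cons_of_mem _ hk))
    rw [Nec.beadList_sum, Nec.beadList_sum, Nec.beadList_of_pos (hL n (by simp))] at h1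
    exact hσ.joints.trans h1

lemma pull_cons_aux {x y z e₀ p q r d d' e t t' u : W} {E : x ⟶ e₀} {C : e₀ ⟶ p} {H : p ⟶ q}
    {K : q ⟶ r} {σ : x ⟶ y ⊗ z} {b : y ⟶ d} {c : z ⟶ e} {m : d ⊗ e ⟶ p} {G : d ⟶ d'}
    {G' : e ⟶ t} {m' : d' ⊗ t ⟶ q} {g : y ⟶ t'} {φ : z ⟶ u} {b' : t' ⟶ d'} {c' : u ⟶ t}
    (h1 : E ≫ C = σ ≫ (b ⊗ₘ c) ≫ m) (h2 : (G ⊗ₘ G') ≫ m' = m ≫ H) (h3 : g ≫ b' = b ≫ G)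
    (h4 : c ≫ G' = φ ≫ c') :
    E ≫ C ≫ H ≫ K = (σ ≫ (g ⊗ₘ φ)) ≫ (b' ⊗ₘ c') ≫ m' ≫ K := by
  rw [reassoc_of% h1, ← reassoc_of% h2, tensorHom_comp_tensorHom_assoc, ← h3, h4, Category.assoc,
    tensorHom_comp_tensorHom_assoc]

/-- This is naturality of the extension. By induction on the beads of the source, `c` factors as `Δⁿ
∨ L ⟶ Δᵐ ∨ N ⟶ M`, where the first map is a join of `g` with the tail and the second only forgets
joints. The second map is handled by `Cut.beadExtend`, the first by `θ.nat` and the induction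
hypothesis. -/
lemma Pull.beadExtend (θ : BeadNat D X) {M L f φ} (h : Pull X M L f φ) (hM : ∀ n ∈ M, 0 < n)
    (hL : ∀ n ∈ L, 0 < n) (c : Nec.mk L hL ⟶ ⟨M, hM⟩) (hc : ∀ i, c.toFun i = f i) :
    beadExtend θ.θ M hM ≫ D.map c.op = φ ≫ beadExtend θ.θ L hL := by
  induction h with
  | nil =>
    obtain rfl : c = 𝟙 _ := Nec.eq_id_of_id hc
    rw [Category.id_comp]
    exact (congrArg (_ ≫ ·) (D.map_id _)).trans (Category.comp_id _)
  | @cons n m M N L σ f φ g hσ hφ ih =>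
    have hL' : ∀ n ∈ L, 0 < n := fun k hk => hL k (List.mem_cons_of_mem _ hk)
    have hN := hσ.pos hM
    let c' : Nec.mk L hL' ⟶ ⟨N, hN⟩ := ⟨f, hφ.interval, hφ.joints hL'⟩
    let k : Nec.bead m ⊗ Nec.mk N hN ⟶ ⟨M, hM⟩ := Nec.incl
      ((List.sum_append).trans (by simpa using hσ.sum.symm)) hσ.joints
    have e : c = (Nec.consIso hL hL').hom ≫ (Nec.beadMap g ⊗ₘ c') ≫ k := Nec.hom_ext fun i => by
      rw [hc]
      change _ = (Nec.beadMap g ⊗ₘ c').toFun i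
      rw [Nec.tensorHom_apply, Nec.bead_sum, Nec.bead_sum]
      rfl
    have e1 := pull_cons_aux (K := D.map (Nec.consIso hL hL').hom.op)
      (hσ.beadExtend θ hM hN k fun _ => rfl) (necμ_natural D (Nec.beadMap g) c') (θ.nat g)
      (ih hN hL' c' fun _ => rfl)
    have e2 : D.map c.op = D.map k.op ≫ D.map (Nec.beadMap g ⊗ₘ c').op ≫
        D.map (Nec.consIso hL hL').hom.op := by
      rw [e, op_comp, op_comp, D.map_comp, D.map_comp, Category.assoc]
    rw [e2]
    exact e1

lemma append_cons_aux {x y z a b c ab q s t u v : W} {tx : x ⟶ a} {ey : y ⟶ b} {ez : z ⟶ c}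
    {m : a ⊗ b ⟶ ab} {k : ab ⟶ q} {m' : q ⊗ c ⟶ s} {p : y ⊗ z ⟶ t} {et : t ⟶ u}
    {n : b ⊗ c ⟶ u} {n' : a ⊗ u ⟶ v} {w : W} {m'' : ab ⊗ c ⟶ w}
    {A : v ⟶ w} {K : w ⟶ s} {K' : v ⟶ s} (h1 : p ≫ et = (ey ⊗ₘ ez) ≫ n)
    (h2 : m ▷ c ≫ m'' = (α_ _ _ _).hom ≫ a ◁ n ≫ n' ≫ A) (h3 : k ▷ c ≫ m' = m'' ≫ K)
    (h4 : A ≫ K = K') :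
    ((α_ _ _ _).hom ≫ x ◁ p) ≫ (tx ⊗ₘ et) ≫ n' ≫ K' =
      ((tx ⊗ₘ ey) ≫ m ≫ k ⊗ₘ ez) ≫ m' := by
  have e1 : ((tx ⊗ₘ ey) ≫ m ≫ k ⊗ₘ ez) = ((tx ⊗ₘ ey) ⊗ₘ ez) ≫ m ▷ c ≫ k ▷ c := by
    simp only [← tensorHom_id, tensorHom_comp_tensorHom, Category.comp_id]
  have e2 : x ◁ p ≫ (tx ⊗ₘ et) = (tx ⊗ₘ (ey ⊗ₘ ez)) ≫ a ◁ n := by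
    simp only [← id_tensorHom, tensorHom_comp_tensorHom, Category.comp_id, Category.id_comp, h1]
  rw [e1, Category.assoc, reassoc_of% e2, Category.assoc, Category.assoc, h3, reassoc_of% h2,
    h4, associator_naturality_assoc]

/-- The extension multiplies the values on the beads starting from the right, so concatenating two
necklaces amounts to reassociating the product, one bead of `L` at a time. -/
lemma beadExtend_append (θ : ∀ n : ℕ, X.obj (op ⟨n⟩) ⟶ D.obj (op (Nec.bead n))) (L M : List ℕ)
    (hL : ∀ n ∈ L, 0 < n) (hM : ∀ n ∈ M, 0 < n) (hLM : ∀ n ∈ L ++ M, 0 < n) :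
    (chainAppend X L M).hom ≫ beadExtend θ (L ++ M) hLM =
      (beadExtend θ L hL ⊗ₘ beadExtend θ M hM) ≫ necμ D ⟨L, hL⟩ ⟨M, hM⟩ := by
  induction L with
  | nil =>
    have h1 : (λ_ (chain X M)).hom ≫ beadExtend θ M hM =
        (necε D ⊗ₘ beadExtend θ M hM) ≫ necμ D (𝟙_ Nec) ⟨M, hM⟩ := by
      rw [MonoidalCategory.tensorHom_def', Category.assoc, necμ_left, leftUnitor_naturality_assoc]
      exact congrArg (_ ≫ ·) ((congrArg (_ ≫ ·) (D.map_id _)).trans (Category.comp_id _)).symm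
    exact h1
  | cons n L ih =>
    have hL' : ∀ n ∈ L, 0 < n := fun k hk => hL k (List.mem_cons_of_mem _ hk)
    have hLM' : ∀ n ∈ L ++ M, 0 < n := fun k hk => hLM k (List.mem_cons_of_mem _ hk)
    have e3 := necμ_natural D (Nec.consIso hL hL').hom (𝟙 (Nec.mk M hM))
    rw [op_id, D.map_id, tensorHom_id, tensorHom_id] at e3
    exact append_cons_aux (tx := θ n) (ih hL' hLM') (necμ_assoc D _ _ _) e3
      (K' := D.map (Nec.consIso hLM hLM').hom.op)
      (map_op_comp_eq D (Nec.hom_eq_of_id (fun i =>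
        Nec.whiskerRight_apply_of_id (f := (Nec.consIso hL hL').hom) (fun _ => rfl) i)
          fun _ => rfl))

variable (X) in
/-- The isomorphism from `X_n` to the value of `X^nec` at `Δⁿ`. -/
def toChain : ∀ n : ℕ, X.obj (op ⟨n⟩) ⟶ chain X (Nec.beadList n)
  | 0 => η X
  | n + 1 => (ρ_ (X.obj (op ⟨n + 1⟩))).inv

/-- Treats degree zero and positive degrees alike: whether `Δⁿ` has no bead or one, cutting off all
of it after `toChain` gives the inverse right unitor. -/
lemma toChain_cut (n : ℕ) : ∃ σ, Cut X n (Nec.beadList n) [] σ ∧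
    toChain X n ≫ σ = (ρ_ (X.obj (op ⟨n⟩))).inv := by
  cases n with
  | zero =>
    refine ⟨_, .zero _, ?_⟩
    have : (unitIso X).hom ≫ (λ_ (𝟙_ W)).inv ≫ (unitIso X).inv ▷ 𝟙_ W =
        (ρ_ (X.obj (op ⟨0⟩))).inv := by
      rw [unitors_inv_equal, ← rightUnitor_inv_naturality, Iso.hom_inv_id_assoc]
    exact this
  | succ n => exact ⟨_, .hit n.succ_pos [], Category.comp_id _⟩

lemma toChain_nat {m n : FinInt} (g : m ⟶ n) :
    X.map g.op ≫ toChain X m.len = toChain X n.len ≫ necMap X (Nec.beadMap g) := by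
  obtain ⟨m⟩ := m
  obtain ⟨n⟩ := n
  cases m with
  | zero =>
    -- The only vertex of `[0]` is sent both to the first and to the last vertex of `[n]`.
    obtain rfl : n = 0 := by
      have := g.prop.map_last
      exact this.symm.trans g.prop.map_zero
    obtain rfl : g = 𝟙 _ := FinInt.hom_ext fun i => by simpa using g.prop.map_add i
    have h : necMap X (Nec.beadMap (𝟙 (FinInt.mk 0))) = 𝟙 _ := necMap_eq .nil
    rw [h, op_id, X.map_id, Category.id_comp]
    exact (Category.comp_id _).symm
  | succ m =>
    obtain ⟨σ, h1, h2⟩ := toChain_cut (X := X) n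
    have h3 := Pull.cons g h1 .nil
    have h4 : glue (m + 1) n g.toFun (fun i => i) = (Nec.beadMap g).toFun :=
      funext fun i => IsInterval.glue_zero_right g.prop (fun _ => rfl) i
    rw [h4] at h3
    have h6 : X.map g.op ≫ (ρ_ (X.obj (op ⟨m + 1⟩))).inv =
        (ρ_ (X.obj (op ⟨n⟩))).inv ≫ (X.map g.op ⊗ₘ 𝟙 (𝟙_ W)) := by
      rw [tensorHom_id, rightUnitor_inv_naturality]
    have h5 : X.map g.op ≫ (ρ_ (X.obj (op ⟨m + 1⟩))).inv =
        toChain X n ≫ σ ≫ (X.map g.op ⊗ₘ 𝟙 (𝟙_ W)) :=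
      h6.trans ((congrArg (· ≫ _) h2.symm).trans (Category.assoc _ _ _))
    exact h5.trans (congrArg (_ ≫ ·) (necMap_eq (f := Nec.beadMap g) h3).symm)

lemma split_unit_aux {x y z : W} (c : x ⟶ y ⊗ z) :
    (ρ_ x).inv ≫ (c ▷ 𝟙_ W ≫ (α_ _ _ _).hom) ≫ (𝟙 y ⊗ₘ 𝟙 (z ⊗ 𝟙_ W) ≫ (𝟙 z ⊗ₘ 𝟙 (𝟙_ W))) =
      c ≫ ((ρ_ y).inv ⊗ₘ (ρ_ z).inv) ≫ (α_ _ _ _).hom ≫ y ◁ (λ_ (z ⊗ 𝟙_ W)).hom := by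
  simp [MonoidalCategory.tensorHom_def]

/-- If `a` or `b` vanishes, `join` is the identity between equal lists of beads and the claim is
counitality. Otherwise the action of `join` is found from the uniqueness of `Pull`: cut the single
bead at `a`, then cut off the remaining bead as a whole. -/
lemma toChain_comul {a b m : ℕ} (h : a + b = m) : toChain X m ≫ necMap X (Nec.join h) =
    comul X h ≫ (toChain X a ⊗ₘ toChain X b) ≫
      (chainAppend X (Nec.beadList a) (Nec.beadList b)).hom := by
  rcases Nat.eq_zero_or_pos a with rfl | ha
  · obtain rfl : b = m := by omega
    have h1 : necMap X (Nec.join h) = 𝟙 _ := necMap_eq (Pull.id (Nec.bead b).pos)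
    have h2 : comul X h ≫ (η X ⊗ₘ toChain X b) ≫ (λ_ _).hom = toChain X b := by
      rw [comul_zero_left, MonoidalCategory.tensorHom_def, Category.assoc, Category.assoc,
        leftUnitor_naturality]
      exact (congrArg (_ ≫ ·) (inv_hom_whiskerRight_assoc (unitIso X) _ _)).trans
        (Iso.inv_hom_id_assoc _ _)
    exact ((congrArg (_ ≫ ·) h1).trans (Category.comp_id _)).trans h2.symm
  rcases Nat.eq_zero_or_pos b with rfl | hb
  · obtain rfl : a = m := by omega
    have h1 : necMap X (Nec.join h) = chainCast X (List.append_nil _).symm :=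
      necMap_eqIso (T := Nec.bead a ⊗ Nec.bead 0) (U := Nec.bead a) (List.append_nil _)
    have h4 : (chainAppend X (Nec.beadList a) []).hom =
        (ρ_ _).hom ≫ chainCast X (List.append_nil _).symm := by
      rw [← chainAppend_nil]
      refine ((Category.comp_id _).symm.trans (congrArg (_ ≫ ·) ?_)).trans
        (Category.assoc _ _ _).symm
      exact ((eqToHom_trans _ _).trans (eqToHom_refl _ _)).symm
    have h2 : comul X h ≫ (toChain X a ⊗ₘ η X) ≫ (ρ_ _).hom = toChain X a := by
      rw [comul_zero_right, MonoidalCategory.tensorHom_def', Category.assoc, Category.assoc,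
        rightUnitor_naturality]
      exact (congrArg (_ ≫ ·) (whiskerLeft_inv_hom_assoc _ (unitIso X) _)).trans
        (Iso.inv_hom_id_assoc _ _)
    refine (congrArg (_ ≫ ·) h1).trans ?_
    refine Eq.trans ?_ (congrArg (fun z => _ ≫ (_ ≫ z)) h4).symm
    have h5 : ∀ {Z : W} (z : chain X (Nec.beadList a) ⟶ Z), toChain X a ≫ z =
        comul X h ≫ (toChain X a ⊗ₘ η X) ≫ (ρ_ _).hom ≫ z := fun z => by
      rw [reassoc_of% h2]
    exact h5 _
  obtain ⟨a, rfl⟩ : ∃ k, a = k + 1 := ⟨a - 1, by omega⟩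
  obtain ⟨b, rfl⟩ : ∃ k, b = k + 1 := ⟨b - 1, by omega⟩
  cases m with
  | zero => omega
  | succ m =>
    have h1 := Pull.cons (𝟙 _) (.mid a.succ_pos b.succ_pos h [])
      (.cons (𝟙 _) (.hit b.succ_pos []) (.nil (X := X)))
    have h2 : necMap X (Nec.join h) = _ := necMap_eq (by
      refine (congrArg (Pull X [m + 1] [a + 1, b + 1] · _) (funext fun i => ?_)).mp h1
      refine IsInterval.glue_id (.id _) (fun _ => rfl) (fun i => ?_) i
      exact IsInterval.glue_id (.id _) (fun _ => rfl) (fun i => rfl) i)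
    refine (congrArg (_ ≫ ·) h2).trans ?_
    rw [op_id, op_id, X.map_id, X.map_id]
    exact split_unit_aux (comul X h)

/-- On a single bead the extension is `θ n` multiplied by the unit of `D`, so the right unit law
gives `θ n` back. Thus restricting an extension recovers the family. -/
lemma toChain_beadExtend (θ : BeadNat D X) (n : ℕ) :
    toChain X n ≫ beadExtend θ.θ (Nec.beadList n) (Nec.bead n).pos = θ.θ n := by
  cases n with
  | zero => exact θ.unit.symm
  | succ n =>
    have h : (ρ_ _).inv ≫ (θ.θ (n + 1) ⊗ₘ necε D) ≫ necμ D (Nec.bead (n + 1)) (𝟙_ Nec) =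
        θ.θ (n + 1) ≫ D.map (ρ_ (Nec.bead (n + 1))).hom.op := by
      rw [MonoidalCategory.tensorHom_def, Category.assoc, necμ_right,
        rightUnitor_naturality_assoc, Iso.inv_hom_id_assoc]
    have h2 : D.map (ρ_ (Nec.bead (n + 1))).hom.op ≫
        D.map (Nec.consIso (Nec.bead (n + 1)).pos (𝟙_ Nec).pos).hom.op = 𝟙 _ := by
      exact (map_op_comp_eq D (f := (Nec.consIso (Nec.bead (n + 1)).pos (𝟙_ Nec).pos).hom)
        (g := (ρ_ (Nec.bead (n + 1))).hom) (h := 𝟙 _)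
        (Nec.eq_id_of_id fun _ => rfl)).trans (D.map_id _)
    have h3 : (ρ_ _).inv ≫ (θ.θ (n + 1) ⊗ₘ necε D) ≫ necμ D (Nec.bead (n + 1)) (𝟙_ Nec) ≫
        D.map (Nec.consIso (Nec.bead (n + 1)).pos (𝟙_ Nec).pos).hom.op = θ.θ (n + 1) := by
      rw [reassoc_of% h, h2]
      exact Category.comp_id _
    exact h3

/-- The morphism `X^nec ⟶ D` given by a compatible family of morphisms `X_n ⟶ D_{Δⁿ}`. -/
def BeadNat.toNec (θ : BeadNat D X) : necFunctor X ⟶ D where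
  app T := beadExtend θ.θ T.unop.beads T.unop.pos
  naturality _ _ g :=
    ((pull_necMap (X := X) g.unop).beadExtend θ _ _ g.unop fun _ => rfl).symm

/-- The family of morphisms `X_n ⟶ D_{Δⁿ}` underlying a morphism `X^nec ⟶ D`. -/
def BeadNat.ofNec (β : necFunctor X ⟶ D) (hε : β.app (op (𝟙_ Nec)) = necε D)
    (hμ : ∀ T U : Nec, (chainAppend X T.beads U.beads).hom ≫ β.app (op (T ⊗ U)) =
      (β.app (op T) ⊗ₘ β.app (op U)) ≫ necμ D T U) : BeadNat D X where
  θ n := toChain X n ≫ β.app (op (Nec.bead n))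
  nat {m n} g := by
    have h : necMap X (Nec.beadMap g) ≫ β.app (op (Nec.bead m.len)) =
        β.app (op (Nec.bead n.len)) ≫ D.map (Nec.beadMap g).op := β.naturality (Nec.beadMap g).op
    have h1 := toChain_nat (X := X) g
    refine (Category.assoc _ _ _).symm.trans ((congrArg (· ≫ _) h1).trans ?_)
    refine (Category.assoc _ _ _).trans ((congrArg (_ ≫ ·) h).trans ?_)
    exact (Category.assoc _ _ _).symm
  comul {a b m} h := by
    have h0 : necMap X (Nec.join h) ≫ β.app (op (Nec.bead a ⊗ Nec.bead b)) =
        β.app (op (Nec.bead m)) ≫ D.map (Nec.join h).op := β.naturality (Nec.join h).op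
    have h1 := toChain_comul (X := X) h
    refine (Category.assoc _ _ _).trans ((congrArg (_ ≫ ·) h0.symm).trans ?_)
    refine (Category.assoc _ _ _).symm.trans ((congrArg (· ≫ _) h1).trans ?_)
    refine (Category.assoc _ _ _).trans (congrArg (_ ≫ ·) ?_)
    refine (Category.assoc _ _ _).trans ((congrArg (_ ≫ ·) (hμ (Nec.bead a) (Nec.bead b))).trans ?_)
    refine (Category.assoc _ _ _).symm.trans (congrArg (· ≫ _) ?_)
    exact tensorHom_comp_tensorHom _ _ _ _
  unit := congrArg (η X ≫ ·) hε

lemma chainAppend_single_aux (x y : W) :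
    (ρ_ x).inv ▷ y ≫ (α_ _ _ _).hom ≫ x ◁ (λ_ y).hom = 𝟙 (x ⊗ y) := by simp

/-- The converse: a necklace is its first bead joined with the others, so multiplicativity forces a
monoidal transformation to be the extension of its values on beads. -/
lemma beadExtend_ofNec (β : necFunctor X ⟶ D) (hε : β.app (op (𝟙_ Nec)) = necε D)
    (hμ : ∀ T U : Nec, (chainAppend X T.beads U.beads).hom ≫ β.app (op (T ⊗ U)) =
      (β.app (op T) ⊗ₘ β.app (op U)) ≫ necμ D T U) (L : List ℕ) (hL : ∀ n ∈ L, 0 < n) :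
    beadExtend (BeadNat.ofNec β hε hμ).θ L hL = β.app (op ⟨L, hL⟩) := by
  induction L with
  | nil => exact hε.symm
  | cons n L ih =>
    have hL' : ∀ n ∈ L, 0 < n := fun k hk => hL k (List.mem_cons_of_mem _ hk)
    -- With the length written as a successor, `beadList` reduces and `consIso` is definitionally an
    -- identity, so `D` sends it to an identity by `D.map_id`.
    obtain ⟨n, rfl⟩ : ∃ k, n = k + 1 := ⟨n - 1, by have := hL n (by simp); omega⟩
    have h1 : D.map (Nec.consIso hL hL').hom.op = 𝟙 _ := D.map_id _
    have h2 := hμ (Nec.bead (n + 1)) ⟨L, hL'⟩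
    have h3 := chainAppend_single_aux (X.obj (op ⟨n + 1⟩)) (chain X L)
    have h4 : (toChain X (n + 1) ≫ β.app (op (Nec.bead (n + 1))) ⊗ₘ β.app (op ⟨L, hL'⟩)) =
        toChain X (n + 1) ▷ _ ≫ (β.app (op (Nec.bead (n + 1))) ⊗ₘ β.app (op ⟨L, hL'⟩)) := by
      rw [← tensorHom_id]
      refine Eq.trans ?_ (tensorHom_comp_tensorHom _ _ _ _).symm
      exact congrArg (_ ⊗ₘ ·) (Category.id_comp _).symm
    rw [beadExtend_cons _ _ _ _ hL', h1, ih hL']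
    have h5 : (toChain X (n + 1) ≫ β.app (op (Nec.bead (n + 1))) ⊗ₘ β.app (op ⟨L, hL'⟩)) ≫
        necμ D (Nec.bead (n + 1)) ⟨L, hL'⟩ = β.app (op ⟨(n + 1) :: L, hL⟩) := by
      refine (congrArg (· ≫ _) h4).trans ((Category.assoc _ _ _).trans ?_)
      refine (congrArg (_ ≫ ·) h2.symm).trans ((Category.assoc _ _ _).symm.trans ?_)
      exact (congrArg (· ≫ _) h3).trans (Category.id_comp _)
    refine Eq.trans ?_ h5
    exact congrArg (_ ≫ ·) (Category.comp_id _)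

end LaxNec

/-! ### Compatible families over a map of vertices -/

section BeadHom

open Functor.LaxMonoidal Functor.OplaxMonoidal

variable {V : Type v} [Category.{u} V] [MonoidalCategory V] [HasColimitsOfSize.{u, u} V]
  [MonoidalClosed V] [BraidedCategory V]

/-- A map on vertices together with a compatible family of morphisms `A_n ⟶ f^* D_{Δⁿ}`. -/
structure BeadHom (A : Templ V) (D : NecCat V) where
  f : A.S → D.S
  nat : BeadNat (D.C ⋙ VQuiv.pull V f) A.X

namespace BeadHom

variable {A : Templ V} {D : NecCat V}

lemma ext_same {f : A.S → D.S} {θ θ' : BeadNat (D.C ⋙ VQuiv.pull V f) A.X}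
    (h : ∀ n a b, (θ.θ n).app a b = (θ'.θ n).app a b) : BeadHom.mk f θ = BeadHom.mk f θ' := by
  obtain rfl : θ = θ' := BeadNat.ext (funext fun n => VQuiv.hom_ext (h n))
  rfl

/-- The functor of necklace categories associated to a compatible family. -/
def toNec (θ : BeadHom A D) : NecCat.Hom ((nec V).obj A) D :=
  @NecCat.Hom.mk V _ _ _ _ _ ((nec V).obj A) D θ.f θ.nat.toNec
  ((Category.id_comp _).trans (Functor.LaxMonoidal.comp_ε D.C (VQuiv.pull V θ.f)))
  fun T U => (beadExtend_append θ.nat.θ T.unop.beads U.unop.beads T.unop.pos U.unop.pos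
    (T.unop ⊗ U.unop).pos).trans
      (congrArg (_ ≫ ·) (Functor.LaxMonoidal.comp_μ D.C (VQuiv.pull V θ.f) _ _))

/-- The compatible family with vertex map `f` underlying a morphism `A^nec ⟶ f^* D`. -/
def natOfNec (f : A.S → D.S) (α : necFunctor A.X ⟶ D.C ⋙ VQuiv.pull V f)
    (unit : ε (necFunctor A.X) ≫ α.app (𝟙_ _) = ε (VQuiv.pull V f) ≫ (VQuiv.pull V f).map (ε D.C))
    (mul : ∀ T U, μ (necFunctor A.X) T U ≫ α.app (T ⊗ U) =
      (α.app T ⊗ₘ α.app U) ≫ μ (VQuiv.pull V f) _ _ ≫ (VQuiv.pull V f).map (μ D.C T U)) :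
    BeadNat (D.C ⋙ VQuiv.pull V f) A.X :=
  BeadNat.ofNec α
    ((Category.id_comp _).symm.trans (unit.trans
      (Functor.LaxMonoidal.comp_ε D.C (VQuiv.pull V f)).symm))
    fun T U => (mul (op T) (op U)).trans (congrArg (_ ≫ ·)
        (Functor.LaxMonoidal.comp_μ D.C (VQuiv.pull V f) (op T) (op U)).symm)

lemma natOfNec_toNec (f : A.S → D.S) (α : necFunctor A.X ⟶ D.C ⋙ VQuiv.pull V f) (unit mul) :
    (natOfNec f α unit mul).toNec = α :=
  NatTrans.ext (funext fun T => beadExtend_ofNec α _ _ T.unop.beads T.unop.pos)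

/-- The compatible family underlying a functor of necklace categories. -/
def ofNec (φ : NecCat.Hom ((nec V).obj A) D) : BeadHom A D where
  f := φ.f
  nat := natOfNec φ.f φ.α φ.unit φ.mul

/-- Functors `A^nec ⟶ D` correspond to compatible families of morphisms `A_n ⟶ D_{Δⁿ}`. -/
def equivNec (A : Templ V) (D : NecCat V) : BeadHom A D ≃ ((nec V).obj A ⟶ D) where
  toFun := toNec
  invFun := ofNec
  left_inv θ := ext_same fun n a b =>
    congrArg (fun z => VQuiv.Hom.app z a b) (toChain_beadExtend θ.nat n)
  right_inv φ := @NecCat.Hom.ext_same V _ _ _ _ _ ((nec V).obj A) D φ.f _ φ.α _ _ _ _ fun T a b =>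
    congrArg (fun z : necFunctor A.X ⟶ D.C ⋙ VQuiv.pull V (S := A.S) φ.f => (z.app T).app a b)
      (natOfNec_toNec φ.f φ.α φ.unit φ.mul)

end BeadHom

end BeadHom
end

/-! ### Limits and initial objects of quivers -/

noncomputable section

namespace VQuiv

variable {V : Type v} [Category.{u} V] {S T : Type u}

variable (V) in
/-- Evaluation of quivers at a pair of vertices. -/
def ev (a b : S) : VQuiv V S ⥤ V where
  obj Q := Q.obj a b
  map f := f.app a b

/-- A cone of quivers is a limit cone if it is so at each pair of vertices. -/
def isLimitOfEv {J : Type*} [Category* J] {F : J ⥤ VQuiv V S} (c : Cone F)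
    (h : ∀ a b, IsLimit ((ev V a b).mapCone c)) : IsLimit c where
  lift s := ⟨fun a b => (h a b).lift ((ev V a b).mapCone s)⟩
  fac s j := VQuiv.hom_ext fun a b => (h a b).fac ((ev V a b).mapCone s) j
  uniq s m hm := VQuiv.hom_ext fun a b => (h a b).uniq ((ev V a b).mapCone s) (m.app a b) fun j =>
    congrArg (fun z => VQuiv.Hom.app z a b) (hm j)

section

variable {J : Type*} [Category* J] [HasLimitsOfShape J V] (F : J ⥤ VQuiv V S)

/-- The pointwise limit cone. -/
def limitCone : Cone F where
  pt := ⟨fun a b => limit (F ⋙ ev V a b)⟩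
  π :=
  { app j := ⟨fun a b => limit.π (F ⋙ ev V a b) j⟩
    naturality _ _ f := VQuiv.hom_ext fun a b =>
      (Category.id_comp _).trans (limit.w (F ⋙ ev V a b) f).symm }

/-- The pointwise limit cone, evaluated at a pair of vertices, is a limit cone. -/
def limitConeEv (a b : S) : IsLimit ((ev V a b).mapCone (limitCone F)) :=
  limit.isLimit (F ⋙ ev V a b)

instance : HasLimitsOfShape J (VQuiv V S) where
  has_limit F := ⟨⟨limitCone F, isLimitOfEv _ (limitConeEv F)⟩⟩

/-- Limits of quivers are computed at each pair of vertices, and `f^*` only reindexes these pairs.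
It makes `f^*` an admissible choice of the functor `G` in the universal properties below. -/
instance (f : S → T) : PreservesLimitsOfShape J (pull V f) where
  preservesLimit {F} := preservesLimit_of_preserves_limit_cone
    (isLimitOfEv _ (limitConeEv F)) (isLimitOfEv _ fun a b => limitConeEv F (f a) (f b))

end

instance [HasLimitsOfSize.{0, 0} V] : HasLimitsOfSize.{0, 0} (VQuiv V S) := ⟨inferInstance⟩

instance [HasLimitsOfSize.{0, 0} V] (f : S → T) : PreservesLimitsOfSize.{0, 0} (pull V f) :=
  ⟨inferInstance⟩

/-- Needed for the starting point of the iteration which produces the cofree sequence. -/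
instance [HasInitial V] : HasInitial (VQuiv V S) :=
  IsInitial.hasInitial (X := ⟨fun _ _ => ⊥_ V⟩) (IsInitial.ofUniqueHom
    (fun _ => ⟨fun _ _ => initial.to _⟩) fun _ _ => VQuiv.hom_ext fun _ _ => initial.hom_ext _ _)

end VQuiv

/-! ### One step of the cofree construction: compatible coassociative decompositions -/

/-- Decompositions `m = a + b` with `a, b > 0`. -/
structure Split (m : ℕ) : Type where
  (a b : ℕ)
  ha : 0 < a
  hb : 0 < b
  h : a + b = m

/-- Decompositions `m = a + b + c` with `a, b, c > 0`. -/
structure TripleSplit (m : ℕ) : Type where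
  (a b c : ℕ)
  ha : 0 < a
  hb : 0 < b
  hc : 0 < c
  h : a + b + c = m

/-- The shape of the limits defining the cofree templicial objects. -/
@[simps]
def splitShape (m : ℕ) : MulticospanShape where
  L := Option (Split m)
  R := Split m ⊕ TripleSplit m
  -- The equations are of two kinds. A split compares the element of `D` (index `none`) with the
  -- corresponding pair; a triple split compares the pair cut at `a + b` with the pair cut at `a`.
  fst := Sum.elim (fun _ => none) fun t => some ⟨t.a + t.b, t.c, by have := t.ha; omega, t.hc, t.h⟩
  snd := Sum.elim some fun t => some ⟨t.a, t.b + t.c, t.ha, by have := t.hb; omega, by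
    have := t.h; omega⟩

lemma comp_map_congr {W W' : Type*} [Category* W] [Category* W'] (G : W ⥤ W') {Z : W'} {x y z : W}
    {φ ψ : Z ⟶ G.obj x} {p : x ⟶ y} (h : φ ≫ G.map p = ψ ≫ G.map p) (f : y ⟶ z) :
    φ ≫ G.map (p ≫ f) = ψ ≫ G.map (p ≫ f) := by
  rw [G.map_comp, reassoc_of% h]

section Cofree

open Functor.LaxMonoidal

variable {W : Type*} [Category* W] [MonoidalCategory W] (D : Necᵒᵖ ⥤ W) [D.LaxMonoidal]

/-- A sequence of objects with coassociative comultiplications, and compatible morphisms to the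
values of `D` on simplices. -/
structure Pre where
  obj : ℕ → W
  -- Only proper splits are recorded and there is no counit: both pieces then have smaller degree,
  -- which makes recursion possible. Degree zero plays no role until `Pre.ext` replaces it by the
  -- unit.
  δ : ∀ {a b m : ℕ}, 0 < a → 0 < b → a + b = m → (obj m ⟶ obj a ⊗ obj b)
  θ : ∀ n, obj n ⟶ D.obj (op (Nec.bead n))
  coassoc : ∀ {a b c m : ℕ} (ha : 0 < a) (hb : 0 < b) (hc : 0 < c) (h : a + b + c = m),
    δ (Nat.add_pos_left ha b) hc h ≫ δ ha hb rfl ▷ obj c ≫ (α_ _ _ _).hom =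
      δ ha (Nat.add_pos_left hb c) (by omega) ≫ obj a ◁ δ hb hc rfl
  mul : ∀ {a b m : ℕ} (ha : 0 < a) (hb : 0 < b) (h : a + b = m),
    θ m ≫ D.map (Nec.join h).op = δ ha hb h ≫ (θ a ⊗ₘ θ b) ≫ necμ D (Nec.bead a) (Nec.bead b)

namespace Pre

variable {D} (X : Pre D)

/-- The diagram whose limit consists of the elements of `D_{Δᵐ}` with compatible coassociative
decompositions. -/
@[simps]
def index (m : ℕ) : MulticospanIndex (splitShape m) W where
  left p := Option.elim p (D.obj (op (Nec.bead m))) fun p => X.obj p.a ⊗ X.obj p.b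
  right := Sum.elim (fun p => D.obj (op (Nec.bead p.a ⊗ Nec.bead p.b)))
    fun t => X.obj t.a ⊗ (X.obj t.b ⊗ X.obj t.c)
  fst := fun
    | .inl p => D.map (Nec.join p.h).op
    | .inr t => X.δ t.ha t.hb rfl ▷ X.obj t.c ≫ (α_ _ _ _).hom
  snd := fun
    | .inl p => (X.θ p.a ⊗ₘ X.θ p.b) ≫ necμ D (Nec.bead p.a) (Nec.bead p.b)
    | .inr t => X.obj t.a ◁ X.δ t.hb t.hc rfl

variable [HasLimitsOfSize.{0, 0} W]

/-- The object of elements of `D_{Δᵐ}` with compatible coassociative decompositions. -/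
def nextObj (m : ℕ) : W := multiequalizer (X.index m)

/-- The underlying element of `D_{Δᵐ}`. -/
def nextθ (m : ℕ) : X.nextObj m ⟶ D.obj (op (Nec.bead m)) := Multiequalizer.ι (X.index m) none

/-- The decompositions. -/
def nextπ {a b m : ℕ} (ha : 0 < a) (hb : 0 < b) (h : a + b = m) :
    X.nextObj m ⟶ X.obj a ⊗ X.obj b := Multiequalizer.ι (X.index m) (some ⟨a, b, ha, hb, h⟩)

lemma nextπ_mul {a b m : ℕ} (ha : 0 < a) (hb : 0 < b) (h : a + b = m) :
    X.nextθ m ≫ D.map (Nec.join h).op =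
      X.nextπ ha hb h ≫ (X.θ a ⊗ₘ X.θ b) ≫ necμ D (Nec.bead a) (Nec.bead b) :=
  Multiequalizer.condition (X.index m) (.inl ⟨a, b, ha, hb, h⟩)

lemma nextπ_coassoc {a b c m : ℕ} (ha : 0 < a) (hb : 0 < b) (hc : 0 < c) (h : a + b + c = m) :
    X.nextπ (Nat.add_pos_left ha b) hc h ≫ X.δ ha hb rfl ▷ X.obj c ≫ (α_ _ _ _).hom =
      X.nextπ ha (Nat.add_pos_left hb c) (by omega) ≫ X.obj a ◁ X.δ hb hc rfl :=
  Multiequalizer.condition (X.index m) (.inr ⟨a, b, c, ha, hb, hc, h⟩)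

section

variable {W' : Type*} [Category* W'] (G : W ⥤ W') [PreservesLimitsOfSize.{0, 0} G] {m : ℕ} {Z : W'}

/-- The projections to the targets of the equations factor through the others, so `nextθ` and the
`nextπ` are jointly monic, also after a functor which preserves the limit. -/
lemma next_hom_ext {φ ψ : Z ⟶ G.obj (X.nextObj m)}
    (h : φ ≫ G.map (X.nextθ m) = ψ ≫ G.map (X.nextθ m))
    (h' : ∀ {a b : ℕ} (ha : 0 < a) (hb : 0 < b) (h : a + b = m),
      φ ≫ G.map (X.nextπ ha hb h) = ψ ≫ G.map (X.nextπ ha hb h)) : φ = ψ := by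
  have h1 : ∀ p, φ ≫ G.map (Multiequalizer.ι (X.index m) p) =
      ψ ≫ G.map (Multiequalizer.ι (X.index m) p) := fun p => by
    cases p with
    | none => exact h
    | some p => exact h' p.ha p.hb p.h
  refine (isLimitOfPreserves G (limit.isLimit (X.index m).multicospan)).hom_ext fun j => ?_
  cases j with
  | left p => exact h1 p
  | right r =>
    have h2 : limit.π (X.index m).multicospan (.right r) =
        Multiequalizer.ι (X.index m) _ ≫ (X.index m).fst r :=
      Multifork.app_right_eq_ι_comp_fst (Multiequalizer.multifork (X.index m)) r
    refine (congrArg (φ ≫ G.map ·) h2).trans (Eq.trans ?_ (congrArg (ψ ≫ G.map ·) h2).symm)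
    exact comp_map_congr G (h1 _) _

/-- The existence half of the universal property; `hm` and `hc` are the two kinds of equations of
the diagram, read after `G`. -/
lemma exists_next_lift (t : Z ⟶ G.obj (D.obj (op (Nec.bead m))))
    (s : ∀ {a b : ℕ}, 0 < a → 0 < b → a + b = m → (Z ⟶ G.obj (X.obj a ⊗ X.obj b)))
    (hm : ∀ {a b : ℕ} (ha : 0 < a) (hb : 0 < b) (h : a + b = m),
      t ≫ G.map (D.map (Nec.join h).op) =
        s ha hb h ≫ G.map ((X.θ a ⊗ₘ X.θ b) ≫ necμ D (Nec.bead a) (Nec.bead b)))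
    (hc : ∀ {a b c : ℕ} (ha : 0 < a) (hb : 0 < b) (hc : 0 < c) (h : a + b + c = m),
      s (Nat.add_pos_left ha b) hc h ≫ G.map (X.δ ha hb rfl ▷ X.obj c ≫ (α_ _ _ _).hom) =
        s ha (Nat.add_pos_left hb c) (by omega) ≫ G.map (X.obj a ◁ X.δ hb hc rfl)) :
    ∃ φ : Z ⟶ G.obj (X.nextObj m), φ ≫ G.map (X.nextθ m) = t ∧
      ∀ {a b : ℕ} (ha : 0 < a) (hb : 0 < b) (h : a + b = m),
        φ ≫ G.map (X.nextπ ha hb h) = s ha hb h := by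
  let k : ∀ p, Z ⟶ G.obj ((X.index m).left p) := fun
    | none => t
    | some p => s p.ha p.hb p.h
  have hk : ∀ r, k ((splitShape m).fst r) ≫ G.map ((X.index m).fst r) =
      k ((splitShape m).snd r) ≫ G.map ((X.index m).snd r) := fun
    | .inl p => hm p.ha p.hb p.h
    | .inr t => hc t.ha t.hb t.hc t.h
  let c : Cone ((X.index m).multicospan ⋙ G) :=
  { pt := Z
    π :=
    { app := fun
        | .left p => k p
        | .right r => k ((splitShape m).fst r) ≫ G.map ((X.index m).fst r)
      naturality := by
        rintro _ _ (_ | r | r)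
        · exact (Category.id_comp _).trans
            ((congrArg (_ ≫ ·) (((X.index m).multicospan ⋙ G).map_id _)).trans
              (Category.comp_id _)).symm
        · exact Category.id_comp _
        · exact (Category.id_comp _).trans (hk r) } }
  have hl := isLimitOfPreserves G (limit.isLimit (X.index m).multicospan)
  exact ⟨hl.lift c, hl.fac c (.left none), fun ha hb h => hl.fac c (.left (some ⟨_, _, ha, hb, h⟩))⟩

end

end Pre

end Cofree
end

noncomputable section

/-! ### Iteration of the step, its stabilization, and the cofree sequence -/

section Cofree

open Functor.LaxMonoidal

variable {W : Type*} [Category* W] [MonoidalCategory W] {D : Necᵒᵖ ⥤ W} [D.LaxMonoidal]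

namespace Pre

/-- Morphisms below level `m`. -/
structure TruncHom (Y X : Pre D) (m : ℕ) where
  app : ∀ k, k < m → (Y.obj k ⟶ X.obj k)
  comul : ∀ {a b k : ℕ} (ha : 0 < a) (hb : 0 < b) (h : a + b = k) (hk : k < m),
    app k hk ≫ X.δ ha hb h = Y.δ ha hb h ≫ (app a (by omega) ⊗ₘ app b (by omega))
  aug : ∀ {k : ℕ} (hk : k < m), app k hk ≫ X.θ k = Y.θ k

/-- Together with its mirror image, moves a coassociativity equation along morphisms which commute
with the comultiplications of the pieces: a twofold cut may be performed before or after applying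
them. -/
lemma coassoc_transfer_left {y₁₂ y yc ya yb x₁₂ xa xb xc : W} (s : y ⟶ y₁₂ ⊗ yc)
    {d : y₁₂ ⟶ ya ⊗ yb} {f : x₁₂ ⟶ xa ⊗ xb}
    {e₁₂ : y₁₂ ⟶ x₁₂} {ea : ya ⟶ xa} {eb : yb ⟶ xb}
    (ec : yc ⟶ xc) (h₁ : e₁₂ ≫ f = d ≫ (ea ⊗ₘ eb)) :
    (s ≫ d ▷ yc ≫ (α_ _ _ _).hom) ≫ (ea ⊗ₘ eb ⊗ₘ ec) =
        (s ≫ (e₁₂ ⊗ₘ ec)) ≫ f ▷ xc ≫ (α_ _ _ _).hom := by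
  have : (e₁₂ ⊗ₘ ec) ≫ f ▷ xc = d ▷ yc ≫ ((ea ⊗ₘ eb) ⊗ₘ ec) := by
    simp only [← tensorHom_id, tensorHom_comp_tensorHom, h₁, Category.comp_id, Category.id_comp]
  rw [Category.assoc, Category.assoc, Category.assoc, reassoc_of% this, associator_naturality]

lemma coassoc_transfer_right {y₂₃ y yc ya yb x₂₃ xa xb xc : W}
    (s' : y ⟶ ya ⊗ y₂₃) {d' : y₂₃ ⟶ yb ⊗ yc}
    {f' : x₂₃ ⟶ xb ⊗ xc} {e₂₃ : y₂₃ ⟶ x₂₃} (ea : ya ⟶ xa) {eb : yb ⟶ xb}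
    {ec : yc ⟶ xc} (h₂ : e₂₃ ≫ f' = d' ≫ (eb ⊗ₘ ec)) :
    (s' ≫ ya ◁ d') ≫ (ea ⊗ₘ eb ⊗ₘ ec) = (s' ≫ (ea ⊗ₘ e₂₃)) ≫ xa ◁ f' := by
  have : (ea ⊗ₘ e₂₃) ≫ xa ◁ f' = ya ◁ d' ≫ (ea ⊗ₘ eb ⊗ₘ ec) := by
    simp only [← id_tensorHom, tensorHom_comp_tensorHom, h₂, Category.comp_id, Category.id_comp]
  rw [Category.assoc, Category.assoc, this]

variable [HasLimitsOfSize.{0, 0} W]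

/-- The limit in degree `m` sees the sequence `X` only in degrees below `m`, because the pieces of a
proper split are smaller. A morphism defined below `m` therefore carries compatible data for `Y` to
compatible data for `X`. -/
lemma TruncHom.exists_lift {Y X : Pre D} {m : ℕ} (e : TruncHom Y X m) {W' : Type*} [Category* W']
    (G : W ⥤ W') [PreservesLimitsOfSize.{0, 0} G] {Z : W'}
    (t : Z ⟶ G.obj (D.obj (op (Nec.bead m))))
    (s : ∀ {a b : ℕ}, 0 < a → 0 < b → a + b = m → (Z ⟶ G.obj (Y.obj a ⊗ Y.obj b)))
    (hm : ∀ {a b : ℕ} (ha : 0 < a) (hb : 0 < b) (h : a + b = m),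
      t ≫ G.map (D.map (Nec.join h).op) =
        s ha hb h ≫ G.map ((Y.θ a ⊗ₘ Y.θ b) ≫ necμ D (Nec.bead a) (Nec.bead b)))
    (hc : ∀ {a b c : ℕ} (ha : 0 < a) (hb : 0 < b) (hc : 0 < c) (h : a + b + c = m),
      s (Nat.add_pos_left ha b) hc h ≫ G.map (Y.δ ha hb rfl ▷ Y.obj c ≫ (α_ _ _ _).hom) =
        s ha (Nat.add_pos_left hb c) (by omega) ≫ G.map (Y.obj a ◁ Y.δ hb hc rfl)) :
    ∃ φ : Z ⟶ G.obj (X.nextObj m), φ ≫ G.map (X.nextθ m) = t ∧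
      ∀ {a b : ℕ} (ha : 0 < a) (hb : 0 < b) (h : a + b = m),
        φ ≫ G.map (X.nextπ ha hb h) =
          s ha hb h ≫ G.map (e.app a (by omega) ⊗ₘ e.app b (by omega)) := by
  refine X.exists_next_lift G t (fun ha hb h => s ha hb h ≫
    G.map (e.app _ (by omega) ⊗ₘ e.app _ (by omega))) (fun ha hb h => ?_)
    fun {a b c} ha hb hc' h => ?_
  · rw [hm ha hb h, Category.assoc, ← G.map_comp, tensorHom_comp_tensorHom_assoc, e.aug, e.aug]
  · have h1 := coassoc_transfer_left (𝟙 _) (e.app c (by omega)) (e.comul ha hb rfl (by omega))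
    have h2 := coassoc_transfer_right (𝟙 _) (e.app a (by omega)) (e.comul hb hc' rfl (by omega))
    rw [Category.id_comp, Category.id_comp] at h1 h2
    rw [Category.assoc, Category.assoc, ← G.map_comp, ← G.map_comp, ← h1, ← h2, G.map_comp,
      ← Category.assoc, hc ha hb hc' h, G.map_comp, Category.assoc]

variable (X : Pre D)

/-- The canonical morphism to the object of compatible decompositions. -/
def toNext (m : ℕ) : X.obj m ⟶ X.nextObj m :=
  Multiequalizer.lift (X.index m) _
    (fun
      | none => X.θ m
      | some p => X.δ p.ha p.hb p.h)
    fun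
      | .inl p => X.mul p.ha p.hb p.h
      | .inr t => X.coassoc t.ha t.hb t.hc t.h

lemma toNext_θ (m : ℕ) : X.toNext m ≫ X.nextθ m = X.θ m :=
  Multiequalizer.lift_ι (X.index m) (X.obj m) _ _ (none : Option (Split m))

lemma toNext_π {a b m : ℕ} (ha : 0 < a) (hb : 0 < b) (h : a + b = m) :
    X.toNext m ≫ X.nextπ ha hb h = X.δ ha hb h :=
  Multiequalizer.lift_ι (X.index m) (X.obj m) _ _ (some (⟨a, b, ha, hb, h⟩ : Split m))

lemma toNext_π_assoc : type_of% (reassoc_of% @toNext_π) := @(reassoc_of% @toNext_π)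

lemma toNext_δ {a b m : ℕ} (ha : 0 < a) (hb : 0 < b) (h : a + b = m) :
    X.toNext m ≫ X.nextπ ha hb h ≫ (X.toNext a ⊗ₘ X.toNext b) =
      X.δ ha hb h ≫ (X.toNext a ⊗ₘ X.toNext b) := by
  rw [toNext_π_assoc]

/-- The sequence of objects of compatible decompositions. -/
@[simps]
def next : Pre D where
  obj := X.nextObj
  -- The limit decomposes into pairs from the old sequence; applying `toNext` to both factors turns
  -- them into pairs from the new one.
  δ ha hb h := X.nextπ ha hb h ≫ (X.toNext _ ⊗ₘ X.toNext _)
  θ := X.nextθ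
  coassoc {a b c m} ha hb hc h := by
    rw [← coassoc_transfer_left _ _ (X.toNext_δ ha hb rfl), X.nextπ_coassoc ha hb hc h,
      ← coassoc_transfer_right _ _ (X.toNext_δ hb hc rfl)]
  mul ha hb h := by
    rw [X.nextπ_mul ha hb h, Category.assoc, tensorHom_comp_tensorHom_assoc, toNext_θ, toNext_θ]

lemma iso_tensor_aux {x y z y' z' : W} (s : x ⟶ y ⊗ z) (f : y ⟶ y') (g : z ⟶ z') [IsIso f]
    [IsIso g] : (s ≫ (f ⊗ₘ g)) ≫ (inv f ⊗ₘ inv g) = s := by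
  simp

lemma iso_tensor_aux' {x y z y' z' : W} (s : x ⟶ y' ⊗ z') (f : y ⟶ y') (g : z ⟶ z') [IsIso f]
    [IsIso g] : (s ≫ (inv f ⊗ₘ inv g)) ≫ (f ⊗ₘ g) = s := by
  simp

/-- The reason for stabilization. If `X` and its successor agree below `m`, then the limits in
degree `m` built from them agree as well, as these depend on lower degrees only. Concretely the
inverses of `toNext` form a truncated morphism from `X.next` to `X`, and the lift `φ` it induces is
the inverse sought. -/
lemma isIso_toNext_next {m : ℕ} (hX : ∀ k < m, IsIso (X.toNext k)) : IsIso (X.next.toNext m) := by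
  let e : TruncHom X.next X m :=
  { app k hk := @inv _ _ _ _ (X.toNext k) (hX k hk)
    comul {a b k} ha hb h hk := by
      have := hX k hk
      have := hX a (by omega)
      have := hX b (by omega)
      refine (IsIso.inv_comp_eq (X.toNext k)).2 ?_
      refine Eq.trans ?_ (Category.assoc _ _ _)
      refine Eq.trans ?_ (congrArg (· ≫ _) (X.toNext_δ ha hb h).symm)
      exact (iso_tensor_aux (X.δ ha hb h) (X.toNext a) (X.toNext b)).symm
    aug {k} hk := (@IsIso.inv_comp_eq _ _ _ _ _ (X.toNext k) (hX k hk) _ _).2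
      (X.toNext_θ k).symm }
  obtain ⟨φ, h1, h2⟩ := e.exists_lift (𝟭 W) (X.next.nextθ m) (fun ha hb h => X.next.nextπ ha hb h)
    (fun ha hb h => X.next.nextπ_mul ha hb h) fun ha hb hc h => X.next.nextπ_coassoc ha hb hc h
  simp only [Functor.id_map] at h1 h2
  refine ⟨φ, X.next_hom_ext (𝟭 W) ?_ fun {a b} ha hb h => ?_,
    X.next.next_hom_ext (𝟭 W) ?_ fun {a b} ha hb h => ?_⟩
  · refine (Category.assoc _ _ _).trans ((congrArg (_ ≫ ·) h1).trans ?_)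
    exact (X.next.toNext_θ m).trans (Category.id_comp _).symm
  · have := hX a (by omega)
    have := hX b (by omega)
    refine (Category.assoc _ _ _).trans ((congrArg (_ ≫ ·) (h2 ha hb h)).trans ?_)
    refine (X.next.toNext_π_assoc ha hb h _).trans ?_
    exact (iso_tensor_aux _ _ _).trans (Category.id_comp _).symm
  · refine (Category.assoc _ _ _).trans ((congrArg (_ ≫ ·) (X.next.toNext_θ m)).trans ?_)
    exact h1.trans (Category.id_comp _).symm
  · have := hX a (by omega)
    have := hX b (by omega)
    refine (Category.assoc _ _ _).trans ((congrArg (_ ≫ ·) (X.next.toNext_π ha hb h)).trans ?_)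
    refine (Category.assoc _ _ _).symm.trans ((congrArg (· ≫ _) (h2 ha hb h)).trans ?_)
    exact (iso_tensor_aux' _ (X.toNext a) (X.toNext b)).trans (Category.id_comp _).symm

variable [HasInitial W]

variable (D) in
/-- The initial sequence. -/
def initial : Pre D where
  obj _ := ⊥_ W
  δ _ _ _ := Limits.initial.to _
  θ _ := Limits.initial.to _
  coassoc _ _ _ _ := Limits.initial.hom_ext _ _
  mul _ _ _ := Limits.initial.hom_ext _ _

variable (D) in
/-- The sequences obtained from the initial one by iterating `Pre.next`. -/
def iter : ℕ → Pre D
  | 0 => initial D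
  | n + 1 => (iter n).next

variable (D) in
/-- The canonical morphisms between the iterates. -/
def toSucc (n k : ℕ) : (iter D n).obj k ⟶ (iter D (n + 1)).obj k := (iter D n).toNext k

lemma toSucc_θ (n k : ℕ) : toSucc D n k ≫ (iter D (n + 1)).θ k = (iter D n).θ k :=
  (iter D n).toNext_θ k

lemma toSucc_δ (n : ℕ) {a b m : ℕ} (ha : 0 < a) (hb : 0 < b) (h : a + b = m) :
    toSucc D n m ≫ (iter D (n + 1)).δ ha hb h =
      (iter D n).δ ha hb h ≫ (toSucc D n a ⊗ₘ toSucc D n b) := (iter D n).toNext_δ ha hb h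

/-- Each step settles one more degree. At stage zero nothing is claimed, so it does not matter that
the iteration starts from the initial sequence. -/
lemma isIso_toSucc (n m : ℕ) (h : m < n) : IsIso (toSucc D n m) := by
  induction n generalizing m with
  | zero => omega
  | succ n ih => exact isIso_toNext_next _ fun k hk => ih k (by omega)

/-- The transition morphisms. -/
def tr {n n' : ℕ} (h : n ≤ n') (k : ℕ) : (iter D n).obj k ⟶ (iter D n').obj k :=
  (Functor.ofSequence (X := fun n => (iter D n).obj k) fun n => toSucc D n k).map (homOfLE h)

lemma tr_refl (n k : ℕ) : tr (D := D) (le_refl n) k = 𝟙 _ :=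
  CategoryTheory.Functor.map_id _ _

lemma tr_trans {n n' n'' : ℕ} (h : n ≤ n') (h' : n' ≤ n'') (k : ℕ) :
    tr (D := D) h k ≫ tr h' k = tr (h.trans h') k :=
  (Functor.map_comp _ (homOfLE h) (homOfLE h')).symm

lemma tr_succ (n k : ℕ) : tr (D := D) (Nat.le_succ n) k = toSucc D n k :=
  Functor.ofSequence_map_homOfLE_succ _ n

lemma isIso_tr {n n' : ℕ} (h : n ≤ n') {k : ℕ} (hk : k < n) : IsIso (tr (D := D) h k) := by
  induction n', h using Nat.le_induction with
  | base => rw [tr_refl]; infer_instance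
  | succ n' h ih =>
    have := isIso_toSucc (D := D) n' k (by omega)
    rw [← tr_trans h (Nat.le_succ n'), tr_succ]
    infer_instance

lemma tr_θ {n n' : ℕ} (h : n ≤ n') (k : ℕ) : tr (D := D) h k ≫ (iter D n').θ k =
    (iter D n).θ k := by
  induction n', h using Nat.le_induction with
  | base => rw [tr_refl, Category.id_comp]
  | succ n' h ih =>
    rw [← tr_trans h (Nat.le_succ n'), tr_succ, Category.assoc]
    exact (congrArg (_ ≫ ·) (toSucc_θ n' k)).trans ih

lemma tr_δ {n n' : ℕ} (h : n ≤ n') {a b k : ℕ} (ha : 0 < a) (hb : 0 < b) (e : a + b = k) :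
    tr (D := D) h k ≫ (iter D n').δ ha hb e =
      (iter D n).δ ha hb e ≫ (tr h a ⊗ₘ tr h b) := by
  induction n', h using Nat.le_induction with
  | base => simp only [tr_refl, Category.id_comp, id_tensorHom_id, Category.comp_id]
  | succ n' h ih =>
    simp only [← tr_trans h (Nat.le_succ n'), tr_succ, Category.assoc,
      ← tensorHom_comp_tensorHom]
    exact (congrArg (_ ≫ ·) (toSucc_δ n' ha hb e)).trans ((reassoc_of% ih) _)

/-- The transition isomorphisms. -/
def trIso (k : ℕ) {n : ℕ} (h : k < n) : (iter D (k + 1)).obj k ≅ (iter D n).obj k :=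
  have := isIso_tr (D := D) (Nat.succ_le_of_lt h) (Nat.lt_succ_self k)
  asIso (tr (Nat.succ_le_of_lt h) k)

/-- The decompositions of the elements of the cofree sequence. -/
def cofreeδ {a b m : ℕ} (ha : 0 < a) (hb : 0 < b) (h : a + b = m) : (iter D (m + 1)).obj m ⟶
    (iter D (a + 1)).obj a ⊗ (iter D (b + 1)).obj b :=
  -- The projection produces both factors at stage `m`. Since `a, b < m`, these degrees are already
  -- stable there and can be moved back to stages `a + 1` and `b + 1`.
  (iter D m).nextπ ha hb h ≫ ((trIso a (by omega)).inv ⊗ₘ (trIso b (by omega)).inv)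

lemma cofreeδ_tr {a b m : ℕ} (ha : 0 < a) (hb : 0 < b) (h : a + b = m) :
    cofreeδ (D := D) ha hb h ≫ ((trIso a (by omega)).hom ⊗ₘ (trIso b (by omega)).hom) =
      (iter D m).nextπ ha hb h := by
  refine (Category.assoc _ _ _).trans ((congrArg (_ ≫ ·) ?_).trans (Category.comp_id _))
  rw [tensorHom_comp_tensorHom, Iso.inv_hom_id, Iso.inv_hom_id, id_tensorHom_id]

/-- Every later stage induces the same comultiplications on the stable values, so identities for the
cofree sequence may be checked at one common stage. -/
lemma tr_cofreeδ {a b m : ℕ} (ha : 0 < a) (hb : 0 < b) (h : a + b = m) {n : ℕ} (hn : m < n) :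
    (trIso m hn).hom ≫ (iter D n).δ ha hb h =
      cofreeδ ha hb h ≫ ((trIso a (by omega : a < n)).hom ⊗ₘ (trIso b (by omega : b < n)).hom) := by
  refine (tr_δ (D := D) (Nat.succ_le_of_lt hn) ha hb h).trans ?_
  have h1 : (iter D (m + 1)).δ ha hb h = cofreeδ ha hb h ≫
      (((trIso a (by omega : a < m)).hom ⊗ₘ (trIso b (by omega : b < m)).hom) ≫
        (toSucc D m a ⊗ₘ toSucc D m b)) :=
    (congrArg (· ≫ _) (cofreeδ_tr ha hb h).symm).trans (Category.assoc _ _ _)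
  rw [h1, Category.assoc, tensorHom_comp_tensorHom, ← tr_succ, ← tr_succ, tensorHom_comp_tensorHom]
  refine congrArg (_ ≫ ·) (congrArg₂ _ ?_ ?_)
  · exact (congrArg (· ≫ _) (tr_trans (by omega : a + 1 ≤ m) _ a)).trans (tr_trans _ _ _)
  · exact (congrArg (· ≫ _) (tr_trans (by omega : b + 1 ≤ m) _ b)).trans (tr_trans _ _ _)

variable (D) in
/-- The cofree sequence. -/
@[simps]
def cofree : Pre D where
  -- Stage `m + 1` is where `isIso_toSucc` begins to apply to degree `m`. By definition it is the
  -- limit in degree `m` built from stage `m`.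
  obj m := (iter D (m + 1)).obj m
  δ := cofreeδ
  θ m := (iter D (m + 1)).θ m
  coassoc {a b c m} ha hb hc h := by
    have h1 := coassoc_transfer_left (cofreeδ (D := D) (Nat.add_pos_left ha b) hc h)
      (trIso (n := m + 1) c (by omega)).hom (tr_cofreeδ ha hb rfl (by omega : a + b < m + 1))
    have h2 := coassoc_transfer_right (cofreeδ (D := D) (m := m) ha
      (Nat.add_pos_left hb c) (by omega))
      (trIso (n := m + 1) a (by omega)).hom (tr_cofreeδ hb hc rfl (by omega : b + c < m + 1))
    -- After moving all three factors to stage `m + 1` by isomorphisms, the equation becomes the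
    -- coassociativity of that stage.
    rw [← cancel_mono ((trIso a (by omega : a < m + 1)).hom ⊗ₘ
      (trIso b (by omega : b < m + 1)).hom ⊗ₘ (trIso c (by omega : c < m + 1)).hom), h1, h2,
      ← tr_cofreeδ _ _ _ (Nat.lt_succ_self m), ← tr_cofreeδ _ _ _ (Nat.lt_succ_self m),
      Category.assoc, Category.assoc, (iter D (m + 1)).coassoc ha hb hc h]
  mul {a b m} ha hb h := by
    refine ((iter D m).nextπ_mul ha hb h).trans ?_
    refine (congrArg (· ≫ _) (cofreeδ_tr ha hb h).symm).trans ((Category.assoc _ _ _).trans ?_)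
    refine congrArg (_ ≫ ·) ((tensorHom_comp_tensorHom_assoc _ _ _ _ _).trans ?_)
    exact congrArg (· ≫ _) (congrArg₂ _ (tr_θ (by omega : a + 1 ≤ m) _)
      (tr_θ (by omega : b + 1 ≤ m) _))

variable (D) in
/-- The comparison of the cofree sequence with its approximations. -/
def cofreeTrunc (m : ℕ) : TruncHom (cofree D) (iter D m) m where
  app k hk := (trIso k hk).hom
  comul ha hb h hk := tr_cofreeδ ha hb h hk
  aug hk := tr_θ (Nat.succ_le_of_lt hk) _

section

variable {W' : Type*} [Category* W'] (G : W ⥤ W') [PreservesLimitsOfSize.{0, 0} G] {m : ℕ} {Z : W'}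

/-- Degree `m` is the limit built from stage `m`, whose lower degrees are isomorphic to those of the
cofree sequence. The cofree sequence thus satisfies the universal property of `next` relative to
itself; this is the uniqueness half. -/
lemma cofree_hom_ext {φ ψ : Z ⟶ G.obj ((cofree D).obj m)}
    (h : φ ≫ G.map ((cofree D).θ m) = ψ ≫ G.map ((cofree D).θ m))
    (h' : ∀ {a b : ℕ} (ha : 0 < a) (hb : 0 < b) (h : a + b = m),
      φ ≫ G.map ((cofree D).δ ha hb h) = ψ ≫ G.map ((cofree D).δ ha hb h)) : φ = ψ := by
  refine (iter D m).next_hom_ext G h fun ha hb e => ?_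
  rw [← cofreeδ_tr]
  exact comp_map_congr G (h' ha hb e) _

/-- The existence half: `cofreeTrunc` carries the given data to stage `m`, where `nextObj` provides
the lift, and the transition isomorphisms bring its decompositions back. -/
lemma exists_cofree_lift (t : Z ⟶ G.obj (D.obj (op (Nec.bead m))))
    (s : ∀ {a b : ℕ}, 0 < a → 0 < b → a + b = m →
      (Z ⟶ G.obj ((cofree D).obj a ⊗ (cofree D).obj b)))
    (hm : ∀ {a b : ℕ} (ha : 0 < a) (hb : 0 < b) (h : a + b = m),
      t ≫ G.map (D.map (Nec.join h).op) = s ha hb h ≫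
        G.map (((cofree D).θ a ⊗ₘ (cofree D).θ b) ≫ necμ D (Nec.bead a) (Nec.bead b)))
    (hc : ∀ {a b c : ℕ} (ha : 0 < a) (hb : 0 < b) (hc : 0 < c) (h : a + b + c = m),
      s (Nat.add_pos_left ha b) hc h ≫
          G.map ((cofree D).δ ha hb rfl ▷ (cofree D).obj c ≫ (α_ _ _ _).hom) =
        s ha (Nat.add_pos_left hb c) (by omega) ≫
          G.map ((cofree D).obj a ◁ (cofree D).δ hb hc rfl)) :
    ∃ φ : Z ⟶ G.obj ((cofree D).obj m), φ ≫ G.map ((cofree D).θ m) = t ∧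
      ∀ {a b : ℕ} (ha : 0 < a) (hb : 0 < b) (h : a + b = m),
        φ ≫ G.map ((cofree D).δ ha hb h) = s ha hb h := by
  obtain ⟨φ, h1, h2⟩ := (cofreeTrunc D m).exists_lift G t s hm hc
  refine ⟨φ, h1, fun {a b} ha hb h => ?_⟩
  have h3 : (cofree D).δ ha hb h = (iter D m).nextπ ha hb h ≫
    ((trIso a (by omega)).inv ⊗ₘ (trIso b (by omega)).inv) := rfl
  rw [h3]
  refine (congrArg (φ ≫ ·) (G.map_comp _ _)).trans ((Category.assoc _ _ _).symm.trans ?_)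
  refine (congrArg (· ≫ _) (h2 ha hb h)).trans ((Category.assoc _ _ _).trans ?_)
  refine ((congrArg (_ ≫ ·) ?_).trans (Category.comp_id _))
  refine (G.map_comp _ _).symm.trans (Eq.trans ?_ (G.map_id _))
  refine congrArg G.map ((tensorHom_comp_tensorHom _ _ _ _).trans ?_)
  exact (congrArg₂ _ (Iso.hom_inv_id _) (Iso.hom_inv_id _)).trans (id_tensorHom_id _ _)

end

end Pre

end Cofree
end

/-! ### Splitting endpoint-preserving maps at a vertex -/

noncomputable section

/-- Cutting the source at `a` forces a cut of the target at `g a`; the second part is translated to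
start at zero. -/
lemma FinInt.exists_split {a b m n : ℕ} (h : a + b = m) (g : FinInt.mk m ⟶ FinInt.mk n) :
    ∃ (n₁ n₂ : ℕ) (g₁ : FinInt.mk a ⟶ ⟨n₁⟩) (g₂ : FinInt.mk b ⟶ ⟨n₂⟩), n₁ + n₂ = n ∧
      ∀ i, g.toFun i = glue a n₁ g₁.toFun g₂.toFun i := by
  have hle : ∀ i, g.toFun a ≤ g.toFun (a + i) := fun i => g.prop.mono (Nat.le_add_right _ _)
  have hn : g.toFun a ≤ n := g.prop.map_le (by dsimp; omega)
  refine ⟨g.toFun a, n - g.toFun a, ⟨fun i => if i ≤ a then g.toFun i else g.toFun a + (i - a), ?_⟩,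
    ⟨fun i => g.toFun (a + i) - g.toFun a, ?_⟩, by omega, fun i => ?_⟩
  · exact {
      mono := fun i j hij => by
        have h1 : g.toFun i ≤ g.toFun j := g.prop.mono hij
        have h2 : i ≤ a → g.toFun i ≤ g.toFun a := fun h => g.prop.mono h
        dsimp only
        split_ifs <;> omega
      map_zero := by simp [g.prop.map_zero]
      map_add := fun i => by
        dsimp only
        split_ifs with h
        · obtain rfl : i = 0 := by omega
          rfl
        · omega }
  · exact {
      mono := fun i j hij => Nat.sub_le_sub_right (g.prop.mono (by omega)) _
      map_zero := by simp
      map_add := fun i => by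
        dsimp only
        rw [← Nat.add_assoc, h]
        refine (congrArg (· - _) (g.prop.map_add i)).trans ?_
        dsimp only
        omega }
  · by_cases hi : i ≤ a
    · rw [glue, if_pos hi]
      exact (if_pos hi).symm
    · have h1 := hle (i - a)
      rw [glue, if_neg hi]
      change _ = g.toFun a + (g.toFun (a + (i - a)) - g.toFun a)
      rw [Nat.add_sub_cancel' h1, Nat.add_sub_cancel' (by omega)]

/-- Evaluation at `a` recovers the place of the cut in the target, and then both parts. The
equalities are between dependent pairs because the targets of the parts may vary. -/
lemma FinInt.split_unique {a b n₁ n₂ n₁' n₂' : ℕ} {g₁ : FinInt.mk a ⟶ ⟨n₁⟩}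
    {g₂ : FinInt.mk b ⟶ ⟨n₂⟩} {g₁' : FinInt.mk a ⟶ ⟨n₁'⟩} {g₂' : FinInt.mk b ⟶ ⟨n₂'⟩}
    (h : ∀ i, glue a n₁ g₁.toFun g₂.toFun i = glue a n₁' g₁'.toFun g₂'.toFun i)
    (hn : n₁ + n₂ = n₁' + n₂') :
    (⟨n₁, g₁⟩ : Σ n, FinInt.mk a ⟶ ⟨n⟩) = ⟨n₁', g₁'⟩ ∧
      (⟨n₂, g₂⟩ : Σ n, FinInt.mk b ⟶ ⟨n⟩) = ⟨n₂', g₂'⟩ := by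
  have h1 : ∀ i ≤ a, g₁.toFun i = g₁'.toFun i := fun i hi => by simpa [glue, hi] using h i
  obtain rfl : n₁ = n₁' := by
    have h2 := g₁.prop.map_last
    have h3 := g₁'.prop.map_last
    exact h2.symm.trans ((h1 _ le_rfl).trans h3)
  obtain rfl : n₂ = n₂' := by omega
  constructor
  · congr 1
    ext i
    by_cases hi : i ≤ a
    · exact h1 i hi
    · rw [g₁.prop.map_of_le (le_of_not_ge hi), g₁'.prop.map_of_le (le_of_not_ge hi)]
  · congr 1
    ext i
    rcases Nat.eq_zero_or_pos i with rfl | hi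
    · rw [g₂.prop.map_zero, g₂'.prop.map_zero]
    · simpa [glue, show ¬ a + i ≤ a by omega] using h (a + i)

/-! ### Solving for morphisms to the cofree sequence by recursion on the degree -/

section Cofree

open Functor.LaxMonoidal

variable {W : Type*} [Category* W] [MonoidalCategory W] {W' : Type*} [Category* W']
  [MonoidalCategory W']

/-- Indexed families of objects with coassociative decompositions, and with compatible morphisms
to the values of `D` on simplices. -/
structure CoFam (D : Necᵒᵖ ⥤ W) [D.LaxMonoidal] (G : W ⥤ W') [G.LaxMonoidal] where
  J : ℕ → Type*
  Q : ∀ {n : ℕ}, J n → W'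
  -- `R h x y z` says that `x` splits into `y` and `z`. Splits exist and are unique, but as a
  -- relation they can be composed without transports between degrees.
  R : ∀ {a b m : ℕ}, a + b = m → J m → J a → J b → Prop
  c : ∀ {a b m : ℕ} {h : a + b = m} {x y z}, R h x y z → (Q x ⟶ Q y ⊗ Q z)
  exists_split : ∀ {a b m : ℕ} (h : a + b = m) (x : J m), ∃ y z, R h x y z
  unique : ∀ {a b m : ℕ} {h : a + b = m} {x y z y' z'}, R h x y z → R h x y' z' → y = y' ∧ z = z'
  assoc : ∀ {a b c ab bc m : ℕ} {h : ab + c = m} {h' : a + b = ab} (k : b + c = bc)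
    (k' : a + bc = m) {x w z y y'}, R h x w z → R h' w y y' → ∃ v, R k' x y v ∧ R k v y' z
  coassoc : ∀ {a b e ab be m : ℕ} {h : ab + e = m} {h' : a + b = ab} {k : b + e = be}
    {k' : a + be = m} {x w z y y' v} (r₁ : R h x w z) (r₂ : R h' w y y') (r₃ : R k' x y v)
    (r₄ : R k v y' z), c r₁ ≫ c r₂ ▷ Q z ≫ (α_ _ _ _).hom = c r₃ ≫ Q y ◁ c r₄
  d : ∀ {n : ℕ} (x : J n), Q x ⟶ G.obj (D.obj (op (Nec.bead n)))
  mul : ∀ {a b m : ℕ} {h : a + b = m} {x y z} (r : R h x y z),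
    d x ≫ G.map (D.map (Nec.join h).op) =
      c r ≫ (d y ⊗ₘ d z) ≫ μ G _ _ ≫ G.map (necμ D (Nec.bead a) (Nec.bead b))

/-- With its mirror image, reduces coassociativity of the decompositions proposed for a lift to
coassociativity of the given family: both sides become a twofold cut followed by the same map to the
threefold tensor product. -/
lemma fam_coassoc_left (G : W ⥤ W') [G.LaxMonoidal] {q q₁₂ q₁ q₂ q₃ : W'} {x₁₂ x₁ x₂ x₃ : W}
    (c₁ : q ⟶ q₁₂ ⊗ q₃) {c₂ : q₁₂ ⟶ q₁ ⊗ q₂} {f₁₂ : q₁₂ ⟶ G.obj x₁₂} {f₁ : q₁ ⟶ G.obj x₁}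
    {f₂ : q₂ ⟶ G.obj x₂} (f₃ : q₃ ⟶ G.obj x₃) {δ : x₁₂ ⟶ x₁ ⊗ x₂}
    (h : f₁₂ ≫ G.map δ = c₂ ≫ (f₁ ⊗ₘ f₂) ≫ μ G _ _) :
    (c₁ ≫ (f₁₂ ⊗ₘ f₃) ≫ μ G _ _) ≫ G.map (δ ▷ x₃ ≫ (α_ _ _ _).hom) =
      (c₁ ≫ c₂ ▷ q₃ ≫ (α_ _ _ _).hom) ≫ (f₁ ⊗ₘ f₂ ⊗ₘ f₃) ≫ G.obj x₁ ◁ μ G _ _ ≫ μ G _ _ := by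
  have h1 : (f₁₂ ⊗ₘ f₃) ≫ G.map δ ▷ G.obj x₃ =
      c₂ ▷ q₃ ≫ ((f₁ ⊗ₘ f₂) ⊗ₘ f₃) ≫ μ G _ _ ▷ G.obj x₃ := by
    simp only [← tensorHom_id, tensorHom_comp_tensorHom, h, Category.comp_id, Category.id_comp]
  rw [Category.assoc, Category.assoc, G.map_comp, ← μ_natural_left_assoc, reassoc_of% h1,
    associativity, associator_naturality_assoc, Category.assoc, Category.assoc]

lemma fam_coassoc_right (G : W ⥤ W') [G.LaxMonoidal] {q q₂₃ q₁ q₂ q₃ : W'} {x₂₃ x₁ x₂ x₃ : W}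
    (c₁ : q ⟶ q₁ ⊗ q₂₃) {c₂ : q₂₃ ⟶ q₂ ⊗ q₃} {f₂₃ : q₂₃ ⟶ G.obj x₂₃} (f₁ : q₁ ⟶ G.obj x₁)
    {f₂ : q₂ ⟶ G.obj x₂} {f₃ : q₃ ⟶ G.obj x₃} {δ : x₂₃ ⟶ x₂ ⊗ x₃}
    (h : f₂₃ ≫ G.map δ = c₂ ≫ (f₂ ⊗ₘ f₃) ≫ μ G _ _) :
    (c₁ ≫ (f₁ ⊗ₘ f₂₃) ≫ μ G _ _) ≫ G.map (x₁ ◁ δ) =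
      (c₁ ≫ q₁ ◁ c₂) ≫ (f₁ ⊗ₘ f₂ ⊗ₘ f₃) ≫ G.obj x₁ ◁ μ G _ _ ≫ μ G _ _ := by
  have h1 : (f₁ ⊗ₘ f₂₃) ≫ G.obj x₁ ◁ G.map δ =
      q₁ ◁ c₂ ≫ (f₁ ⊗ₘ f₂ ⊗ₘ f₃) ≫ G.obj x₁ ◁ μ G _ _ := by
    simp only [← id_tensorHom, tensorHom_comp_tensorHom, h, Category.comp_id, Category.id_comp]
  rw [Category.assoc, Category.assoc, ← μ_natural_right, reassoc_of% h1, Category.assoc]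

lemma fam_mul_aux (G : W ⥤ W') [G.LaxMonoidal] {q q₁ q₂ : W'} {x₁ x₂ d₁ d₂ d : W} {c : q ⟶ q₁ ⊗ q₂}
    {f₁ : q₁ ⟶ G.obj x₁} {f₂ : q₂ ⟶ G.obj x₂} {θ₁ : x₁ ⟶ d₁} {θ₂ : x₂ ⟶ d₂} (m : d₁ ⊗ d₂ ⟶ d)
    {g₁ : q₁ ⟶ G.obj d₁} {g₂ : q₂ ⟶ G.obj d₂} (h₁ : f₁ ≫ G.map θ₁ = g₁) (h₂ : f₂ ≫ G.map θ₂ = g₂) :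
    (c ≫ (f₁ ⊗ₘ f₂) ≫ μ G _ _) ≫ G.map ((θ₁ ⊗ₘ θ₂) ≫ m) =
      c ≫ (g₁ ⊗ₘ g₂) ≫ μ G _ _ ≫ G.map m := by
  rw [Category.assoc, Category.assoc, G.map_comp, ← μ_natural_assoc,
    tensorHom_comp_tensorHom_assoc, h₁, h₂]

namespace CoFam

open Pre

variable {D : Necᵒᵖ ⥤ W} [D.LaxMonoidal] [HasLimitsOfSize.{0, 0} W] [HasInitial W] {G : W ⥤ W'}
  [G.LaxMonoidal] [PreservesLimitsOfSize.{0, 0} G] (E : CoFam D G)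

/-- The morphisms to the cofree sequence which are compatible with the decompositions. -/
inductive Sol : ∀ {m : ℕ} (x : E.J m), (E.Q x ⟶ G.obj ((cofree D).obj m)) → Prop
  -- The morphisms in lower degrees are part of the evidence, so a solution carries all of the
  -- recursion below it. By `Sol.unique` their choice is immaterial.
  | mk {m : ℕ} {x : E.J m} {φ : E.Q x ⟶ G.obj ((cofree D).obj m)}
    (ψ₁ : ∀ {a b : ℕ} (_ : a + b = m) (y : E.J a), 0 < a → 0 < b →
      (E.Q y ⟶ G.obj ((cofree D).obj a)))
    (ψ₂ : ∀ {a b : ℕ} (_ : a + b = m) (z : E.J b), 0 < a → 0 < b →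
      (E.Q z ⟶ G.obj ((cofree D).obj b)))
    (h₁ : ∀ {a b : ℕ} (h : a + b = m) (y : E.J a) (ha : 0 < a) (hb : 0 < b), Sol y (ψ₁ h y ha hb))
    (h₂ : ∀ {a b : ℕ} (h : a + b = m) (z : E.J b) (ha : 0 < a) (hb : 0 < b), Sol z (ψ₂ h z ha hb))
    (aug : φ ≫ G.map ((cofree D).θ m) = E.d x)
    (comul : ∀ {a b : ℕ} (ha : 0 < a) (hb : 0 < b) (h : a + b = m) {y z} (r : E.R h x y z),
      φ ≫ G.map ((cofree D).δ ha hb h) = E.c r ≫ (ψ₁ h y ha hb ⊗ₘ ψ₂ h z ha hb) ≫ μ G _ _) :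
    Sol x φ

variable {E}

/-- A morphism to the cofree sequence is determined by its component in `D` and its proper
decompositions, and the latter are built from solutions in lower degrees, which agree by strong
induction. -/
lemma Sol.unique {m : ℕ} {x : E.J m} {φ φ' : E.Q x ⟶ G.obj ((cofree D).obj m)} (h : E.Sol x φ)
    (h' : E.Sol x φ') : φ = φ' := by
  induction m using Nat.strong_induction_on with
  | _ m ih =>
    cases h with | mk ψ₁ ψ₂ h₁ h₂ aug comul =>
    cases h' with | mk ψ₁' ψ₂' h₁' h₂' aug' comul' =>
    refine cofree_hom_ext G (aug.trans aug'.symm) fun {a b} ha hb h => ?_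
    obtain ⟨y, z, r⟩ := E.exists_split h x
    rw [comul ha hb h r, comul' ha hb h r, ih a (by omega) (h₁ h y ha hb) (h₁' h y ha hb),
      ih b (by omega) (h₂ h z ha hb) (h₂' h z ha hb)]

lemma Sol.aug {m : ℕ} {x : E.J m} {φ : E.Q x ⟶ G.obj ((cofree D).obj m)} (h : E.Sol x φ) :
    φ ≫ G.map ((cofree D).θ m) = E.d x := by
  obtain ⟨_, _, _, _, aug, _⟩ := h
  exact aug

/-- Uniqueness permits arbitrary solutions for the pieces instead of those stored in the evidence.
-/
lemma Sol.comul {m : ℕ} {x : E.J m} {φ : E.Q x ⟶ G.obj ((cofree D).obj m)} (h : E.Sol x φ)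
    {a b : ℕ} (ha : 0 < a) (hb : 0 < b) {e : a + b = m} {y z} (r : E.R e x y z) {ψ₁ ψ₂}
    (h₁ : E.Sol y ψ₁) (h₂ : E.Sol z ψ₂) :
    φ ≫ G.map ((cofree D).δ ha hb e) = E.c r ≫ (ψ₁ ⊗ₘ ψ₂) ≫ μ G _ _ := by
  obtain ⟨_, _, h₁', h₂', _, comul⟩ := h
  rw [comul ha hb e r, h₁.unique (h₁' e y ha hb), h₂.unique (h₂' e z ha hb)]

/-- Solutions in lower degrees are paired along the split of `x` and handed to `exists_cofree_lift`.
Its two conditions are the multiplicativity `E.mul` and the coassociativity `E.coassoc` of the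
family. -/
lemma exists_sol (m : ℕ) (x : E.J m) : ∃ φ, E.Sol x φ := by
  induction m using Nat.strong_induction_on with
  | _ m ih =>
    choose ψ hψ using ih
    have hs : ∀ {a b : ℕ} (h : a + b = m), ∃ y z, E.R h x y z := fun h => E.exists_split h x
    choose y z r using fun {a b : ℕ} => @hs a b
    obtain ⟨φ, h1, h2⟩ := exists_cofree_lift G (E.d x) (fun {a b} ha hb h => E.c (r h) ≫
      (ψ a (by omega) (y h) ⊗ₘ ψ b (by omega) (z h)) ≫ μ G _ _)
      (fun ha hb h => by
        rw [fam_mul_aux G _ (hψ _ _ _).aug (hψ _ _ _).aug]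
        exact E.mul (r h))
      fun {a b c} ha hb hc h => by
        -- The left piece is split once more and `E.assoc` yields the other bracketing of the
        -- threefold split; uniqueness identifies its first cut with the chosen split of `x` at `a`.
        obtain ⟨y₁, y₂, r'⟩ := E.exists_split (rfl : a + b = a + b) (y h)
        obtain ⟨v, r₁, r₂⟩ := E.assoc (rfl : b + c = b + c) (by omega) (r h) r'
        obtain ⟨rfl, rfl⟩ := E.unique r₁ (r (by omega))
        rw [fam_coassoc_left G _ _ ((hψ _ _ _).comul ha hb r' (hψ a (by omega) _)
          (hψ b (by omega) _)), fam_coassoc_right G _ _ ((hψ _ _ _).comul hb hc r₂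
          (hψ b (by omega) _) (hψ c (by omega) _)), E.coassoc (r h) r' r₁ r₂]
    refine ⟨φ, .mk (fun {a b} h y ha hb => ψ a (by omega) y)
      (fun {a b} h z ha hb => ψ b (by omega) z)
      (fun _ _ _ _ => hψ _ _ _) (fun _ _ _ _ => hψ _ _ _) h1 fun ha hb h _ _ r' => ?_⟩
    obtain ⟨rfl, rfl⟩ := E.unique r' (r h)
    exact h2 ha hb h

variable (E)

/-- The unique compatible family of morphisms to the cofree sequence. -/
def sol {m : ℕ} (x : E.J m) : E.Q x ⟶ G.obj ((cofree D).obj m) := (exists_sol m x).choose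

lemma sol_aug {m : ℕ} (x : E.J m) : E.sol x ≫ G.map ((cofree D).θ m) = E.d x :=
  (exists_sol m x).choose_spec.aug

variable {E} in
lemma sol_comul {a b m : ℕ} (ha : 0 < a) (hb : 0 < b) {h : a + b = m} {x y z} (r : E.R h x y z) :
    E.sol x ≫ G.map ((cofree D).δ ha hb h) = E.c r ≫ (E.sol y ⊗ₘ E.sol z) ≫ μ G _ _ :=
  (exists_sol m x).choose_spec.comul ha hb r (exists_sol a y).choose_spec
    (exists_sol b z).choose_spec

end CoFam

end Cofree
end

/-! ### Degree zero, and the action of `Δ_f` on the cofree sequence -/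

noncomputable section

section

open Functor.LaxMonoidal

variable {W : Type*} [Category* W] [MonoidalCategory W] {W' : Type*} [Category* W']
  [MonoidalCategory W'] {G : W ⥤ W'} [G.LaxMonoidal]

/-- At a split with an empty piece the comultiplication is a unitor followed by the inverse counit,
so compatibility with it is the unit law of `G` and puts no condition on `φ`. -/
lemma counit_left_aux {x y : W'} {w : W} (u : x ≅ 𝟙_ W') (φ : y ⟶ G.obj w) :
    φ ≫ G.map (λ_ w).inv =
      ((λ_ y).inv ≫ u.inv ▷ y) ≫ ((u.hom ≫ ε G) ⊗ₘ φ) ≫ μ G _ _ :=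
  zero_cut_aux u φ (by
    rw [Functor.LaxMonoidal.left_unitality, Category.assoc, Category.assoc, ← G.map_comp, Iso.hom_inv_id,
      G.map_id,
      Category.comp_id]) rfl

lemma counit_right_aux {x y : W'} {w : W} (u : x ≅ 𝟙_ W') (φ : y ⟶ G.obj w) :
    φ ≫ G.map (ρ_ w).inv =
      ((ρ_ y).inv ≫ y ◁ u.inv) ≫ (φ ⊗ₘ (u.hom ≫ ε G)) ≫ μ G _ _ := by
  have h1 : y ◁ u.inv ≫ (φ ⊗ₘ (u.hom ≫ ε G)) = φ ▷ _ ≫ _ ◁ ε G := by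
    rw [← MonoidalCategory.tensorHom_def, ← id_tensorHom, tensorHom_comp_tensorHom,
      Category.id_comp, Iso.inv_hom_id_assoc]
  have h2 : G.obj w ◁ ε G ≫ μ G w (𝟙_ W) = (ρ_ _).hom ≫ G.map (ρ_ w).inv := by
    rw [Functor.LaxMonoidal.right_unitality, Category.assoc, Category.assoc, ← G.map_comp, Iso.hom_inv_id,
      G.map_id,
      Category.comp_id]
  rw [Category.assoc, reassoc_of% h1, h2, rightUnitor_naturality_assoc, Iso.inv_hom_id_assoc]

end

section Cofree

open Functor.LaxMonoidal

variable {W : Type*} [Category* W] [MonoidalCategory W] {D : Necᵒᵖ ⥤ W} [D.LaxMonoidal]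

namespace Pre

variable (X : Pre D)

/-- The given sequence of objects, with the object in degree zero replaced by the unit. -/
abbrev ext : ℕ → W
  | 0 => 𝟙_ W
  | n + 1 => X.obj (n + 1)

/-- The morphisms to the values of `D` on simplices. -/
def extθ : ∀ n, X.ext n ⟶ D.obj (op (Nec.bead n))
  | 0 => necε D
  | n + 1 => X.θ (n + 1)

/-- The comultiplications, including the trivial ones. -/
def extδ : ∀ {a b m : ℕ}, a + b = m → (X.ext m ⟶ X.ext a ⊗ X.ext b)
  | 0, b, m, h => eqToHom (congrArg X.ext (by omega)) ≫ (λ_ (X.ext b)).inv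
  | a + 1, 0, m, h => eqToHom (congrArg X.ext (by omega)) ≫ (ρ_ (X.ext (a + 1))).inv
  | a + 1, b + 1, 0, h => by omega
  | a + 1, b + 1, m + 1, h => X.δ (Nat.succ_pos a) (Nat.succ_pos b) h

lemma extδ_zero_left {b : ℕ} (h : 0 + b = b) : X.extδ h = (λ_ (X.ext b)).inv := by
  rw [extδ, eqToHom_refl, Category.id_comp]

lemma extδ_zero_right {a : ℕ} (h : a + 0 = a) : X.extδ h = (ρ_ (X.ext a)).inv := by
  cases a with
  | zero =>
    rw [extδ_zero_left]
    exact unitors_inv_equal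
  | succ a => rw [extδ, eqToHom_refl, Category.id_comp]

/-- As soon as one of the three lengths vanishes this is coherence of unitors; otherwise it is the
coassociativity of `X`. The proof of `extθ_mul` has the same structure. -/
lemma extδ_coassoc {a b c ab bc m : ℕ} (h₁ : ab + c = m) (h₂ : a + b = ab) (h₃ : a + bc = m)
    (h₄ : b + c = bc) : X.extδ h₁ ≫ X.extδ h₂ ▷ X.ext c ≫ (α_ _ _ _).hom =
      X.extδ h₃ ≫ X.ext a ◁ X.extδ h₄ := by
  rcases Nat.eq_zero_or_pos a with rfl | ha
  · obtain rfl : b = ab := by omega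
    obtain rfl : bc = m := by omega
    rw [extδ_zero_left, extδ_zero_left, ← leftUnitor_inv_naturality]
    simp
  rcases Nat.eq_zero_or_pos b with rfl | hb
  · obtain rfl : a = ab := by omega
    obtain rfl : c = bc := by omega
    rw [extδ_zero_left, extδ_zero_right]
    simp
  rcases Nat.eq_zero_or_pos c with rfl | hc
  · obtain rfl : b = bc := by omega
    obtain rfl : ab = m := by omega
    rw [extδ_zero_right, extδ_zero_right]
    simp
  obtain ⟨a, rfl⟩ := Nat.exists_eq_add_one.2 ha
  obtain ⟨b, rfl⟩ := Nat.exists_eq_add_one.2 hb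
  obtain ⟨c, rfl⟩ := Nat.exists_eq_add_one.2 hc
  subst h₂ h₄ h₁
  exact X.coassoc (Nat.succ_pos a) (Nat.succ_pos b) (Nat.succ_pos c) rfl

lemma extθ_mul {a b m : ℕ} (h : a + b = m) : X.extθ m ≫ D.map (Nec.join h).op =
    X.extδ h ≫ (X.extθ a ⊗ₘ X.extθ b) ≫ necμ D (Nec.bead a) (Nec.bead b) := by
  rcases Nat.eq_zero_or_pos a with rfl | ha
  · obtain rfl : b = m := by omega
    have e : Nec.join h = (λ_ (Nec.bead b)).hom := Nec.hom_ext fun _ => rfl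
    have h1 := zero_cut_aux (Iso.refl (𝟙_ W)) (X.extθ b) (necμ_left D (Nec.bead b))
      (Category.id_comp _).symm
    rw [Iso.refl_inv, id_whiskerRight, Category.comp_id] at h1
    rw [extδ_zero_left]
    exact (congrArg (fun z => _ ≫ D.map z.op) e).trans h1
  rcases Nat.eq_zero_or_pos b with rfl | hb
  · obtain rfl : a = m := by omega
    have e : Nec.join h = (ρ_ (Nec.bead a)).hom := Nec.hom_ext fun _ => rfl
    have h1 : (X.extθ a ⊗ₘ necε D) ≫ necμ D (Nec.bead a) (𝟙_ Nec) =
        (ρ_ _).hom ≫ X.extθ a ≫ D.map (ρ_ (Nec.bead a)).hom.op := by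
      rw [MonoidalCategory.tensorHom_def, Category.assoc, necμ_right, rightUnitor_naturality_assoc]
    rw [extδ_zero_right, Iso.eq_inv_comp]
    exact (congrArg (fun z => _ ≫ _ ≫ D.map z.op) e).trans h1.symm
  obtain ⟨a, rfl⟩ := Nat.exists_eq_add_one.2 ha
  obtain ⟨b, rfl⟩ := Nat.exists_eq_add_one.2 hb
  subst h
  exact X.mul (Nat.succ_pos a) (Nat.succ_pos b) rfl

variable [HasLimitsOfSize.{0, 0} W] [HasInitial W]

/-- In positive degree `ext` is the cofree sequence itself, with the same proper splits. Degree zero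
is excluded, since there the object was replaced by the unit. -/
lemma ext_hom_ext {W' : Type*} [Category* W'] (G : W ⥤ W') [PreservesLimitsOfSize.{0, 0} G] {m : ℕ}
    (hm : 0 < m) {Z : W'} {φ ψ : Z ⟶ G.obj ((cofree D).ext m)}
    (h : φ ≫ G.map ((cofree D).extθ m) = ψ ≫ G.map ((cofree D).extθ m))
    (h' : ∀ {a b : ℕ} (_ : 0 < a) (_ : 0 < b) (h : a + b = m),
      φ ≫ G.map ((cofree D).extδ h) = ψ ≫ G.map ((cofree D).extδ h)) : φ = ψ := by
  obtain ⟨m, rfl⟩ := Nat.exists_eq_add_one.2 hm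
  refine cofree_hom_ext G h fun {a b} ha hb e => ?_
  obtain ⟨a, rfl⟩ := Nat.exists_eq_add_one.2 ha
  obtain ⟨b, rfl⟩ := Nat.exists_eq_add_one.2 hb
  exact h' ha hb e

variable (D) in
/-- The decompositions controlling the action of `Δ_f` on the cofree sequence. -/
def actFam : CoFam D (𝟭 W) where
  -- An index of degree `m` is a map `g : [m] ⟶ [n]`, with attached object `X_n`, so a solution at
  -- `g` is a candidate for `X(g) : X_n ⟶ X_m`. All maps out of `[m]` are solved for together,
  -- because cutting `g` leads to maps with other targets.
  J m := Σ n, (FinInt.mk m ⟶ FinInt.mk n)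
  Q x := (cofree D).ext x.1
  R {a _ _} _ x y z := y.1 + z.1 = x.1 ∧
    ∀ i, x.2.toFun i = glue a y.1 y.2.toFun z.2.toFun i
  c r := (cofree D).extδ r.1
  exists_split h x := by
    obtain ⟨n₁, n₂, g₁, g₂, h1, h2⟩ := FinInt.exists_split h x.2
    exact ⟨⟨n₁, g₁⟩, ⟨n₂, g₂⟩, h1, h2⟩
  unique := by
    rintro a b m h x ⟨y, g⟩ ⟨z, g'⟩ ⟨y', k⟩ ⟨z', k'⟩ ⟨h1, h2⟩ ⟨h3, h4⟩
    exact FinInt.split_unique (fun i => (h2 i).symm.trans (h4 i)) (h1.trans h3.symm)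
  assoc := by
    rintro a b c _ _ _ rfl rfl rfl k' ⟨x, f⟩ ⟨w, g⟩ ⟨z, g'⟩ ⟨y, k⟩ ⟨y', k₁⟩ ⟨h1, h2⟩ ⟨h3, h4⟩
    dsimp only at h1 h2 h3 h4
    subst h1 h3
    refine ⟨⟨y' + z, k₁ ⊗ₘ g'⟩, ⟨(Nat.add_assoc _ _ _).symm, fun i => ?_⟩, rfl, fun i => rfl⟩
    rw [h2, funext h4]
    exact IsInterval.glue_assoc i
  coassoc := fun r₁ r₂ r₃ r₄ => extδ_coassoc _ r₁.1 r₂.1 r₃.1 r₄.1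
  d x := (cofree D).extθ x.1 ≫ D.map (Nec.beadMap x.2).op
  mul := by
    rintro a b m h ⟨x, f⟩ ⟨y, g⟩ ⟨z, k⟩ ⟨h1, h2⟩
    have h3 := map_op_comp_eq D (Nec.join_natural h h1 f g k h2).symm
    have h4 := extθ_mul (cofree D) h1
    rw [op_comp, D.map_comp] at h3
    refine (Category.assoc _ _ _).trans ((congrArg (_ ≫ ·) h3).trans ?_)
    refine (Category.assoc _ _ _).symm.trans ((congrArg (· ≫ _) h4).trans ?_)
    refine (Category.assoc _ _ _).trans (congrArg (_ ≫ ·) ((Category.assoc _ _ _).trans ?_))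
    refine (congrArg (_ ≫ ·) (necμ_natural D (Nec.beadMap g) (Nec.beadMap k)).symm).trans ?_
    refine (tensorHom_comp_tensorHom_assoc _ _ _ _ _).trans (congrArg (_ ≫ ·) ?_)
    exact (Category.id_comp _).symm

/-- The action of `Δ_f` on the cofree sequence. -/
def act : ∀ {m n : ℕ}, (FinInt.mk m ⟶ FinInt.mk n) → ((cofree D).ext n ⟶ (cofree D).ext m)
  -- A map out of `[0]` preserving both end points has target `[0]`.
  | 0, _, g => eqToHom (congrArg _ (g.prop.map_last.symm.trans g.prop.map_zero))
  | _ + 1, n, g => (actFam D).sol ⟨n, g⟩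

lemma act_extθ {m n : ℕ} (g : FinInt.mk m ⟶ FinInt.mk n) :
    act g ≫ (cofree D).extθ m = (cofree D).extθ n ≫ D.map (Nec.beadMap g).op := by
  cases m with
  | zero =>
    obtain rfl : n = 0 := g.prop.map_last.symm.trans g.prop.map_zero
    obtain rfl : g = 𝟙 _ := FinInt.hom_ext fun i => by simpa using g.prop.map_add i
    refine (Category.id_comp _).trans (Eq.trans ?_ (congrArg (_ ≫ ·) (D.map_id _).symm))
    exact (Category.comp_id _).symm
  | succ m => exact (actFam D).sol_aug ⟨n, g⟩

/-- For proper splits this is the equation solved by `actFam`. If one piece of the source has length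
zero, so does its image, and `g` coincides with the other piece. -/
lemma act_extδ {a b m a' b' m' : ℕ} (h : a + b = m) (h' : a' + b' = m')
    {g : FinInt.mk m ⟶ ⟨m'⟩} {g₁ : FinInt.mk a ⟶ ⟨a'⟩} {g₂ : FinInt.mk b ⟶ ⟨b'⟩}
    (hg : ∀ i, g.toFun i = glue a a' g₁.toFun g₂.toFun i) :
    act g ≫ (cofree D).extδ h = (cofree D).extδ h' ≫ (act g₁ ⊗ₘ act g₂) := by
  rcases Nat.eq_zero_or_pos a with rfl | ha
  · obtain rfl : a' = 0 := g₁.prop.map_last.symm.trans g₁.prop.map_zero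
    obtain rfl : b = m := by omega
    obtain rfl : b' = m' := by omega
    obtain rfl : g = g₂ := FinInt.hom_ext fun i =>
      (hg i).trans (IsInterval.glue_zero_left g₁.prop.map_zero g₂.prop.map_zero i)
    rw [extδ_zero_left, extδ_zero_left, leftUnitor_inv_naturality, ← id_tensorHom]
    rfl
  rcases Nat.eq_zero_or_pos b with rfl | hb
  · obtain rfl : b' = 0 := g₂.prop.map_last.symm.trans g₂.prop.map_zero
    obtain rfl : a = m := by omega
    obtain rfl : a' = m' := by omega
    obtain rfl : g = g₁ := FinInt.hom_ext fun i => (hg i).trans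
      (IsInterval.glue_zero_right g₁.prop (fun i => by simpa using g₂.prop.map_add i) i)
    rw [extδ_zero_right, extδ_zero_right, rightUnitor_inv_naturality, ← tensorHom_id]
    rfl
  obtain ⟨a, rfl⟩ := Nat.exists_eq_add_one.2 ha
  obtain ⟨b, rfl⟩ := Nat.exists_eq_add_one.2 hb
  subst h
  have := CoFam.sol_comul (E := actFam D) (x := ⟨m', g⟩) (y := ⟨a', g₁⟩) (z := ⟨b', g₂⟩)
    (Nat.succ_pos a) (Nat.succ_pos b) (h := rfl) ⟨h', hg⟩
  refine this.trans (congrArg (_ ≫ ·) ?_)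
  exact Category.comp_id _

/-- Functoriality comes from uniqueness: by induction on the degree, the identity satisfies the
equations `act_extθ` and `act_extδ` which determine the action. -/
lemma act_id (m : ℕ) : act (𝟙 (FinInt.mk m)) = 𝟙 ((cofree D).ext m) := by
  induction m using Nat.strong_induction_on with
  | _ m ih =>
    rcases Nat.eq_zero_or_pos m with rfl | hm
    · rfl
    refine ext_hom_ext (𝟭 W) hm ?_ fun {a b} ha hb h => ?_
    · refine (act_extθ _).trans ((congrArg (_ ≫ ·) (D.map_id _)).trans ?_)
      exact (Category.comp_id _).trans (Category.id_comp _).symm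
    · refine (act_extδ h h (g₁ := 𝟙 _) (g₂ := 𝟙 _) fun i =>
        (IsInterval.glue_id (.id _) (fun _ => rfl) (fun _ => rfl) i).symm).trans ?_
      rw [ih a (by omega), ih b (by omega), id_tensorHom_id]
      exact (Category.comp_id _).trans (Category.id_comp _).symm

/-- Uniqueness again: `f` is cut at `a`, and `g` is then cut at the image of `a`, so that the pieces
of the composite are the composites of the pieces. -/
lemma act_comp {l m n : ℕ} (f : FinInt.mk l ⟶ FinInt.mk m) (g : FinInt.mk m ⟶ FinInt.mk n) :
    act (D := D) (f ≫ g) = act g ≫ act f := by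
  induction l using Nat.strong_induction_on generalizing m n with
  | _ l ih =>
    rcases Nat.eq_zero_or_pos l with rfl | hl
    · obtain rfl : m = 0 := f.prop.map_last.symm.trans f.prop.map_zero
      obtain rfl : n = 0 := g.prop.map_last.symm.trans g.prop.map_zero
      exact (Category.comp_id _).symm
    refine ext_hom_ext (𝟭 W) hl ?_ fun {a b} ha hb h => ?_
    · refine (act_extθ _).trans (Eq.symm ?_)
      refine (Category.assoc _ _ _).trans ((congrArg (_ ≫ ·) (act_extθ f)).trans ?_)
      refine (Category.assoc _ _ _).symm.trans ((congrArg (· ≫ _) (act_extθ g)).trans ?_)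
      exact (Category.assoc _ _ _).trans (congrArg (_ ≫ ·) (map_op_comp_eq D rfl))
    · obtain ⟨m₁, m₂, f₁, f₂, h1, hf⟩ := FinInt.exists_split h f
      obtain ⟨n₁, n₂, g₁, g₂, h2, hg⟩ := FinInt.exists_split h1 g
      refine (act_extδ h h2 (g₁ := f₁ ≫ g₁) (g₂ := f₂ ≫ g₂) fun i => ?_).trans (Eq.symm ?_)
      · rw [FinInt.comp_apply, hf, hg]
        exact IsInterval.glue_comp f₁.prop g₁.prop g₂.prop.map_zero i
      · refine (Category.assoc _ _ _).trans ((congrArg (_ ≫ ·) (act_extδ h h1 hf)).trans ?_)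
        refine (Category.assoc _ _ _).symm.trans ((congrArg (· ≫ _) (act_extδ h1 h2 hg)).trans ?_)
        rw [Category.assoc, tensorHom_comp_tensorHom, ih a (by omega), ih b (by omega)]

/-- Absorbs the associators and unitors of `Δ_f`, which are the identity on vertices but relate
lengths that are only propositionally equal. -/
lemma act_extδ_of_id {a b m m' : ℕ} (h : a + b = m) (h' : a + b = m')
    {g : FinInt.mk m ⟶ ⟨m'⟩} (hg : ∀ i, g.toFun i = i) :
    act g ≫ (cofree D).extδ h = (cofree D).extδ h' := by
  refine (act_extδ h h' (g₁ := 𝟙 _) (g₂ := 𝟙 _) fun i => ?_).trans ?_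
  · rw [hg]
    exact (IsInterval.glue_id (.id _) (fun _ => rfl) (fun _ => rfl) i).symm
  · rw [act_id, act_id, id_tensorHom_id, Category.comp_id]

end Pre

open Pre

variable [HasLimitsOfSize.{0, 0} W] [HasInitial W]

variable (D) in
/-- The cofree strongly unital colax monoidal functor. -/
def cofreeFunctor : FinIntᵒᵖ ⥤ W where
  obj n := (cofree D).ext n.unop.len
  map g := act g.unop
  map_id _ := act_id _
  map_comp f g := act_comp g.unop f.unop

/-- Degree zero is the unit by definition and the counit is its identity, so strong unitality holds
at once. -/
instance : (cofreeFunctor D).OplaxMonoidal where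
  η := 𝟙 (𝟙_ W)
  δ m n := (cofree D).extδ (rfl : m.unop.len + n.unop.len = m.unop.len + n.unop.len)
  δ_natural_left f Z := by
    rw [← tensorHom_id, ← (cofreeFunctor D).map_id]
    exact (act_extδ rfl rfl fun _ => rfl).symm
  δ_natural_right Z f := by
    rw [← id_tensorHom, ← (cofreeFunctor D).map_id]
    exact (act_extδ rfl rfl fun _ => rfl).symm
  oplax_associativity m n p := by
    refine (extδ_coassoc (cofree D) rfl rfl (Nat.add_assoc _ _ _).symm rfl).trans ?_
    exact (congrArg (· ≫ _) (act_extδ_of_id rfl (Nat.add_assoc _ _ _).symm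
      fun _ => rfl).symm).trans (Category.assoc _ _ _)
  oplax_left_unitality n := by
    refine Eq.trans ?_ (congrArg (_ ≫ ·) ((congrArg (_ ≫ ·) (id_whiskerRight _ _)).trans
      (Category.comp_id _))).symm
    refine Eq.trans ?_ (act_extδ_of_id rfl (Nat.zero_add _) fun _ => rfl).symm
    exact (extδ_zero_left _ _).symm
  oplax_right_unitality n := by
    refine Eq.trans ?_ (congrArg (_ ≫ ·) ((congrArg (_ ≫ ·)
      (MonoidalCategory.whiskerLeft_id _ _)).trans (Category.comp_id _))).symm
    refine Eq.trans ?_ (act_extδ_of_id rfl (Nat.add_zero _) fun _ => rfl).symm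
    exact (extδ_zero_right _ _).symm

instance : IsIso (Functor.OplaxMonoidal.η (cofreeFunctor D)) :=
  inferInstanceAs (IsIso (𝟙 (𝟙_ W)))

lemma comul_cofreeFunctor {a b m : ℕ} (h : a + b = m) :
    comul (cofreeFunctor D) h = (cofree D).extδ h :=
  act_extδ_of_id rfl h fun _ => rfl

/-! ### The universal property of the cofree colax functor -/

section Colax

open Functor.OplaxMonoidal

variable {W' : Type*} [Category* W'] [MonoidalCategory W'] (A : FinIntᵒᵖ ⥤ W') [A.OplaxMonoidal]
  (X : FinIntᵒᵖ ⥤ W) [X.OplaxMonoidal] (G : W ⥤ W') [G.LaxMonoidal]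

/-- Natural families of morphisms `A_n ⟶ G (X_n)` which are compatible with the
comultiplications and the counits. -/
@[ext]
structure ColaxNat where
  α : A ⟶ X ⋙ G
  counit : α.app (𝟙_ _) ≫ G.map (η X) = η A ≫ ε G
  comul : ∀ m n, α.app (m ⊗ n) ≫ G.map (δ X m n) = δ A m n ≫ (α.app m ⊗ₘ α.app n) ≫ μ G _ _

variable {A X G}

lemma ColaxNat.app_comul (φ : ColaxNat A X G) {a b m : ℕ} (h : a + b = m) :
    φ.α.app (op ⟨m⟩) ≫ G.map (_root_.comul X h) =
      _root_.comul A h ≫ (φ.α.app (op ⟨a⟩) ⊗ₘ φ.α.app (op ⟨b⟩)) ≫ μ G _ _ := by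
  unfold _root_.comul
  refine (congrArg (_ ≫ ·) (G.map_comp _ _)).trans ((Category.assoc _ _ _).symm.trans ?_)
  refine (congrArg (· ≫ _) (φ.α.naturality _).symm).trans ((Category.assoc _ _ _).trans ?_)
  exact (congrArg (_ ≫ ·) (φ.comul (op ⟨a⟩) (op ⟨b⟩))).trans (Category.assoc _ _ _).symm

/-- The counit of the cofree functor is an identity, so the component in degree zero is dictated by
that of `A`. -/
lemma ColaxNat.app_zero (φ : ColaxNat A (cofreeFunctor D) G) :
    φ.α.app (op ⟨0⟩) = η A ≫ ε G :=
  ((Category.comp_id _).symm.trans (congrArg (_ ≫ ·) (G.map_id _).symm)).trans φ.counit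

/-- The compatible family of morphisms `A_n ⟶ G (D_{Δⁿ})` underlying a morphism to the cofree
functor. -/
def ColaxNat.toBead (φ : ColaxNat A (cofreeFunctor D) G) : BeadNat (D ⋙ G) A where
  θ n := φ.α.app (op ⟨n⟩) ≫ G.map ((cofree D).extθ n)
  nat {m n} g := by
    refine (Category.assoc _ _ _).symm.trans ((congrArg (· ≫ _) (φ.α.naturality g.op)).trans ?_)
    refine (Category.assoc _ _ _).trans (Eq.trans (congrArg (_ ≫ ·) ?_) (Category.assoc _ _ _).symm)
    refine (G.map_comp _ _).symm.trans (Eq.trans ?_ (G.map_comp _ _))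
    exact congrArg G.map (act_extθ g)
  comul {a b m} h := by
    have h1 := φ.app_comul h
    rw [comul_cofreeFunctor] at h1
    have h2 := congrArg G.map (extθ_mul (cofree D) h)
    rw [G.map_comp, G.map_comp] at h2
    refine (Category.assoc _ _ _).trans ((congrArg (_ ≫ ·) h2).trans ?_)
    refine (Category.assoc _ _ _).symm.trans ((congrArg (· ≫ _) h1).trans ?_)
    exact fam_mul_aux G _ rfl rfl
  unit := (congrArg (· ≫ _) φ.app_zero).trans (Category.assoc _ _ _)

variable [IsIso (η A)]

/-- The family of objects `A_n`, with the morphisms to `G (D_{Δⁿ})`. -/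
def beadFam (β : BeadNat (D ⋙ G) A) : CoFam D G where
  -- One index per degree: here the family is the colax functor `A` itself, and its solution is the
  -- lift to the cofree functor.
  J _ := PUnit.{1}
  Q {n} _ := A.obj (op ⟨n⟩)
  R _ _ _ _ := True
  c {_ _ _ h _ _ _} _ := _root_.comul A h
  exists_split _ _ := ⟨.unit, .unit, trivial⟩
  unique _ _ := ⟨rfl, rfl⟩
  assoc := by
    intros
    exact ⟨.unit, trivial, trivial⟩
  coassoc _ _ _ _ := comul_coassoc _ _ _ _
  d {n} _ := β.θ n
  mul {_ _ _ h _ _ _} _ := β.comul h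

variable [PreservesLimitsOfSize.{0, 0} G]

/-- The family of morphisms `A_n ⟶ G (X_n)` given by the universal property of the cofree
sequence `X`. -/
def beadLift (β : BeadNat (D ⋙ G) A) : ∀ n, A.obj (op ⟨n⟩) ⟶ G.obj ((cofree D).ext n)
  | 0 => η A ≫ ε G
  | _ + 1 => (beadFam β).sol PUnit.unit

lemma beadLift_extθ (β : BeadNat (D ⋙ G) A) (n : ℕ) :
    beadLift β n ≫ G.map ((cofree D).extθ n) = β.θ n := by
  cases n with
  | zero => exact (Category.assoc _ _ _).trans β.unit.symm
  | succ n => exact (beadFam β).sol_aug (m := n + 1) PUnit.unit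

lemma beadLift_extδ (β : BeadNat (D ⋙ G) A) {a b m : ℕ} (h : a + b = m) :
    beadLift β m ≫ G.map ((cofree D).extδ h) =
      comul A h ≫ (beadLift β a ⊗ₘ beadLift β b) ≫ μ G _ _ := by
  rcases Nat.eq_zero_or_pos a with rfl | ha
  · obtain rfl : b = m := by omega
    rw [extδ_zero_left, comul_zero_left]
    exact counit_left_aux (unitIso A) _
  rcases Nat.eq_zero_or_pos b with rfl | hb
  · obtain rfl : a = m := by omega
    rw [extδ_zero_right, comul_zero_right]
    exact counit_right_aux (unitIso A) _
  obtain ⟨a, rfl⟩ := Nat.exists_eq_add_one.2 ha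
  obtain ⟨b, rfl⟩ := Nat.exists_eq_add_one.2 hb
  subst h
  exact CoFam.sol_comul (E := beadFam β) (x := PUnit.unit) (y := PUnit.unit)
    (z := PUnit.unit)
    (Nat.succ_pos a) (Nat.succ_pos b) (h := rfl) trivial

/-- The recursion defining the lift does not see the action of `Δ_f`. Naturality follows by
induction on `m` from uniqueness, cutting `g` along every proper split of its source and using the
naturality of `β`. -/
lemma beadLift_natural (β : BeadNat (D ⋙ G) A) {m n : ℕ} (g : FinInt.mk m ⟶ FinInt.mk n) :
    A.map g.op ≫ beadLift β m = beadLift β n ≫ G.map (act g) := by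
  induction m using Nat.strong_induction_on generalizing n with
  | _ m ih =>
    rcases Nat.eq_zero_or_pos m with rfl | hm
    · obtain rfl : n = 0 := g.prop.map_last.symm.trans g.prop.map_zero
      obtain rfl : g = 𝟙 _ := FinInt.hom_ext fun i => by simpa using g.prop.map_add i
      refine ((congrArg (· ≫ _) (A.map_id _)).trans (Category.id_comp _)).trans ?_
      exact ((congrArg (_ ≫ ·) (G.map_id _)).trans (Category.comp_id _)).symm
    refine ext_hom_ext G hm ?_ fun {a b} ha hb h => ?_
    · rw [Category.assoc, beadLift_extθ, Category.assoc, ← G.map_comp, act_extθ, G.map_comp,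
        ← Category.assoc, beadLift_extθ]
      exact β.nat g
    · obtain ⟨n₁, n₂, g₁, g₂, h1, hg⟩ := FinInt.exists_split h g
      rw [Category.assoc, beadLift_extδ, Category.assoc, ← G.map_comp, act_extδ h h1 hg, G.map_comp,
        ← Category.assoc (beadLift β n), beadLift_extδ, Category.assoc, Category.assoc,
        ← μ_natural, tensorHom_comp_tensorHom_assoc, ← ih a (by omega) g₁, ← ih b (by omega) g₂,
        ← Category.assoc, comul_natural h h1 g g₁ g₂ hg, Category.assoc,
        tensorHom_comp_tensorHom_assoc]

/-- The morphism to the cofree functor given by the universal property. -/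
def BeadNat.lift (β : BeadNat (D ⋙ G) A) : ColaxNat A (cofreeFunctor D) G where
  α :=
  { app n := beadLift β n.unop.len
    naturality _ _ g := beadLift_natural β g.unop }
  counit := (congrArg (_ ≫ ·) (G.map_id _)).trans (Category.comp_id _)
  comul _ _ := (beadLift_extδ β rfl).trans (congrArg (· ≫ _) (comul_refl A _ _))

/-- Morphisms to the cofree functor correspond to compatible families of morphisms
`A_n ⟶ G (D_{Δⁿ})`. -/
def ColaxNat.equivBead : ColaxNat A (cofreeFunctor D) G ≃ BeadNat (D ⋙ G) A where
  toFun := ColaxNat.toBead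
  invFun := BeadNat.lift
  right_inv β := BeadNat.ext (funext fun n => beadLift_extθ β n)
  left_inv φ := by
    refine ColaxNat.ext (NatTrans.ext (funext fun n => ?_))
    obtain ⟨⟨n⟩⟩ := n
    change beadLift φ.toBead n = φ.α.app (op ⟨n⟩)
    -- In positive degree both morphisms have the same component in `D`, and by induction the same
    -- proper decompositions.
    induction n using Nat.strong_induction_on with
    | _ n ih =>
      rcases Nat.eq_zero_or_pos n with rfl | hn
      · exact φ.app_zero.symm
      refine ext_hom_ext G hn (beadLift_extθ _ n) fun {a b} ha hb h => ?_
      have := φ.app_comul h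
      rw [comul_cofreeFunctor] at this
      refine (beadLift_extδ _ h).trans (Eq.trans ?_ this.symm)
      rw [ih a (by omega), ih b (by omega)]
      rfl

end Colax

end Cofree

/-! ### The right adjoint of `(-)^nec` -/

section Temp

open Functor.LaxMonoidal Functor.OplaxMonoidal

variable {V : Type v} [Category.{u} V] [MonoidalCategory V] [HasColimitsOfSize.{u, u} V]
  [MonoidalClosed V] [BraidedCategory V]

/-- Restriction to single beads commutes with the morphism `φ` induces on necklaces; the naturality
of the adjunction bijection in the templicial variable rests on it. -/
lemma toChain_chainHom {A B : Templ V} (φ : Templ.Hom A B) (n : ℕ) :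
    toChain A.X n ≫ chainHom φ.α (Nec.beadList n) =
      φ.α.app (op ⟨n⟩) ≫ (VQuiv.pull V φ.f).map (toChain B.X n) := by
  cases n with
  | zero => exact φ.counit.symm
  | succ n =>
    have h := counit_right_aux (G := VQuiv.pull V φ.f) (Iso.refl _) (φ.α.app (op ⟨n + 1⟩))
    rw [Iso.refl_hom, Iso.refl_inv, Category.id_comp, MonoidalCategory.whiskerLeft_id,
      Category.comp_id] at h
    exact h.symm

namespace BeadHom

variable {A B : Templ V} {D : NecCat V}

lemma ofNec_comp_app (φ : Templ.Hom A B) (ψ : NecCat.Hom ((nec V).obj B) D) (n : ℕ) (a b : A.S) :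
    ((ofNec (NecCat.Hom.comp ((nec V).map φ) ψ)).nat.θ n).app a b =
      (φ.α.app (op ⟨n⟩)).app a b ≫ ((ofNec ψ).nat.θ n).app (φ.f a) (φ.f b) := by
  have h := congrArg (fun z => VQuiv.Hom.app z a b) (toChain_chainHom φ n)
  refine (Category.assoc _ _ _).symm.trans ((congrArg (· ≫ _) h).trans ?_)
  exact Category.assoc _ _ _

end BeadHom

variable [HasLimitsOfSize.{0, 0} V] [HasInitial V] {A B : Templ V} {D : NecCat V}

/-- The cofree templicial object on a necklace category. -/
abbrev temp (D : NecCat V) : Templ V := { S := D.S, X := cofreeFunctor D.C }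

/-- The compatible family underlying a morphism to the cofree colax functor. -/
def BeadHom.ofColax (f : A.S → D.S) (φ : ColaxNat A.X (cofreeFunctor D.C) (VQuiv.pull V f)) :
    BeadHom A D := ⟨f, φ.toBead⟩

/-- The compatible family underlying a morphism to the cofree templicial object. -/
def BeadHom.ofTemp (φ : Templ.Hom A (temp D)) : BeadHom A D :=
  ofColax φ.f ⟨φ.α, φ.counit, φ.comul⟩

/-- The morphism to the cofree templicial object given by a compatible family. -/
def BeadHom.toTemp (θ : BeadHom A D) : Templ.Hom A (temp D) :=
  Templ.Hom.mk (B := temp D) θ.f θ.nat.lift.α θ.nat.lift.counit θ.nat.lift.comul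

lemma BeadHom.toTemp_ofTemp_aux (f : A.S → D.S)
    (φ : ColaxNat A.X (cofreeFunctor D.C) (VQuiv.pull V f)) (n a b) :
    (φ.toBead.lift.α.app n).app a b = (φ.α.app n).app a b :=
  congrArg (fun z : ColaxNat A.X (cofreeFunctor D.C) (VQuiv.pull V f) => (z.α.app n).app a b)
    (ColaxNat.equivBead.symm_apply_apply φ)

/-- Morphisms to the cofree templicial object on `D` correspond to compatible families of morphisms
to the values of `D` on simplices. -/
def BeadHom.equivTemp (A : Templ V) (D : NecCat V) : (A ⟶ temp D) ≃ BeadHom A D where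
  toFun := BeadHom.ofTemp
  invFun := BeadHom.toTemp
  left_inv φ := Templ.Hom.ext_same (toTemp_ofTemp_aux (D := D) (Templ.Hom.f φ)
    ⟨Templ.Hom.α φ, Templ.Hom.counit φ, Templ.Hom.comul φ⟩)
  right_inv θ := congrArg (BeadHom.mk θ.f) (ColaxNat.equivBead.apply_symm_apply θ.nat)

lemma BeadHom.ofTemp_comp_app (φ : Templ.Hom A B) (ψ : Templ.Hom B (temp D)) (n : ℕ) (a b : A.S) :
    ((ofTemp (φ.comp ψ)).nat.θ n).app a b =
      (φ.α.app (op ⟨n⟩)).app a b ≫ ((ofTemp ψ).nat.θ n).app (φ.f a) (φ.f b) :=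
  Category.assoc _ _ _

/-- Under `equivTemp` it suffices to compare the families on beads. On both sides the family is the
component of `φ` followed by that of `ψ`, and `beadLift_extθ` recovers the latter from its lift. -/
lemma BeadHom.toTemp_comp (φ : A ⟶ B) (ψ : (nec V).obj B ⟶ D) :
    toTemp (ofNec ((nec V).map φ ≫ ψ)) = φ ≫ (toTemp (ofNec ψ) : B ⟶ temp D) := by
  refine (BeadHom.equivTemp A D).symm_apply_eq.2 ?_
  refine ext_same fun n a b => (ofNec_comp_app φ ψ n a b).trans ?_
  refine Eq.trans ?_ (ofTemp_comp_app φ (toTemp (ofNec ψ)) n a b).symm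
  exact congrArg (fun z => _ ≫ VQuiv.Hom.app z _ _) (beadLift_extθ (ofNec ψ).nat n).symm

variable (V) in
/-- The functor `(-)^nec` is left adjoint to the cofree templicial object functor. -/
lemma nec_isLeftAdjoint : (nec V).IsLeftAdjoint :=
  (Adjunction.adjunctionOfEquivRight (F := nec V) (G_obj := temp)
    (fun A D => (BeadHom.equivNec A D).symm.trans (BeadHom.equivTemp A D).symm)
    fun _ _ _ φ ψ => BeadHom.toTemp_comp φ ψ).isLeftAdjoint

end Temp
end

noncomputable section
-- Necklace categories from composition laws given hom-object by hom-object
section NecCatOfDay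

open Functor.LaxMonoidal

variable {V : Type v} [Category.{u} V] [MonoidalCategory V] [HasColimitsOfSize.{u, u} V]
  [MonoidalClosed V] [BraidedCategory V] {S : Type u}

namespace DayCat

variable (B : DayCat Nec V S)

/-- The quivers of a family of composition laws indexed by necklaces. -/
@[reducible]
def quiv : Necᵒᵖ ⥤ VQuiv V S where
  obj T := ⟨fun a b => (B.K a b).obj T⟩
  map g := ⟨fun a b => (B.K a b).map g⟩
  map_id T := by
    ext a b
    exact (B.K a b).map_id T
  map_comp f g := by
    ext a b
    exact (B.K a b).map_comp f g

/-- The unit of the lax structure. -/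
@[reducible]
def quivε : VQuiv.tUnit V S ⟶ B.quiv.obj (𝟙_ _) :=
  ⟨fun a b => VQuiv.uDesc fun h => B.e a ≫ eqToHom (by rw [h]; rfl)⟩

/-- The multiplication of the lax structure. -/
@[reducible]
def quivμ (T U : Necᵒᵖ) : VQuiv.tObj (B.quiv.obj T) (B.quiv.obj U) ⟶ B.quiv.obj (T ⊗ U) :=
  ⟨fun a b => VQuiv.tDesc fun c => B.m a c b T.unop U.unop⟩

lemma uι_quivε (a : S) : VQuiv.uι V a ≫ B.quivε.app a a = B.e a :=
  (VQuiv.uι_uDesc fun _ => B.e a ≫ 𝟙 _).trans (Category.comp_id _)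

lemma tι_quivμ (T U : Necᵒᵖ) (a b c : S) :
    VQuiv.tι _ _ a b c ≫ (B.quivμ T U).app a c = B.m a b c T.unop U.unop :=
  VQuiv.tι_tDesc _ _

lemma quiv_natural {T T' U U' : Necᵒᵖ} (f : T ⟶ T') (g : U ⟶ U') :
    VQuiv.tHom (B.quiv.map f) (B.quiv.map g) ≫ B.quivμ T' U' =
      B.quivμ T U ≫ B.quiv.map (f ⊗ₘ g) := by
  ext a b
  refine VQuiv.tObj_hom_ext fun c => ?_
  refine (VQuiv.tι_tHom_assoc _ _ _ _ _ _).trans ?_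
  refine Eq.trans ?_ (VQuiv.tι_tDesc_assoc _ _ _).symm
  refine (congrArg (_ ≫ ·) (B.tι_quivμ T' U' a c b)).trans ?_
  exact B.nat a c b f.unop g.unop

/-- On the summand belonging to a sequence of vertices `a, b, c, d` the equation is `B.assoc`; all
else is moving coprojections through tensor products. -/
lemma quiv_assoc (T U X : Necᵒᵖ) :
    VQuiv.tHom (B.quivμ T U) (𝟙 (B.quiv.obj X)) ≫ B.quivμ (T ⊗ U) X ≫
        B.quiv.map (α_ T U X).hom =
      (VQuiv.tAssoc _ _ _).hom ≫ VQuiv.tHom (𝟙 (B.quiv.obj T)) (B.quivμ U X) ≫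
        B.quivμ T (U ⊗ X) := by
  ext a d
  refine VQuiv.tObj_hom_ext fun c => VQuiv.tObj_hom_ext_right fun b => ?_
  have h1 := VQuiv.tι_tAssoc_hom_assoc (B.quiv.obj T) (B.quiv.obj U) (B.quiv.obj X) a b c d
    ((VQuiv.tHom (𝟙 (B.quiv.obj T)) (B.quivμ U X)).app a d ≫ (B.quivμ T (U ⊗ X)).app a d)
  refine Eq.trans ?_ h1.symm
  have h2 := VQuiv.tι_tHom_assoc (𝟙 (B.quiv.obj T)) (B.quivμ U X) a b d
    ((B.quivμ T (U ⊗ X)).app a d)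
  refine Eq.trans ?_ (congrArg (_ ≫ ·) (congrArg (_ ≫ ·) h2.symm))
  have h3 := VQuiv.tι_tHom_assoc (B.quivμ T U) (𝟙 (B.quiv.obj X)) a c d
    ((B.quivμ (T ⊗ U) X).app a d ≫ (B.quiv.map (α_ T U X).hom).app a d)
  refine (congrArg (_ ≫ ·) h3).trans ?_
  have h4 := B.assoc a b c d T.unop U.unop X.unop
  have h5 := B.tι_quivμ T U a b c
  have h6 := B.tι_quivμ U X b c d
  have h7 := B.tι_quivμ (T ⊗ U) X a c d
  have h8 := B.tι_quivμ T (U ⊗ X) a b d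
  have h9 : (B.K a d).map (α_ T.unop U.unop X.unop).hom.op ≫ (B.K a d).map (α_ T U X).hom =
      𝟙 _ := by
    rw [← (B.K a d).map_comp]
    exact (congrArg (B.K a d).map (α_ T U X).inv_hom_id).trans ((B.K a d).map_id _)
  rw [VQuiv.id_app, VQuiv.id_app, tensorHom_id, id_tensorHom, h8]
  refine (congrArg (fun z => _ ≫ _ ≫ z) ((Category.assoc _ _ _).symm.trans
    (congrArg (· ≫ _) h7))).trans ?_
  refine (Category.assoc _ _ _).symm.trans ((congrArg (· ≫ _) ((comp_whiskerRight _ _ _).symm.trans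
    (congrArg (· ▷ _) h5))).trans ?_)
  refine (Category.assoc _ _ _).symm.trans ((congrArg (· ≫ _) h4).trans ?_)
  refine (Category.assoc _ _ _).trans (congrArg (_ ≫ ·) ?_)
  refine (Category.assoc _ _ _).trans ?_
  refine (congrArg (_ ≫ ·) ((Category.assoc _ _ _).trans ((congrArg (_ ≫ ·) h9).trans
    (Category.comp_id _)))).trans ?_
  refine Eq.trans ?_ (Category.assoc _ _ _)
  refine congrArg (· ≫ _) ?_
  exact (congrArg (_ ◁ ·) h6).symm.trans (MonoidalCategory.whiskerLeft_comp _ _ _)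

lemma quiv_left (T : Necᵒᵖ) :
    (VQuiv.tLeft (B.quiv.obj T)).hom =
      VQuiv.tHom B.quivε (𝟙 (B.quiv.obj T)) ≫ B.quivμ (𝟙_ _) T ≫ B.quiv.map (λ_ T).hom := by
  ext a b
  refine VQuiv.tObj_hom_ext fun c => VQuiv.tUnit_hom_ext_right fun e => ?_
  subst e
  rw [eqToHom_refl, Category.id_comp, Category.id_comp]
  refine (VQuiv.uι_tLeft_hom _ _ _).trans ?_
  have h3 := VQuiv.tι_tHom_assoc B.quivε (𝟙 (B.quiv.obj T)) a a b
    ((B.quivμ (𝟙_ _) T).app a b ≫ (B.quiv.map (λ_ T).hom).app a b)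
  refine Eq.trans ?_ (congrArg (_ ≫ ·) h3).symm
  have h4 := B.left a b T.unop
  have h5 := B.uι_quivε a
  have h7 := B.tι_quivμ (𝟙_ _) T a a b
  have h9 : (B.K a b).map (λ_ T.unop).hom.op ≫ (B.K a b).map (λ_ T).hom = 𝟙 _ := by
    rw [← (B.K a b).map_comp]
    exact (congrArg (B.K a b).map (λ_ T).inv_hom_id).trans ((B.K a b).map_id _)
  rw [VQuiv.id_app, tensorHom_id]
  refine Eq.trans ?_ (congrArg (fun z => _ ≫ _ ≫ z) ((Category.assoc _ _ _).symm.trans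
    (congrArg (· ≫ _) h7))).symm
  refine Eq.trans ?_ ((Category.assoc _ _ _).symm.trans (congrArg (· ≫ _)
    ((comp_whiskerRight _ _ _).symm.trans (congrArg (· ▷ _) h5)))).symm
  refine Eq.trans ?_ ((Category.assoc _ _ _).symm.trans (congrArg (· ≫ _) h4)).symm
  exact ((Category.assoc _ _ _).trans ((congrArg (_ ≫ ·) h9).trans (Category.comp_id _))).symm

lemma quiv_right (T : Necᵒᵖ) :
    (VQuiv.tRight (B.quiv.obj T)).hom =
      VQuiv.tHom (𝟙 (B.quiv.obj T)) B.quivε ≫ B.quivμ T (𝟙_ _) ≫ B.quiv.map (ρ_ T).hom := by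
  ext a b
  refine VQuiv.tObj_hom_ext fun c => VQuiv.tUnit_hom_ext_left fun e => ?_
  subst e
  rw [eqToHom_refl, Category.id_comp, Category.id_comp]
  refine (VQuiv.uι_tRight_hom _ _ _).trans ?_
  have h3 := VQuiv.tι_tHom_assoc (𝟙 (B.quiv.obj T)) B.quivε a c c
    ((B.quivμ T (𝟙_ _)).app a c ≫ (B.quiv.map (ρ_ T).hom).app a c)
  refine Eq.trans ?_ (congrArg (_ ≫ ·) h3).symm
  have h4 := B.right a c T.unop
  have h5 := B.uι_quivε c
  have h7 := B.tι_quivμ T (𝟙_ _) a c c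
  have h9 : (B.K a c).map (ρ_ T.unop).hom.op ≫ (B.K a c).map (ρ_ T).hom = 𝟙 _ := by
    rw [← (B.K a c).map_comp]
    exact (congrArg (B.K a c).map (ρ_ T).inv_hom_id).trans ((B.K a c).map_id _)
  rw [VQuiv.id_app, id_tensorHom]
  refine Eq.trans ?_ (congrArg (fun z => _ ≫ _ ≫ z) ((Category.assoc _ _ _).symm.trans
    (congrArg (· ≫ _) h7))).symm
  refine Eq.trans ?_ ((Category.assoc _ _ _).symm.trans (congrArg (· ≫ _)
    ((MonoidalCategory.whiskerLeft_comp _ _ _).symm.trans (congrArg (_ ◁ ·) h5)))).symm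
  refine Eq.trans ?_ ((Category.assoc _ _ _).symm.trans (congrArg (· ≫ _) h4)).symm
  exact ((Category.assoc _ _ _).trans ((congrArg (_ ≫ ·) h9).trans (Category.comp_id _))).symm

instance : B.quiv.LaxMonoidal := .ofTensorHom
  (ε := B.quivε)
  (μ := B.quivμ)
  (μ_natural := B.quiv_natural)
  (associativity := B.quiv_assoc)
  (left_unitality := B.quiv_left)
  (right_unitality := B.quiv_right)

/-- The necklace category given by a family of composition laws. -/
abbrev toNecCat : NecCat V where
  S := S
  C := B.quiv

lemma toNecCat_comp (a b c : S) (T U : Nec) : B.toNecCat.comp a b c T U = B.m a b c T U :=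
  B.tι_quivμ (op T) (op U) a b c

lemma toNecCat_one (a : S) : B.toNecCat.one a = B.e a :=
  B.uι_quivε a

end DayCat

/-- A functor of necklace categories, given by its values on hom-objects. -/
def NecCat.Hom.ofComp {A B : NecCat V} (f : A.S → B.S) (α : A.C ⟶ B.C ⋙ VQuiv.pull V f)
    (h1 : ∀ a, A.one a ≫ (α.app (op (𝟙_ Nec))).app a a = B.one (f a))
    (h2 : ∀ a b c T U, A.comp a b c T U ≫ (α.app (op (T ⊗ U))).app a c =
      ((α.app (op T)).app a b ⊗ₘ (α.app (op U)).app b c) ≫ B.comp (f a) (f b) (f c) T U) :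
    NecCat.Hom A B where
  f := f
  α := α
  unit := by
    ext a b
    refine VQuiv.tUnit_hom_ext fun e => ?_
    subst e
    rw [eqToHom_refl, Category.id_comp, Category.id_comp]
    refine ((Category.assoc _ _ _).symm.trans (h1 a)).trans ?_
    exact (congrArg (· ≫ _) (VQuiv.uι_pullε f a)).symm.trans (Category.assoc _ _ _)
  mul T U := by
    ext a b
    refine VQuiv.tObj_hom_ext fun c => ?_
    refine ((Category.assoc _ _ _).symm.trans (h2 a c b T.unop U.unop)).trans ?_
    refine Eq.trans ?_ (VQuiv.tι_tHom_assoc (α.app T) (α.app U) a c b _).symm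
    refine congrArg (_ ≫ ·) ?_
    exact (VQuiv.tι_pullμ_assoc f (B.C.obj T) (B.C.obj U) a c b
      ((μ B.C T U).app (f a) (f b))).symm

end NecCatOfDay

/-! ### Strong monoidality of `T ↦ N(P_T)` -/

section StrongNerve

open Functor.LaxMonoidal

/-- The front part of a set of vertices of a join. -/
def VertSets.fst {T U : Nec} (W : VertSets.{u} (T ⊗ U)) : VertSets.{u} T where
  carrier := {i | i ∈ W.carrier ∧ i ≤ T.beads.sum}
  joints_subset _ hi := ⟨W.joints_subset ((Nec.joints_append T.beads U.beads).symm.subset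
    (Or.inl hi)), Nec.le_of_mem_joints hi⟩
  le_sum _ hi := hi.2

/-- The back part of a set of vertices of a join. -/
def VertSets.snd {T U : Nec} (W : VertSets.{u} (T ⊗ U)) : VertSets.{u} U where
  carrier := {i | T.beads.sum + i ∈ W.carrier}
  joints_subset i hi := W.joints_subset ((Nec.joints_append T.beads U.beads).symm.subset
    (Or.inr ⟨i, hi, rfl⟩))
  le_sum i hi := by
    have h : T.beads.sum + i ≤ (T.beads ++ U.beads).sum := W.le_sum _ hi
    rw [List.sum_append] at h
    omega

lemma VertSets.join_fst_snd {T U : Nec} (W : VertSets.{u} (T ⊗ U)) : W.fst.join W.snd = W := by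
  refine VertSets.ext (Set.ext fun i => ⟨?_, fun h => ?_⟩)
  · rintro (h | ⟨j, h, rfl⟩)
    · exact h.1
    · exact h
  · by_cases hi : i ≤ T.beads.sum
    · exact Or.inl ⟨h, hi⟩
    · refine Or.inr ⟨i - T.beads.sum, ?_, by simp only; omega⟩
      change T.beads.sum + _ ∈ W.carrier
      rwa [Nat.add_sub_cancel' (by omega)]

/-- The two halves of a join meet only in the gluing vertex. If that vertex comes from `X`, it
nevertheless lies in `W`, because the last vertex of `T` is a joint and `W` contains all joints. -/
lemma VertSets.fst_join {T U : Nec} (W : VertSets.{u} T) (X : VertSets.{u} U) :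
    (W.join X).fst = W := by
  refine VertSets.ext (Set.ext fun i => ⟨?_, fun h => ⟨Or.inl h, W.le_sum i h⟩⟩)
  rintro ⟨h | ⟨j, h, rfl⟩, h'⟩
  · exact h
  · have : j = 0 := by
      simp only at h'
      omega
    subst this
    exact W.joints_subset (Nec.sum_mem_joints _)

lemma VertSets.snd_join {T U : Nec} (W : VertSets.{u} T) (X : VertSets.{u} U) :
    (W.join X).snd = X := by
  refine VertSets.ext (Set.ext fun i => ⟨?_, fun h => Or.inr ⟨i, h, rfl⟩⟩)
  rintro (h | ⟨j, h, h'⟩)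
  · have : i = 0 := by
      have := W.le_sum _ h
      omega
    subst this
    exact X.joints_subset (Nec.zero_mem_joints _)
  · obtain rfl : j = i := Nat.add_left_cancel h'
    exact h

section

variable {T U X T' U' : Nec} {n m : SimplexCategoryᵒᵖ}

/-- A pair of simplices as a simplex of the product. -/
abbrev simplexPair {K L : SSet.{u}} (σ : K.obj n) (τ : L.obj n) : (K ⊗ L).obj n := (σ, τ)

/-- The join of two chains of vertex sets. -/
def necJoin (σ : (necNerve.{u}.obj T).obj n) (τ : (necNerve.{u}.obj U).obj n) :
    (necNerve.{u}.obj (T ⊗ U)).obj n :=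
  (necNerveμ T U).app n (simplexPair (K := necNerve.obj T) (L := necNerve.obj U) σ τ)

/-- The constant chain of vertex sets of the unit necklace. -/
def necUnit (n : SimplexCategoryᵒᵖ) : (necNerve.{u}.obj (𝟙_ Nec)).obj n :=
  necNerveε.app n PUnit.unit

/-- The front part of a chain of vertex sets of a join. -/
def necFst (σ : (necNerve.{u}.obj (T ⊗ U)).obj n) : (necNerve.{u}.obj T).obj n :=
  ({ obj i := (CategoryTheory.Functor.obj σ i).fst
     map g := homOfLE fun _ h => ⟨leOfHom (CategoryTheory.Functor.map σ g) h.1, h.2⟩ } :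
    Fin (n.unop.len + 1) ⥤ VertSets.{u} T)

/-- The back part of a chain of vertex sets of a join. -/
def necSnd (σ : (necNerve.{u}.obj (T ⊗ U)).obj n) : (necNerve.{u}.obj U).obj n :=
  ({ obj i := (CategoryTheory.Functor.obj σ i).snd
     map g := homOfLE fun _ h => leOfHom (CategoryTheory.Functor.map σ g) h } :
    Fin (n.unop.len + 1) ⥤ VertSets.{u} U)

lemma necJoin_fst_snd (σ : (necNerve.{u}.obj (T ⊗ U)).obj n) :
    necJoin (necFst σ) (necSnd σ) = σ :=
  VertSets.functor_ext fun i : Fin (n.unop.len + 1) => congrArg VertSets.carrier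
    (VertSets.join_fst_snd (CategoryTheory.Functor.obj σ i))

@[simp] lemma necFst_necJoin (σ : (necNerve.{u}.obj T).obj n) (τ : (necNerve.{u}.obj U).obj n) :
    necFst (necJoin σ τ) = σ :=
  VertSets.functor_ext fun i : Fin (n.unop.len + 1) => congrArg VertSets.carrier
    (VertSets.fst_join (CategoryTheory.Functor.obj σ i) (CategoryTheory.Functor.obj τ i))

@[simp] lemma necSnd_necJoin (σ : (necNerve.{u}.obj T).obj n) (τ : (necNerve.{u}.obj U).obj n) :
    necSnd (necJoin σ τ) = τ :=
  VertSets.functor_ext fun i : Fin (n.unop.len + 1) => congrArg VertSets.carrier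
    (VertSets.snd_join (CategoryTheory.Functor.obj σ i) (CategoryTheory.Functor.obj τ i))

/-- A simplex of the nerve of a join is the join of two simplices. -/
lemma exists_necJoin (σ : (necNerve.{u}.obj (T ⊗ U)).obj n) : ∃ τ ρ, σ = necJoin τ ρ :=
  ⟨_, _, (necJoin_fst_snd σ).symm⟩

lemma necJoin_natural (f : T ⟶ T') (g : U ⟶ U') (σ : (necNerve.{u}.obj T).obj n)
    (τ : (necNerve.{u}.obj U).obj n) :
    (necNerve.map (f ⊗ₘ g)).app n (necJoin σ τ) =
      necJoin ((necNerve.map f).app n σ) ((necNerve.map g).app n τ) :=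
  (ConcreteCategory.congr_hom (congrArg (fun z => NatTrans.app z n) (μ_natural necNerve.{u} f g))
    (simplexPair (K := necNerve.obj T) (L := necNerve.obj U) σ τ)).symm

lemma necJoin_assoc (σ : (necNerve.{u}.obj T).obj n) (τ : (necNerve.{u}.obj U).obj n)
    (ρ : (necNerve.{u}.obj X).obj n) :
    (necNerve.map (α_ T U X).hom).app n (necJoin (necJoin σ τ) ρ) = necJoin σ (necJoin τ ρ) := by
  refine VertSets.functor_ext fun i : Fin (n.unop.len + 1) => ?_
  refine (Set.image_id _).trans ?_
  change (_ ∪ _) ∪ (fun i => (T.beads ++ U.beads).sum + i) '' _ = _ ∪ _ '' (_ ∪ _ '' _)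
  rw [Set.image_union, Set.union_assoc, Set.image_image, List.sum_append]
  simp only [Nat.add_assoc]

lemma necJoin_left (σ : (necNerve.{u}.obj T).obj n) :
    (necNerve.map (λ_ T).hom).app n (necJoin (necUnit n) σ) = σ := by
  refine VertSets.functor_ext fun i : Fin (n.unop.len + 1) => ?_
  refine (Set.image_id _).trans ?_
  change {0} ∪ (fun i => 0 + i) '' _ = _
  simp only [Nat.zero_add, Set.image_id']
  refine Set.union_eq_self_of_subset_left (Set.singleton_subset_iff.2 ?_)
  exact VertSets.joints_subset _ (Nec.zero_mem_joints _)

lemma necJoin_right (σ : (necNerve.{u}.obj T).obj n) :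
    (necNerve.map (ρ_ T).hom).app n (necJoin σ (necUnit n)) = σ := by
  refine VertSets.functor_ext fun i : Fin (n.unop.len + 1) => ?_
  refine (Set.image_id _).trans ?_
  change _ ∪ (fun i => T.beads.sum + i) '' {0} = _
  simp only [Set.image_singleton, Nat.add_zero]
  refine Set.union_eq_self_of_subset_right (Set.singleton_subset_iff.2 ?_)
  exact VertSets.joints_subset _ (Nec.sum_mem_joints _)

end

/-- The poset `P_{Δ⁰}` has the single element `{0}`: zero is a joint and there is no other vertex.
The unit comparison is therefore bijective too. -/
lemma eq_necUnit {n : SimplexCategoryᵒᵖ} (σ : (necNerve.{u}.obj (𝟙_ Nec)).obj n) :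
    σ = necUnit n := by
  refine VertSets.functor_ext fun i : Fin (n.unop.len + 1) => Set.ext fun j =>
    ⟨fun h => ?_, fun h => ?_⟩
  · exact Set.mem_singleton_iff.2 (Nat.le_zero.1 ((CategoryTheory.Functor.obj σ i).le_sum j h))
  · exact (CategoryTheory.Functor.obj σ i).joints_subset (h ▸ Nec.zero_mem_joints _)

end StrongNerve
end

noncomputable section

/-! ### Objects of maps from a simplicial set to a simplicial object -/

section Power

variable {V : Type v} [Category.{u} V] [HasLimitsOfSize.{u, u} V]

/-- The category of elements has a `u`-small set of objects, and its hom-sets are cut out of those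
of `SimplexCategoryᵒᵖ`, so they lie in the lowest universe; `u`-small limits suffice. -/
instance (N : SSet.{u}) : HasLimitsOfShape N.Elements V :=
  have := hasLimitsOfSizeShrink.{0, u, u, u} V
  inferInstance

/-- The object of maps from a simplicial set `N` to a simplicial object `Y`. -/
def Power (N : SSet.{u}) (Y : SimplexCategoryᵒᵖ ⥤ V) : V :=
  limit (CategoryOfElements.π N ⋙ Y)

namespace Power

variable {N : SSet.{u}} {Y : SimplexCategoryᵒᵖ ⥤ V} {Z : V}

/-- The value of a map at a simplex. -/
def π {n : SimplexCategoryᵒᵖ} (σ : N.obj n) : Power N Y ⟶ Y.obj n :=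
  limit.π (CategoryOfElements.π N ⋙ Y) ⟨n, σ⟩

@[simp] lemma w {n m : SimplexCategoryᵒᵖ} (f : n ⟶ m) (σ : N.obj n) :
    π σ ≫ Y.map f = π (Y := Y) (N.map f σ) :=
  limit.w (CategoryOfElements.π N ⋙ Y) (j := ⟨n, σ⟩) (j' := ⟨m, N.map f σ⟩) ⟨f, rfl⟩

/-- The map with given values. -/
def lift (s : ∀ n (_ : N.obj n), Z ⟶ Y.obj n)
    (h : ∀ {n m} (f : n ⟶ m) (σ : N.obj n), s n σ ≫ Y.map f = s m (N.map f σ)) : Z ⟶ Power N Y :=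
  limit.lift (CategoryOfElements.π N ⋙ Y)
    { pt := Z
      π := { app p := s p.1 p.2
             naturality := by
              rintro ⟨n, σ⟩ ⟨m, τ⟩ ⟨f, hf⟩
              exact (Category.id_comp _).trans ((h f σ).trans (congrArg (s m) hf)).symm } }

@[simp] lemma lift_π (s : ∀ n (_ : N.obj n), Z ⟶ Y.obj n) (h) {n : SimplexCategoryᵒᵖ}
    (σ : N.obj n) : lift s h ≫ π σ = s n σ :=
  limit.lift_π _ _

lemma hom_ext {f g : Z ⟶ Power N Y} (h : ∀ n (σ : N.obj n), f ≫ π σ = g ≫ π σ) : f = g :=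
  limit.hom_ext fun p => h p.1 p.2

end Power

end Power

/-! ### The right adjoint of `𝔰`: the necklace category of chains -/

section Chains

open Functor.LaxMonoidal

variable {V : Type v} [Category.{u} V] [MonoidalCategory V] [HasLimitsOfSize.{u, u} V]

/-- The composition of two elements of a given dimension. -/
abbrev ECat.compAt (C : ECat.{u} (SimplexCategoryᵒᵖ ⥤ V)) (n : SimplexCategoryᵒᵖ) (a b c : C.obj) :
    (a ⟶[SimplexCategoryᵒᵖ ⥤ V] b).obj n ⊗ (b ⟶[SimplexCategoryᵒᵖ ⥤ V] c).obj n ⟶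
      (a ⟶[SimplexCategoryᵒᵖ ⥤ V] c).obj n :=
  (eComp (SimplexCategoryᵒᵖ ⥤ V) a b c).app n

/-- The identity in a given dimension. -/
abbrev ECat.idAt (C : ECat.{u} (SimplexCategoryᵒᵖ ⥤ V)) (n : SimplexCategoryᵒᵖ) (a : C.obj) :
    𝟙_ V ⟶ (a ⟶[SimplexCategoryᵒᵖ ⥤ V] a).obj n :=
  (eId (SimplexCategoryᵒᵖ ⥤ V) a).app n

namespace ECat

variable (C : ECat.{u} (SimplexCategoryᵒᵖ ⥤ V)) {n m : SimplexCategoryᵒᵖ} (a b c d : C.obj)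

lemma compAt_map (g : n ⟶ m) :
    C.compAt n a b c ≫ (a ⟶[SimplexCategoryᵒᵖ ⥤ V] c).map g =
      ((a ⟶[SimplexCategoryᵒᵖ ⥤ V] b).map g ⊗ₘ (b ⟶[SimplexCategoryᵒᵖ ⥤ V] c).map g) ≫
        C.compAt m a b c :=
  ((eComp (SimplexCategoryᵒᵖ ⥤ V) a b c).naturality g).symm

lemma idAt_map (g : n ⟶ m) :
    C.idAt n a ≫ (a ⟶[SimplexCategoryᵒᵖ ⥤ V] a).map g = C.idAt m a :=
  ((eId (SimplexCategoryᵒᵖ ⥤ V) a).naturality g).symm.trans (Category.id_comp _)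

lemma compAt_assoc :
    C.compAt n a b c ▷ _ ≫ C.compAt n a c d =
      (α_ _ _ _).hom ≫ _ ◁ C.compAt n b c d ≫ C.compAt n a b d :=
  ((Iso.inv_comp_eq _).1 (congrArg (fun z => NatTrans.app z n)
    (e_assoc (SimplexCategoryᵒᵖ ⥤ V) a b c d)))

lemma idAt_compAt :
    C.idAt n a ▷ _ ≫ C.compAt n a a b = (λ_ _).hom :=
  ((Iso.inv_comp_eq _).1 (congrArg (fun z => NatTrans.app z n)
    (e_id_comp (SimplexCategoryᵒᵖ ⥤ V) a b))).trans (Category.comp_id _)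

lemma compAt_idAt :
    _ ◁ C.idAt n b ≫ C.compAt n a b b = (ρ_ _).hom :=
  ((Iso.inv_comp_eq _).1 (congrArg (fun z => NatTrans.app z n)
    (e_comp_id (SimplexCategoryᵒᵖ ⥤ V) a b))).trans (Category.comp_id _)

lemma chainsK_aux {T U : Nec} (g : T ⟶ U) (f : n ⟶ m) (σ : (necNerve.{u}.obj T).obj n) :
    Power.π (Y := a ⟶[SimplexCategoryᵒᵖ ⥤ V] b) ((necNerve.map g).app n σ) ≫
        (a ⟶[SimplexCategoryᵒᵖ ⥤ V] b).map f =
      Power.π ((necNerve.map g).app m ((necNerve.obj T).map f σ)) := by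
  rw [Power.w]
  exact congrArg Power.π (ConcreteCategory.congr_hom ((necNerve.map g).naturality f) σ).symm

/-- The functor `T ↦ Map(N(P_T), C(a, b))`. -/
@[reducible]
def chainsK : Necᵒᵖ ⥤ V where
  obj T := Power (necNerve.{u}.obj T.unop) (a ⟶[SimplexCategoryᵒᵖ ⥤ V] b)
  map g := Power.lift (fun n σ => Power.π ((necNerve.map g.unop).app n σ))
    (C.chainsK_aux a b g.unop)
  map_id T := Power.hom_ext fun n σ => by
    rw [Power.lift_π, Category.id_comp]
    exact congrArg Power.π (ConcreteCategory.congr_hom (congrArg (fun z => NatTrans.app z n)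
      (necNerve.map_id T.unop)) σ)
  map_comp f g := Power.hom_ext fun n σ => by
    rw [Power.lift_π, Category.assoc, Power.lift_π, Power.lift_π]
    exact congrArg Power.π (ConcreteCategory.congr_hom (congrArg (fun z => NatTrans.app z n)
      (necNerve.map_comp g.unop f.unop)) σ)

lemma chainsK_map_π {T U : Nec} (g : T ⟶ U) (σ : (necNerve.{u}.obj T).obj n) :
    (C.chainsK a b).map g.op ≫ Power.π σ = Power.π ((necNerve.map g).app n σ) :=
  (congrArg (· ≫ _) rfl).trans (Power.lift_π (N := necNerve.{u}.obj T)
    (fun n σ => Power.π ((necNerve.map g).app n σ)) (C.chainsK_aux a b g) σ)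

/-- The composition law of `chainsK`. -/
def chainsM (T U : Nec) :
    (C.chainsK a b).obj (op T) ⊗ (C.chainsK b c).obj (op U) ⟶ (C.chainsK a c).obj (op (T ⊗ U)) :=
  -- A chain of vertex sets of a join is a pair of chains, and the product takes the values on the
  -- two halves and composes them in `C`.
  Power.lift (fun n σ => (Power.π (necFst σ) ⊗ₘ Power.π (necSnd σ)) ≫ C.compAt n a b c)
    fun f σ => by
      rw [Category.assoc, compAt_map, tensorHom_comp_tensorHom_assoc, Power.w, Power.w]
      rfl

lemma chainsM_π (T U : Nec) (σ : (necNerve.{u}.obj T).obj n) (τ : (necNerve.{u}.obj U).obj n) :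
    C.chainsM a b c T U ≫ Power.π (necJoin σ τ) =
      (Power.π σ ⊗ₘ Power.π τ) ≫ C.compAt n a b c := by
  refine (Power.lift_π _ _ _).trans ?_
  rw [necFst_necJoin, necSnd_necJoin]

/-- The identities of `chainsK`. -/
def chainsE : 𝟙_ V ⟶ (C.chainsK a a).obj (op (𝟙_ Nec)) :=
  Power.lift (fun n _ => C.idAt n a) fun f _ => C.idAt_map a f

lemma chainsE_π (σ : (necNerve.{u}.obj (𝟙_ Nec)).obj n) :
    C.chainsE a ≫ Power.π σ = C.idAt n a :=
  Power.lift_π _ _ _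

/-- The family of composition laws on the objects `Map(N(P_T), C(a, b))`. -/
@[reducible]
def chains : DayCat Nec V C.obj where
  K := C.chainsK
  m := C.chainsM
  e := C.chainsE
  -- Every chain on a join of necklaces is the join of two chains, so each law is tested on such
  -- chains, where naturality is immediate and the other laws become those of `C`.
  nat a b c T T' U U' f g := Power.hom_ext fun n σ => by
    obtain ⟨τ, ρ, rfl⟩ := exists_necJoin σ
    rw [Category.assoc, Category.assoc, chainsM_π, chainsK_map_π, necJoin_natural, chainsM_π,
      tensorHom_comp_tensorHom_assoc, chainsK_map_π, chainsK_map_π]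
  assoc a b c d T U X := Power.hom_ext fun n σ => by
    obtain ⟨τ, ρ, rfl⟩ := exists_necJoin σ
    obtain ⟨τ, τ', rfl⟩ := exists_necJoin τ
    rw [Category.assoc, Category.assoc, Category.assoc, Category.assoc, chainsM_π, chainsK_map_π,
      necJoin_assoc, chainsM_π, ← tensorHom_id, ← id_tensorHom, tensorHom_comp_tensorHom_assoc,
      tensorHom_comp_tensorHom_assoc, chainsM_π, chainsM_π, Category.id_comp, Category.id_comp,
      ← Category.comp_id (Power.π ρ), ← tensorHom_comp_tensorHom, tensorHom_id, Category.assoc,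
      compAt_assoc, associator_naturality_assoc, ← Category.comp_id (Power.π τ),
      ← tensorHom_comp_tensorHom, Category.comp_id, id_tensorHom, Category.assoc, Category.comp_id]
  left a b T := Power.hom_ext fun n σ => by
    obtain ⟨τ, ρ, rfl⟩ := exists_necJoin σ
    obtain rfl := eq_necUnit τ
    rw [Category.assoc, Category.assoc, chainsK_map_π, chainsM_π, necJoin_left, ← tensorHom_id,
      tensorHom_comp_tensorHom_assoc, chainsE_π, Category.id_comp,
      MonoidalCategory.tensorHom_def', Category.assoc, idAt_compAt, leftUnitor_naturality]
  right a b T := Power.hom_ext fun n σ => by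
    obtain ⟨τ, ρ, rfl⟩ := exists_necJoin σ
    obtain rfl := eq_necUnit ρ
    rw [Category.assoc, Category.assoc, chainsK_map_π, chainsM_π, necJoin_right, ← id_tensorHom,
      tensorHom_comp_tensorHom_assoc, chainsE_π, Category.id_comp,
      MonoidalCategory.tensorHom_def, Category.assoc, compAt_idAt, rightUnitor_naturality]

end ECat
end Chains
end

noncomputable section

/-! ### Functors out of the realization and the adjunction `𝔰 ⊣ 𝔫` -/

section Realize

open Functor.LaxMonoidal

variable {V : Type v} [Category.{u} V] [MonoidalCategory V] [HasColimitsOfSize.{u, u} V]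
  [MonoidalClosed V] [BraidedCategory V]

/-- The data of a functor from the realization of a necklace category to an enriched category. -/
structure RealData (A : NecCat V) (C : ECat.{u} (SimplexCategoryᵒᵖ ⥤ V)) where
  f : A.S → C.obj
  ζ : ∀ (a b : A.S) (T : Nec) (n : SimplexCategoryᵒᵖ) (_ : (necNerve.{u}.obj T).obj n),
    (A.C.obj (op T)).obj a b ⟶ (f a ⟶[SimplexCategoryᵒᵖ ⥤ V] f b).obj n
  ζ_map : ∀ (a b : A.S) (T : Nec) {n m : SimplexCategoryᵒᵖ} (g : n ⟶ m)
    (σ : (necNerve.{u}.obj T).obj n),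
    ζ a b T n σ ≫ (f a ⟶[SimplexCategoryᵒᵖ ⥤ V] f b).map g = ζ a b T m ((necNerve.obj T).map g σ)
  map_ζ : ∀ (a b : A.S) {T U : Nec} (g : T ⟶ U) (n : SimplexCategoryᵒᵖ)
    (σ : (necNerve.{u}.obj T).obj n),
    (A.C.map g.op).app a b ≫ ζ a b T n σ = ζ a b U n ((necNerve.map g).app n σ)
  unit : ∀ (a : A.S) (n : SimplexCategoryᵒᵖ),
    A.one a ≫ ζ a a (𝟙_ Nec) n (necUnit n) = C.idAt n (f a)
  mul : ∀ (a b c : A.S) (T U : Nec) (n : SimplexCategoryᵒᵖ) (σ : (necNerve.{u}.obj T).obj n)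
    (τ : (necNerve.{u}.obj U).obj n),
    A.comp a b c T U ≫ ζ a c (T ⊗ U) n (necJoin σ τ) =
      (ζ a b T n σ ⊗ₘ ζ b c U n τ) ≫ C.compAt n (f a) (f b) (f c)

namespace RealData

variable {A A' : NecCat V} {C : ECat.{u} (SimplexCategoryᵒᵖ ⥤ V)}

lemma ext_same {f : A.S → C.obj} {ζ ζ' h1 h2 h3 h4 h1' h2' h3' h4'}
    (h : ∀ a b T n σ, ζ a b T n σ = ζ' a b T n σ) :
    RealData.mk (A := A) (C := C) f ζ h1 h2 h3 h4 = RealData.mk f ζ' h1' h2' h3' h4' := by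
  obtain rfl : ζ = ζ' := by
    funext a b T n σ
    exact h a b T n σ
  rfl

section
variable [HasLimitsOfSize.{u, u} V]

/-- The morphism to the object of chains given by the components of `ζ`. -/
def lift (r : RealData A C) (a b : A.S) (T : Nec) :
    (A.C.obj (op T)).obj a b ⟶ (C.chainsK (r.f a) (r.f b)).obj (op T) :=
  Power.lift (fun n σ => r.ζ a b T n σ) fun g σ => r.ζ_map a b T g σ

lemma lift_π (r : RealData A C) (a b : A.S) (T : Nec) {n : SimplexCategoryᵒᵖ}
    (σ : (necNerve.{u}.obj T).obj n) : r.lift a b T ≫ Power.π σ = r.ζ a b T n σ :=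
  Power.lift_π _ _ _

lemma lift_natural (r : RealData A C) (a b : A.S) {T U : Nec} (g : T ⟶ U) :
    (A.C.map g.op).app a b ≫ r.lift a b T = r.lift a b U ≫ (C.chainsK _ _).map g.op :=
  Power.hom_ext fun n σ => by
    rw [Category.assoc, Category.assoc, lift_π, r.map_ζ, C.chainsK_map_π, lift_π]

lemma one_lift (r : RealData A C) (a : A.S) :
    A.one a ≫ r.lift a a (𝟙_ Nec) = C.chainsE (r.f a) :=
  Power.hom_ext fun n σ => by
    obtain rfl := eq_necUnit σ
    rw [Category.assoc, lift_π, r.unit, C.chainsE_π]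

lemma comp_lift (r : RealData A C) (a b c : A.S) (T U : Nec) :
    A.comp a b c T U ≫ r.lift a c (T ⊗ U) =
      (r.lift a b T ⊗ₘ r.lift b c U) ≫ C.chainsM (r.f a) (r.f b) (r.f c) T U :=
  Power.hom_ext fun n σ => by
    obtain ⟨τ, ρ, rfl⟩ := exists_necJoin σ
    rw [Category.assoc, Category.assoc, lift_π, r.mul, C.chainsM_π,
      tensorHom_comp_tensorHom_assoc, lift_π, lift_π]

/-- The functor to the necklace category of chains. -/
def toChains (r : RealData A C) : NecCat.Hom A C.chains.toNecCat :=
  .ofComp (B := C.chains.toNecCat) r.f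
    { app T := ⟨fun a b => r.lift a b T.unop⟩
      naturality T U g := by
        ext a b
        exact r.lift_natural a b g.unop }
    (fun a => (r.one_lift a).trans (C.chains.toNecCat_one (r.f a)).symm)
    (fun a b c T U => (r.comp_lift a b c T U).trans
      (congrArg (_ ≫ ·) (C.chains.toNecCat_comp (r.f a) (r.f b) (r.f c) T U).symm))

/-- The data underlying a functor to the necklace category of chains. -/
def ofChains (φ : NecCat.Hom A C.chains.toNecCat) : RealData A C where
  f := φ.f
  ζ a b T n σ := (φ.α.app (op T)).app a b ≫ Power.π σ
  ζ_map a b T n m g σ := (Category.assoc _ _ _).trans (congrArg (_ ≫ ·) (Power.w g σ))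
  map_ζ a b T U g n σ := by
    have h := congrArg (fun z => VQuiv.Hom.app z a b) (φ.α.naturality g.op)
    refine (Category.assoc _ _ _).symm.trans ((congrArg (· ≫ _) h).trans ?_)
    exact (Category.assoc _ _ _).trans (congrArg (_ ≫ ·) (C.chainsK_map_π _ _ g σ))
  unit a n := by
    refine (Category.assoc _ _ _).symm.trans ((congrArg (· ≫ _) (φ.map_one a)).trans ?_)
    exact ((congrArg (· ≫ _) (C.chains.toNecCat_one (φ.f a))).trans (C.chainsE_π _ _))
  mul a b c T U n σ τ := by
    refine (Category.assoc _ _ _).symm.trans ((congrArg (· ≫ _) (φ.map_comp a b c T U)).trans ?_)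
    refine (Category.assoc _ _ _).trans ?_
    refine (congrArg (_ ≫ ·) ((congrArg (· ≫ _)
      (C.chains.toNecCat_comp (φ.f a) (φ.f b) (φ.f c) T U)).trans
        (C.chainsM_π _ _ _ _ _ _ _))).trans ?_
    exact tensorHom_comp_tensorHom_assoc _ _ _ _ _

/-- Functors to the necklace category of chains are given by the data of `RealData`. -/
def equivChains (A : NecCat V) (C : ECat.{u} (SimplexCategoryᵒᵖ ⥤ V)) :
    RealData A C ≃ (A ⟶ C.chains.toNecCat) where
  toFun := toChains
  invFun := ofChains
  left_inv r := ext_same r.lift_π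
  right_inv φ := NecCat.Hom.ext_same (h1' := NecCat.Hom.unit φ) (h2' := NecCat.Hom.mul φ)
    fun T a b => Power.hom_ext fun _ σ => (ofChains φ).lift_π a b T.unop σ

end

/-- The composition law of the realization in a given dimension. -/
def compAt (A : NecCat V) (a b c : A.S) (n : SimplexCategoryᵒᵖ) :
    (A.toDay.hom (freeNecNerve V) a b).obj n ⊗ (A.toDay.hom (freeNecNerve V) b c).obj n ⟶
      (A.toDay.hom (freeNecNerve V) a c).obj n :=
  (A.toDay.comp (freeNecNerve V) a b c).app n

/-- The value of a functor of necklace categories on a hom-object. -/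
def homAt (φ : NecCat.Hom A A') (a b : A.S) (T : Nec) :
    (A.C.obj (op T)).obj a b ⟶ (A'.C.obj (op T)).obj (φ.f a) (φ.f b) :=
  (φ.α.app (op T)).app a b

/-- The coprojections of the hom-objects of the realization in a given dimension. -/
def ιAt (A : NecCat V) (a b : A.S) (T : Nec) (n : SimplexCategoryᵒᵖ) :
    (A.C.obj (op T)).obj a b ⊗ (freeObj V).obj ((necNerve.{u}.obj T).obj n) ⟶
      (A.toDay.hom (freeNecNerve V) a b).obj n :=
  (A.toDay.ι (freeNecNerve V) a b T).app n

lemma ιAt_map (a b : A.S) (T : Nec) {n m : SimplexCategoryᵒᵖ} (g : n ⟶ m) :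
    ιAt A a b T n ≫ (A.toDay.hom (freeNecNerve V) a b).map g =
      _ ◁ (freeObj V).map ((necNerve.obj T).map g) ≫ ιAt A a b T m :=
  ((A.toDay.ι (freeNecNerve V) a b T).naturality g).symm.trans
    (congrArg (· ≫ _) (id_tensorHom _ _))

lemma map_ιAt (a b : A.S) {T U : Nec} (g : T ⟶ U) (n : SimplexCategoryᵒᵖ) :
    (A.C.map g.op).app a b ▷ _ ≫ ιAt A a b T n =
      _ ◁ (freeObj V).map ((necNerve.map g).app n) ≫ ιAt A a b U n :=
  (congrArg (· ≫ _) (tensorHom_id _ _)).symm.trans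
    ((congrArg (fun z => NatTrans.app z n) (A.toDay.ι_cond (freeNecNerve V) a b g)).trans
      (congrArg (· ≫ _) (id_tensorHom _ _)))

lemma ιAt_one (a : A.S) (n : SimplexCategoryᵒᵖ) :
    (A.toDay.one (freeNecNerve V) a).app n =
      ((λ_ (𝟙_ V)).inv ≫ (A.one a ⊗ₘ fι (necUnit n))) ≫ ιAt A a a (𝟙_ Nec) n :=
  congrArg (fun z => ((λ_ (𝟙_ V)).inv ≫ (A.one a ⊗ₘ z)) ≫ ιAt A a a (𝟙_ Nec) n)
    (fι_map (V := V) (necNerveε.{u}.app n) PUnit.unit)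

lemma ιAt_comp (a b c : A.S) (T U : Nec) (n : SimplexCategoryᵒᵖ) :
    (ιAt A a b T n ⊗ₘ ιAt A b c U n) ≫ compAt A a b c n =
      (tensorμ _ _ _ _ ≫ (A.comp a b c T U ⊗ₘ
        (freeμ _ _ ≫ (freeObj V).map ((necNerveμ T U).app n)))) ≫ ιAt A a c (T ⊗ U) n :=
  congrArg (fun z => NatTrans.app z n) (A.toDay.ι_comp (freeNecNerve V) a b c T U)

lemma ιAt_toDay_map (φ : NecCat.Hom A A') (a b : A.S) (T : Nec) (n : SimplexCategoryᵒᵖ) :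
    ιAt A a b T n ≫ (φ.toDay.map (freeNecNerve V) a b).app n =
      homAt φ a b T ▷ _ ≫ ιAt A' (φ.f a) (φ.f b) T n :=
  (congrArg (fun z => NatTrans.app z n) (φ.toDay.ι_map (freeNecNerve V) a b T)).trans
    (congrArg (· ≫ _) (tensorHom_id _ _))

lemma ιAt_hom_ext {a b : A.S} {n : SimplexCategoryᵒᵖ} {Z : V}
    {f g : (A.toDay.hom (freeNecNerve V) a b).obj n ⟶ Z}
    (h : ∀ T, ιAt A a b T n ≫ f = ιAt A a b T n ≫ g) : f = g :=
  coend_map_hom_ext (A.toDay.bi (freeNecNerve V) a b) ((evaluation SimplexCategoryᵒᵖ V).obj n) h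

/-- The generalized element of a hom-object of the realization given by a chain of vertex sets. -/
def elem (A : NecCat V) (a b : A.S) (T : Nec) (n : SimplexCategoryᵒᵖ)
    (σ : (necNerve.{u}.obj T).obj n) :
    (A.C.obj (op T)).obj a b ⟶ (A.toDay.hom (freeNecNerve V) a b).obj n :=
  (ρ_ _).inv ≫ ((A.C.obj (op T)).obj a b ◁ fι σ) ≫ ιAt A a b T n

/-- The hom-object is covered by the summands `A_T ⊗ F(N(P_T)_n)`. As `F` is a coproduct of units,
which tensoring preserves, each summand is covered by copies of `A_T`, one for each chain. -/
lemma elem_hom_ext {a b : A.S} {n : SimplexCategoryᵒᵖ} {Z : V}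
    {f g : (A.toDay.hom (freeNecNerve V) a b).obj n ⟶ Z}
    (h : ∀ T σ, elem A a b T n σ ≫ f = elem A a b T n σ ≫ g) : f = g := by
  refine ιAt_hom_ext fun T => free_hom_ext_left fun σ => ?_
  have h := h T σ
  unfold elem at h
  rwa [Category.assoc, Category.assoc, Category.assoc, Category.assoc, cancel_epi] at h

lemma elem_map (a b : A.S) (T : Nec) {n m : SimplexCategoryᵒᵖ} (g : n ⟶ m)
    (σ : (necNerve.{u}.obj T).obj n) :
    elem A a b T n σ ≫ (A.toDay.hom (freeNecNerve V) a b).map g =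
      elem A a b T m ((necNerve.obj T).map g σ) := by
  unfold elem
  rw [Category.assoc, Category.assoc, ιAt_map, ← whiskerLeft_comp_assoc, fι_map]

lemma map_elem (a b : A.S) {T U : Nec} (g : T ⟶ U) (n : SimplexCategoryᵒᵖ)
    (σ : (necNerve.{u}.obj T).obj n) :
    (A.C.map g.op).app a b ≫ elem A a b T n σ = elem A a b U n ((necNerve.map g).app n σ) := by
  unfold elem
  rw [rightUnitor_inv_naturality_assoc, ← whisker_exchange_assoc, map_ιAt,
    ← whiskerLeft_comp_assoc, fι_map]

lemma one_elem (a : A.S) (n : SimplexCategoryᵒᵖ) :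
    A.one a ≫ elem A a a (𝟙_ Nec) n (necUnit n) = (A.toDay.one (freeNecNerve V) a).app n := by
  refine Eq.trans ?_ (ιAt_one a n).symm
  rw [MonoidalCategory.tensorHom_def, Category.assoc, Category.assoc,
    unitors_inv_equal]
  unfold elem
  rw [rightUnitor_inv_naturality_assoc]

/-- Composition in the realization first interchanges necklace factors and simplicial factors. On
elements the simplicial factors are units, so the interchange reduces to unitors
(`rightUnitor_monoidal`) and only `m` and the product of `s` and `t` remain. -/
lemma tensorμ_elem {X Y Z P Q R : V} (m : X ⊗ Y ⟶ Z) {s : 𝟙_ V ⟶ P} {t : 𝟙_ V ⟶ Q} {r : 𝟙_ V ⟶ R}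
    {k : P ⊗ Q ⟶ R} (h : (s ⊗ₘ t) ≫ k = (λ_ _).hom ≫ r) :
    (((ρ_ X).inv ≫ X ◁ s) ⊗ₘ ((ρ_ Y).inv ≫ Y ◁ t)) ≫ tensorμ _ _ _ _ ≫ (m ⊗ₘ k) =
      m ≫ (ρ_ Z).inv ≫ Z ◁ r := by
  have h2 : ((ρ_ X).inv ⊗ₘ (ρ_ Y).inv) ≫ tensorμ _ _ _ _ = (ρ_ _).inv ≫ _ ◁ (λ_ (𝟙_ V)).inv := by
    rw [← cancel_mono (_ ◁ (λ_ (𝟙_ V)).hom ≫ (ρ_ _).hom), Category.assoc, ← rightUnitor_monoidal]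
    simp
  rw [← tensorHom_comp_tensorHom_assoc, ← id_tensorHom, ← id_tensorHom, tensorμ_natural_assoc,
    tensorHom_comp_tensorHom, h, id_tensorHom_id, Category.id_comp, reassoc_of% h2,
    rightUnitor_inv_naturality_assoc, ← whisker_exchange, ← id_tensorHom, tensorHom_comp_tensorHom,
    Iso.inv_hom_id_assoc, Category.id_comp, MonoidalCategory.tensorHom_def']

/-- The simplicial part multiplies summands of `F` by joining chains, which is `h1`; the interchange
is taken care of by `tensorμ_elem`. -/
lemma comp_elem (a b c : A.S) (T U : Nec) (n : SimplexCategoryᵒᵖ)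
    (σ : (necNerve.{u}.obj T).obj n) (τ : (necNerve.{u}.obj U).obj n) :
    A.comp a b c T U ≫ elem A a c (T ⊗ U) n (necJoin σ τ) =
      (elem A a b T n σ ⊗ₘ elem A b c U n τ) ≫ compAt A a b c n := by
  have h0 : fι (V := V) (A := (necNerve.{u}.obj T).obj n × (necNerve.{u}.obj U).obj n) (σ, τ) ≫
      (freeObj V).map ((necNerveμ T U).app n) = fι (necJoin σ τ) := fι_map _ _
  have h1 : (fι σ ⊗ₘ fι τ) ≫ freeμ _ _ ≫ (freeObj V).map ((necNerveμ T U).app n) =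
      (λ_ _).hom ≫ fι (necJoin σ τ) :=
    (fι_freeμ_assoc _ _ _).trans (congrArg (_ ≫ ·) h0)
  have h2 := tensorμ_elem (A.comp a b c T U) h1
  unfold elem
  rw [← Category.assoc (ρ_ _).inv (_ ◁ fι σ), ← Category.assoc (ρ_ _).inv (_ ◁ fι τ),
    ← tensorHom_comp_tensorHom_assoc, ιAt_comp]
  refine Eq.trans ?_ ((congrArg (· ≫ ιAt A a c (T ⊗ U) n) h2).symm.trans (Category.assoc _ _ _))
  simp only [Category.assoc]

lemma elem_toDay_map (φ : NecCat.Hom A A') (a b : A.S) (T : Nec) (n : SimplexCategoryᵒᵖ)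
    (σ : (necNerve.{u}.obj T).obj n) :
    elem A a b T n σ ≫ (φ.toDay.map (freeNecNerve V) a b).app n =
      homAt φ a b T ≫ elem A' (φ.f a) (φ.f b) T n σ := by
  unfold elem
  rw [rightUnitor_inv_naturality_assoc, Category.assoc, Category.assoc, ιAt_toDay_map,
    whisker_exchange_assoc]

/-- Tensoring on the left preserves coproducts, so the braiding is used to bring the free factor to
the last position. -/
lemma free_hom_ext_tensor_right {X W Z : V} {B : Type u} {f g : (X ⊗ (freeObj V).obj B) ⊗ W ⟶ Z}
    (h : ∀ b, (X ◁ fι b) ▷ W ≫ f = (X ◁ fι b) ▷ W ≫ g) : f = g := by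
  rw [← cancel_epi (β_ W (X ⊗ (freeObj V).obj B)).hom, ← cancel_epi (α_ W X _).hom]
  refine free_hom_ext_left fun b => ?_
  rw [associator_naturality_right_assoc, associator_naturality_right_assoc,
    BraidedCategory.braiding_naturality_right_assoc,
    BraidedCategory.braiding_naturality_right_assoc, h]

lemma free_hom_ext_tensor_left {Y W Z : V} {B : Type u} {f g : W ⊗ (Y ⊗ (freeObj V).obj B) ⟶ Z}
    (h : ∀ b, W ◁ Y ◁ fι b ≫ f = W ◁ Y ◁ fι b ≫ g) : f = g := by
  rw [← cancel_epi (α_ W Y _).hom]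
  refine free_hom_ext_left fun b => ?_
  rw [associator_naturality_right_assoc, associator_naturality_right_assoc, h]

variable (A) in
-- The version of `elem_hom_ext` in two variables, for checking compatibility with composition: both
-- coends and both coproducts are preserved by the tensor product.
lemma compAt_hom_ext {a b c : A.S} {n : SimplexCategoryᵒᵖ} {Z : V}
    {f g : (A.toDay.hom (freeNecNerve V) a b).obj n ⊗ (A.toDay.hom (freeNecNerve V) b c).obj n ⟶ Z}
    (h : ∀ T U σ τ, (elem A a b T n σ ⊗ₘ elem A b c U n τ) ≫ f =
      (elem A a b T n σ ⊗ₘ elem A b c U n τ) ≫ g) : f = g := by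
  have key : ∀ T U, (ιAt A a b T n ⊗ₘ ιAt A b c U n) ≫ f =
      (ιAt A a b T n ⊗ₘ ιAt A b c U n) ≫ g := fun T U => by
    refine free_hom_ext_tensor_right fun σ => free_hom_ext_tensor_left fun τ => ?_
    have h := h T U σ τ
    unfold elem at h
    rw [← tensorHom_comp_tensorHom_assoc, ← tensorHom_comp_tensorHom_assoc,
      ← tensorHom_comp_tensorHom_assoc, ← tensorHom_comp_tensorHom_assoc, cancel_epi,
      MonoidalCategory.tensorHom_def', Category.assoc, Category.assoc] at h
    exact h
  refine coend_map_hom_ext (A.toDay.bi (freeNecNerve V) a b)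
    ((evaluation SimplexCategoryᵒᵖ V).obj n ⋙ tensorRight _) fun T => ?_
  refine coend_map_hom_ext (A.toDay.bi (freeNecNerve V) b c)
    ((evaluation SimplexCategoryᵒᵖ V).obj n ⋙ tensorLeft _) fun U => ?_
  have := key T U
  rw [MonoidalCategory.tensorHom_def', Category.assoc, Category.assoc] at this
  exact this

section

variable (Ψ : (realize V).obj A ⟶ C)

/-- The morphism on hom-objects in a given dimension of a functor on the realization. -/
def mapAt (a b : A.S) (n : SimplexCategoryᵒᵖ) :
    (A.toDay.hom (freeNecNerve V) a b).obj n ⟶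
      (EnrichedFunctor.obj Ψ a ⟶[SimplexCategoryᵒᵖ ⥤ V] EnrichedFunctor.obj Ψ b).obj n :=
  (EnrichedFunctor.map Ψ a b).app n

lemma mapAt_map (a b : A.S) {n m : SimplexCategoryᵒᵖ} (g : n ⟶ m) :
    mapAt Ψ a b n ≫ (EnrichedFunctor.obj Ψ a ⟶[SimplexCategoryᵒᵖ ⥤ V]
        EnrichedFunctor.obj Ψ b : SimplexCategoryᵒᵖ ⥤ V).map g =
      (A.toDay.hom (freeNecNerve V) a b).map g ≫ mapAt Ψ a b m :=
  ((EnrichedFunctor.map Ψ a b).naturality g).symm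

lemma one_mapAt (a : A.S) (n : SimplexCategoryᵒᵖ) :
    (A.toDay.one (freeNecNerve V) a).app n ≫ mapAt Ψ a a n = C.idAt n _ :=
  congrArg (fun z => NatTrans.app z n) (EnrichedFunctor.map_id Ψ a)

lemma compAt_mapAt (a b c : A.S) (n : SimplexCategoryᵒᵖ) :
    compAt A a b c n ≫ mapAt Ψ a c n = (mapAt Ψ a b n ⊗ₘ mapAt Ψ b c n) ≫ C.compAt n _ _ _ :=
  congrArg (fun z => NatTrans.app z n) (EnrichedFunctor.map_comp Ψ a b c)

/-- The data underlying a functor on the realization. -/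
def ofRealize : RealData A C where
  f a := EnrichedFunctor.obj Ψ a
  ζ a b T n σ := elem A a b T n σ ≫ mapAt Ψ a b n
  ζ_map a b T n m g σ := by rw [Category.assoc, mapAt_map, ← Category.assoc, elem_map]
  map_ζ a b T U g n σ := by rw [← Category.assoc, map_elem]
  unit a n := by rw [← Category.assoc, one_elem, one_mapAt]
  mul a b c T U n σ τ := by
    rw [← Category.assoc, comp_elem, Category.assoc, compAt_mapAt, tensorHom_comp_tensorHom_assoc]

end

section

variable (r : RealData A C)

/-- The summand of `desc` on a necklace. -/
def descAt (a b : A.S) (T : Nec) (n : SimplexCategoryᵒᵖ) :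
    (A.C.obj (op T)).obj a b ⊗ (freeObj V).obj ((necNerve.{u}.obj T).obj n) ⟶
      (r.f a ⟶[SimplexCategoryᵒᵖ ⥤ V] r.f b).obj n :=
  tensorSigmaDesc fun σ => (ρ_ _).hom ≫ r.ζ a b T n σ

lemma fι_descAt (a b : A.S) (T : Nec) (n : SimplexCategoryᵒᵖ) (σ : (necNerve.{u}.obj T).obj n) :
    _ ◁ fι σ ≫ r.descAt a b T n = (ρ_ _).hom ≫ r.ζ a b T n σ :=
  ι_tensorSigmaDesc _ _

lemma descAt_map (a b : A.S) (T : Nec) {n m : SimplexCategoryᵒᵖ} (g : n ⟶ m) :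
    r.descAt a b T n ≫ (r.f a ⟶[SimplexCategoryᵒᵖ ⥤ V] r.f b).map g =
      _ ◁ (freeObj V).map ((necNerve.obj T).map g) ≫ r.descAt a b T m :=
  free_hom_ext_left fun σ => by
    rw [← Category.assoc, fι_descAt, Category.assoc, ζ_map, ← whiskerLeft_comp_assoc, fι_map,
      fι_descAt]

lemma map_descAt (a b : A.S) {T U : Nec} (g : T ⟶ U) (n : SimplexCategoryᵒᵖ) :
    (A.C.map g.op).app a b ▷ _ ≫ r.descAt a b T n =
      _ ◁ (freeObj V).map ((necNerve.map g).app n) ≫ r.descAt a b U n :=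
  free_hom_ext_left fun σ => by
    rw [whisker_exchange_assoc, fι_descAt, ← whiskerLeft_comp_assoc, fι_map, fι_descAt,
      rightUnitor_naturality_assoc, map_ζ]

/-- The morphism out of the coend given by the components of `ζ`. -/
def desc (a b : A.S) :
    A.toDay.hom (freeNecNerve V) a b ⟶ (r.f a ⟶[SimplexCategoryᵒᵖ ⥤ V] r.f b) :=
  coend.desc (F := A.toDay.bi (freeNecNerve V) a b) (fun T =>
    { app n := r.descAt a b T n
      naturality _ _ g :=
        (congrArg (· ≫ _) (id_tensorHom _ _)).trans (r.descAt_map a b T g).symm })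
    fun {_ _} g => NatTrans.ext (funext fun n => r.map_descAt a b g n)

lemma ιAt_desc (a b : A.S) (T : Nec) (n : SimplexCategoryᵒᵖ) :
    ιAt A a b T n ≫ (r.desc a b).app n = r.descAt a b T n :=
  congrArg (fun z => NatTrans.app z n) (coend.ι_desc (F := A.toDay.bi (freeNecNerve V) a b) _ _ T)

lemma elem_desc (a b : A.S) (T : Nec) (n : SimplexCategoryᵒᵖ)
    (σ : (necNerve.{u}.obj T).obj n) :
    elem A a b T n σ ≫ (r.desc a b).app n = r.ζ a b T n σ := by
  unfold elem
  rw [Category.assoc, Category.assoc, ιAt_desc, fι_descAt, Iso.inv_hom_id_assoc]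

lemma one_desc (a : A.S) :
    A.toDay.one (freeNecNerve V) a ≫ r.desc a a = eId (SimplexCategoryᵒᵖ ⥤ V) (r.f a) :=
  NatTrans.ext (funext fun n => by
    refine (congrArg (· ≫ _) (one_elem a n).symm).trans ((Category.assoc _ _ _).trans ?_)
    exact (congrArg (_ ≫ ·) (r.elem_desc _ _ _ _ _)).trans (r.unit a n))

lemma comp_desc (a b c : A.S) :
    A.toDay.comp (freeNecNerve V) a b c ≫ r.desc a c =
      (r.desc a b ⊗ₘ r.desc b c) ≫ eComp (SimplexCategoryᵒᵖ ⥤ V) (r.f a) (r.f b) (r.f c) :=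
  NatTrans.ext (funext fun n => compAt_hom_ext A fun T U σ τ => by
    refine (Category.assoc _ _ _).symm.trans ?_
    refine (congrArg (· ≫ _) (comp_elem a b c T U n σ τ).symm).trans ?_
    refine (Category.assoc _ _ _).trans ((congrArg (_ ≫ ·) (r.elem_desc _ _ _ _ _)).trans ?_)
    refine (r.mul a b c T U n σ τ).trans ?_
    refine Eq.trans ?_ (tensorHom_comp_tensorHom_assoc _ _ _ _ _).symm
    rw [elem_desc, elem_desc])

/-- The functor on the realization given by the data `r`. -/
def toRealize : (realize V).obj A ⟶ C :=
  @EnrichedFunctor.mk (SimplexCategoryᵒᵖ ⥤ V) _ _ A.S A.realization C.obj _ r.f r.desc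
    r.one_desc r.comp_desc

end

/-- Functors on the realization are given by the data of `RealData`. -/
def equivRealize (A : NecCat V) (C : ECat.{u} (SimplexCategoryᵒᵖ ⥤ V)) :
    ((realize V).obj A ⟶ C) ≃ RealData A C where
  toFun := ofRealize
  invFun := toRealize
  left_inv Ψ := @ECat.ext_same (SimplexCategoryᵒᵖ ⥤ V) _ _ A.S C.obj A.realization _ _ _ _ _ _
    (EnrichedFunctor.map_id Ψ) (EnrichedFunctor.map_comp Ψ) fun a b =>
      NatTrans.ext (funext fun n => elem_hom_ext fun T σ => (ofRealize Ψ).elem_desc a b T n σ)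
  right_inv r := ext_same r.elem_desc

lemma ofRealize_map_comp (φ : A ⟶ A') (Ψ : (realize V).obj A' ⟶ C) (a b : A.S) (T : Nec)
    (n : SimplexCategoryᵒᵖ) (σ : (necNerve.{u}.obj T).obj n) :
    (ofRealize ((realize V).map φ ≫ Ψ)).ζ a b T n σ =
      homAt φ a b T ≫ (ofRealize Ψ).ζ (NecCat.Hom.f φ a) (NecCat.Hom.f φ b) T n σ :=
  (Category.assoc _ _ _).symm.trans ((congrArg (· ≫ _) (elem_toDay_map φ a b T n σ)).trans
    (Category.assoc _ _ _))

/-- Expresses naturality in `A` in terms of necklace functors: restricting along `φ` before or after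
passing to chains gives the same data. -/
lemma ofRealize_map [HasLimitsOfSize.{u, u} V] (φ : A ⟶ A') (Ψ : (realize V).obj A' ⟶ C) :
    ofRealize ((realize V).map φ ≫ Ψ) = ofChains (NecCat.Hom.comp φ (toChains (ofRealize Ψ))) :=
  ext_same fun a b T n σ => (ofRealize_map_comp φ Ψ a b T n σ).trans
    ((congrArg (_ ≫ ·) ((ofRealize Ψ).lift_π _ _ T σ).symm).trans (Category.assoc _ _ _).symm)

end RealData

variable (V) in
/-- The functor `𝔰` is left adjoint to the functor of chains. -/
lemma realize_isLeftAdjoint [HasLimitsOfSize.{u, u} V] : (realize V).IsLeftAdjoint :=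
  (Adjunction.adjunctionOfEquivRight (F := realize V) (G_obj := fun C => C.chains.toNecCat)
    (fun A C => (RealData.equivRealize A C).trans (RealData.equivChains A C))
    fun A' _ C φ Ψ => (RealData.equivChains A' C).eq_symm_apply.1
      (RealData.ofRealize_map φ Ψ)).isLeftAdjoint

end Realize
end

/-! ### Functors out of `F̃(K)^nec` as families of points indexed by simplices -/

noncomputable section

open Simplicial SimplexCategory

/-- The composition of simplices of the hom-objects of a simplicially enriched category. -/
def ECat.mulS (E : ECat.{u} SSet.{u}) (k : SimplexCategoryᵒᵖ) (a b c : E.obj)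
    (x : (a ⟶[SSet.{u}] b).obj k) (y : (b ⟶[SSet.{u}] c).obj k) : (a ⟶[SSet.{u}] c).obj k :=
  (eComp SSet.{u} a b c).app k (simplexPair x y)

/-- The identity simplices of the hom-objects of a simplicially enriched category. -/
def ECat.oneS (E : ECat.{u} SSet.{u}) (k : SimplexCategoryᵒᵖ) (a : E.obj) :
    (a ⟶[SSet.{u}] a).obj k :=
  (eId SSet.{u} a).app k PUnit.unit

/-- A family of maps from the hom-objects of the simplices of `K` to a simplicially enriched
category. -/
structure SimpData (K : SSet.{u}) (E : ECat.{u} SSet.{u}) where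
  f : K _⦋0⦌ → E.obj
  v : ∀ (n : ℕ) (a b : K _⦋0⦌) (_ : SimpQuiv K n a b) (k : SimplexCategoryᵒᵖ)
    (_ : (necNerve.{u}.obj (Nec.bead n)).obj k), (f a ⟶[SSet.{u}] f b).obj k
  v_map : ∀ (n : ℕ) (a b : K _⦋0⦌) (x : SimpQuiv K n a b) {k l : SimplexCategoryᵒᵖ} (g : k ⟶ l)
    (σ : (necNerve.{u}.obj (Nec.bead n)).obj k),
    (f a ⟶[SSet.{u}] f b).map g (v n a b x k σ) = v n a b x l ((necNerve.obj _).map g σ)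
  nat : ∀ {m n : FinInt} (g : m ⟶ n) (a b : K _⦋0⦌) (x : SimpQuiv K n.len a b)
    (k : SimplexCategoryᵒᵖ) (σ : (necNerve.{u}.obj (Nec.bead m.len)).obj k),
    v m.len a b (SimpQuiv.res K g a b x) k σ =
      v n.len a b x k ((necNerve.map (Nec.beadMap g)).app k σ)
  comul : ∀ (m n : ℕ) (a c b : K _⦋0⦌) (x : SimpQuiv K (m + n) a b) (y : SimpQuiv K m a c)
    (z : SimpQuiv K n c b) (_ : front K m n x.1 = y.1) (_ : back K m n x.1 = z.1)
    (k : SimplexCategoryᵒᵖ) (σ : (necNerve.{u}.obj (Nec.bead m)).obj k)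
    (τ : (necNerve.{u}.obj (Nec.bead n)).obj k),
    v (m + n) a b x k ((necNerve.map (Nec.join rfl)).app k (necJoin σ τ)) =
      E.mulS k _ _ _ (v m a c y k σ) (v n c b z k τ)
  unit : ∀ (a : K _⦋0⦌) (x : SimpQuiv K 0 a a) (k : SimplexCategoryᵒᵖ),
    v 0 a a x k (necUnit k) = E.oneS k (f a)

lemma SimpData.ext_same {K : SSet.{u}} {E : ECat.{u} SSet.{u}} {f : K _⦋0⦌ → E.obj}
    {v v' h1 h2 h3 h4 h1' h2' h3' h4'} (h : ∀ n a b x k σ, v n a b x k σ = v' n a b x k σ) :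
    SimpData.mk (K := K) (E := E) f v h1 h2 h3 h4 = SimpData.mk f v' h1' h2' h3' h4' := by
  obtain rfl : v = v' := by
    funext n a b x k σ
    exact h n a b x k σ
  rfl

section

open Functor.LaxMonoidal Functor.OplaxMonoidal

variable {V : Type v} [Category.{u} V] [MonoidalCategory V] [HasColimitsOfSize.{u, u} V]
  [MonoidalClosed V] [BraidedCategory V] [HasLimitsOfSize.{u, u} V]
  {K : SSet.{u}} {C : ECat.{u} (SimplexCategoryᵒᵖ ⥤ V)} {f : K _⦋0⦌ → C.obj}

namespace ChainVal

/-- The value of a morphism to an object of chains. -/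
def val {n : FinInt} {T : Nec}
    (θ : (freeQuiv V K).obj (op n) ⟶ (VQuiv.pull V f).obj (C.chains.quiv.obj (op T)))
    {a b : K _⦋0⦌} (x : SimpQuiv K n.len a b) {k : SimplexCategoryᵒᵖ}
    (σ : (necNerve.{u}.obj T).obj k) : 𝟙_ V ⟶ (f a ⟶[SimplexCategoryᵒᵖ ⥤ V] f b).obj k :=
  fι x ≫ θ.app a b ≫ Power.π (Y := (f a ⟶[SimplexCategoryᵒᵖ ⥤ V] f b)) σ

variable {m n : FinInt} {T U : Nec}
    (θ : (freeQuiv V K).obj (op n) ⟶ (VQuiv.pull V f).obj (C.chains.quiv.obj (op T)))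

variable {θ} in
-- The source is a coproduct of units over simplices and the target a limit over chains, so a
-- morphism is a matrix of points indexed by pairs of a simplex and a chain.
lemma hom_ext
    {θ' : (freeQuiv V K).obj (op n) ⟶ (VQuiv.pull V f).obj (C.chains.quiv.obj (op T))}
    (h : ∀ a b (x : SimpQuiv K n.len a b) k (σ : (necNerve.{u}.obj T).obj k),
      val θ x σ = val θ' x σ) : θ = θ' := by
  ext a b
  refine free_hom_ext fun x => Power.hom_ext fun k σ => ?_
  exact (Category.assoc _ _ _).trans ((h a b x k σ).trans (Category.assoc _ _ _).symm)

lemma val_map {a b : K _⦋0⦌} (x : SimpQuiv K n.len a b) {k l : SimplexCategoryᵒᵖ} (g : k ⟶ l)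
    (σ : (necNerve.{u}.obj T).obj k) :
    val θ x σ ≫ (f a ⟶[SimplexCategoryᵒᵖ ⥤ V] f b).map g = val θ x ((necNerve.obj T).map g σ) := by
  refine (Category.assoc _ _ _).trans (congrArg (_ ≫ ·) ?_)
  exact (Category.assoc _ _ _).trans (congrArg (_ ≫ ·) (Power.w g σ))

lemma val_res (g : m ⟶ n) {a b : K _⦋0⦌} (x : SimpQuiv K n.len a b) {k : SimplexCategoryᵒᵖ}
    (θ : (freeQuiv V K).obj (op m) ⟶ (VQuiv.pull V f).obj (C.chains.quiv.obj (op T)))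
    (σ : (necNerve.{u}.obj T).obj k) :
    val ((freeQuiv V K).map g.op ≫ θ) x σ = val θ (SimpQuiv.res K g a b x) σ := by
  have h : fι x ≫ ((freeQuiv V K).map g.op).app a b = fι (SimpQuiv.res K g a b x) := fι_map _ _
  unfold val
  refine (congrArg (_ ≫ ·) (Category.assoc _ _ _)).trans ?_
  exact (Category.assoc _ _ _).symm.trans (congrArg (· ≫ _) h)

lemma val_nec (g : U ⟶ T) {a b : K _⦋0⦌} (x : SimpQuiv K n.len a b) {k : SimplexCategoryᵒᵖ}
    (σ : (necNerve.{u}.obj U).obj k) :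
    val (θ ≫ (VQuiv.pull V f).map (C.chains.quiv.map g.op)) x σ =
      val θ x ((necNerve.map g).app k σ) := by
  unfold val
  refine congrArg (_ ≫ ·) ((Category.assoc _ _ _).trans (congrArg (_ ≫ ·) ?_))
  exact C.chainsK_map_π _ _ g σ

lemma val_unit {a : K _⦋0⦌} (x : SimpQuiv K 0 a a) (k : SimplexCategoryᵒᵖ) :
    val (n := 𝟙_ FinInt) (T := 𝟙_ Nec)
      (η (freeQuiv V K) ≫ ε (VQuiv.pull V f) ≫ (VQuiv.pull V f).map (ε C.chains.quiv)) x
      (necUnit k) = C.idAt k (f a) := by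
  -- A vertex is its own first and last vertex, so `K₀(a, a)` consists of `a` alone.
  have hx : x = ⟨a, vert_zero _ _ _, vert_zero _ _ _⟩ :=
    Subtype.ext ((vert_zero K x.1 0).symm.trans x.2.1)
  have h1 : fι x ≫ (η (freeQuiv V K)).app a a = VQuiv.uι V a := by
    rw [hx]
    exact el_freeη K a (vert_zero _ _ _) (vert_zero _ _ _)
  have h2 := C.chains.uι_quivε (f a)
  unfold val
  refine (congrArg (_ ≫ ·) (Category.assoc _ _ _)).trans ?_
  refine (Category.assoc _ _ _).symm.trans ((congrArg (· ≫ _) h1).trans ?_)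
  refine (congrArg (_ ≫ ·) (Category.assoc _ _ _)).trans ?_
  refine (Category.assoc _ _ _).symm.trans ((congrArg (· ≫ _) (VQuiv.uι_pullε f a)).trans ?_)
  refine (Category.assoc _ _ _).symm.trans ((congrArg (· ≫ _) h2).trans ?_)
  exact C.chainsE_π _ _

/-- The comultiplication of `F̃(K)` sends the generator of `x` to those of its front and back faces,
and the product of chains evaluates its factors on the two halves of the join. The value at a
simplex and a joined chain is thus a composite of two values in `C`. -/
lemma val_comul {a c b : K _⦋0⦌} (x : SimpQuiv K (m.len + n.len) a b) (y : SimpQuiv K m.len a c)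
    (z : SimpQuiv K n.len c b) (hy : front K m.len n.len x.1 = y.1)
    (hz : back K m.len n.len x.1 = z.1) {k : SimplexCategoryᵒᵖ}
    (θ' : (freeQuiv V K).obj (op m) ⟶ (VQuiv.pull V f).obj (C.chains.quiv.obj (op U)))
    (σ : (necNerve.{u}.obj U).obj k) (τ : (necNerve.{u}.obj T).obj k) :
    val (n := m ⊗ n) (T := U ⊗ T) (δ (freeQuiv V K) (op m) (op n) ≫ (θ' ⊗ₘ θ) ≫
        μ (VQuiv.pull V f) _ _ ≫ (VQuiv.pull V f).map (μ C.chains.quiv (op U) (op T))) x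
      (necJoin σ τ) =
      (λ_ (𝟙_ V)).inv ≫ (val θ' y σ ⊗ₘ val θ z τ) ≫ C.compAt k (f a) (f c) (f b) := by
  obtain ⟨y, hya, hyc⟩ := y
  obtain ⟨z, hzc, hzb⟩ := z
  have h1 : fι x ≫ (δ (freeQuiv V K) (op m) (op n)).app a b =
      VQuiv.pr (el K y hya hyc) (el K z hzc hzb) :=
    el_freeδ (V := V) K (m := op m) (n := op n) x.1 hy hz x.2.1 x.2.2 _ _ _ _
  have h2 := VQuiv.pr_tHom (el (V := V) K (n := op m) y hya hyc) (el K (n := op n) z hzc hzb) θ' θ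
  have h3 := VQuiv.pr_pull f (Q := C.chains.quiv.obj (op U)) (P := C.chains.quiv.obj (op T))
    (el (V := V) K (n := op m) y hya hyc ≫ θ'.app a c) (el K (n := op n) z hzc hzb ≫ θ.app c b)
  have h4 := C.chains.tι_quivμ (op U) (op T) (f a) (f c) (f b)
  unfold val
  refine (congrArg (_ ≫ ·) (Category.assoc _ _ _)).trans ?_
  refine (Category.assoc _ _ _).symm.trans ((congrArg (· ≫ _) h1).trans ?_)
  refine (congrArg (_ ≫ ·) (Category.assoc _ _ _)).trans ?_
  refine (Category.assoc _ _ _).symm.trans ((congrArg (· ≫ _) h2).trans ?_)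
  refine (congrArg (_ ≫ ·) (Category.assoc _ _ _)).trans ?_
  refine (Category.assoc _ _ _).symm.trans ((congrArg (· ≫ _) h3).trans ?_)
  refine (Category.assoc _ _ _).trans (congrArg (_ ≫ ·) ((Category.assoc _ _ _).trans ?_))
  refine (congrArg (_ ≫ ·) ((Category.assoc _ _ _).symm.trans ((congrArg (· ≫ _) h4).trans
    (C.chainsM_π _ _ _ _ _ σ τ)))).trans ?_
  refine (tensorHom_comp_tensorHom_assoc _ _ _ _ _).trans ?_
  exact congrArg (· ≫ _) (congrArg₂ (fun x y => x ⊗ₘ y) (Category.assoc _ _ _)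
    (Category.assoc _ _ _))

/-- The morphism to an object of chains with given values. -/
def lift (w : ∀ (a b : K _⦋0⦌) (_ : SimpQuiv K n.len a b) (k : SimplexCategoryᵒᵖ)
      (_ : (necNerve.{u}.obj T).obj k), 𝟙_ V ⟶ (f a ⟶[SimplexCategoryᵒᵖ ⥤ V] f b).obj k)
    (hw : ∀ (a b : K _⦋0⦌) (x : SimpQuiv K n.len a b) {k l : SimplexCategoryᵒᵖ} (g : k ⟶ l)
      (σ : (necNerve.{u}.obj T).obj k),
      w a b x k σ ≫ (f a ⟶[SimplexCategoryᵒᵖ ⥤ V] f b).map g =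
        w a b x l ((necNerve.obj T).map g σ)) :
    (freeQuiv V K).obj (op n) ⟶ (VQuiv.pull V f).obj (C.chains.quiv.obj (op T)) :=
  ⟨fun a b => fDesc fun x => Power.lift (w a b x) (hw a b x)⟩

lemma val_lift (w : ∀ (a b : K _⦋0⦌) (_ : SimpQuiv K n.len a b) (k : SimplexCategoryᵒᵖ)
      (_ : (necNerve.{u}.obj T).obj k), 𝟙_ V ⟶ (f a ⟶[SimplexCategoryᵒᵖ ⥤ V] f b).obj k)
    (hw) {a b : K _⦋0⦌} (x : SimpQuiv K n.len a b) {k : SimplexCategoryᵒᵖ}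
    (σ : (necNerve.{u}.obj T).obj k) : val (lift w hw) x σ = w a b x k σ :=
  (fι_fDesc_assoc _ _ _).trans (Power.lift_π _ _ _)

end ChainVal

namespace SimpData

open ChainVal

/-- The lax structure of `V(I, -)` tensors two points and precomposes with `I ≅ I ⊗ I`; unfolding it
shows how points compose in `𝓤 C`. -/
lemma forget_mulS (k : SimplexCategoryᵒᵖ) (a b c : C.obj)
    (x : 𝟙_ V ⟶ (a ⟶[SimplexCategoryᵒᵖ ⥤ V] b).obj k)
    (y : 𝟙_ V ⟶ (b ⟶[SimplexCategoryᵒᵖ ⥤ V] c).obj k) :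
    ((forgetECat V).obj C).mulS k a b c x y =
      (λ_ (𝟙_ V)).inv ≫ (x ⊗ₘ y) ≫ C.compAt k a b c :=
  Category.assoc _ _ _

lemma forget_oneS (k : SimplexCategoryᵒᵖ) (a : C.obj) :
    ((forgetECat V).obj C).oneS k a = C.idAt k a :=
  Category.id_comp _

/-- The family of maps underlying a compatible family of morphisms to objects of chains. -/
def ofBead (θ : BeadHom (freeTemplObj V K) C.chains.toNecCat) :
    SimpData K ((forgetECat V).obj C) where
  f := θ.f
  v n a b x k σ := val (n := ⟨n⟩) (C := C) (f := θ.f) (θ.nat.θ n) x σ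
  v_map n a b x k l g σ := val_map (n := ⟨n⟩) (C := C) (f := θ.f) (θ.nat.θ n) x g σ
  nat {m n} g a b x k σ := by
    refine (val_res (C := C) (f := θ.f) g x (θ.nat.θ m.len) σ).symm.trans ?_
    refine Eq.trans ?_ (val_nec (C := C) (f := θ.f) (θ.nat.θ n.len) (Nec.beadMap g) x σ)
    exact congrArg (fun z => val (C := C) (f := θ.f) z x σ) (θ.nat.nat g)
  comul m n a c b x y z hy hz k σ τ := by
    refine Eq.trans ?_ (forget_mulS k _ _ _ _ _).symm
    refine Eq.trans ?_ (val_comul (m := ⟨m⟩) (n := ⟨n⟩) (C := C) (f := θ.f) (θ.nat.θ n) x y z hy hz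
      (θ.nat.θ m) σ τ)
    refine (val_nec (n := ⟨m + n⟩) (C := C) (f := θ.f) (θ.nat.θ (m + n)) (Nec.join rfl) x
      (necJoin σ τ)).symm.trans ?_
    refine congrArg (fun z => val (n := ⟨m + n⟩) (C := C) (f := θ.f) z x (necJoin σ τ)) ?_
    refine (θ.nat.comul rfl).trans ?_
    refine congrArg₂ (fun z w => z ≫ (θ.nat.θ m ⊗ₘ θ.nat.θ n) ≫ w) (comul_refl _ m n) ?_
    exact Functor.LaxMonoidal.comp_μ C.chains.quiv (VQuiv.pull V θ.f) _ _
  unit a x k := by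
    refine Eq.trans ?_ (forget_oneS k _).symm
    refine Eq.trans ?_ (val_unit (C := C) (f := θ.f) x k)
    refine congrArg (fun z => val (n := ⟨0⟩) (C := C) (f := θ.f) z x (necUnit k)) ?_
    refine θ.nat.unit.trans (congrArg (_ ≫ ·) ?_)
    exact Functor.LaxMonoidal.comp_ε C.chains.quiv (VQuiv.pull V θ.f)

/-- The map on vertices, regarded as taking values in the objects of `C`. -/
def base (d : SimpData K ((forgetECat V).obj C)) : K _⦋0⦌ → C.obj := d.f

/-- The compatible family of morphisms to objects of chains given by a family of maps. -/
def toBeadNat (d : SimpData K ((forgetECat V).obj C)) :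
    BeadNat (C.chains.toNecCat.C ⋙ VQuiv.pull V d.base) (freeQuiv V K) :=
  { θ n := lift (n := ⟨n⟩) (C := C) (f := d.base) (d.v n) (d.v_map n)
    nat {m n} g := by
      refine ChainVal.hom_ext (C := C) (f := d.base) (T := Nec.bead m.len) fun a b x k σ => ?_
      refine (val_res (C := C) (f := d.base) g x _ σ).trans ?_
      refine Eq.trans ?_ (val_nec (C := C) (f := d.base) _ (Nec.beadMap g) x σ).symm
      refine (val_lift (C := C) (f := d.base) _ _ _ _).trans ?_
      exact (d.nat g a b x k σ).trans (val_lift (C := C) (f := d.base) _ _ _ _).symm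
    comul {m n l} h := by
      subst h
      refine ChainVal.hom_ext (n := ⟨m + n⟩) (C := C) (f := d.base) (T := Nec.bead m ⊗ Nec.bead n)
        fun a b x k σ => ?_
      obtain ⟨σ, τ, rfl⟩ := exists_necJoin σ
      refine (val_nec (n := ⟨m + n⟩) (C := C) (f := d.base) _ (Nec.join rfl) x
        (necJoin σ τ)).trans ?_
      refine (val_lift (C := C) (f := d.base) _ _ _ _).trans ?_
      -- There is no choice in the intermediate vertex: it is the last vertex of the front face,
      -- which is also the first one of the back face.
      let y : SimpQuiv K m a (vert K (Fin.last m) (front K m n x.1)) :=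
        ⟨front K m n x.1, (vert_front_zero _ _ _ _).trans x.2.1, rfl⟩
      let z : SimpQuiv K n (vert K (Fin.last m) (front K m n x.1)) b :=
        ⟨back K m n x.1, vert_back_zero _ _ _ _, (vert_back_last _ _ _ _).trans x.2.2⟩
      refine (d.comul m n a _ b x y z rfl rfl k σ τ).trans ?_
      refine (forget_mulS k _ _ _ _ _).trans ?_
      have h := val_comul (m := ⟨m⟩) (n := ⟨n⟩) (C := C) (f := d.base)
        (lift (n := ⟨n⟩) (C := C) (f := d.base) (d.v n) (d.v_map n)) x y z rfl rfl
        (lift (n := ⟨m⟩) (C := C) (f := d.base) (d.v m) (d.v_map m)) σ τ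
      have h1 := val_lift (n := ⟨m⟩) (C := C) (f := d.base) (d.v m) (d.v_map m) y σ
      have h2 := val_lift (n := ⟨n⟩) (C := C) (f := d.base) (d.v n) (d.v_map n) z τ
      refine (congrArg₂ (fun p q => (λ_ (𝟙_ V)).inv ≫ (p ⊗ₘ q) ≫ C.compAt k _ _ _)
        h1.symm h2.symm).trans (h.symm.trans ?_)
      refine congrArg (fun z => val (n := ⟨m + n⟩) (C := C) (f := d.base) z x (necJoin σ τ)) ?_
      refine congrArg₂ (fun z w => z ≫
        (lift (n := ⟨m⟩) (C := C) (f := d.base) (d.v m) (d.v_map m) ⊗ₘ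
          lift (n := ⟨n⟩) (C := C) (f := d.base) (d.v n) (d.v_map n)) ≫ w)
        (comul_refl (freeTemplObj V K).X m n).symm ?_
      exact (Functor.LaxMonoidal.comp_μ C.chains.quiv (VQuiv.pull V d.base) _ _).symm
    unit := by
      refine ChainVal.hom_ext (n := ⟨0⟩) (C := C) (f := d.base) (T := 𝟙_ Nec) fun a b x k σ => ?_
      obtain rfl : a = b := x.2.1.symm.trans ((vert_zero K x.1 0).trans
        ((vert_zero K x.1 (Fin.last 0)).symm.trans x.2.2))
      obtain rfl := eq_necUnit σ
      refine (val_lift (n := ⟨0⟩) (C := C) (f := d.base) _ _ _ _).trans ?_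
      refine (d.unit a x k).trans ?_
      refine (forget_oneS k _).trans ?_
      refine (val_unit (C := C) (f := d.base) x k).symm.trans ?_
      refine congrArg (fun z => val (n := ⟨0⟩) (C := C) (f := d.base) z x (necUnit k)) ?_
      refine congrArg (_ ≫ ·) ?_
      exact (Functor.LaxMonoidal.comp_ε C.chains.quiv (VQuiv.pull V d.base)).symm }

/-- The compatible family of morphisms to objects of chains given by a family of maps. -/
def toBead (d : SimpData K ((forgetECat V).obj C)) :
    BeadHom (freeTemplObj V K) C.chains.toNecCat :=
  ⟨d.base, d.toBeadNat⟩

/-- Compatible families of morphisms from a free templicial object to objects of chains are given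
by families of maps. -/
def equivBead (K : SSet.{u}) (C : ECat.{u} (SimplexCategoryᵒᵖ ⥤ V)) :
    BeadHom (freeTemplObj V K) C.chains.toNecCat ≃ SimpData K ((forgetECat V).obj C) where
  toFun := ofBead
  invFun := toBead
  left_inv θ := BeadHom.ext_same fun n a b => congrArg (fun z => VQuiv.Hom.app z a b)
    (ChainVal.hom_ext (n := ⟨n⟩) (C := C) (f := θ.f) fun _ _ _ _ _ =>
      val_lift (n := ⟨n⟩) (C := C) (f := θ.f) _ _ _ _)
  right_inv d := ext_same fun n _ _ x _ σ =>
    val_lift (n := ⟨n⟩) (C := C) (f := d.base) (d.v n) (d.v_map n) x σ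

end SimpData

end
end

/-! ### Simplices of hom-objects with varying end points -/

noncomputable section

open Simplicial SimplexCategory

/-- The simplices of the hom-objects of a simplicially enriched category. -/
structure ECat.Arr (E : ECat.{u} SSet.{u}) (k : SimplexCategoryᵒᵖ) where
  src : E.obj
  tgt : E.obj
  val : (src ⟶[SSet.{u}] tgt).obj k

namespace ECat.Arr

variable {E : ECat.{u} SSet.{u}} {k l : SimplexCategoryᵒᵖ} {a b c a' b' c' : E.obj}
  {x : (a ⟶[SSet.{u}] b).obj k} {y : (b ⟶[SSet.{u}] c).obj k}
  {x' : (a' ⟶[SSet.{u}] b').obj k} {y' : (b' ⟶[SSet.{u}] c').obj k}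

/-- Simplices of different hom-objects are compared in `Arr`, where objects may change along
propositional equalities. Once the end points are the same, this brings the equality back to the
hom-object. -/
lemma val_injective {x' : (a ⟶[SSet.{u}] b).obj k} (h : (⟨a, b, x⟩ : E.Arr k) = ⟨a, b, x'⟩) :
    x = x' := by
  cases h
  rfl

lemma mk_map (h : (⟨a, b, x⟩ : E.Arr k) = ⟨a', b', x'⟩) (g : k ⟶ l) :
    (⟨a, b, (a ⟶[SSet.{u}] b).map g x⟩ : E.Arr l) = ⟨a', b', (a' ⟶[SSet.{u}] b').map g x'⟩ := by
  cases h
  rfl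

lemma mk_mul (h : (⟨a, b, x⟩ : E.Arr k) = ⟨a', b', x'⟩)
    (h' : (⟨b, c, y⟩ : E.Arr k) = ⟨b', c', y'⟩) :
    (⟨a, c, E.mulS k a b c x y⟩ : E.Arr k) = ⟨a', c', E.mulS k a' b' c' x' y'⟩ := by
  cases h
  cases h'
  rfl

lemma mk_one (h : a = a') :
    (⟨a, a, E.oneS k a⟩ : E.Arr k) = ⟨a', a', E.oneS k a'⟩ := by
  cases h
  rfl

lemma exists_val (A : E.Arr k) (ha : A.src = a) (hb : A.tgt = b) :
    ∃ x : (a ⟶[SSet.{u}] b).obj k, (⟨a, b, x⟩ : E.Arr k) = A := by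
  cases ha
  cases hb
  exact ⟨A.val, rfl⟩

end ECat.Arr

/-- The action of an enriched functor on the simplices of the hom-objects. -/
def ECat.arr {D E : ECat.{u} SSet.{u}} (F : D ⟶ E) {k : SimplexCategoryᵒᵖ} (i j : D.obj)
    (σ : (i ⟶[SSet.{u}] j).obj k) : E.Arr k :=
  ⟨F.obj i, F.obj j, (F.map i j).app k σ⟩

/-- Comparing functors through `arr` avoids a transport along the equality of the maps on objects.
-/
lemma ECat.hom_ext {D E : ECat.{u} SSet.{u}} {F G : D ⟶ E} (h : ∀ i, F.obj i = G.obj i)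
    (h' : ∀ k (i j : D.obj) (σ : (i ⟶[SSet.{u}] j).obj k), arr F i j σ = arr G i j σ) : F = G := by
  obtain ⟨o, m, h1, h2⟩ := F
  obtain ⟨o', m', h1', h2'⟩ := G
  obtain rfl : o = o' := funext h
  refine ECat.ext_same fun a b => NatTrans.ext (funext fun k => ?_)
  exact ConcreteCategory.hom_ext _ _ fun σ => Arr.val_injective (h' k a b σ)

lemma ECat.arr_mul {D E : ECat.{u} SSet.{u}} (F : D ⟶ E) {k : SimplexCategoryᵒᵖ} (a b c : D.obj)
    (x : (a ⟶[SSet.{u}] b).obj k) (y : (b ⟶[SSet.{u}] c).obj k) :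
    arr F a c (D.mulS k a b c x y) = ⟨F.obj a, F.obj c,
      E.mulS k _ _ _ ((F.map a b).app k x) ((F.map b c).app k y)⟩ :=
  congrArg (Arr.mk (F.obj a) (F.obj c)) (ConcreteCategory.congr_hom
    (congrArg (fun z => NatTrans.app z k) (F.map_comp a b c))
    (simplexPair (K := (a ⟶[SSet.{u}] b)) (L := (b ⟶[SSet.{u}] c)) x y))

lemma ECat.arr_one {D E : ECat.{u} SSet.{u}} (F : D ⟶ E) {k : SimplexCategoryᵒᵖ} (a : D.obj) :
    arr F a a (D.oneS k a) = ⟨F.obj a, F.obj a, E.oneS k _⟩ :=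
  congrArg (Arr.mk (F.obj a) (F.obj a)) (ConcreteCategory.congr_hom
    (congrArg (fun z => NatTrans.app z k) (F.map_id a)) (PUnit.unit : (𝟙_ SSet.{u}).obj k))

/-! ### Hom-objects of `ℭ[Δⁿ]` as chains of vertex sets of a bead -/

namespace Thickening

/-- The objects of the thickening of `[n]`. -/
abbrev Ob (n : ℕ) : Type u := SimplicialThickening (ULift.{u} (Fin (n + 1)))

/-- The index of an object of the thickening of `[n]`. -/
abbrev ix {n : ℕ} (i : Ob.{u} n) : Fin (n + 1) := i.as.down

/-- The object of the thickening of `[n]` with a given index. -/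
abbrev ob {n : ℕ} (i : Fin (n + 1)) : Ob.{u} n := ⟨⟨i⟩⟩

/-- The chains of paths between two objects of the thickening of `[n]`. -/
abbrev Chain {n : ℕ} (k : SimplexCategoryᵒᵖ) (i j : Ob.{u} n) : Type u := (i ⟶[SSet.{u}] j).obj k

variable {n : ℕ} {i j : Ob.{u} n} {k l : SimplexCategoryᵒᵖ}

/-- A set in a chain of paths. -/
def Chain.set (σ : Chain k i j) (t : Fin (k.unop.len + 1)) : Set ℕ :=
  {s | ∃ w ∈ (CategoryTheory.Functor.obj (D := i ⟶ j) σ t).I, (w.down : ℕ) = s}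

lemma Chain.le (σ : Chain k i j) : (ix i : ℕ) ≤ ix j :=
  (SimplicialThickening.Path.le (CategoryTheory.Functor.obj (D := i ⟶ j) σ 0) : i.as ≤ j.as)

lemma functor_ext {I : Type*} [Category* I] {F G : I ⥤ (i ⟶ j)}
    (h : ∀ t, (F.obj t).I = (G.obj t).I) : F = G :=
  CategoryTheory.Functor.ext (fun t => SimplicialThickening.Path.ext (h t))
    (fun _ _ _ => InducedCategory.hom_ext (Subsingleton.elim _ _))

/-- A path is determined by its vertices, and these by their numerical values. Equalities of chains
thus become equalities of sets of natural numbers, which ignore the end points occurring in the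
types. -/
lemma Chain.ext {σ τ : Chain k i j} (h : ∀ t, σ.set t = τ.set t) : σ = τ := by
  refine functor_ext (fun t : Fin (k.unop.len + 1) => Set.ext fun w => ?_)
  constructor <;> intro hw
  · obtain ⟨w', hw', e⟩ := (h t).subset ⟨w, hw, rfl⟩
    obtain rfl : w' = w := ULift.ext _ _ (Fin.ext e)
    exact hw'
  · obtain ⟨w', hw', e⟩ := (h t).superset ⟨w, hw, rfl⟩
    obtain rfl : w' = w := ULift.ext _ _ (Fin.ext e)
    exact hw'

/-- The vertex set of a path. -/
def pathSet {m : ℕ} (h : ix i + m = (ix j : ℕ)) (W : i ⟶ j) : VertSets.{u} (Nec.bead m) where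
  -- The path is shifted to start at zero, so that a path from `i` to `j` becomes a vertex set of
  -- one bead of length `j - i`.
  carrier := {t | ∃ w ∈ W.I, (w.down : ℕ) = ix i + t}
  joints_subset := by
    change Nec.joints (Nec.beadList m) ⊆ _
    rw [Nec.joints_beadList]
    rintro t (rfl | rfl)
    · exact ⟨_, W.left, rfl⟩
    · exact ⟨_, W.right, h.symm⟩
  le_sum := by
    rintro t ⟨w, hw, e⟩
    rw [Nec.bead_sum]
    have h1 : (w.down : ℕ) ≤ ix j := W.le_right w hw
    omega

/-- The vertex sets of a chain of paths. -/
def pathBead {m : ℕ} (h : ix i + m = (ix j : ℕ)) (σ : Chain k i j) :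
    (necNerve.{u}.obj (Nec.bead m)).obj k :=
  ({ obj t := pathSet h (CategoryTheory.Functor.obj (D := i ⟶ j) σ t)
     map g := homOfLE fun _ ⟨w, hw, e⟩ =>
      ⟨w, leOfHom (CategoryTheory.Functor.map (D := i ⟶ j) σ g).hom hw, e⟩ } :
    Fin (k.unop.len + 1) ⥤ VertSets.{u} (Nec.bead m))

/-- The path given by a vertex set. -/
def setPath (W : VertSets.{u} (Nec.bead n)) : ob.{u} (0 : Fin (n + 1)) ⟶ ob (Fin.last n) where
  I := {w | (w.down : ℕ) ∈ W.carrier}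
  left := W.joints_subset (Nec.zero_mem_joints _)
  right := W.joints_subset (by
    have := Nec.sum_mem_joints (Nec.beadList n)
    rwa [Nec.beadList_sum] at this)
  left_le w _ := Fin.zero_le w.down
  le_right w _ := Fin.le_last w.down

/-- The chain of paths given by a chain of vertex sets. -/
def beadPath (σ : (necNerve.{u}.obj (Nec.bead n)).obj k) :
    Chain.{u} k (ob (0 : Fin (n + 1))) (ob (Fin.last n)) :=
  ({ obj t := setPath (CategoryTheory.Functor.obj (D := VertSets.{u} (Nec.bead n)) σ t)
     map g := ⟨homOfLE fun _ hw =>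
      leOfHom (CategoryTheory.Functor.map (D := VertSets.{u} (Nec.bead n)) σ g) hw⟩ } :
    Fin (k.unop.len + 1) ⥤ (ob.{u} (0 : Fin (n + 1)) ⟶ ob (Fin.last n)))

/-- A set in a chain of vertex sets. -/
def beadSet {T : Nec} (σ : (necNerve.{u}.obj T).obj k) (t : Fin (k.unop.len + 1)) : Set ℕ :=
  (CategoryTheory.Functor.obj (D := VertSets.{u} T) σ t).carrier

lemma bead_ext {T : Nec} {σ τ : (necNerve.{u}.obj T).obj k} (h : ∀ t, beadSet σ t = beadSet τ t) :
    σ = τ :=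
  VertSets.functor_ext h

lemma mem_pathBead {m : ℕ} (h : ix i + m = (ix j : ℕ)) (σ : Chain k i j) (t s) :
    s ∈ beadSet (pathBead h σ) t ↔ (ix i + s : ℕ) ∈ σ.set t := Iff.rfl

lemma set_beadPath (σ : (necNerve.{u}.obj (Nec.bead n)).obj k) (t) :
    (beadPath σ).set t = beadSet σ t := by
  refine Set.ext fun s => ⟨?_, fun hs => ?_⟩
  · rintro ⟨w, hw, rfl⟩
    exact hw
  · have h := (CategoryTheory.Functor.obj (D := VertSets.{u} (Nec.bead n)) σ t).le_sum s hs
    rw [Nec.bead_sum] at h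
    exact ⟨⟨⟨s, Nat.lt_succ_of_le h⟩⟩, hs, rfl⟩

lemma le_of_mem_set {σ : Chain k i j} {t s} (h : s ∈ σ.set t) : (ix i : ℕ) ≤ s ∧ s ≤ ix j := by
  obtain ⟨w, hw, rfl⟩ := h
  exact ⟨(CategoryTheory.Functor.obj (D := i ⟶ j) σ t).left_le w hw,
    (CategoryTheory.Functor.obj (D := i ⟶ j) σ t).le_right w hw⟩

/-- The composition of chains of paths. -/
abbrev Chain.mul {p : Ob.{u} n} (σ : Chain k i p) (τ : Chain k p j) : Chain k i j :=
  ECat.mulS ⟨Ob.{u} n⟩ k i p j σ τ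

lemma set_mul {p : Ob.{u} n} (σ : Chain k i p) (τ : Chain k p j) (t) :
    (σ.mul τ).set t = σ.set t ∪ τ.set t := by
  refine Set.ext fun s => ⟨?_, ?_⟩
  · rintro ⟨w, hw | hw, rfl⟩
    · exact Or.inl ⟨w, hw, rfl⟩
    · exact Or.inr ⟨w, hw, rfl⟩
  · rintro (⟨w, hw, rfl⟩ | ⟨w, hw, rfl⟩)
    · exact ⟨w, Or.inl hw, rfl⟩
    · exact ⟨w, Or.inr hw, rfl⟩

lemma set_one (t) : Chain.set (ECat.oneS ⟨Ob.{u} n⟩ k i : Chain k i i) t = {(ix i : ℕ)} := by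
  refine Set.ext fun s => ⟨?_, ?_⟩
  · rintro ⟨w, rfl, rfl⟩
    rfl
  · rintro rfl
    exact ⟨_, rfl, rfl⟩

/-- The action of an order map on chains of paths. -/
abbrev Chain.push {m : ℕ} (g : ⦋n⦌ ⟶ ⦋m⦌) (σ : Chain k i j) :
    Chain k (ob (g (ix i))) (ob (g (ix j))) :=
  ((thickening.{u}.map g).map i j).app k σ

lemma mem_set_push {m : ℕ} (g : ⦋n⦌ ⟶ ⦋m⦌) (σ : Chain k i j) (t s) :
    s ∈ (σ.push g).set t ↔ ∃ w : Fin (n + 1), (w : ℕ) ∈ σ.set t ∧ (g w : ℕ) = s := by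
  constructor
  · rintro ⟨_, ⟨w, hw, rfl⟩, rfl⟩
    exact ⟨w.down, ⟨w, hw, rfl⟩, rfl⟩
  · rintro ⟨w, ⟨w', hw', e⟩, rfl⟩
    obtain rfl : w'.down = w := Fin.ext e
    exact ⟨_, ⟨w', hw', rfl⟩, rfl⟩

lemma mem_map_bead {T U : Nec} (g : T ⟶ U) (σ : (necNerve.{u}.obj T).obj k) (t s) :
    s ∈ beadSet ((necNerve.map g).app k σ) t ↔ ∃ r ∈ beadSet σ t, g.toFun r = s := Iff.rfl

lemma beadSet_join {m p : ℕ} (σ : (necNerve.{u}.obj (Nec.bead m)).obj k)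
    (τ : (necNerve.{u}.obj (Nec.bead p)).obj k) (t) :
    beadSet ((necNerve.map (Nec.join rfl : _ ⟶ Nec.bead (m + p))).app k (necJoin σ τ)) t =
      beadSet σ t ∪ (fun s => m + s) '' beadSet τ t := by
  refine (Set.image_id _).trans ?_
  change _ ∪ (fun s => (Nec.bead m).beads.sum + s) '' _ = _
  rw [Nec.bead_sum]
  rfl

end Thickening
end

/-! ### From families of points to maps into the homotopy coherent nerve -/

noncomputable section

open Simplicial SimplexCategory

open Thickening

/-- The edge of a simplex spanned by an interval of its vertices. -/
def SimpQuiv.seg (K : SSet.{u}) {n m : ℕ} {i j : Fin (n + 1)} (h : i + m = (j : ℕ)) (x : K _⦋n⦌) :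
    SimpQuiv K m (vert K i x) (vert K j x) :=
  ⟨K.map (subinterval i m (by omega)).op x,
    (vert_map K _ _ _).trans (congrArg (vert K · x) (Fin.ext (Nat.zero_add _))),
    (vert_map K _ _ _).trans (congrArg (vert K · x) (Fin.ext ((Nat.add_comm _ _).trans h)))⟩

lemma SimpQuiv.map_seg (K : SSet.{u}) {n m p : ℕ} {i j : Fin (n + 1)} (h : i + m = (j : ℕ))
    (x : K _⦋n⦌) (g : ⦋p⦌ ⟶ ⦋m⦌) (g' : ⦋p⦌ ⟶ ⦋n⦌) (hg : ∀ t, (g' t : ℕ) = g t + i) :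
    K.map g.op (SimpQuiv.seg K h x).1 = K.map g'.op x := by
  refine (ConcreteCategory.congr_hom (K.map_comp _ _) x).symm.trans
    (congrArg (fun z => K.map z x) (congrArg Quiver.Hom.op ?_))
  exact SimplexCategory.Hom.ext _ _ (OrderHom.ext _ _ (funext fun t => Fin.ext (hg t).symm))

namespace SimpData

variable {K L : SSet.{u}} {E E' : ECat.{u} SSet.{u}}

lemma ext_arr {d d' : SimpData K E} (hf : ∀ a, d.f a = d'.f a)
    (hv : ∀ n a b x k σ, (⟨_, _, d.v n a b x k σ⟩ : E.Arr k) = ⟨_, _, d'.v n a b x k σ⟩) :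
    d = d' := by
  obtain ⟨f, v, h1, h2, h3, h4⟩ := d
  obtain ⟨f', v', h1', h2', h3', h4'⟩ := d'
  obtain rfl : f = f' := funext hf
  exact ext_same fun n a b x k σ => ECat.Arr.val_injective (hv n a b x k σ)

variable (d : SimpData K E)

/-- The vertices `a` and `b` are determined by the simplex, so the value depends only on the latter.
-/
lemma arr_congr {n : ℕ} {a b a' b' : K _⦋0⦌} {x : SimpQuiv K n a b} {x' : SimpQuiv K n a' b'}
    (h : x.1 = x'.1) {k : SimplexCategoryᵒᵖ} (σ : (necNerve.{u}.obj (Nec.bead n)).obj k) :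
    (⟨_, _, d.v n a b x k σ⟩ : E.Arr k) = ⟨_, _, d.v n a' b' x' k σ⟩ := by
  obtain ⟨x, rfl, rfl⟩ := x
  obtain ⟨x', rfl, rfl⟩ := x'
  obtain rfl : x = x' := h
  rfl

/-- A form of `d.nat` in which the end points are free and the image chain is only known through its
elements. -/
lemma arr_nat {m n : ℕ} {a b a' b' : K _⦋0⦌} (g : FinInt.mk m ⟶ FinInt.mk n)
    {x : SimpQuiv K n a b} {x' : SimpQuiv K m a' b'}
    (h : K.map (FinInt.toSimplex.map g).op x.1 = x'.1) {k : SimplexCategoryᵒᵖ}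
    (σ : (necNerve.{u}.obj (Nec.bead m)).obj k) (τ : (necNerve.{u}.obj (Nec.bead n)).obj k)
    (hτ : ∀ t s, s ∈ beadSet τ t ↔ ∃ r ∈ beadSet σ t, g.toFun r = s) :
    (⟨_, _, d.v m a' b' x' k σ⟩ : E.Arr k) = ⟨_, _, d.v n a b x k τ⟩ := by
  obtain rfl : τ = (necNerve.map (Nec.beadMap g)).app k σ :=
    bead_ext fun t => Set.ext fun s => hτ t s
  refine (d.arr_congr (x' := SimpQuiv.res K g a b x) h.symm σ).trans ?_
  exact congrArg (ECat.Arr.mk _ _) (d.nat g a b x k σ)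

section
variable {n : ℕ} (x : K _⦋n⦌)

/-- The map on hom-objects of the enriched functor associated to a simplex. -/
def thickMap (i j : Ob.{u} n) :
    (i ⟶[SSet.{u}] j) ⟶ (d.f (vert K (ix i) x) ⟶[SSet.{u}] d.f (vert K (ix j) x)) where
  -- The edge from `i` to `j` makes sense only for `i ≤ j`, which the existence of the chain `σ`
  -- guarantees.
  app k := ↾fun σ => d.v (ix j - ix i) _ _
    (SimpQuiv.seg K (Nat.add_sub_cancel' (Chain.le σ)) x) k
    (pathBead (Nat.add_sub_cancel' (Chain.le σ)) σ)
  naturality _ _ g := ConcreteCategory.hom_ext _ _ fun σ =>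
    (d.v_map _ _ _ (SimpQuiv.seg K (Nat.add_sub_cancel' (Chain.le σ)) x) g
      (pathBead (Nat.add_sub_cancel' (Chain.le σ)) σ)).symm

/-- Replaces the truncated difference in the definition by an arbitrary length with the right sum.
-/
lemma thickMap_app {i j : Ob.{u} n} {m : ℕ} (h : ix i + m = (ix j : ℕ)) {k : SimplexCategoryᵒᵖ}
    (σ : Chain k i j) :
    (d.thickMap x i j).app k σ = d.v m _ _ (SimpQuiv.seg K h x) k (pathBead h σ) := by
  obtain rfl : m = ix j - ix i := by omega
  rfl

lemma thickMap_one (i : Ob.{u} n) (k : SimplexCategoryᵒᵖ) :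
    (d.thickMap x i i).app k (ECat.oneS ⟨Ob.{u} n⟩ k i) = E.oneS k _ := by
  refine (d.thickMap_app x (Nat.add_zero _) _).trans (Eq.trans ?_
    (d.unit _ (SimpQuiv.seg K (Nat.add_zero _) x) k))
  exact congrArg (d.v 0 _ _ _ k) (eq_necUnit _)

/-- The union of a chain from `i` to `p` and one from `p` to `j` is, after shifting, the join of the
shifted chains. Moreover the front and back faces of the edge spanned by `[i, j]` are the edges
spanned by `[i, p]` and `[p, j]`, so the claim is an instance of `d.comul`. -/
lemma thickMap_mul {i p j : Ob.{u} n} {k : SimplexCategoryᵒᵖ} (σ : Chain k i p) (τ : Chain k p j) :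
    (d.thickMap x i j).app k (σ.mul τ) =
      E.mulS k _ _ _ ((d.thickMap x i p).app k σ) ((d.thickMap x p j).app k τ) := by
  obtain ⟨m, hm⟩ := Nat.exists_eq_add_of_le σ.le
  obtain ⟨m', hm'⟩ := Nat.exists_eq_add_of_le τ.le
  have h : ix i + (m + m') = (ix j : ℕ) := by omega
  rw [d.thickMap_app x h, d.thickMap_app x hm.symm, d.thickMap_app x hm'.symm]
  refine Eq.trans ?_ (d.comul m m' _ _ _ (SimpQuiv.seg K h x) _ _ ?_ ?_ k _ _)
  · refine congrArg (d.v _ _ _ _ k) (bead_ext fun t => ?_)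
    rw [beadSet_join]
    refine Set.ext fun s => ?_
    rw [mem_pathBead, set_mul]
    constructor
    · rintro (h1 | h1)
      · exact Or.inl h1
      -- The vertex is `i + s`, which is at least `p` as it lies on a path starting there; the
      -- witness is its distance from `p`.
      · refine Or.inr ⟨ix i + s - ix p, ?_, ?_⟩
        · have := le_of_mem_set h1
          rw [mem_pathBead]
          rwa [Nat.add_sub_cancel' this.1]
        · have := le_of_mem_set h1
          dsimp only
          omega
    · rintro (h1 | ⟨r, h1, rfl⟩)
      · exact Or.inl h1
      · refine Or.inr ?_
        rw [mem_pathBead, hm] at h1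
        rwa [← Nat.add_assoc]
  · exact SimpQuiv.map_seg K h x _ _ fun t => rfl
  · exact SimpQuiv.map_seg K h x _ _ fun t => by
      change (t : ℕ) + ix p = t + m + ix i
      omega

/-- The enriched functor associated to a simplex. -/
def thick : thickening.{u}.obj ⦋n⦌ ⟶ E :=
  EnrichedFunctor.mk (fun i : Ob.{u} n => d.f (vert K (ix i) x)) (d.thickMap x)
    (fun i => NatTrans.ext (funext fun k => ConcreteCategory.hom_ext _ _ fun _ =>
      d.thickMap_one x i k))
    (fun _ _ _ => NatTrans.ext (funext fun _ => ConcreteCategory.hom_ext _ _ fun σ =>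
      d.thickMap_mul x σ.1 σ.2))

lemma arr_thick {i j : Ob.{u} n} {m : ℕ} (h : ix i + m = (ix j : ℕ)) {k : SimplexCategoryᵒᵖ}
    (σ : Chain k i j) : ECat.arr (d.thick x) i j σ =
      ⟨_, _, d.v m _ _ (SimpQuiv.seg K h x) k (pathBead h σ)⟩ :=
  congrArg (ECat.Arr.mk _ _) (d.thickMap_app x h σ)

end

/-- The restriction of an order map to an interval. -/
def restr {m n : ℕ} (g : Fin (m + 1) →o Fin (n + 1)) {i j : Fin (m + 1)} {p q : ℕ}
    (h : i + p = (j : ℕ)) (h' : g i + q = (g j : ℕ)) : FinInt.mk p ⟶ FinInt.mk q :=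
  FinInt.ofOrderHom
    { toFun t := ⟨g ⟨i + t, by omega⟩ - g i, by
        have h1 : g ⟨i + t, by omega⟩ ≤ g j := g.monotone (Fin.mk_le_of_le_val (by omega))
        have h2 : (g ⟨i + t, by omega⟩ : ℕ) ≤ g j := h1
        omega⟩
      monotone' s t hst := Nat.sub_le_sub_right (g.monotone
        (Fin.mk_le_of_le_val (Nat.add_le_add_left hst _))) _ }
    (Fin.ext (Nat.sub_self _))
    (Fin.ext (by
      have : (⟨i + p, by omega⟩ : Fin (m + 1)) = j := Fin.ext h
      change (g ⟨i + p, _⟩ : ℕ) - g i = q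
      rw [this]
      omega))

lemma restr_apply {m n : ℕ} (g : Fin (m + 1) →o Fin (n + 1)) {i j : Fin (m + 1)} {p q : ℕ}
    (h : i + p = (j : ℕ)) (h' : g i + q = (g j : ℕ)) (t : Fin (m + 1)) {s : ℕ}
    (hs : i + s = (t : ℕ)) (hp : s ≤ p) : g i + (restr g h h').toFun s = (g t : ℕ) := by
  have h1 : (restr g h h').toFun s = g ⟨i + s, by omega⟩ - g i := dif_pos (Nat.lt_succ_of_le hp)
  have h2 : (⟨i + s, by omega⟩ : Fin (m + 1)) = t := Fin.ext hs
  rw [h2] at h1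
  have h3 : g i ≤ g t := g.monotone (Fin.le_def.2 (by omega))
  have h4 : (g i : ℕ) ≤ g t := h3
  omega

/-- The data are natural in `Δ_f` only, yet `thick` is natural in all of `Δ`: on the hom-object from
`i` to `j`, an order map `g` matters only through its restriction `[i, j] ⟶ [g i, g j]`, which does
preserve end points. -/
lemma thick_map {m n : ℕ} (g : ⦋m⦌ ⟶ ⦋n⦌) (x : K _⦋n⦌) :
    d.thick (K.map g.op x) = thickening.map g ≫ d.thick x := by
  refine ECat.hom_ext (fun i : Ob.{u} m => congrArg d.f (vert_map K _ _ _)) ?_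
  intro k (i : Ob.{u} m) (j : Ob.{u} m) (σ : Chain k i j)
  obtain ⟨p, hp⟩ := Nat.exists_eq_add_of_le σ.le
  obtain ⟨q, hq⟩ := Nat.exists_eq_add_of_le (σ.push g).le
  refine (d.arr_thick _ hp.symm σ).trans (Eq.trans ?_ (d.arr_thick x hq.symm (σ.push g)).symm)
  refine d.arr_nat (restr g.toOrderHom hp.symm hq.symm) ?_ _ _ fun t s => ?_
  · refine (SimpQuiv.map_seg K _ x _ (subinterval (ix i) p (by omega) ≫ g) fun t => ?_).trans
      (ConcreteCategory.congr_hom (K.map_comp _ _) x)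
    refine Eq.symm ((Nat.add_comm _ _).trans ?_)
    exact restr_apply g.toOrderHom hp.symm hq.symm (subinterval (ix i) p (by omega) t)
      (Nat.add_comm _ _) (Nat.le_of_lt_succ t.2)
  · rw [mem_pathBead, mem_set_push]
    constructor
    · rintro ⟨w, hw, e⟩
      have := le_of_mem_set hw
      have h1 : ix i + (w - ix i : ℕ) = (w : ℕ) := Nat.add_sub_cancel' this.1
      refine ⟨w - ix i, ?_, ?_⟩
      · rwa [mem_pathBead, h1]
      · have := restr_apply g.toOrderHom hp.symm hq.symm w h1 (by omega)
        exact Nat.add_left_cancel (this.trans e)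
    · rintro ⟨r, hr, rfl⟩
      have hr' : r ≤ p := by
        have h := (pathSet hp.symm (CategoryTheory.Functor.obj (D := i ⟶ j) σ t)).le_sum r hr
        rwa [Nec.bead_sum] at h
      have hlt : ix i + r < m + 1 := by omega
      exact ⟨⟨ix i + r, hlt⟩, hr,
        (restr_apply g.toOrderHom hp.symm hq.symm ⟨ix i + r, hlt⟩ rfl (by omega)).symm⟩

/-- The simplicial map to the homotopy coherent nerve given by a family of maps. -/
def toNerve : K ⟶ hcNerve.{u}.obj E where
  app n := ↾fun x => d.thick (n := n.unop.len) x
  naturality m n g := ConcreteCategory.hom_ext _ _ fun x =>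
    d.thick_map (m := n.unop.len) (n := m.unop.len) g.unop x

end SimpData
end

/-! ### From maps into the homotopy coherent nerve back to families of points -/

noncomputable section

open Simplicial SimplexCategory

open Thickening

namespace Thickening

variable {n : ℕ} {i j i' j' : Ob.{u} n} {k l : SimplexCategoryᵒᵖ}

/-- A chain of paths between equal objects. -/
def Chain.cast (hi : ix i = ix i') (hj : ix j = ix j') (σ : Chain k i j) : Chain k i' j' :=
  (congrArg₂ (fun a b : Fin (n + 1) => Chain.{u} k (ob a) (ob b)) hi hj).mp σ

lemma set_cast (hi : ix i = ix i') (hj : ix j = ix j') (σ : Chain k i j) (t) :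
    (σ.cast hi hj).set t = σ.set t := by
  obtain ⟨⟨i⟩⟩ := i
  obtain ⟨⟨i'⟩⟩ := i'
  obtain ⟨⟨j⟩⟩ := j
  obtain ⟨⟨j'⟩⟩ := j'
  obtain rfl : i = i' := hi
  obtain rfl : j = j' := hj
  rfl

lemma arr_congr {E : ECat.{u} SSet.{u}} (F : thickening.{u}.obj ⦋n⦌ ⟶ E) (hi : ix i = ix i')
    (hj : ix j = ix j') {σ : Chain k i j} {τ : Chain k i' j'} (h : ∀ t, σ.set t = τ.set t) :
    ECat.arr F i j σ = ECat.arr F i' j' τ := by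
  obtain ⟨⟨i⟩⟩ := i
  obtain ⟨⟨i'⟩⟩ := i'
  obtain ⟨⟨j⟩⟩ := j
  obtain ⟨⟨j'⟩⟩ := j'
  obtain rfl : i = i' := hi
  obtain rfl : j = j' := hj
  exact congrArg (ECat.arr F _ _) (Chain.ext h)

end Thickening

namespace NerveHom

variable {K : SSet.{u}} {E : ECat.{u} SSet.{u}} (Φ : K ⟶ hcNerve.{u}.obj E)

/-- The enriched functor given by a simplex. -/
def app {n : ℕ} (x : K _⦋n⦌) : thickening.{u}.obj ⦋n⦌ ⟶ E := Φ.app (op ⦋n⦌) x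

lemma app_map {m n : ℕ} (g : ⦋m⦌ ⟶ ⦋n⦌) (x : K _⦋n⦌) :
    app Φ (K.map g.op x) = thickening.map g ≫ app Φ x :=
  ConcreteCategory.congr_hom (Φ.naturality g.op) x

/-- The map on vertices. -/
def f (a : K _⦋0⦌) : E.obj := (app Φ a).obj (ob.{u} (0 : Fin 1))

lemma f_vert {n : ℕ} (x : K _⦋n⦌) (i : Ob.{u} n) : f Φ (vert K (ix i) x) = (app Φ x).obj i :=
  congrArg (fun F : thickening.{u}.obj ⦋0⦌ ⟶ E => F.obj (ob.{u} (0 : Fin 1)))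
    (app_map Φ (⦋0⦌.const ⦋n⦌ (ix i)) x)

/-- Simplicial naturality of `Φ` at the level of chains: as chains are determined by their sets of
vertices, it is enough to know that `τ` is the image of `σ` as a set. -/
lemma arr_map {m n : ℕ} (g : ⦋m⦌ ⟶ ⦋n⦌) (x : K _⦋n⦌) {y : K _⦋m⦌} (hy : K.map g.op x = y)
    {k : SimplexCategoryᵒᵖ} {i j : Ob.{u} m} {i' j' : Ob.{u} n} (hi : g (ix i) = ix i')
    (hj : g (ix j) = ix j') (σ : Chain k i j) (τ : Chain k i' j')
    (h : ∀ t s, s ∈ τ.set t ↔ ∃ w : Fin (m + 1), (w : ℕ) ∈ σ.set t ∧ (g w : ℕ) = s) :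
    ECat.arr (app Φ y) i j σ = ECat.arr (app Φ x) i' j' τ := by
  subst hy
  refine (congrArg (fun F : thickening.{u}.obj ⦋m⦌ ⟶ E => ECat.arr F i j σ)
    (app_map Φ g x)).trans ?_
  refine arr_congr (i := ob (g (ix i))) (j := ob (g (ix j))) (σ := σ.push g) (app Φ x) hi hj
    fun t => Set.ext fun s => ?_
  exact (mem_set_push g σ t s).trans (h t s).symm

variable {n : ℕ} {a b : K _⦋0⦌} (x : SimpQuiv K n a b) {k l : SimplexCategoryᵒᵖ}
  (σ : (necNerve.{u}.obj (Nec.bead n)).obj k)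

/-- The functor attached to `x` sends its extreme vertices to the images of `a` and `b` only up to
propositional equality; the passage through `Arr` yields an element of the required hom-object. -/
lemma exists_v : ∃ v : (f Φ a ⟶[SSet.{u}] f Φ b).obj k, (⟨_, _, v⟩ : E.Arr k) =
    ECat.arr (app Φ x.1) (ob.{u} (0 : Fin (n + 1))) (ob (Fin.last n)) (beadPath σ) :=
  ECat.Arr.exists_val _
    ((f_vert Φ x.1 (ob 0)).symm.trans (congrArg (f Φ) x.2.1))
    ((f_vert Φ x.1 (ob (Fin.last n))).symm.trans (congrArg (f Φ) x.2.2))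

/-- The map on hom-objects given by a simplex. -/
def v : (f Φ a ⟶[SSet.{u}] f Φ b).obj k := (exists_v Φ x σ).choose

lemma arr_v : (⟨_, _, v Φ x σ⟩ : E.Arr k) =
    ECat.arr (app Φ x.1) (ob.{u} (0 : Fin (n + 1))) (ob (Fin.last n)) (beadPath σ) :=
  (exists_v Φ x σ).choose_spec

lemma v_map (g : k ⟶ l) : (f Φ a ⟶[SSet.{u}] f Φ b).map g (v Φ x σ) =
    v Φ x ((necNerve.obj _).map g σ) := by
  refine ECat.Arr.val_injective ((ECat.Arr.mk_map (arr_v Φ x σ) g).trans (Eq.trans ?_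
    (arr_v Φ x _).symm))
  exact congrArg (ECat.Arr.mk _ _) (ConcreteCategory.congr_hom
    (((app Φ x.1).map (ob.{u} (0 : Fin (n + 1))) (ob (Fin.last n))).naturality g)
    (beadPath σ)).symm

lemma arr_mul {n : ℕ} (x : K _⦋n⦌) {i p j : Ob.{u} n} (σ : Chain k i p) (τ : Chain k p j)
    {a b c : K _⦋0⦌} {u : (f Φ a ⟶[SSet.{u}] f Φ b).obj k} {w : (f Φ b ⟶[SSet.{u}] f Φ c).obj k}
    (hu : (⟨_, _, u⟩ : E.Arr k) = ECat.arr (app Φ x) i p σ)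
    (hw : (⟨_, _, w⟩ : E.Arr k) = ECat.arr (app Φ x) p j τ) :
    (⟨_, _, E.mulS k _ _ _ u w⟩ : E.Arr k) = ECat.arr (app Φ x) i j (σ.mul τ) :=
  (ECat.Arr.mk_mul hu hw).trans (ECat.arr_mul (app Φ x) i p j σ τ).symm

/-- In `ℭ[Δ^{m+n}]` the path of a join is the composite, through the vertex `m`, of the images `σ'`
and `τ'` of the two paths under the front and back inclusions. The functor attached to `x` preserves
this composite, and on the two images it restricts to the functors attached to `y` and `z`. -/
lemma v_comul {m n : ℕ} {a c b : K _⦋0⦌} (x : SimpQuiv K (m + n) a b) (y : SimpQuiv K m a c)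
    (z : SimpQuiv K n c b) (hy : front K m n x.1 = y.1) (hz : back K m n x.1 = z.1)
    (σ : (necNerve.{u}.obj (Nec.bead m)).obj k) (τ : (necNerve.{u}.obj (Nec.bead n)).obj k) :
    v Φ x ((necNerve.map (Nec.join rfl)).app k (necJoin σ τ)) =
      E.mulS k _ _ _ (v Φ y σ) (v Φ z τ) := by
  let p : Fin (m + n + 1) := ⟨m, by omega⟩
  let σ' : Chain.{u} k (ob 0) (ob p) := ((beadPath σ).push
    (subinterval (n := m + n) 0 m (by omega))).cast rfl rfl
  let τ' : Chain.{u} k (ob p) (ob (Fin.last (m + n))) := ((beadPath τ).push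
    (subinterval (n := m + n) m n le_rfl)).cast (Fin.ext (Nat.zero_add m))
      (Fin.ext (Nat.add_comm n m))
  have h1 (t s) : s ∈ σ'.set t ↔ ∃ w : Fin (m + 1), (w : ℕ) ∈ (beadPath σ).set t ∧
      (subinterval (n := m + n) 0 m (by omega) w : ℕ) = s := by
    refine (Set.ext_iff.1 (set_cast _ _ _ t) s).trans ?_
    exact mem_set_push _ _ _ _
  have h2 (t s) : s ∈ τ'.set t ↔ ∃ w : Fin (n + 1), (w : ℕ) ∈ (beadPath τ).set t ∧
      (subinterval (n := m + n) m n le_rfl w : ℕ) = s := by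
    refine (Set.ext_iff.1 (set_cast _ _ _ t) s).trans ?_
    exact mem_set_push _ _ _ _
  refine ECat.Arr.val_injective ((arr_v Φ x _).trans (Eq.trans ?_ (arr_mul Φ x.1 σ' τ'
    ((arr_v Φ y σ).trans (arr_map Φ (subinterval 0 m (by omega)) x.1 hy
      (i := ob 0) (j := ob (Fin.last m)) (i' := ob 0) (j' := ob p) rfl rfl (beadPath σ) σ' h1))
    ((arr_v Φ z τ).trans (arr_map Φ (subinterval m n le_rfl) x.1 hz
      (i := ob 0) (j := ob (Fin.last n)) (i' := ob p) (j' := ob (Fin.last (m + n)))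
      (Fin.ext (Nat.zero_add m)) (Fin.ext (Nat.add_comm n m)) (beadPath τ) τ' h2))).symm))
  refine arr_congr _ rfl rfl fun t => ?_
  rw [set_beadPath, set_mul, beadSet_join]
  refine congrArg₂ (· ∪ ·) (Set.ext fun s => Iff.trans ?_ (h1 t s).symm)
    (Set.ext fun s => Iff.trans ?_ (h2 t s).symm)
  · rw [← set_beadPath]
    constructor
    · intro hs
      exact ⟨⟨s, Nat.lt_succ_of_le (le_of_mem_set hs).2⟩, hs, rfl⟩
    · rintro ⟨w, hw, rfl⟩
      exact hw
  · rw [← set_beadPath]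
    constructor
    · rintro ⟨s, hs, rfl⟩
      exact ⟨⟨s, Nat.lt_succ_of_le (le_of_mem_set hs).2⟩, hs, Nat.add_comm _ _⟩
    · rintro ⟨w, hw, rfl⟩
      exact ⟨w, hw, Nat.add_comm _ _⟩

lemma v_unit (x : SimpQuiv K 0 a a) : v Φ x (necUnit k) = E.oneS k (f Φ a) := by
  refine ECat.Arr.val_injective ((arr_v Φ x _).trans ?_)
  refine Eq.trans ?_ (ECat.Arr.mk_one
    ((f_vert Φ x.1 (ob 0)).symm.trans (congrArg (f Φ) x.2.1)))
  refine Eq.trans ?_ (ECat.arr_one (app Φ x.1) (ob.{u} (0 : Fin 1)))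
  refine arr_congr (i := ob.{u} (0 : Fin 1)) (j := ob (Fin.last 0)) (i' := ob.{u} (0 : Fin 1))
    (j' := ob.{u} (0 : Fin 1)) (app Φ x.1) rfl rfl fun t => ?_
  exact (set_beadPath _ _).trans (set_one (i := ob.{u} (0 : Fin 1)) t).symm

/-- The family of maps given by a simplicial map to the homotopy coherent nerve. -/
def toSimpData : SimpData K E where
  f := f Φ
  v _ _ _ x _ σ := v Φ x σ
  v_map _ _ _ x _ _ g σ := v_map Φ x σ g
  nat {m n} g a b x k σ := by
    refine ECat.Arr.val_injective ((arr_v Φ _ σ).trans (Eq.trans ?_ (arr_v Φ x _).symm))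
    refine arr_map Φ (m := m.len) (n := n.len) (FinInt.toSimplex.map g) x.1 rfl
      (i := ob 0) (j := ob (Fin.last m.len)) (i' := ob 0) (j' := ob (Fin.last n.len))
      (Fin.ext g.prop.map_zero) (Fin.ext g.prop.map_last) _ _ fun t s => ?_
    rw [set_beadPath, set_beadPath, mem_map_bead]
    constructor
    · rintro ⟨r, hr, rfl⟩
      rw [← set_beadPath] at hr
      exact ⟨⟨r, Nat.lt_succ_of_le (le_of_mem_set hr).2⟩, (set_beadPath σ t).subset hr, rfl⟩
    · rintro ⟨w, hw, rfl⟩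
      exact ⟨w, hw, rfl⟩
  comul _ _ _ _ _ x y z hy hz _ σ τ := v_comul Φ x y z hy hz σ τ
  unit _ x _ := v_unit Φ x

end NerveHom

/-- Simplicial maps to the homotopy coherent nerve are given by families of maps. -/
def SimpData.equivNerve (K : SSet.{u}) (E : ECat.{u} SSet.{u}) :
    SimpData K E ≃ (K ⟶ hcNerve.{u}.obj E) where
  toFun := toNerve
  invFun := NerveHom.toSimpData
  left_inv d := by
    refine ext_arr (fun a => congrArg d.f (vert_zero K a 0)) fun n a b x k σ => ?_
    refine (NerveHom.arr_v d.toNerve x σ).trans ?_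
    refine (d.arr_thick x.1 (i := ob.{u} (0 : Fin (n + 1))) (j := ob (Fin.last n))
      (Nat.zero_add n) (beadPath σ)).trans ?_
    -- The edge of a simplex spanned by all its vertices equals the simplex only propositionally;
    -- naturality at the identity of `[n]` bridges the two.
    refine (d.arr_nat (𝟙 (FinInt.mk n)) (x := x) (x' := SimpQuiv.seg K (Nat.zero_add n) x.1) ?_ _ _
      fun t s => ?_)
    · exact congrArg (fun z : ⦋n⦌ ⟶ ⦋n⦌ => K.map z.op x.1)
        (SimplexCategory.Hom.ext _ _ (OrderHom.ext _ _ rfl))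
    · change _ ↔ ∃ r, (0 + r : ℕ) ∈ Chain.set (beadPath σ) t ∧ r = s
      rw [set_beadPath]
      simp
  right_inv Φ := by
    refine NatTrans.ext (funext fun n => ConcreteCategory.hom_ext _ _ fun x => ?_)
    induction n using Opposite.rec with | op n =>
    refine ECat.hom_ext (fun i : Ob.{u} n.len => NerveHom.f_vert (n := n.len) Φ x i) ?_
    intro k (i : Ob.{u} n.len) (j : Ob.{u} n.len) (σ : Chain k i j)
    obtain ⟨m, hm⟩ := Nat.exists_eq_add_of_le σ.le
    refine (SimpData.arr_thick _ (n := n.len) x hm.symm σ).trans ((NerveHom.arr_v Φ _ _).trans ?_)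
    -- A chain from `i` to `j` in `ℭ[Δⁿ]` is the image, under the inclusion of an interval, of a
    -- chain from the first to the last vertex of `ℭ[Δᵐ]`. Hence `Φ` is determined by the values
    -- `v`.
    refine NerveHom.arr_map Φ (subinterval (ix i) m (by omega)) (n := n.len) x rfl
      (i := ob 0) (j := ob (Fin.last m)) (i' := i) (j' := j) (Fin.ext (Nat.zero_add _))
      (Fin.ext ((Nat.add_comm _ _).trans hm.symm)) _ σ fun t s => ?_
    rw [set_beadPath]
    constructor
    · intro hs
      have h := le_of_mem_set hs
      refine ⟨⟨s - ix i, by omega⟩, ?_, Nat.sub_add_cancel h.1⟩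
      rw [mem_pathBead]
      change (ix i : ℕ) + (s - ix i) ∈ _
      rwa [Nat.add_sub_cancel' h.1]
    · rintro ⟨w, hw, rfl⟩
      rw [mem_pathBead, Nat.add_comm] at hw
      exact hw

end

/-! ### Naturality and the adjunction `ℭ_V ∘ F̃ ⊣ N^hc ∘ 𝓤` -/

noncomputable section

open Simplicial SimplexCategory

open Thickening

namespace SimpData

variable {K L : SSet.{u}} {E E' : ECat.{u} SSet.{u}}

/-- A simplicial map carries the edge of `x` spanned by an interval to the corresponding edge of its
image, so it is enough to compare the families themselves. -/
lemma toNerve_comp_left (φ : L ⟶ K) (d : SimpData K E) (d' : SimpData L E)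
    (hf : ∀ a, d'.f a = d.f (φ.app _ a))
    (hv : ∀ n a b x k σ, (⟨_, _, d'.v n a b x k σ⟩ : E.Arr k) =
      ⟨_, _, d.v n _ _ (SimpQuiv.mapOf φ n a b x) k σ⟩) : d'.toNerve = φ ≫ d.toNerve := by
  refine NatTrans.ext (funext fun n => ConcreteCategory.hom_ext _ _ fun x => ?_)
  induction n using Opposite.rec with | op n =>
  refine ECat.hom_ext (fun i : Ob.{u} n.len => (hf _).trans (congrArg d.f
    (vert_app (n := n.len) φ (ix i) x).symm)) ?_
  intro k (i : Ob.{u} n.len) (j : Ob.{u} n.len) (σ : Chain k i j)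
  obtain ⟨m, hm⟩ := Nat.exists_eq_add_of_le σ.le
  refine (d'.arr_thick (n := n.len) x hm.symm σ).trans (Eq.trans ?_
    (d.arr_thick (n := n.len) (φ.app (op n) x) hm.symm σ).symm)
  refine (hv _ _ _ _ _ _).trans (d.arr_congr ?_ _)
  exact ConcreteCategory.congr_hom (φ.naturality _) x

lemma toNerve_comp_right (G : E ⟶ E') (d : SimpData K E) (d' : SimpData K E')
    (hf : ∀ a, d'.f a = EnrichedFunctor.obj G (d.f a))
    (hv : ∀ n a b x k σ, (⟨_, _, d'.v n a b x k σ⟩ : E'.Arr k) =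
      ECat.arr G (d.f a) (d.f b) (d.v n a b x k σ)) : d'.toNerve = d.toNerve ≫ hcNerve.map G := by
  refine NatTrans.ext (funext fun n => ConcreteCategory.hom_ext _ _ fun x => ?_)
  induction n using Opposite.rec with | op n =>
  refine ECat.hom_ext (fun i : Ob.{u} n.len => hf _) ?_
  intro k (i : Ob.{u} n.len) (j : Ob.{u} n.len) (σ : Chain k i j)
  obtain ⟨m, hm⟩ := Nat.exists_eq_add_of_le σ.le
  refine (d'.arr_thick (n := n.len) x hm.symm σ).trans ((hv _ _ _ _ _ _).trans ?_)
  exact congrArg (fun A : E.Arr k => ECat.arr G A.src A.tgt A.val)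
    (d.arr_thick (n := n.len) x hm.symm σ).symm

section

variable {V : Type v} [Category.{u} V] [MonoidalCategory V] [HasColimitsOfSize.{u, u} V]
  [MonoidalClosed V] [BraidedCategory V] [HasLimitsOfSize.{u, u} V]
  {C D : ECat.{u} (SimplexCategoryᵒᵖ ⥤ V)}

/-- The family of maps underlying a functor on the categorification of a free templicial object. -/
def ofCategorify (Ψ : (freeTempl V ⋙ categorify V).obj K ⟶ C) :
    SimpData K ((forgetECat V).obj C) :=
  ofBead (BeadHom.ofNec (RealData.toChains (RealData.ofRealize
    (A := (nec V).obj (freeTemplObj V K)) Ψ)))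

/-- Unwinds the composite bijection: the value at `x` and `σ` is `Ψ` restricted to the generator `x`
of a single bead, at the chain `σ`. -/
lemma ofCategorify_v (Ψ : (freeTempl V ⋙ categorify V).obj K ⟶ C) (n : ℕ) (a b : K _⦋0⦌)
    (x : SimpQuiv K n a b) (k : SimplexCategoryᵒᵖ)
    (σ : (necNerve.{u}.obj (Nec.bead n)).obj k) :
    (ofCategorify Ψ).v n a b x k σ = fι x ≫ (toChain (freeQuiv V K) n).app a b ≫
      (RealData.ofRealize (A := (nec V).obj (freeTemplObj V K)) Ψ).ζ a b (Nec.bead n) k σ := by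
  refine congrArg (fι x ≫ ·) ?_
  refine (Category.assoc _ _ _).trans (congrArg (_ ≫ ·) ?_)
  exact RealData.lift_π _ _ _ _ _

/-- The bijections involved are natural by `ofRealize_map` and `ofNec_comp_app`, and on generators
the map of free templicial objects sends a simplex to its image under `φ`. -/
lemma ofCategorify_left (φ : L ⟶ K) (Ψ : (freeTempl V ⋙ categorify V).obj K ⟶ C) :
    (ofCategorify ((freeTempl V ⋙ categorify V).map φ ≫ Ψ)).toNerve =
      φ ≫ (ofCategorify Ψ).toNerve := by
  have h : RealData.toChains (RealData.ofRealize (A := (nec V).obj (freeTemplObj V L))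
      ((freeTempl V ⋙ categorify V).map φ ≫ Ψ)) =
        NecCat.Hom.comp ((nec V).map (freeTemplMap V φ)) (RealData.toChains
          (RealData.ofRealize (A := (nec V).obj (freeTemplObj V K)) Ψ)) :=
    (congrArg RealData.toChains (RealData.ofRealize_map ((nec V).map (freeTemplMap V φ)) Ψ)).trans
      ((RealData.equivChains ((nec V).obj (freeTemplObj V L)) C).apply_symm_apply _)
  refine (congrArg (fun χ => (ofBead (BeadHom.ofNec χ)).toNerve) h).trans ?_
  refine toNerve_comp_left φ _ _ (fun _ => rfl) fun n a b x k σ => congrArg (ECat.Arr.mk _ _) ?_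
  have h1 : fι x ≫ ((freeTemplα V φ).app (op ⟨n⟩)).app a b = fι (SimpQuiv.mapOf φ n a b x) :=
    fι_map _ _
  have h2 := BeadHom.ofNec_comp_app (freeTemplMap V φ) (RealData.toChains
    (RealData.ofRealize (A := (nec V).obj (freeTemplObj V K)) Ψ)) n a b
  refine (congrArg (fι x ≫ ·) ((congrArg (· ≫ _) h2).trans (Category.assoc _ _ _))).trans ?_
  exact (Category.assoc _ _ _).symm.trans (congrArg (· ≫ _) h1)

lemma ofCategorify_right (Ψ : (freeTempl V ⋙ categorify V).obj K ⟶ C) (G : C ⟶ D) :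
    (ofCategorify (Ψ ≫ G)).toNerve =
      (ofCategorify Ψ).toNerve ≫ (forgetECat V ⋙ hcNerve).map G := by
  refine toNerve_comp_right ((forgetECat V).map G) _ _ (fun _ => rfl)
    fun n a b x k σ => congrArg (ECat.Arr.mk _ _) ?_
  refine (ofCategorify_v (Ψ ≫ G) n a b x k σ).trans ?_
  refine Eq.trans ?_ (congrArg (· ≫ (EnrichedFunctor.map G _ _).app k)
    (ofCategorify_v Ψ n a b x k σ)).symm
  refine Eq.trans ?_ (Category.assoc _ _ _).symm
  refine congrArg (fι x ≫ ·) (Eq.trans ?_ (Category.assoc _ _ _).symm)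
  exact congrArg (_ ≫ ·) (Category.assoc _ _ _).symm

end

end SimpData

section

variable (V : Type v) [Category.{u} V] [MonoidalCategory V] [HasColimitsOfSize.{u, u} V]
  [MonoidalClosed V] [BraidedCategory V] [HasLimitsOfSize.{u, u} V]

/-- Functors on the categorification of a free templicial object are given by simplicial maps to the
homotopy coherent nerve. -/
def categorifyEquiv (K : SSet.{u}) (C : ECat.{u} (SimplexCategoryᵒᵖ ⥤ V)) :
    ((freeTempl V ⋙ categorify V).obj K ⟶ C) ≃ (K ⟶ (forgetECat V ⋙ hcNerve.{u}).obj C) :=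
  (RealData.equivRealize ((nec V).obj (freeTemplObj V K)) C).trans
    ((RealData.equivChains _ C).trans ((BeadHom.equivNec (freeTemplObj V K) _).symm.trans
      ((SimpData.equivBead K C).trans (SimpData.equivNerve K ((forgetECat V).obj C)))))

/-- The composite of categorification and the free functor is left adjoint to the composite of the
homotopy coherent nerve and the forgetful functor. -/
def categorifyAdj : freeTempl V ⋙ categorify V ⊣ forgetECat V ⋙ hcNerve.{u} :=
  Adjunction.mkOfHomEquiv
    { homEquiv := categorifyEquiv V
      homEquiv_naturality_left_symm  φ Φ :=
        (Equiv.symm_apply_eq _).2 (Eq.trans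
          (congrArg (φ ≫ ·) ((categorifyEquiv V _ _).apply_symm_apply Φ).symm)
          (SimpData.ofCategorify_left φ _).symm)
      homEquiv_naturality_right Ψ G := SimpData.ofCategorify_right Ψ G }

end
end

/-! ### The adjunction `𝓕 ⊣ 𝓤` on enriched categories -/

noncomputable section

open Simplicial SimplexCategory

namespace FreeForget

variable {V : Type v} [Category.{u} V] [MonoidalCategory V] [HasColimitsOfSize.{u, u} V]
  [MonoidalClosed V] [BraidedCategory V] [HasLimitsOfSize.{u, u} V]
  {D D' : ECat.{u} SSet.{u}} {C C' : ECat.{u} (SimplexCategoryᵒᵖ ⥤ V)}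

section

variable (G : (freeECat V).obj D ⟶ C)

/-- The map on objects. -/
def obj (a : D.obj) : C.obj := EnrichedFunctor.obj G a

/-- The morphism on hom-objects in a given dimension of a functor on a free enriched category. -/
def mapAt (a b : D.obj) (k : SimplexCategoryᵒᵖ) :
    (freeObj V).obj ((a ⟶[SSet.{u}] b).obj k) ⟶
      (obj G a ⟶[SimplexCategoryᵒᵖ ⥤ V] obj G b).obj k :=
  (EnrichedFunctor.map G a b).app k

lemma mapAt_map (a b : D.obj) {k l : SimplexCategoryᵒᵖ} (g : k ⟶ l) :
    mapAt G a b k ≫ (obj G a ⟶[SimplexCategoryᵒᵖ ⥤ V] obj G b).map g =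
      (freeObj V).map ((a ⟶[SSet.{u}] b).map g) ≫ mapAt G a b l :=
  ((EnrichedFunctor.map G a b).naturality g).symm

lemma one_mapAt (a : D.obj) (k : SimplexCategoryᵒᵖ) :
    fι (D.oneS k a) ≫ mapAt G a a k = C.idAt k (obj G a) := by
  have h : (fι PUnit.unit ≫ (freeObj V).map ((eId SSet.{u} a).app k)) ≫ mapAt G a a k =
      C.idAt k (obj G a) := congrArg (fun z => NatTrans.app z k) (EnrichedFunctor.map_id G a)
  exact (congrArg (· ≫ _) (fι_map ((eId SSet.{u} a).app k) PUnit.unit).symm).trans h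

/-- Composition in `𝓕 D` passes through `F(A) ⊗ F(B) ⟶ F(A × B)`, which sends a pair of generators
to the generator of the pair; functoriality of `G`, read on generators, is then multiplicativity for
points. -/
lemma comp_mapAt (a b c : D.obj) (k : SimplexCategoryᵒᵖ) (x : (a ⟶[SSet.{u}] b).obj k)
    (y : (b ⟶[SSet.{u}] c).obj k) :
    fι (D.mulS k a b c x y) ≫ mapAt G a c k = (λ_ (𝟙_ V)).inv ≫
      (fι x ≫ mapAt G a b k ⊗ₘ fι y ≫ mapAt G b c k) ≫
        C.compAt k (obj G a) (obj G b) (obj G c) := by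
  have h : (freeμ _ _ ≫ (freeObj V).map ((eComp SSet.{u} a b c).app k)) ≫ mapAt G a c k =
      (mapAt G a b k ⊗ₘ mapAt G b c k) ≫ C.compAt k (obj G a) (obj G b) (obj G c) :=
    congrArg (fun z => NatTrans.app z k) (EnrichedFunctor.map_comp G a b c)
  have h1 : fι (V := V) (x, y) ≫ (freeObj V).map ((eComp SSet.{u} a b c).app k) =
      fι (D.mulS k a b c x y) :=
    fι_map ((eComp SSet.{u} a b c).app k)
      (simplexPair (K := (a ⟶[SSet.{u}] b)) (L := (b ⟶[SSet.{u}] c)) x y)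
  refine Eq.trans ?_ (congrArg ((λ_ (𝟙_ V)).inv ≫ ·) (tensorHom_comp_tensorHom_assoc _ _ _ _ _))
  refine Eq.trans ?_ (congrArg (fun z => (λ_ (𝟙_ V)).inv ≫ (fι x ⊗ₘ fι y) ≫ z) h)
  refine (congrArg (· ≫ _) h1.symm).trans ?_
  rw [Category.assoc, Category.assoc, fι_freeμ_assoc, Iso.inv_hom_id_assoc]

/-- The functor to a forgetful enriched category associated to a functor on a free one. -/
def toForget : D ⟶ (forgetECat V).obj C :=
  EnrichedFunctor.mk (V := SSet.{u}) (C := D.obj) (D := ((forgetECat V).obj C).obj)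
    (fun a => (obj G a : C.obj))
    (fun a b =>
      { app k := ↾fun x => fι x ≫ mapAt G a b k
        naturality _ l g := ConcreteCategory.hom_ext _ _ fun x =>
          ((fι_map_assoc ((a ⟶[SSet.{u}] b).map g) x (mapAt G a b l)).symm.trans
            (congrArg (fι x ≫ ·) (mapAt_map G a b g).symm)).trans (Category.assoc _ _ _).symm })
    (fun a => NatTrans.ext (funext fun k => ConcreteCategory.hom_ext _ _ fun _ =>
      (one_mapAt G a k).trans (SimpData.forget_oneS k (obj G a)).symm))
    (fun a b c => NatTrans.ext (funext fun k => ConcreteCategory.hom_ext _ _ fun x =>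
      (comp_mapAt G a b c k x.1 x.2).trans (SimpData.forget_mulS k (obj G a) (obj G b) (obj G c)
        _ _).symm))

end

section

variable (H : D ⟶ (forgetECat V).obj C)

/-- The map on objects. -/
def base (a : D.obj) : C.obj :=
  (EnrichedFunctor.obj H a : ((forgetECat V).obj C).obj)

/-- The map on simplices of hom-objects of a functor to a forgetful enriched category. -/
def valAt (a b : D.obj) (k : SimplexCategoryᵒᵖ) (x : (a ⟶[SSet.{u}] b).obj k) :
    𝟙_ V ⟶ (base H a ⟶[SimplexCategoryᵒᵖ ⥤ V] base H b).obj k :=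
  (EnrichedFunctor.map (D := ((forgetECat V).obj C).obj) H a b).app k x

lemma valAt_map (a b : D.obj) {k l : SimplexCategoryᵒᵖ} (g : k ⟶ l)
    (x : (a ⟶[SSet.{u}] b).obj k) :
    valAt H a b k x ≫ (base H a ⟶[SimplexCategoryᵒᵖ ⥤ V] base H b).map g =
      valAt H a b l ((a ⟶[SSet.{u}] b).map g x) :=
  (ConcreteCategory.congr_hom
    ((EnrichedFunctor.map (D := ((forgetECat V).obj C).obj) H a b).naturality g) x).symm

lemma valAt_one (a : D.obj) (k : SimplexCategoryᵒᵖ) :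
    valAt H a a k (D.oneS k a) = C.idAt k (base H a) :=
  (ECat.Arr.val_injective (ECat.arr_one H (k := k) a)).trans (SimpData.forget_oneS k (base H a))

lemma valAt_mul (a b c : D.obj) (k : SimplexCategoryᵒᵖ) (x : (a ⟶[SSet.{u}] b).obj k)
    (y : (b ⟶[SSet.{u}] c).obj k) :
    valAt H a c k (D.mulS k a b c x y) = (λ_ (𝟙_ V)).inv ≫ (valAt H a b k x ⊗ₘ valAt H b c k y) ≫
      C.compAt k (base H a) (base H b) (base H c) :=
  (ECat.Arr.val_injective (ECat.arr_mul H a b c x y)).trans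
    (SimpData.forget_mulS k (base H a) (base H b) (base H c) _ _)

/-- The functor on a free enriched category associated to a functor to a forgetful one. -/
def ofForget : (freeECat V).obj D ⟶ C :=
  EnrichedFunctor.mk (V := SimplexCategoryᵒᵖ ⥤ V) (C := ((freeECat V).obj D).obj)
    (fun a : D.obj => base H a)
    (fun a b : D.obj =>
      { app k := fDesc (valAt H a b k)
        naturality k l g := free_hom_ext fun x =>
          (fι_map_assoc ((a ⟶[SSet.{u}] b).map g) x _).trans ((fι_fDesc _ _).trans
            ((valAt_map H a b g x).symm.trans (fι_fDesc_assoc _ _ _).symm)) })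
    (fun a : D.obj => NatTrans.ext (funext fun k => by
      refine (congrArg (· ≫ fDesc (valAt H a a k))
        (fι_map ((eId SSet.{u} a).app k) PUnit.unit)).trans ?_
      exact (fι_fDesc _ _).trans (valAt_one H a k)))
    (fun a b c : D.obj => NatTrans.ext (funext fun k => by
      change (freeμ _ _ ≫ (freeObj V).map ((eComp SSet.{u} a b c).app k)) ≫ fDesc (valAt H a c k) =
        (fDesc (valAt H a b k) ⊗ₘ fDesc (valAt H b c k)) ≫ C.compAt k _ _ _
      refine free_hom_ext₂ fun x y => ?_
      have h1 : fι (V := V) (x, y) ≫ (freeObj V).map ((eComp SSet.{u} a b c).app k) =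
          fι (D.mulS k a b c x y) :=
        fι_map ((eComp SSet.{u} a b c).app k)
          (simplexPair (K := (a ⟶[SSet.{u}] b)) (L := (b ⟶[SSet.{u}] c)) x y)
      rw [tensorHom_comp_tensorHom_assoc, fι_fDesc, fι_fDesc, Category.assoc, fι_freeμ_assoc]
      refine (congrArg (_ ≫ ·) ((Category.assoc _ _ _).symm.trans
        ((congrArg (· ≫ _) h1).trans ((fι_fDesc _ _).trans (valAt_mul H a b c k x y))))).trans ?_
      exact Iso.hom_inv_id_assoc _ _))

end

variable (D C) in
/-- Functors on a free enriched category correspond to functors to a forgetful one. -/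
def equiv : ((freeECat V).obj D ⟶ C) ≃ (D ⟶ (forgetECat V).obj C) where
  toFun := toForget
  invFun := ofForget
  left_inv G := ECat.ext_same (h1' := EnrichedFunctor.map_id G)
    (h2' := EnrichedFunctor.map_comp G) fun _ _ => NatTrans.ext (funext fun _ =>
      free_hom_ext fun _ => fι_fDesc _ _)
  right_inv H := ECat.ext_same (h1' := EnrichedFunctor.map_id H)
    (h2' := EnrichedFunctor.map_comp H) fun _ _ => NatTrans.ext (funext fun _ =>
      ConcreteCategory.hom_ext _ _ fun _ => fι_fDesc _ _)

variable (V) in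
/-- The free functor on enriched categories is left adjoint to the forgetful functor. -/
def adj : freeECat V ⊣ forgetECat V :=
  Adjunction.mkOfHomEquiv
    { homEquiv := equiv
      homEquiv_naturality_left_symm φ _ := ECat.ext_same fun a b =>
        NatTrans.ext (funext fun k => free_hom_ext fun x => (fι_fDesc _ _).trans
          ((fι_map_assoc ((EnrichedFunctor.map φ a b).app k) x _).trans (fι_fDesc _ _)).symm)
      homEquiv_naturality_right _ _ := ECat.ext_same fun _ _ =>
        NatTrans.ext (funext fun _ => ConcreteCategory.hom_ext _ _ fun _ =>
          (Category.assoc _ _ _).symm) }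

end FreeForget

end

/-! ### The case of sets, and the two isomorphisms -/

noncomputable section

open Simplicial SimplexCategory

/-- The canonical functor from the forgetful enriched category of a simplicially enriched
category. -/
def unforget (C : ECat.{u} SSet.{u}) :
    (forgetECat (Type u)).obj (C : ECat.{u} (SimplexCategoryᵒᵖ ⥤ Type u)) ⟶ C :=
  EnrichedFunctor.mk (V := SSet.{u})
    (C := ((forgetECat (Type u)).obj (C : ECat.{u} (SimplexCategoryᵒᵖ ⥤ Type u))).obj)
    (D := C.obj) (fun a => (a : C.obj))
    (fun _ _ =>
      { app _ := ↾fun x => ConcreteCategory.hom (C := Type u) x PUnit.unit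
        naturality _ _ _ := rfl })
    (fun _ => rfl) (fun _ _ _ => rfl)

/-- The inverse of `unforget`. -/
def intoForget (C : ECat.{u} SSet.{u}) :
    C ⟶ (forgetECat (Type u)).obj (C : ECat.{u} (SimplexCategoryᵒᵖ ⥤ Type u)) :=
  EnrichedFunctor.mk (V := SSet.{u}) (C := C.obj)
    (D := ((forgetECat (Type u)).obj (C : ECat.{u} (SimplexCategoryᵒᵖ ⥤ Type u))).obj)
    (fun a => (a : C.obj))
    (fun _ _ =>
      { app _ := ↾fun x => ↾fun _ => x
        naturality _ _ _ := rfl })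
    (fun _ => rfl) (fun _ _ _ => rfl)

/-- The forgetful functor on categories enriched in simplicial sets is isomorphic to the
identity. -/
def forgetTypeIso : forgetECat (Type u) ≅ 𝟭 (ECat.{u} SSet.{u}) :=
  NatIso.ofComponents (fun C =>
    { hom := unforget C
      inv := intoForget C
      hom_inv_id := ECat.ext_same fun _ _ => rfl
      inv_hom_id := ECat.ext_same fun _ _ => rfl })
    fun _ => ECat.ext_same fun _ _ => rfl

/-- The adjunction for `V` the category of sets: a map from the one-point set is an element, so `𝓤`
drops out and a left adjoint of `N^hc` itself remains. -/
lemma hcNerve_isRightAdjoint : hcNerve.{u}.IsRightAdjoint :=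
  ((categorifyAdj (Type u)).ofNatIsoRight
    (Functor.isoWhiskerRight forgetTypeIso hcNerve ≪≫ hcNerve.leftUnitor)).isRightAdjoint

/-- A composite of right adjoints to simplicial sets is represented by the values of the left
adjoints on the standard simplices. -/
def nerveIso {A : Type v} [Category.{u} A] {B : Type w} [Category.{u} B] {L : SSet.{u} ⥤ A}
    {M : A ⥤ B} {N : B ⥤ A} {R : B ⥤ SSet.{u}} (adj : M ⊣ N) (adj' : L ⋙ M ⊣ R) :
    N ⋙ yoneda ⋙ (Functor.whiskeringLeft _ _ _).obj (SSet.stdSimplex ⋙ L).op ≅ R :=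
  NatIso.ofComponents (fun X => NatIso.ofComponents
    -- In degree `n`: `Hom(L Δⁿ, N X) ≃ Hom(M L Δⁿ, X) ≃ Hom(Δⁿ, R X) ≃ (R X)_n`.
    (fun n => Equiv.toIso ((adj.homEquiv (L.obj (SSet.stdSimplex.obj n.unop)) X).symm.trans
      ((adj'.homEquiv (SSet.stdSimplex.obj n.unop) X).trans SSet.yonedaEquiv)))
    fun {n m} g => ConcreteCategory.hom_ext _ _ fun h => by
      have h1 := adj.homEquiv_naturality_left_symm (L.map (SSet.stdSimplex.map g.unop)) h
      have h2 := adj'.homEquiv_naturality_left (SSet.stdSimplex.map g.unop)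
        ((adj.homEquiv _ _).symm h)
      refine (congrArg SSet.yonedaEquiv ((congrArg _ h1).trans h2)).trans ?_
      exact (SSet.yonedaEquiv_naturality _ _).symm)
    fun {X Y} g => NatTrans.ext (funext fun n => ConcreteCategory.hom_ext _ _ fun h => by
      have h1 := adj.homEquiv_naturality_right_symm h g
      have h2 := adj'.homEquiv_naturality_right ((adj.homEquiv _ _).symm h) g
      refine (congrArg SSet.yonedaEquiv ((congrArg _ h1).trans h2)).trans ?_
      exact SSet.yonedaEquiv_comp _ _)

end

theorem mainTheorem11 (V : Type v) [Category.{u} V] [MonoidalCategory V] [SymmetricCategory V]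
    [MonoidalClosed V] [HasLimitsOfSize.{u, u} V] [HasColimitsOfSize.{u, u} V] :
    ∃ (_ : (nec V).IsLeftAdjoint) (_ : (realize V).IsLeftAdjoint) (_ : hcNerve.{u}.IsRightAdjoint),
      Nonempty (freeTempl V ⋙ categorify V ≅ hcNerve.{u}.leftAdjoint ⋙ freeECat V) ∧
      Nonempty (templHcNerve V ⋙ forgetTempl V ≅ forgetECat V ⋙ hcNerve.{u}) := by
  -- The cofree construction uses limits indexed by splits, which live in the lowest universe, and
  -- an initial object.
  have := hasLimitsOfSizeShrink.{0, 0, u, u} V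
  have := hasColimitsOfSizeShrink.{0, 0, u, u} V
  have h1 : (nec V).IsLeftAdjoint := nec_isLeftAdjoint V
  have h2 : (realize V).IsLeftAdjoint := realize_isLeftAdjoint V
  have h3 : hcNerve.{u}.IsRightAdjoint := hcNerve_isRightAdjoint
  have adj : categorify V ⊣ templHcNerve V :=
    (Adjunction.ofIsLeftAdjoint (nec V)).comp (Adjunction.ofIsLeftAdjoint (realize V))
  refine ⟨h1, h2, h3, ⟨?_⟩, ⟨?_⟩⟩
  -- Both composites are left adjoint to `N^hc ∘ 𝓤`.
  · exact (categorifyAdj V).leftAdjointUniq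
      ((Adjunction.ofIsRightAdjoint hcNerve.{u}).comp (FreeForget.adj V))
  -- By definition the functor `Ũ` is represented in degree `n` by `F̃(Δⁿ)`, so the left-hand side
  -- has the form treated in `nerveIso`.
  · exact nerveIso adj (categorifyAdj V)
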